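/- \textbf{Setting.} Let $n\ge 1$ and let $\Gamma_*=\Gamma^1_*\cup\Gamma^2_*\cup\Gamma^3_*\subset\mathbb{R}^{n+1}$ be a standard double bubble: three spherical caps (one of them possibly a flat ball) with common boundary sphere $\Sigma_*$, the triple junction, meeting there at angles $2\pi/3$; $\Gamma^1_*$ lies between the other two. $\Omega_{12}$ and $\Omega_{13}$ are the regions enclosed by $\Gamma^1_*\cup\Gamma^2_*$ and $\Gamma^1_*\cup\Gamma^3_*$. Let $N^i_*$ be the unit normals, $N^1_*$ pointing out of $\Omega_{12}$, $N^2_*$ into $\Omega_{12}$, $N^3_*$ out of $\Omega_{13}$, and let $\nu^i_*$ be the outer unit conormals on $\Sigma_*$. Let $B\subset\mathbb{R}^n$ be the unit ball and $\varphi_i:\overline B\to\Gamma^i_*$ smooth (up to the boundary) parametrizations (injective immersions onto $\Gamma_*^i$) with $\varphi_1=\varphi_2=\varphi_3$ on $\partial B$; functions on $\Gamma^i_*$ and $\Sigma_*$ are identified with functions on $B$ and $\partial B$. Let $\tau^i_*$ be smooth tangential fields on $\Gamma^i_*$ with $\tau^i_*=\nu^i_*$ on $\Sigma_*$. On two different surfaces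 $\Gamma_*^{k}$ fix smooth functions $f^{k}$ with compact support in $\Gamma_*^{k}\setminus(\Sigma_*\cup\operatorname{supp}\tau_*^{k})$ and $\int_{\Gamma_*^k}f^{k}\,d\mathcal{H}^n=1$, and extend them by zero to the other surfaces. $H^k(\Gamma_*^i)=H^k(B)=W^{k,2}(B)$, $H^{k-1/2}(\Sigma_*)$ is the space of traces on $\partial B$ of functions in $H^k(B)$ with the quotient norm, and $H^k_{TJ}(\Gamma_*)=\prod_{i=1}^3H^k(\Gamma_*^i)$. Let $m\in\mathbb{N}$, $m>2+\frac n2$, and $$X=\Big\{\boldsymbol\rho\in H^m_{TJ}(\Gamma_*)\ \Big|\ \rho^1+\rho^2+\rho^3=0\text{ on }\Sigma_*\Big\},\qquad V=\Big\{\boldsymbol\rho\in X\ \Big|\ \int_{\Gamma^1_*}\rho^1=\int_{\Gamma^2_*}\rho^2=\int_{\Gamma^3_*}\rho^3\Big\},$$ $$W=H^{m-2}_{TJ}(\Gamma_*)\times\big(H^{m-\frac32}(\Sigma_*)\big)^2 .$$ For $\boldsymbol\rho\in X$ near $0$ let $\Gamma_{\boldsymbol\rho}$ be the cluster whose $i$-th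 surface is parametrized by $$\varphi_i+\rho^iN^i_*+\mu^i\tau^i_*,\qquad \boldsymbol\mu=-\tfrac1{\sqrt3}\big(\rho^2-\rho^3,\ \rho^3-\rho^1,\ \rho^1-\rho^2\big),$$ where the $\rho^i$ are evaluated at the same point of $\overline B$ (local tangential part). Let $\partial^{\boldsymbol\rho}_j$, $g^{\boldsymbol\rho}_{jk}$, $g_{\boldsymbol\rho}^{jk}$, $N_{\boldsymbol\rho}$, $\nu_{\boldsymbol\rho}$, $h^{\boldsymbol\rho}_{jk}$, $H_{\boldsymbol\rho}$ be the coordinate tangent vectors, metric, inverse metric, unit normals (continuing $N_*$), outer unit conormals, second fundamental form and mean curvature (sum of the principal curvatures) of its surfaces, and $J_{\Gamma_{\boldsymbol\rho}},J_{\Sigma_{\boldsymbol\rho}}$ the factors between the surface measures of $\Gamma_{\boldsymbol\rho}$ and $\Gamma_*$, resp. between the measures of their boundaries. On $\Sigma_*$ the indices $j,k\le n-1$ refer to an arbitrary smooth local frame of the tangent bundle of $\partial B$ (e.g. the coordinate fields of a chart of $\partial B$), and membership in $H^{m-\frac32}(\Sigma_*)$ and analyticity are understood after multiplication with an arbitrary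 smooth cut-off function supported in the domain of the frame. \textbf{Lemma (Analyticity of $\widetilde E'$).} There are open neighborhoods $0\in U\subset V$ and $0\in\widetilde U\subset X$ such that the following maps are well defined and real analytic. \begin{enumerate} \item $\widetilde U\to H^{m-1}_{TJ}(\Gamma_*,\mathbb{R}^{n+1})$, $\boldsymbol\rho\mapsto\partial_j^{\boldsymbol\rho}$ ($1\le j\le n$), and $\widetilde U\to(H^{m-\frac32}(\Sigma_*,\mathbb{R}^{n+1}))^3$, $\boldsymbol\rho\mapsto\partial_j^{\boldsymbol\rho}$ ($1\le j\le n-1$). \item $\widetilde U\to H^{m-1}_{TJ}(\Gamma_*)$, $\boldsymbol\rho\mapsto g^{\boldsymbol\rho}_{jk}$ and $\boldsymbol\rho\mapsto g_{\boldsymbol\rho}^{jk}$ ($1\le j,k\le n$), and $\widetilde U\to(H^{m-\frac32}(\Sigma_*))^3$, $\boldsymbol\rho\mapsto g^{\boldsymbol\rho}_{jk}$ and $\boldsymbol\rho\mapsto g_{\boldsymbol\rho}^{jk}$ ($1\le j,k\le n-1$). \item $\widetilde U\to H^{m-1}_{TJ}(\Gamma_*)$, $\boldsymbol\rho\mapsto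 J_{\Gamma_{\boldsymbol\rho}}$, and $\widetilde U\to(H^{m-\frac32}(\Sigma_*))^3$, $\boldsymbol\rho\mapsto J_{\Sigma_{\boldsymbol\rho}}$. \item $\widetilde U\to H^{m-1}_{TJ}(\Gamma_*,\mathbb{R}^{n+1})$, $\boldsymbol\rho\mapsto N_{\boldsymbol\rho}$, and $\widetilde U\to H^{m-1}_{TJ}(\Gamma_*)$, $\boldsymbol\rho\mapsto N_{\boldsymbol\rho}\cdot N_*$, $\boldsymbol\rho\mapsto N_{\boldsymbol\rho}\cdot\tau_*$. \item $\widetilde U\to(H^{m-\frac32}(\Sigma_*,\mathbb{R}^{n+1}))^3$, $\boldsymbol\rho\mapsto\nu_{\boldsymbol\rho}$, and $\widetilde U\to(H^{m-\frac32}(\Sigma_*))^3$, $\boldsymbol\rho\mapsto\nu_{\boldsymbol\rho}\cdot N_*$, $\boldsymbol\rho\mapsto\nu_{\boldsymbol\rho}\cdot\tau_*$. \item $\widetilde U\to H^{m-2}_{TJ}(\Gamma_*)$, $\boldsymbol\rho\mapsto h^{\boldsymbol\rho}_{jk}$ ($1\le j,k\le n$). \item $\widetilde U\to H^{m-2}_{TJ}(\Gamma_*)$,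 $\boldsymbol\rho\mapsto H_{\boldsymbol\rho}$. \item $\gamma:U\to X\subset H^m_{TJ}(\Gamma_*)$. Here $\gamma=\mathrm{Id}+\bar\gamma$, with $\bar\gamma$ taking values in the span of the two functions $f^k$, is the parametrization of the volume constraint: $\gamma(U)$ is the set of all $\boldsymbol u\in\widetilde U$ such that $\Gamma^1_{\boldsymbol u}\cup\Gamma^2_{\boldsymbol u}$ and $\Gamma^1_{\boldsymbol u}\cup\Gamma^3_{\boldsymbol u}$ enclose the same volumes as $\Gamma_*^1\cup\Gamma_*^2$ and $\Gamma_*^1\cup\Gamma_*^3$. (That such a $\gamma$ exists is part of the claim.) \item $\widetilde E':U\to W$, where $\widetilde E(\boldsymbol\rho)=\sum_{i=1}^3\mathrm{Area}(\Gamma^i_{\gamma(\boldsymbol\rho)})$. That is, $\widetilde E$ is Fréchet differentiable on $U$, and there is a real analytic map $U\to W$, $\boldsymbol\rho_0\mapsto(\mathfrak f,\mathfrak b^2,\mathfrak b^3)$, which represents its derivative: for all $\boldsymbol\rho_0\in U$ and $\boldsymbol\rho\in V$ $$\widetilde E'(\boldsymbol\rho_0)\boldsymbol\rho=\sum_{i=1}^3\int_{\Gamma_*^i}\mathfrak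 f^i\rho^i\,d\mathcal{H}^n+\int_{\Sigma_*}\big(\mathfrak b^2\rho^2+\mathfrak b^3\rho^3\big)\,d\mathcal{H}^{n-1}.$$ \end{enumerate} -/

import Mathlib

open MeasureTheory Metric Set
open scoped ContDiff RealInnerProductSpace ENNReal Matrix

namespace TripleJunction

noncomputable section

/-- Euclidean space `ℝⁿ`. -/
abbrev E (n : ℕ) : Type := EuclideanSpace ℝ (Fin n)

/-! ### Sobolev spaces on the unit ball -/

/-- Lebesgue measure on the open unit ball `B` of `ℝⁿ`. -/
abbrev ballMeasure (n : ℕ) : Measure (E n) := volume.restrict (ball (0 : E n) 1)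

/-- Multi-indices `α ∈ ℕⁿ` with `|α| ≤ k`. -/
abbrev MultiIdx (n k : ℕ) : Type := {α : Fin n → Fin (k + 1) // ∑ i, (α i : ℕ) ≤ k}

/-- `g` is the weak partial derivative of `f` in direction `i` on the open unit ball. -/
def IsWeakPartial {n : ℕ} (i : Fin n) (f g : E n → ℝ) : Prop :=
  ∀ ψ : E n → ℝ, ContDiff ℝ ∞ ψ → tsupport ψ ⊆ ball (0 : E n) 1 →
    ∫ x, f x * fderiv ℝ ψ x (EuclideanSpace.single i 1) ∂(ballMeasure n)
      = - ∫ x, g x * ψ x ∂(ballMeasure n)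

theorem integrable_mul_of_tsupport {n : ℕ} (f : Lp ℝ 2 (ballMeasure n)) {h : E n → ℝ}
    (hc : Continuous h) (hs : tsupport h ⊆ ball (0 : E n) 1) :
    Integrable (fun x => f x * h x) (ballMeasure n) := by
  have : IsFiniteMeasure (ballMeasure n) :=
    ⟨by rw [Measure.restrict_apply_univ]; exact measure_ball_lt_top⟩
  have hf : Integrable (fun x => f x) (ballMeasure n) :=
    (Lp.memLp f).integrable (by norm_num)
  have hcs : HasCompactSupport h :=
    (isCompact_closedBall (0 : E n) 1).of_isClosed_subset (isClosed_tsupport h)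
      (hs.trans ball_subset_closedBall)
  obtain ⟨C, hC⟩ := hc.bounded_above_of_compact_support hcs
  exact hf.mul_bdd (c := C) hc.aestronglyMeasurable (Filter.Eventually.of_forall hC)

theorem integrable_mul_partial {n : ℕ} (f : Lp ℝ 2 (ballMeasure n)) {ψ : E n → ℝ}
    (hψ : ContDiff ℝ ∞ ψ) (hs : tsupport ψ ⊆ ball (0 : E n) 1) (v : E n) :
    Integrable (fun x => f x * fderiv ℝ ψ x v) (ballMeasure n) := by
  refine integrable_mul_of_tsupport f ((hψ.continuous_fderiv (by simp)).clm_apply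
    continuous_const) ?_
  exact (tsupport_fderiv_apply_subset ℝ v).trans hs

/-- The Sobolev space `H^k(B) = W^{k,2}(B)`. An element is stored as the family
`(D^α f)_{|α| ≤ k}` of all its weak derivatives, each in `L²(B)`; that `u_α = D^α u_0` is expressed
by: `u_{α + e_i}` is the weak `i`-th partial derivative of `u_α`. The norm is
`(∑_{|α| ≤ k} ‖D^α f‖²_{L²})^{1/2}`. -/
def sobolev (n k : ℕ) : Submodule ℝ (PiLp 2 fun _ : MultiIdx n k => Lp ℝ 2 (ballMeasure n)) where
  carrier := {u | ∀ (α β : MultiIdx n k) (i : Fin n),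
    (∀ j, (β.1 j : ℕ) = α.1 j + if j = i then 1 else 0) → IsWeakPartial i (u α) (u β)}
  zero_mem' := by
    intro α β i _ ψ _ _
    have h0 : ((0 : Lp ℝ 2 (ballMeasure n)) : E n → ℝ) =ᵐ[ballMeasure n] 0 := Lp.coeFn_zero _ _ _
    have e (h : E n → ℝ) :
        ∫ x, ((0 : Lp ℝ 2 (ballMeasure n)) : E n → ℝ) x * h x ∂(ballMeasure n) = 0 := by
      rw [integral_eq_zero_of_ae]
      filter_upwards [h0] with x hx
      rw [hx, Pi.zero_apply, zero_mul]
    simp only [PiLp.zero_apply]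
    rw [e, e, neg_zero]
  add_mem' := by
    intro u v hu hv α β i hαβ ψ hψ hs
    have key (p q : Lp ℝ 2 (ballMeasure n)) (h : E n → ℝ)
        (hp : Integrable (fun x => p x * h x) (ballMeasure n))
        (hq : Integrable (fun x => q x * h x) (ballMeasure n)) :
        ∫ x, (p + q : Lp ℝ 2 (ballMeasure n)) x * h x ∂(ballMeasure n)
          = ∫ x, p x * h x ∂(ballMeasure n) + ∫ x, q x * h x ∂(ballMeasure n) := by
      rw [← integral_add hp hq]
      refine integral_congr_ae ?_
      filter_upwards [Lp.coeFn_add p q] with x hx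
      rw [hx, Pi.add_apply, add_mul]
    simp only [PiLp.add_apply]
    rw [key _ _ _ (integrable_mul_partial _ hψ hs _) (integrable_mul_partial _ hψ hs _),
      key _ _ _ (integrable_mul_of_tsupport _ hψ.continuous hs)
        (integrable_mul_of_tsupport _ hψ.continuous hs),
      hu α β i hαβ ψ hψ hs, hv α β i hαβ ψ hψ hs]
    ring
  smul_mem' := by
    intro c u hu α β i hαβ ψ hψ hs
    have key (p : Lp ℝ 2 (ballMeasure n)) (h : E n → ℝ) :
        ∫ x, (c • p : Lp ℝ 2 (ballMeasure n)) x * h x ∂(ballMeasure n)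
          = c * ∫ x, p x * h x ∂(ballMeasure n) := by
      rw [← integral_const_mul]
      refine integral_congr_ae ?_
      filter_upwards [Lp.coeFn_smul c p] with x hx
      rw [hx, Pi.smul_apply, smul_eq_mul, mul_assoc]
    simp only [PiLp.smul_apply]
    rw [key, key, hu α β i hαβ ψ hψ hs]
    ring

/-- The Sobolev space `H^k(B)` as a type. -/
abbrev H (n k : ℕ) : Type := ↥(sobolev n k)

instance H.instNormedAddCommGroup (n k : ℕ) : NormedAddCommGroup (H n k) :=
  Submodule.normedAddCommGroup _

instance H.instNormedSpace (n k : ℕ) : NormedSpace ℝ (H n k) := Submodule.normedSpace _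

/-- The underlying (almost everywhere defined) function of an element of `H^k(B)`. -/
def H.fn {n k : ℕ} (u : H n k) : E n → ℝ :=
  (u.1 ⟨fun _ => 0, by simp⟩ : Lp ℝ 2 (ballMeasure n))

/-- `g` is continuous on the closed ball and a representative of `u`. -/
def IsContRep {n k : ℕ} (u : H n k) (g : E n → ℝ) : Prop :=
  ContinuousOn g (closedBall 0 1) ∧ u.fn =ᵐ[ballMeasure n] g

/-- The continuous representative of `u ∈ H^k(B)` on the closed ball. It exists if `k > n / 2`, and
is then unique on the closed ball. -/
def H.contRep {n k : ℕ} (u : H n k) : E n → ℝ := Classical.epsilon (IsContRep u)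

theorem H.fn_add {n k : ℕ} (u v : H n k) : (u + v).fn =ᵐ[ballMeasure n] u.fn + v.fn :=
  Lp.coeFn_add _ _

theorem H.fn_smul {n k : ℕ} (c : ℝ) (u : H n k) : (c • u).fn =ᵐ[ballMeasure n] c • u.fn :=
  Lp.coeFn_smul _ _

theorem H.fn_zero {n k : ℕ} : (0 : H n k).fn =ᵐ[ballMeasure n] 0 :=
  Lp.coeFn_zero _ _ _

/-- The functions in `H^k(B)` with vanishing trace on `∂B` (`k ≥ 1`): the closure in `H^k(B)` of the
functions that are continuous up to the boundary and vanish on `∂B`. If `k > n / 2`, then taking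
the closure adds nothing. -/
def zeroTrace (n k : ℕ) : Submodule ℝ (H n k) :=
  Submodule.topologicalClosure
    { carrier := {u | ∃ g, IsContRep u g ∧ ∀ x ∈ sphere (0 : E n) 1, g x = 0}
      zero_mem' := ⟨0, ⟨continuousOn_const, H.fn_zero⟩, fun _ _ => rfl⟩
      add_mem' := by
        rintro u v ⟨g, ⟨hg, hug⟩, hg0⟩ ⟨h, ⟨hh, hvh⟩, hh0⟩
        exact ⟨g + h, ⟨hg.add hh, (H.fn_add u v).trans (hug.add hvh)⟩,
          fun x hx => by simp [hg0 x hx, hh0 x hx]⟩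
      smul_mem' := by
        rintro c u ⟨g, ⟨hg, hug⟩, hg0⟩
        exact ⟨c • g, ⟨hg.const_smul c, (H.fn_smul c u).trans (hug.const_smul c)⟩,
          fun x hx => by simp [hg0 x hx]⟩ }

instance zeroTrace_isClosed (n k : ℕ) : IsClosed (zeroTrace n k : Set (H n k)) :=
  Submodule.isClosed_topologicalClosure _

/-- The fractional Sobolev space `H^{k-1/2}(∂B)` (`k ≥ 1`): the space of traces on `∂B` of functions
in `H^k(B)`, with the quotient norm. -/
def HTrace (n k : ℕ) : Type := H n k ⧸ zeroTrace n k

instance HTrace.instNormedAddCommGroup (n k : ℕ) : NormedAddCommGroup (HTrace n k) :=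
  Submodule.Quotient.normedAddCommGroup (zeroTrace n k)

instance HTrace.instNormedSpace (n k : ℕ) : NormedSpace ℝ (HTrace n k) :=
  inferInstanceAs (NormedSpace ℝ (H n k ⧸ zeroTrace n k))

/-- The trace operator `H^k(B) → H^{k-1/2}(∂B)`. -/
def H.trace {n k : ℕ} (u : H n k) : HTrace n k := (zeroTrace n k).mkQ u

/-- The function on `∂B` given by an element of `H^{k-1/2}(∂B)`, where `k > n / 2`. Only its values
on the unit sphere are meaningful. -/
def HTrace.val {n k : ℕ} (q : HTrace n k) : E n → ℝ :=
  (Classical.epsilon fun u : H n k => u.trace = q).contRep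

/-- `ρ ↦ (Q ρ i)_{i ∈ ι}` is a well defined and real analytic map from `U` into `H^k(B)^ι`. -/
def AnalyticIntoH {X ι : Type*} [NormedAddCommGroup X] [NormedSpace ℝ X] [Fintype ι] {n : ℕ}
    (k : ℕ) (U : Set X) (Q : X → ι → E n → ℝ) : Prop :=
  ∃ F : X → ι → H n k, AnalyticOnNhd ℝ F U ∧
    ∀ ρ ∈ U, ∀ i, (F ρ i).fn =ᵐ[ballMeasure n] Q ρ i

/-- `ρ ↦ (Q ρ i)_{i ∈ ι}` is a well defined and real analytic map from `U` into
`H^{k-1/2}(∂B)^ι`. -/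
def AnalyticIntoTrace {X ι : Type*} [NormedAddCommGroup X] [NormedSpace ℝ X] [Fintype ι] {n : ℕ}
    (k : ℕ) (U : Set X) (Q : X → ι → E n → ℝ) : Prop :=
  ∃ F : X → ι → HTrace n k, AnalyticOnNhd ℝ F U ∧
    ∀ ρ ∈ U, ∀ i, ∀ x ∈ sphere (0 : E n) 1, (F ρ i).val x = Q ρ i x

/-! ### Geometry of hypersurfaces parametrized over the closed unit ball -/

/-- The partial derivative `∂_j X` on the closed unit ball (one-sided at the boundary). -/
def pd {n : ℕ} {F : Type*} [NormedAddCommGroup F] [NormedSpace ℝ F] (j : Fin n) (X : E n → F)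
    (x : E n) : F :=
  fderivWithin ℝ X (closedBall 0 1) x (EuclideanSpace.single j 1)

/-- The derivative of `X` at `x` in direction `t` (one-sided at the boundary). -/
def dirDeriv {n : ℕ} {F : Type*} [NormedAddCommGroup F] [NormedSpace ℝ F] (t : E n) (X : E n → F)
    (x : E n) : F :=
  fderivWithin ℝ X (closedBall 0 1) x t

/-- The metric tensor `g_{jk} = ∂_j X · ∂_k X`. -/
def metric {n : ℕ} (X : E n → E (n + 1)) (x : E n) : Matrix (Fin n) (Fin n) ℝ :=
  Matrix.of fun j k => ⟪pd j X x, pd k X x⟫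

/-- The density `√(det g)` of the surface measure. -/
def areaDensity {n : ℕ} (X : E n → E (n + 1)) (x : E n) : ℝ := √(metric X x).det

/-- The density, with respect to the surface measure of the unit sphere, of the measure of the
boundary `X(∂B)`. The determinant of the form `g` on the orthogonal complement of a unit vector `x`
is `xᵀ adj(g) x`. -/
def bdryDensity {n : ℕ} (X : E n → E (n + 1)) (x : E n) : ℝ :=
  √(x.ofLp ⬝ᵥ ((metric X x).adjugate *ᵥ x.ofLp))

/-- The cross product of `n` vectors in `ℝ^{n+1}`. -/
def cross {n : ℕ} (v : Fin n → E (n + 1)) : E (n + 1) :=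
  WithLp.toLp 2 fun l => (Matrix.of (Fin.cons (Pi.single l 1) fun j => (v j).ofLp) :
    Matrix (Fin (n + 1)) (Fin (n + 1)) ℝ).det

/-- The outer unit conormal of the hypersurface `X(B)` along its boundary, at `x ∈ ∂B`. The vector
`w = ∑_j (g⁻¹x)_j ∂_j X` satisfies `w · dX(t) = x · t` for all `t`. -/
def outerConormal {n : ℕ} (X : E n → E (n + 1)) (x : E n) : E (n + 1) :=
  let w := ∑ j, ((metric X x)⁻¹ *ᵥ x.ofLp) j • pd j X x
  ‖w‖⁻¹ • w

/-- The open set enclosed by a compact set `S`: the union of all bounded connected components of the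
complement of `S`. -/
def enclosed {n : ℕ} (S : Set (E n)) : Set (E n) :=
  {p | p ∉ S ∧ Bornology.IsBounded (connectedComponentIn Sᶜ p)}

/-! ### Standard double bubbles -/

/-- The spherical cap (a flat ball if `θ = 0`) whose boundary is the sphere of radius `r` about `c`
in the hyperplane through `c` orthogonal to the unit vector `a`, and which leaves this boundary
under the angle `θ ∈ (-π, π)`, measured from the inner side of the hyperplane towards `a`. -/
def sphericalCap {n : ℕ} (c a : E n) (r θ : ℝ) : Set (E n) :=
  {p | (θ = 0 ∧ ⟪p - c, a⟫ = 0 ∧ ‖p - c‖ ≤ r) ∨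
    (θ ≠ 0 ∧ ‖p - (c - (r * Real.cot θ) • a)‖ = r / |Real.sin θ| ∧ 0 ≤ θ * ⟪p - c, a⟫)}

/-- A standard double bubble in `ℝ^{n+1}`: three spherical caps (one possibly flat) with a common
boundary sphere, at which they meet under angles of `2π/3`. -/
structure StandardDoubleBubble (n : ℕ) where
  /-- centre of the triple junction -/
  c : E (n + 1)
  /-- axis of rotation -/
  a : E (n + 1)
  /-- radius of the triple junction -/
  r : ℝ
  /-- angle of the middle surface -/
  θ : ℝ
  norm_a : ‖a‖ = 1
  r_pos : 0 < r
  θ_mem : θ ∈ Ioo (-(Real.pi / 3)) (Real.pi / 3)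

namespace StandardDoubleBubble

variable {n : ℕ} (Γ : StandardDoubleBubble n)

/-- The angles of the three caps; the surface with index `0` is the one between the other two. -/
def angle (i : Fin 3) : ℝ := ![Γ.θ, Γ.θ + 2 * Real.pi / 3, Γ.θ - 2 * Real.pi / 3] i

/-- The three hypersurfaces. -/
def surface (i : Fin 3) : Set (E (n + 1)) := sphericalCap Γ.c Γ.a Γ.r (Γ.angle i)

/-- The unit normal of the `i`-th surface at `p`. It points out of the first chamber for `i = 0`,
into the first chamber for `i = 1`, and out of the second chamber for `i = 2`, where the first
chamber lies between the surfaces `0, 1` and the second one between the surfaces `0, 2`. -/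
def normal (i : Fin 3) (p : E (n + 1)) : E (n + 1) :=
  -((Real.sin (Γ.angle i) / Γ.r) • (p - Γ.c) + Real.cos (Γ.angle i) • Γ.a)

/-- The outer unit conormal of the `i`-th surface at a point `p` of the triple junction. -/
def conormal (i : Fin 3) (p : E (n + 1)) : E (n + 1) :=
  (Real.cos (Γ.angle i) / Γ.r) • (p - Γ.c) - Real.sin (Γ.angle i) • Γ.a

end StandardDoubleBubble

/-- A standard double bubble together with the choices used to describe nearby clusters: smooth
parametrizations over the closed unit ball that agree on its boundary, tangential fields, and bump
functions. Functions on the surfaces are pulled back to the ball. -/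
structure ReferenceCluster (n : ℕ) extends StandardDoubleBubble n where
  /-- parametrizations of the three surfaces -/
  φ : Fin 3 → E n → E (n + 1)
  φ_smooth : ∀ i, ContDiffOn ℝ ∞ (φ i) (closedBall 0 1)
  φ_injOn : ∀ i, InjOn (φ i) (closedBall 0 1)
  φ_immersion : ∀ i, ∀ x ∈ closedBall (0 : E n) 1,
    Function.Injective (fderivWithin ℝ (φ i) (closedBall 0 1) x)
  φ_image : ∀ i, φ i '' closedBall 0 1 = toStandardDoubleBubble.surface i
  φ_boundary : ∀ i j, ∀ x ∈ sphere (0 : E n) 1, φ i x = φ j x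
  /-- tangential vector fields -/
  τ : Fin 3 → E n → E (n + 1)
  τ_smooth : ∀ i, ContDiffOn ℝ ∞ (τ i) (closedBall 0 1)
  τ_tangent : ∀ i, ∀ x ∈ closedBall (0 : E n) 1,
    ⟪τ i x, toStandardDoubleBubble.normal i (φ i x)⟫ = 0
  τ_boundary : ∀ i, ∀ x ∈ sphere (0 : E n) 1,
    τ i x = toStandardDoubleBubble.conormal i (φ i x)
  /-- the two surfaces that carry the bump functions -/
  s : Fin 2 → Fin 3
  s_injective : Function.Injective s
  /-- bump functions, on the surfaces `s 0` and `s 1` -/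
  f : Fin 2 → E n → ℝ
  f_smooth : ∀ j, ContDiff ℝ ∞ (f j)
  f_support : ∀ j, tsupport (f j) ⊆ ball (0 : E n) 1
  f_support_τ : ∀ j : Fin 2,
    Disjoint (tsupport (f j)) (closure {x ∈ closedBall (0 : E n) 1 | τ (s j) x ≠ 0})
  f_integral : ∀ j : Fin 2, ∫ x, f j x * areaDensity (φ (s j)) x ∂(ballMeasure n) = 1

/-! ### Clusters described by height functions -/

/-- The matrix `𝒯` that gives the tangential part as a function of the normal part, for the contact
angles `2π/3`. -/
def tangentialMatrix : Matrix (Fin 3) (Fin 3) ℝ :=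
  (-(1 / √3)) • !![0, 1, -1; -1, 0, 1; 1, -1, 0]

namespace ReferenceCluster

variable {n : ℕ} (D : ReferenceCluster n)

/-- The unit normal `N_*^i`, pulled back to the ball. -/
def N (i : Fin 3) (x : E n) : E (n + 1) := D.normal i (D.φ i x)

/-- The parametrization `φ_i + u^i N_*^i + μ^i(u) τ_*^i`, where `μ(u) = 𝒯 u` is taken pointwise. -/
def graph (u : Fin 3 → E n → ℝ) (i : Fin 3) (x : E n) : E (n + 1) :=
  D.φ i x + u i x • D.N i x + (tangentialMatrix *ᵥ fun j => u j x) i • D.τ i x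

/-- The integral over the `i`-th reference surface. -/
def refIntegral (i : Fin 3) (f : E n → ℝ) : ℝ := ∫ x, f x * areaDensity (D.φ i) x ∂(ballMeasure n)

end ReferenceCluster

/-- The triples of height functions in `H^m` with `ρ¹ + ρ² + ρ³ = 0` on the triple junction. -/
def heightSpace (n m : ℕ) : Submodule ℝ (Fin 3 → H n m) :=
  (zeroTrace n m).comap (∑ i, LinearMap.proj i)

/-- The triples of height functions in `H^m` with vanishing sum on the triple junction, as a type. -/
abbrev Height (n m : ℕ) : Type := ↥(heightSpace n m)

instance Height.instNormedAddCommGroup (n m : ℕ) : NormedAddCommGroup (Height n m) :=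
  Submodule.normedAddCommGroup _

instance Height.instNormedSpace (n m : ℕ) : NormedSpace ℝ (Height n m) := Submodule.normedSpace _

namespace ReferenceCluster

variable {n m : ℕ} (D : ReferenceCluster n)

theorem continuousOn_areaDensity (i : Fin 3) :
    ContinuousOn (areaDensity (D.φ i)) (closedBall 0 1) := by
  have hu : UniqueDiffOn ℝ (closedBall (0 : E n) 1) :=
    uniqueDiffOn_convex (convex_closedBall _ _) (by
      rw [interior_closedBall _ one_ne_zero]; exact ⟨0, mem_ball_self one_pos⟩)
  have hp (j : Fin n) : ContinuousOn (pd j (D.φ i)) (closedBall 0 1) :=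
    ((D.φ_smooth i).continuousOn_fderivWithin hu (by simp)).clm_apply continuousOn_const
  have hM : ContinuousOn (metric (D.φ i)) (closedBall 0 1) :=
    continuousOn_pi.2 fun j => continuousOn_pi.2 fun k => (hp j).inner (hp k)
  exact (Continuous.matrix_det continuous_id).comp_continuousOn hM |>.sqrt

theorem integrable_refIntegral (i : Fin 3) (u : H n m) :
    Integrable (fun x => u.fn x * areaDensity (D.φ i) x) (ballMeasure n) := by
  have : IsFiniteMeasure (ballMeasure n) :=
    ⟨by rw [Measure.restrict_apply_univ]; exact measure_ball_lt_top⟩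
  have hf : Integrable u.fn (ballMeasure n) := (Lp.memLp _).integrable (by norm_num)
  obtain ⟨C, hC⟩ := (isCompact_closedBall (0 : E n) 1).exists_bound_of_continuousOn
    (D.continuousOn_areaDensity i)
  refine hf.mul_bdd (c := C) ?_ ?_
  · exact ((D.continuousOn_areaDensity i).mono ball_subset_closedBall).aestronglyMeasurable
      measurableSet_ball
  · filter_upwards [ae_restrict_mem measurableSet_ball] with x hx
    exact hC x (ball_subset_closedBall hx)

/-- The space `V` of all triples of height functions in `H^m` with vanishing sum on the triple
junction and equal integrals over the three surfaces. -/
def V (m : ℕ) : Submodule ℝ (Height n m) where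
  carrier := {ρ | ∀ i j, D.refIntegral i (ρ.1 i).fn = D.refIntegral j (ρ.1 j).fn}
  zero_mem' := by
    have h (i : Fin 3) : D.refIntegral i (0 : H n m).fn = 0 := by
      refine integral_eq_zero_of_ae ?_
      filter_upwards [H.fn_zero (n := n) (k := m)] with x hx
      simp [hx]
    exact fun i j => (h i).trans (h j).symm
  add_mem' := by
    intro ρ σ hρ hσ
    have h (i : Fin 3) : D.refIntegral i ((ρ + σ).1 i).fn
        = D.refIntegral i (ρ.1 i).fn + D.refIntegral i (σ.1 i).fn := by
      unfold refIntegral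
      rw [← integral_add (D.integrable_refIntegral i _) (D.integrable_refIntegral i _)]
      refine integral_congr_ae ?_
      filter_upwards [H.fn_add (ρ.1 i) (σ.1 i)] with x hx
      have : ((ρ + σ).1 i).fn x = (ρ.1 i + σ.1 i).fn x := rfl
      rw [this, hx, Pi.add_apply, add_mul]
    intro i j
    rw [h, h, hρ i j, hσ i j]
  smul_mem' := by
    intro c ρ hρ
    have h (i : Fin 3) : D.refIntegral i ((c • ρ).1 i).fn = c * D.refIntegral i (ρ.1 i).fn := by
      unfold refIntegral
      rw [← integral_const_mul]
      refine integral_congr_ae ?_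
      filter_upwards [H.fn_smul c (ρ.1 i)] with x hx
      have : ((c • ρ).1 i).fn x = (c • ρ.1 i).fn x := rfl
      rw [this, hx, Pi.smul_apply, smul_eq_mul, mul_assoc]
    intro i j
    rw [h, h, hρ i j]

instance V.instNormedAddCommGroup : NormedAddCommGroup (D.V m) := Submodule.normedAddCommGroup _

instance V.instNormedSpace : NormedSpace ℝ (D.V m) := Submodule.normedSpace _

/-- The parametrization of the `i`-th surface of the cluster `Γ_ρ`. -/
def surf (ρ : Height n m) (i : Fin 3) : E n → E (n + 1) := D.graph (fun j => (ρ.1 j).contRep) i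

/-- The factor `J_{Γ_ρ}` between the surface measures of `Γ_ρ` and `Γ_*`. -/
def J (ρ : Height n m) (i : Fin 3) (x : E n) : ℝ :=
  areaDensity (D.surf ρ i) x / areaDensity (D.φ i) x

/-- The factor `J_{Σ_ρ}` between the measures of the boundaries of `Γ_ρ` and `Γ_*`. -/
def JBdry (ρ : Height n m) (i : Fin 3) (x : E n) : ℝ :=
  bdryDensity (D.surf ρ i) x / bdryDensity (D.φ i) x

/-- The unit normal `N_ρ`: the normalized cross product of the coordinate vector fields, with the
sign that makes it equal to `N_*` for `ρ = 0`. -/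
def unitNormal (ρ : Height n m) (i : Fin 3) (x : E n) : E (n + 1) :=
  let w := cross fun j => pd j (D.surf ρ i) x
  (Real.sign ⟪cross fun j => pd j (D.φ i) x, D.N i x⟫ * ‖w‖⁻¹) • w

/-- The outer unit conormal `ν_ρ`. -/
def unitConormal (ρ : Height n m) (i : Fin 3) (x : E n) : E (n + 1) := outerConormal (D.surf ρ i) x

/-- The second fundamental form `h_{jk} = ∂_j ∂_k X · N_ρ`. -/
def secondFundamentalForm (ρ : Height n m) (i : Fin 3) (j k : Fin n) (x : E n) : ℝ :=
  ⟪pd j (pd k (D.surf ρ i)) x, D.unitNormal ρ i x⟫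

/-- The mean curvature (sum of the principal curvatures) `H_ρ = g^{jk} h_{jk}`. -/
def meanCurvature (ρ : Height n m) (i : Fin 3) (x : E n) : ℝ :=
  ∑ j, ∑ k, (metric (D.surf ρ i) x)⁻¹ j k * D.secondFundamentalForm ρ i j k x

/-- The cluster `Γ_ρ` encloses the same two volumes as the reference double bubble. -/
def VolumeConstraint (ρ : Height n m) : Prop :=
  ∀ j : Fin 3, j ≠ 0 →
    volume (enclosed (D.surf ρ 0 '' closedBall 0 1 ∪ D.surf ρ j '' closedBall 0 1))
      = volume (enclosed (D.surface 0 ∪ D.surface j))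

/-- On `U`, the map `γ` is of the form `Id + γ̄` with `γ̄` taking values in the span of the two bump
functions, and it parametrizes the set of all `u ∈ U'` whose cluster satisfies the volume
constraints. -/
def IsVolumeParametrization (U : Set (D.V m)) (U' : Set (Height n m)) (γ : D.V m → Height n m) :
    Prop :=
  (∀ ρ ∈ U, ∃ b : Fin 2 → ℝ, ∀ i, ((γ ρ).1 i).fn =ᵐ[ballMeasure n]
    fun x => (ρ.1.1 i).fn x + ∑ j : Fin 2, if D.s j = i then b j * D.f j x else 0) ∧
  γ '' U = {u ∈ U' | D.VolumeConstraint u}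

/-- The surface area of the cluster `Γ_ρ`. -/
def area (ρ : Height n m) : ℝ := ∑ i, ∫ x, areaDensity (D.surf ρ i) x ∂(ballMeasure n)

/-- The space `W = H^{m-2}(Γ_*) × H^{m-3/2}(Σ_*)²`. -/
abbrev W (n m : ℕ) : Type := (Fin 3 → H n (m - 2)) × (Fin 2 → HTrace n (m - 1))

/-- The functional on `V` given by `w = (𝔣, 𝔟², 𝔟³) ∈ W`, that is
`ρ ↦ ∑_i ∫_{Γ_*^i} 𝔣^i ρ^i + ∫_{Σ_*} (𝔟² ρ² + 𝔟³ ρ³)`. -/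
def pairing (w : W n m) (ρ : D.V m) : ℝ :=
  ∑ i, D.refIntegral i (fun x => (w.1 i).fn x * (ρ.1.1 i).fn x) +
    ∫ x : sphere (0 : E n) 1, ((w.2 0).val x * (ρ.1.1 1).contRep x
      + (w.2 1).val x * (ρ.1.1 2).contRep x) * bdryDensity (D.φ 0) x ∂(volume.toSphere)

end ReferenceCluster

/-- A smooth frame `t` of the tangent bundle of the unit sphere over `O ∩ ∂B` (for instance the
coordinate vector fields of a chart), and a smooth cut-off function `η` supported in `O`. -/
structure IsLocalFrame {n : ℕ} (O : Set (E n)) (t : Fin (n - 1) → E n → E n) (η : E n → ℝ) :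
    Prop where
  isOpen : IsOpen O
  smooth : ∀ j, ContDiffOn ℝ ∞ (t j) O
  tangent : ∀ j, ∀ x ∈ O ∩ sphere 0 1, ⟪t j x, x⟫ = 0
  linearIndependent : ∀ x ∈ O ∩ sphere 0 1, LinearIndependent ℝ fun j => t j x
  cutoff_smooth : ContDiff ℝ ∞ η
  cutoff_support : tsupport η ⊆ O

/-- The metric tensor of the boundary `X(∂B)` with respect to a frame of `∂B`. -/
def bdryMetric {n : ℕ} (X : E n → E (n + 1)) (t : Fin (n - 1) → E n → E n) (x : E n) :
    Matrix (Fin (n - 1)) (Fin (n - 1)) ℝ :=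
  Matrix.of fun j k => ⟪dirDeriv (t j x) X x, dirDeriv (t k x) X x⟫

end

end TripleJunction

open TripleJunction

/-!
The proof rests on two facts about the spaces `H^k(B)` with `k > n / 2`: their elements have
continuous representatives on the closed ball (`exists_isContRep`), and they form an algebra
(`exists_mul`). Both follow from potential estimates for smooth functions
(`exists_sq_le_lintegral_energy`): the square of a function is bounded by a weakly singular
potential of its derivatives, and the composition of weakly singular kernels improves the
singularity. Density of smooth functions, by dilation and mollification, carries the estimates over
to Sobolev functions.

*Analyticity.* The families of functions on the ball that depend analytically on the height
functions with values in `H^k(B)` form a subalgebra (`analyticAlg`), which is closed under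
inversion and square roots near functions bounded away from zero. All geometric quantities of a
nearby cluster are polynomials in the height functions, their derivatives, fixed smooth functions,
and inverses and square roots of such expressions; this gives tangent vectors, metrics, area
elements, normals and curvatures. Quantities on the triple junction are treated as restrictions of
expressions on the whole ball; for the inverse of the metric with respect to a frame this uses
`inv_transpose_mul_frameMatrix`.

*Representation of derivatives.* Integrals of expressions in the height functions and their first
derivatives have derivatives of the form `σ ↦ ∑ ∫ P_a Λ_a σ`, with coefficients `P_a` that depend
analytically on the point and with `Λ_a σ` a component of `σ` or one of its first derivatives
(`localAlg`, `HasLocalDeriv`). The divergence theorem on the ball (`IsWeakPartial.integral_eq`)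
moves the derivatives to the coefficients, and the condition `σ¹ + σ² + σ³ = 0` on the sphere
eliminates one of the three boundary terms. So such a functional is represented by an element of
`W`, linearly and continuously in the coefficients (`exists_pairing_eq`).

*Volumes.* The enclosed volume is defined by the bounded components of the complement, so it has to
be identified with an integral. Two neighbouring caps form a surface that is star-shaped about a
point of the axis, and the rays from that point are transversal to it (`exists_star_center`). This
persists under `C¹`-small perturbations (`IsStarSurface.exists_stable`): a perturbation of the
surface extends, homogeneously of degree one, to a perturbation of the identity that is small in the
Lipschitz sense, hence to a homeomorphism. A star-shaped surface encloses the cone below it, whose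
volume is an integral by the change of variables `(s, x) ↦ s Z(x)`
(`IsStarSurface.volume_enclosed`). Consequently the volumes near the reference cluster are
differences of the functionals `coneVolume`, which have derivatives of the above form. By the first
variation formula (`integral_first_variation`) their derivatives in the directions of the two bump
functions are `0` or `1`, whence the matrix of derivatives of the constraints is invertible
(`exists_volume`).

*Constraint.* The bump functions span a complement of `V` (`exists_isComplementFrame`), so the
inverse function theorem yields the analytic parametrization `γ` of the volume constraint as a graph
over `V` (`IsComplementFrame.exists_param`). The derivative of the area along `γ` is the derivative
of the area plus a combination of the derivatives of the volumes with analytic Lagrange multipliers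
(`IsComplementFrame.exists_multipliers`), and is therefore represented by an analytic map into `W`.
-/

namespace TripleJunction

noncomputable section

open Filter Topology
open ENNReal (ofReal)
open EuclideanSpace (single)
open Real (sin cos tan)
open Finset (sum_congr sum_add_distrib sum_mul mul_sum)

/-- The closed unit ball of `ℝⁿ`. -/
notation "𝔹" n:max => closedBall (0 : E n) 1

/-- The unit sphere of `ℝⁿ`. -/
notation "𝕊" n:max => sphere (0 : E n) 1

/-- Lebesgue measure on the unit ball of `ℝⁿ`. -/
notation "𝔪" n:max => ballMeasure n

/-! ### Weak derivatives and the structure of `H^k(B)` -/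

instance ballMeasure_isFinite (n : ℕ) : IsFiniteMeasure (𝔪 n) :=
  ⟨by rw [Measure.restrict_apply_univ]; exact measure_ball_lt_top⟩

theorem memLp_of_tsupport {n : ℕ} {h : E n → ℝ} (hc : Continuous h)
    (hs : tsupport h ⊆ ball (0 : E n) 1) : MemLp h 2 (𝔪 n) := by
  have hcs : HasCompactSupport h :=
    (isCompact_closedBall (0 : E n) 1).of_isClosed_subset (isClosed_tsupport h)
      (hs.trans ball_subset_closedBall)
  exact (hc.memLp_of_hasCompactSupport hcs).restrict _

theorem continuous_integral_mul_Lp {n : ℕ} {h : E n → ℝ} (hm : MemLp h 2 (𝔪 n)) :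
    Continuous fun p : Lp ℝ 2 (𝔪 n) => ∫ x, p x * h x ∂𝔪 n := by
  have e : (fun p : Lp ℝ 2 (𝔪 n) => ∫ x, p x * h x ∂𝔪 n)
      = fun p => ⟪hm.toLp h, p⟫ := by
    funext p
    rw [L2.inner_def]
    refine integral_congr_ae ?_
    filter_upwards [hm.coeFn_toLp] with x hx
    simp [hx]
  rw [e]
  exact continuous_const.inner continuous_id

theorem IsWeakPartial.congr {n : ℕ} {i : Fin n} {f g f' g' : E n → ℝ} (h : IsWeakPartial i f g)
    (hf : f =ᵐ[𝔪 n] f') (hg : g =ᵐ[𝔪 n] g') : IsWeakPartial i f' g' := by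
  intro ψ hψ hs
  rw [← integral_congr_ae (hf.mono fun x hx => show f x * _ = _ by rw [hx]), h ψ hψ hs,
    integral_congr_ae (hg.mono fun x hx => show g x * _ = _ by rw [hx])]

theorem ae_eq_of_integral_mul_eq {n : ℕ} {g g' : E n → ℝ}
    (hg : Integrable g (𝔪 n)) (hg' : Integrable g' (𝔪 n))
    (h : ∀ ψ : E n → ℝ, ContDiff ℝ ∞ ψ → tsupport ψ ⊆ ball (0 : E n) 1 →
      ∫ x, g x * ψ x ∂𝔪 n = ∫ x, g' x * ψ x ∂𝔪 n) :
    g =ᵐ[𝔪 n] g' := by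
  have key := isOpen_ball.ae_eq_zero_of_integral_contDiff_smul_eq_zero (μ := (volume : Measure (E n)))
    (U := ball (0 : E n) 1) (f := fun x => g x - g' x)
    (IntegrableOn.locallyIntegrableOn (hg.sub hg')) (fun ψ hψ hcs hs => ?_)
  · refine (ae_restrict_iff' measurableSet_ball).2 ?_
    filter_upwards [key] with x hx hxb
    exact sub_eq_zero.1 (hx hxb)
  · have hzero : ∀ x, x ∉ ball (0 : E n) 1 → ψ x • (g x - g' x) = 0 := fun x hx => by
      rw [image_eq_zero_of_notMem_tsupport fun h => hx (hs h), zero_smul]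
    rw [← setIntegral_eq_integral_of_forall_compl_eq_zero hzero]
    obtain ⟨C, hC⟩ := hψ.continuous.bounded_above_of_compact_support hcs
    have i1 := hg.mul_bdd (c := C) hψ.continuous.aestronglyMeasurable (.of_forall hC)
    have i2 := hg'.mul_bdd (c := C) hψ.continuous.aestronglyMeasurable
      (.of_forall hC)
    have : ∫ x in ball (0 : E n) 1, ψ x • (g x - g' x)
        = ∫ x, (g x * ψ x - g' x * ψ x) ∂𝔪 n := by
      refine integral_congr_ae (.of_forall fun x => ?_)
      simp only [smul_eq_mul]; ring
    rw [this, integral_sub i1 i2, h ψ hψ hs, sub_self]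

theorem IsWeakPartial.unique {n : ℕ} {i : Fin n} {f g g' : E n → ℝ} (h : IsWeakPartial i f g)
    (h' : IsWeakPartial i f g') (hg : Integrable g (𝔪 n))
    (hg' : Integrable g' (𝔪 n)) : g =ᵐ[𝔪 n] g' :=
  ae_eq_of_integral_mul_eq hg hg' fun ψ hψ hs => by
    have := (h ψ hψ hs).symm.trans (h' ψ hψ hs)
    linarith

theorem contDiff_partial {n : ℕ} {ψ : E n → ℝ} (hψ : ContDiff ℝ ∞ ψ) (v : E n) :
    ContDiff ℝ ∞ fun x => fderiv ℝ ψ x v :=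
  (hψ.fderiv_right (m := ∞) (by simp)).clm_apply contDiff_const

/-- Weak derivatives commute, because derivatives of test functions do. -/
theorem IsWeakPartial.comm {n : ℕ} {i j : Fin n} {f gi gj h : E n → ℝ} (hi : IsWeakPartial i f gi)
    (hj : IsWeakPartial j f gj) (hji : IsWeakPartial j gi h) : IsWeakPartial i gj h := by
  intro ψ hψ hs
  have hsym : ∀ x, fderiv ℝ (fun y => fderiv ℝ ψ y (single i 1)) x
        (single j 1)
      = fderiv ℝ (fun y => fderiv ℝ ψ y (single j 1)) x
        (single i 1) := by
    intro x
    have hd : DifferentiableAt ℝ (fderiv ℝ ψ) x :=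
      ((hψ.fderiv_right (m := ∞) (by simp)).differentiable (by simp)) x
    have hs2 : IsSymmSndFDerivAt ℝ ψ x :=
      (hψ.contDiffAt).isSymmSndFDerivAt (by
      simpa using (WithTop.coe_le_coe.2 le_top : ((2 : ℕ∞) : WithTop ℕ∞) ≤ ((⊤ : ℕ∞) : WithTop ℕ∞)))
    rw [fderiv_clm_apply hd (differentiableAt_const _), fderiv_clm_apply hd (differentiableAt_const _)]
    simpa using hs2 _ _
  have h1 := hj _ (contDiff_partial hψ (single i 1))
    ((tsupport_fderiv_apply_subset ℝ _).trans hs)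
  have h2 := hi _ (contDiff_partial hψ (single j 1))
    ((tsupport_fderiv_apply_subset ℝ _).trans hs)
  have h3 := hji ψ hψ hs
  have h12 := h2.symm.trans (by simpa only [hsym] using h1)
  linarith

instance H.instCompleteSpace (n k : ℕ) : CompleteSpace (H n k) := by
  have hc : IsClosed (sobolev n k : Set (PiLp 2 fun _ : MultiIdx n k => Lp ℝ 2 (𝔪 n))) := by
    have e : (sobolev n k : Set (PiLp 2 fun _ : MultiIdx n k => Lp ℝ 2 (𝔪 n)))
        = ⋂ (α : MultiIdx n k) (β : MultiIdx n k) (i : Fin n)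
          (_ : ∀ j, (β.1 j : ℕ) = α.1 j + if j = i then 1 else 0)
          (ψ : E n → ℝ) (_ : ContDiff ℝ ∞ ψ) (_ : tsupport ψ ⊆ ball (0 : E n) 1),
          {u | ∫ x, u α x * fderiv ℝ ψ x (single i 1) ∂𝔪 n
            = - ∫ x, u β x * ψ x ∂𝔪 n} := by
      ext u
      simp only [mem_iInter, mem_ofPred_eq]
      rfl
    rw [e]
    refine isClosed_iInter fun α => isClosed_iInter fun β => isClosed_iInter fun i =>
      isClosed_iInter fun _ => isClosed_iInter fun ψ => isClosed_iInter fun hψ =>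
      isClosed_iInter fun hs => isClosed_eq ?_ ?_
    · exact (continuous_integral_mul_Lp (memLp_of_tsupport (contDiff_partial hψ _).continuous
        ((tsupport_fderiv_apply_subset ℝ _).trans hs))).comp (PiLp.continuous_apply 2 _ α)
    · exact ((continuous_integral_mul_Lp (memLp_of_tsupport hψ.continuous hs)).comp
        (PiLp.continuous_apply 2 _ β)).neg
  exact hc.completeSpace_coe

theorem H.integrable_fn {n k : ℕ} (u : H n k) : Integrable u.fn (𝔪 n) :=
  (Lp.memLp _).integrable (by norm_num)

theorem H.norm_apply_le {n k : ℕ} (u : H n k) (α : MultiIdx n k) : ‖u.1 α‖ ≤ ‖u‖ :=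
  PiLp.norm_apply_le u.1 α

theorem H.norm_le_of_forall {n k : ℕ} (w : H n k) {C : ℝ} (h : ∀ β, ‖w.1 β‖ ≤ C) :
    ‖w‖ ≤ Fintype.card (MultiIdx n k) * C := by
  have h1 : ‖w‖ ≤ ∑ β, ‖w.1 β‖ := by
    refine le_of_sq_le_sq ?_ (Finset.sum_nonneg fun _ _ => norm_nonneg _)
    change ‖w.1‖ ^ 2 ≤ _
    rw [PiLp.norm_sq_eq_of_L2]
    exact Finset.sum_sq_le_sq_sum_of_nonneg fun _ _ => norm_nonneg _
  refine h1.trans ?_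
  simpa only [nsmul_eq_mul, Finset.card_univ] using
    Finset.sum_le_card_nsmul Finset.univ _ _ fun β _ => h β

/-- The multi-index `α + e_i`. -/
def MultiIdx.shift {n k : ℕ} (i : Fin n) (α : MultiIdx n k) : MultiIdx n (k + 1) :=
  ⟨fun j => ⟨α.1 j + if j = i then 1 else 0, by have := (α.1 j).2; split_ifs <;> omega⟩, by
    have := α.2
    simp only [sum_add_distrib, Finset.sum_ite_eq', Finset.mem_univ, if_true]
    omega⟩

/-- A multi-index of order `≤ k`, regarded as one of order `≤ k + 1`. -/
def MultiIdx.incl {n k : ℕ} (α : MultiIdx n k) : MultiIdx n (k + 1) :=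
  ⟨fun j => (α.1 j).castSucc, by simpa using α.2.trans (Nat.le_succ k)⟩

theorem MultiIdx.ext {n k : ℕ} {α β : MultiIdx n k} (h : ∀ j, (α.1 j : ℕ) = β.1 j) : α = β :=
  Subtype.ext (funext fun j => Fin.ext (h j))

theorem MultiIdx.shift_injective {n k : ℕ} (i : Fin n) :
    Function.Injective (MultiIdx.shift (k := k) i) := fun α β h => MultiIdx.ext fun j => by
  have := congrArg (fun γ : MultiIdx n (k + 1) => (γ.1 j : ℕ)) h
  simpa [MultiIdx.shift] using this

theorem MultiIdx.incl_injective {n k : ℕ} :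
    Function.Injective (MultiIdx.incl (n := n) (k := k)) := fun α β h => MultiIdx.ext fun j => by
  have := congrArg (fun γ : MultiIdx n (k + 1) => (γ.1 j : ℕ)) h
  simpa [MultiIdx.incl] using this

/-- The operator that selects derivatives along an embedding of multi-indices. -/
def H.pull {n k l : ℕ} (e : MultiIdx n k → MultiIdx n l) (he : Function.Injective e)
    (hc : ∀ (α β : MultiIdx n k) (i : Fin n), (∀ j, (β.1 j : ℕ) = α.1 j + if j = i then 1 else 0) →
      ∀ j, ((e β).1 j : ℕ) = (e α).1 j + if j = i then 1 else 0) : H n l →L[ℝ] H n k :=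
  LinearMap.mkContinuous
    { toFun := fun u => ⟨WithLp.toLp 2 fun α => u.1 (e α), fun α β i h =>
        u.2 (e α) (e β) i (hc α β i h)⟩
      map_add' := fun _ _ => rfl
      map_smul' := fun _ _ => rfl } 1 (by
    intro u
    rw [one_mul]
    refine le_of_sq_le_sq ?_ (norm_nonneg _)
    change ‖WithLp.toLp 2 fun α => u.1 (e α)‖ ^ 2 ≤ ‖u.1‖ ^ 2
    rw [PiLp.norm_sq_eq_of_L2, PiLp.norm_sq_eq_of_L2]
    calc ∑ α, ‖u.1 (e α)‖ ^ 2 = ∑ β ∈ Finset.univ.map ⟨e, he⟩, ‖u.1 β‖ ^ 2 := by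
          rw [Finset.sum_map]; rfl
      _ ≤ _ := Finset.sum_le_sum_of_subset_of_nonneg (Finset.subset_univ _)
          fun _ _ _ => sq_nonneg _)

/-- The weak partial derivative `∂_i : H^{k+1}(B) → H^k(B)`. -/
def H.D {n k : ℕ} (i : Fin n) : H n (k + 1) →L[ℝ] H n k :=
  H.pull (MultiIdx.shift i) (MultiIdx.shift_injective i) fun α β l h j => by
    simp only [MultiIdx.shift, h j]; ring

/-- The inclusion `H^{k+1}(B) → H^k(B)`. -/
def H.res {n k : ℕ} : H n (k + 1) →L[ℝ] H n k :=
  H.pull MultiIdx.incl MultiIdx.incl_injective fun α β l h j => by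
    simp only [MultiIdx.incl, Fin.val_castSucc, h j]

theorem H.fn_res {n k : ℕ} (u : H n (k + 1)) : (H.res u).fn = u.fn := rfl

theorem H.isWeakPartial {n k : ℕ} (i : Fin n) (u : H n (k + 1)) :
    IsWeakPartial i u.fn (H.D i u).fn :=
  u.2 _ _ i fun j => by simp [MultiIdx.shift]

/-- Lowering a nonzero entry of a multi-index by one. -/
theorem exists_sub_single {n N : ℕ} (f : Fin n → ℕ) (h : ∑ j, f j = N + 1) :
    ∃ (i : Fin n) (g : Fin n → ℕ), (∀ j, f j = g j + if j = i then 1 else 0) ∧ ∑ j, g j = N := by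
  obtain ⟨i, -, hi⟩ : ∃ i ∈ Finset.univ, f i ≠ 0 :=
    Finset.exists_ne_zero_of_sum_ne_zero (by omega)
  have hj : ∀ j, f j = (f j - if j = i then 1 else 0) + if j = i then 1 else 0 := by
    intro j
    split_ifs with hj
    · subst hj; omega
    · rfl
  refine ⟨i, _, hj, ?_⟩
  rw [sum_congr rfl fun j _ => hj j, sum_add_distrib] at h
  simpa using h

/-- A multi-index of order `≤ k + 1` either has order `≤ k` or is of the form `α + e_i`. -/
theorem MultiIdx.cases {n k : ℕ} (β : MultiIdx n (k + 1)) :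
    (∃ α : MultiIdx n k, α.incl = β) ∨ ∃ (i : Fin n) (α : MultiIdx n k), α.shift i = β := by
  by_cases h : ∑ i, (β.1 i : ℕ) ≤ k
  · refine Or.inl ⟨⟨fun j => ⟨β.1 j, ?_⟩, h⟩, MultiIdx.ext fun j => rfl⟩
    have := Finset.single_le_sum (f := fun i => (β.1 i : ℕ)) (fun _ _ => Nat.zero_le _)
      (Finset.mem_univ j)
    omega
  · have h1 : ∑ i, (β.1 i : ℕ) = k + 1 := le_antisymm β.2 (by omega)
    obtain ⟨i, g, hg, hsum⟩ := exists_sub_single (fun j => (β.1 j : ℕ)) h1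
    refine Or.inr ⟨i, ⟨fun j => ⟨g j, ?_⟩, hsum.le⟩, MultiIdx.ext fun j => (hg j).symm⟩
    have := Finset.single_le_sum (f := g) (fun _ _ => Nat.zero_le _) (Finset.mem_univ j)
    omega

/-- The norm of `H^{k+1}(B)` is controlled by the norms in `H^k(B)` of `u` and its first
derivatives. -/
theorem H.norm_le_of_D (n k : ℕ) : ∃ C : ℝ, 0 ≤ C ∧ ∀ w : H n (k + 1),
    ‖w‖ ≤ C * (‖H.res w‖ + ∑ i, ‖H.D i w‖) := by
  refine ⟨Fintype.card (MultiIdx n (k + 1)), Nat.cast_nonneg _, fun w =>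
    w.norm_le_of_forall fun β => ?_⟩
  have hs : 0 ≤ ∑ i, ‖H.D i w‖ := Finset.sum_nonneg fun _ _ => norm_nonneg _
  rcases β.cases with ⟨α, rfl⟩ | ⟨i, α, rfl⟩
  · exact ((H.res w).norm_apply_le α).trans (le_add_of_nonneg_right hs)
  · refine ((H.D i w).norm_apply_le α).trans ?_
    have := Finset.single_le_sum (f := fun i => ‖H.D i w‖) (fun _ _ => norm_nonneg _)
      (Finset.mem_univ i)
    exact this.trans (le_add_of_nonneg_left (norm_nonneg _))

theorem Lp_integrable {n : ℕ} (p : Lp ℝ 2 (𝔪 n)) : Integrable p (𝔪 n) :=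
  (Lp.memLp p).integrable (by norm_num)

theorem H.ext_fn : ∀ {n k : ℕ} {u v : H n k}, u.fn =ᵐ[𝔪 n] v.fn → u = v := by
  intro n k
  induction k with
  | zero =>
    intro u v h
    refine Subtype.ext (PiLp.ext fun α => Lp.ext ?_)
    have : α = ⟨fun _ => 0, by simp⟩ := MultiIdx.ext fun j => by
      have := (α.1 j).2
      simp only [Fin.val_zero]; omega
    rw [this]; exact h
  | succ k ih =>
    intro u v h
    have hr : H.res u = H.res v := ih h
    have hD (i : Fin n) : H.D i u = H.D i v := ih
      (((H.isWeakPartial i u).congr h EventuallyEq.rfl).unique (H.isWeakPartial i v)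
        (H.integrable_fn _) (H.integrable_fn _))
    refine Subtype.ext (PiLp.ext fun β => ?_)
    rcases β.cases with ⟨α, rfl⟩ | ⟨i, α, rfl⟩
    · exact congrArg (fun w : H n k => w.1 α) hr
    · exact congrArg (fun w : H n k => w.1 α) (hD i)

/-- Induction over multi-indices, adding one unit vector at a time. -/
theorem MultiIdx.induct {n k : ℕ} {P : MultiIdx n k → Prop} (h0 : P ⟨fun _ => 0, by simp⟩)
    (hs : ∀ (α β : MultiIdx n k) (i : Fin n),
      (∀ j, (β.1 j : ℕ) = α.1 j + if j = i then 1 else 0) → P α → P β) (α : MultiIdx n k) : P α := by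
  induction hN : ∑ i, (α.1 i : ℕ) generalizing α with
  | zero =>
    have : α = ⟨fun _ => 0, by simp⟩ := MultiIdx.ext fun j => by
      have := (Finset.sum_eq_zero_iff.1 hN) j (Finset.mem_univ j)
      simpa using this
    rwa [this]
  | succ N ih =>
    obtain ⟨i, g, hg, hsum⟩ := exists_sub_single (fun j => (α.1 j : ℕ)) hN
    have hN' := α.2
    exact hs ⟨fun j => ⟨g j, by have := (α.1 j).2; have := hg j; omega⟩,
      hsum.le.trans (by omega)⟩ α i hg (ih _ hsum)

/-- If `v_i ∈ H^k(B)` is the weak derivative `∂_i u` of `u ∈ H^k(B)`, then `D^α v_i = ∂_i D^α u`. -/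
theorem H.isWeakPartial_comp {n k : ℕ} {i : Fin n} {u v : H n k} (h : IsWeakPartial i u.fn v.fn)
    (α : MultiIdx n k) : IsWeakPartial i (u.1 α) (v.1 α) := by
  induction α using MultiIdx.induct with
  | h0 => exact h
  | hs α β j hαβ ih => exact ih.comm (u.2 α β j hαβ) (v.2 α β j hαβ)

/-- A function in `H^k(B)` whose weak first derivatives are in `H^k(B)` belongs to `H^{k+1}(B)`. -/
theorem H.exists_of_partials {n k : ℕ} (u : H n k) (v : Fin n → H n k)
    (h : ∀ i, IsWeakPartial i u.fn (v i).fn) :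
    ∃ w : H n (k + 1), H.res w = u ∧ ∀ i, H.D i w = v i := by
  classical
  have hex : ∀ β : MultiIdx n (k + 1), ∃ p : Lp ℝ 2 (𝔪 n),
      (∀ α : MultiIdx n k, α.incl = β → p = u.1 α) ∧
      ∀ (i : Fin n) (α : MultiIdx n k), α.shift i = β → p = (v i).1 α := by
    -- all the possible choices of the derivative with multi-index `β` agree
    have c1 : ∀ (α α' : MultiIdx n k) (i : Fin n), α'.shift i = α.incl → u.1 α = (v i).1 α' := by
      intro α α' i hi
      refine Lp.ext (IsWeakPartial.unique (u.2 α' α i fun j => ?_) (H.isWeakPartial_comp (h i) α')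
        (Lp_integrable _) (Lp_integrable _))
      have := congrArg (fun γ : MultiIdx n (k + 1) => (γ.1 j : ℕ)) hi
      simpa [MultiIdx.shift, MultiIdx.incl] using this.symm
    have c2 : ∀ (i i' : Fin n) (α α' : MultiIdx n k), α.shift i = α'.shift i' →
        (v i).1 α = (v i').1 α' := by
      intro i i' α α' hh
      have hj : ∀ j, (α.1 j : ℕ) + (if j = i then 1 else 0) = α'.1 j + if j = i' then 1 else 0 := by
        intro j
        exact congrArg (fun γ : MultiIdx n (k + 1) => (γ.1 j : ℕ)) hh
      by_cases hii : i = i'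
      · subst hii
        rw [MultiIdx.shift_injective i hh]
      -- here `α = γ + e_{i'}` and `α' = γ + e_i`
      have hα : ∀ j, (α.1 j : ℕ) = (α.1 j - if j = i' then 1 else 0) + if j = i' then 1 else 0 := by
        intro j
        have := hj j
        split_ifs with h1
        · subst h1; simp only [if_neg (Ne.symm hii), if_true] at this; omega
        · simp
      have hsum : ∑ j, ((α.1 j : ℕ) - if j = i' then 1 else 0) ≤ k :=
        (Finset.sum_le_sum fun j _ => Nat.sub_le _ _).trans α.2
      let γ : MultiIdx n k := ⟨fun j => ⟨α.1 j - if j = i' then 1 else 0,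
        lt_of_le_of_lt (Nat.sub_le _ _) (α.1 j).2⟩, hsum⟩
      have g1 : ∀ j, (α.1 j : ℕ) = γ.1 j + if j = i' then 1 else 0 := hα
      have g2 : ∀ j, (α'.1 j : ℕ) = γ.1 j + if j = i then 1 else 0 := by
        intro j
        have e1 := hj j
        have e2 := g1 j
        omega
      have d1 : IsWeakPartial i (u.1 γ) ((v i).1 γ) := H.isWeakPartial_comp (h i) γ
      have d2 : IsWeakPartial i' (u.1 γ) (u.1 α) := u.2 γ α i' g1
      have d3 : IsWeakPartial i' ((v i).1 γ) ((v i).1 α) := (v i).2 γ α i' g1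
      have e1 : IsWeakPartial i (u.1 α) ((v i).1 α) := d1.comm d2 d3
      have d4 : IsWeakPartial i' (u.1 γ) ((v i').1 γ) := H.isWeakPartial_comp (h i') γ
      have d5 : IsWeakPartial i ((v i').1 γ) ((v i').1 α') := (v i').2 γ α' i g2
      have e2 : (u.1 α : E n → ℝ) =ᵐ[𝔪 n] (v i').1 γ :=
        d2.unique d4 (Lp_integrable _) (Lp_integrable _)
      exact Lp.ext ((e1.congr e2 EventuallyEq.rfl).unique d5 (Lp_integrable _)
        (Lp_integrable _))
    intro β
    rcases β.cases with ⟨α, rfl⟩ | ⟨i, α, rfl⟩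
    · exact ⟨u.1 α, fun α' hα' => by rw [MultiIdx.incl_injective hα'], fun i α' hα' => c1 _ _ _ hα'⟩
    · exact ⟨(v i).1 α, fun α' hα' => (c1 _ _ _ hα'.symm).symm,
        fun i' α' hα' => c2 _ _ _ _ hα'.symm⟩
  choose p hp1 hp2 using hex
  refine ⟨⟨WithLp.toLp 2 p, ?_⟩, ?_, ?_⟩
  · intro β β' i hβ
    change IsWeakPartial i (p β) (p β')
    -- since `|β'| = |β| + 1`, the index `β` has order at most `k`
    have hle : ∑ j, (β.1 j : ℕ) ≤ k := by
      have h1 := β'.2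
      rw [sum_congr rfl fun j _ => hβ j, sum_add_distrib] at h1
      simp at h1
      omega
    have hlt : ∀ j, (β.1 j : ℕ) < k + 1 := fun j => by
      have := Finset.single_le_sum (f := fun i => (β.1 i : ℕ)) (fun _ _ => Nat.zero_le _)
        (Finset.mem_univ j)
      omega
    let α : MultiIdx n k := ⟨fun j => ⟨β.1 j, hlt j⟩, hle⟩
    have e1 : α.incl = β := MultiIdx.ext fun j => rfl
    have e2 : α.shift i = β' := MultiIdx.ext fun j => (hβ j).symm
    rw [hp1 β α e1, hp2 β' i α e2]
    exact H.isWeakPartial_comp (h i) α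
  · exact Subtype.ext (PiLp.ext fun α => hp1 _ α rfl)
  · exact fun i => Subtype.ext (PiLp.ext fun α => hp2 _ i α rfl)

/-- `L²(B)` as `H^0(B)`. -/
theorem H.exists_zero {n : ℕ} {f : E n → ℝ} (hf : MemLp f 2 (𝔪 n)) :
    ∃ u : H n 0, u.fn =ᵐ[𝔪 n] f := by
  refine ⟨⟨WithLp.toLp 2 fun _ => hf.toLp f, ?_⟩, hf.coeFn_toLp⟩
  intro α β i h
  have := h i
  have h2 := (β.1 i).2
  simp at this

/-! ### Density of smooth functions in `H^k(B)` -/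

/-- A classical derivative on the open ball is a weak derivative. -/
theorem isWeakPartial_of_contDiffOn {n : ℕ} (i : Fin n) {f : E n → ℝ}
    (hf : ContDiffOn ℝ 1 f (ball (0 : E n) 1)) :
    IsWeakPartial i f fun x => fderiv ℝ f x (single i 1) := by
  intro ψ hψ hs
  have hK : IsCompact (tsupport ψ) := (isCompact_closedBall (0 : E n) 1).of_isClosed_subset
    (isClosed_tsupport ψ) (hs.trans ball_subset_closedBall)
  have hz : ∀ x, x ∉ tsupport ψ → ψ x = 0 := fun x hx => image_eq_zero_of_notMem_tsupport hx
  have hz' : ∀ x, x ∉ tsupport ψ → fderiv ℝ ψ x (single i 1) = 0 := fun x hx =>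
    image_eq_zero_of_notMem_tsupport (f := fun x => fderiv ℝ ψ x (single i 1))
      fun h => hx (tsupport_fderiv_apply_subset ℝ _ h)
  have hd : ∀ x ∈ tsupport ψ, DifferentiableAt ℝ f x := fun x hx =>
    (hf.differentiableOn one_ne_zero).differentiableAt (isOpen_ball.mem_nhds (hs hx))
  have hfc : ContinuousOn f (tsupport ψ) := hf.continuousOn.mono hs
  have hf'c : ContinuousOn (fun x => fderiv ℝ f x (single i 1)) (tsupport ψ) :=
    ((hf.continuousOn_fderiv_of_isOpen isOpen_ball le_rfl).clm_apply continuousOn_const).mono hs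
  have hψ' := (contDiff_partial hψ (single i 1)).continuous
  have key {h : E n → ℝ} (hc : ContinuousOn h (tsupport ψ)) (h0 : ∀ x, x ∉ tsupport ψ → h x = 0) :
      Integrable h volume :=
    (integrableOn_iff_integrable_of_support_subset fun x hx => by
      by_contra hx'; exact hx (h0 x hx')).1 (hc.integrableOn_compact hK)
  have e1 : ∫ x, f x * fderiv ℝ ψ x (single i 1) ∂𝔪 n
      = ∫ x, f x * fderiv ℝ ψ x (single i 1) :=
    setIntegral_eq_integral_of_forall_compl_eq_zero
      fun x hx => by rw [hz' x fun h => hx (hs h), mul_zero]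
  have e2 : ∫ x, fderiv ℝ f x (single i 1) * ψ x ∂𝔪 n
      = ∫ x, fderiv ℝ f x (single i 1) * ψ x :=
    setIntegral_eq_integral_of_forall_compl_eq_zero
      fun x hx => by rw [hz x fun h => hx (hs h), mul_zero]
  rw [e1, e2]
  exact integral_mul_fderiv_eq_neg_fderiv_mul_of_integrable (μ := (volume : Measure (E n)))
    (f := f) (g := ψ) (v := single i 1)
    (key (hf'c.mul hψ.continuous.continuousOn) fun x hx => by rw [hz x hx, mul_zero])
    (key (hfc.mul hψ'.continuousOn) fun x hx => by rw [hz' x hx, mul_zero])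
    (key (hfc.mul hψ.continuous.continuousOn) fun x hx => by rw [hz x hx, mul_zero])
    hd (fun x _ => hψ.differentiable (by simp) x)

/-- The kernel `t ↦ φ(y - t)` of the mollification with a bump function `φ` of integral `1`. -/
def kern {n : ℕ} (φ : ContDiffBump (0 : E n)) (y t : E n) : ℝ := φ.normed volume (y - t)

/-- The mollification, with a smooth bump function `φ` as kernel, of the extension by zero of a
function on the ball. -/
def molly {n : ℕ} (φ : ContDiffBump (0 : E n)) (p : E n → ℝ) (y : E n) : ℝ :=
  ∫ t, p t * kern φ y t ∂𝔪 n

section Kernel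

variable {n : ℕ} (φ : ContDiffBump (0 : E n)) (y : E n)

theorem kern_nonneg (t : E n) : 0 ≤ kern φ y t := φ.nonneg_normed _

theorem continuous_kern : Continuous (kern φ y) :=
  φ.continuous_normed.comp (continuous_const.sub continuous_id)

theorem integrable_kern : Integrable (kern φ y) := φ.integrable_normed.comp_sub_left y

theorem integral_kern : ∫ t, kern φ y t = 1 :=
  (integral_sub_left_eq_self (φ.normed volume) volume y).trans φ.integral_normed

theorem integrable_mul_kern {q : E n → ℝ} (hq : Integrable q (𝔪 n)) :
    Integrable (fun t => q t * kern φ y t) (𝔪 n) :=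
  hq.mul_bdd (c := 1 / volume.real (closedBall (0 : E n) φ.rIn))
    (continuous_kern φ y).aestronglyMeasurable (.of_forall fun t => by
      rw [Real.norm_of_nonneg (kern_nonneg φ y t)]
      exact φ.normed_le_div_measure_closedBall_rIn _ _)

theorem norm_sub_lt_of_kern_ne_zero {t : E n} (h : kern φ y t ≠ 0) : ‖y - t‖ < φ.rOut := by
  have : y - t ∈ Function.support (φ.normed (volume : Measure (E n))) := h
  rwa [φ.support_normed_eq, mem_ball_zero_iff] at this

end Kernel

theorem molly_eq_convolution {n : ℕ} (φ : ContDiffBump (0 : E n)) (p : E n → ℝ) :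
    molly φ p = convolution ((ball (0 : E n) 1).indicator p) (φ.normed volume)
      (ContinuousLinearMap.mul ℝ ℝ) volume := by
  funext y
  rw [molly, convolution_def, ballMeasure, ← integral_indicator measurableSet_ball]
  refine integral_congr_ae (.of_forall fun t => ?_)
  by_cases ht : t ∈ ball (0 : E n) 1 <;> simp [ht, kern]

theorem locallyIntegrable_indicator {n : ℕ} {p : E n → ℝ} (hp : Integrable p (𝔪 n)) :
    LocallyIntegrable ((ball (0 : E n) 1).indicator p) volume :=
  ((integrable_indicator_iff measurableSet_ball).2 hp).locallyIntegrable

theorem contDiff_molly {n : ℕ} (φ : ContDiffBump (0 : E n)) {p : E n → ℝ}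
    (hp : Integrable p (𝔪 n)) : ContDiff ℝ ∞ (molly φ p) := by
  rw [molly_eq_convolution]
  exact φ.hasCompactSupport_normed.contDiff_convolution_right _ (locallyIntegrable_indicator hp)
    φ.contDiff_normed

theorem tsupport_kern {n : ℕ} (φ : ContDiffBump (0 : E n)) (y : E n) :
    tsupport (kern φ y) ⊆ closedBall y φ.rOut := by
  refine closure_minimal (fun t ht => ?_) isClosed_closedBall
  rw [mem_closedBall, dist_comm, dist_eq_norm]
  exact (norm_sub_lt_of_kern_ne_zero φ y ht).le

/-- Mollification commutes with weak derivatives away from the boundary. -/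
theorem fderiv_molly {n : ℕ} (φ : ContDiffBump (0 : E n)) {i : Fin n} {p q : E n → ℝ}
    (hp : Integrable p (𝔪 n)) (h : IsWeakPartial i p q) {y : E n}
    (hy : ‖y‖ + φ.rOut < 1) :
    fderiv ℝ (molly φ p) y (single i 1) = molly φ q y := by
  have hφ1 : ContDiff ℝ 1 (φ.normed (volume : Measure (E n))) := φ.contDiff_normed
  have hφ : ContDiff ℝ ∞ (φ.normed (volume : Measure (E n))) := φ.contDiff_normed
  have h1 := (φ.hasCompactSupport_normed (μ := (volume : Measure (E n)))).hasFDerivAt_convolution_right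
    (ContinuousLinearMap.mul ℝ ℝ) (locallyIntegrable_indicator hp) hφ1 y
  rw [molly_eq_convolution, h1.fderiv, convolution_precompR_apply _ (locallyIntegrable_indicator hp)
    (φ.hasCompactSupport_normed.fderiv ℝ) (hφ1.continuous_fderiv one_ne_zero)]
  have h2 := h (kern φ y) (hφ.comp (contDiff_const.sub contDiff_id))
    ((tsupport_kern φ y).trans fun t ht => by
      rw [mem_closedBall, dist_eq_norm] at ht
      rw [mem_ball_zero_iff]
      calc ‖t‖ = ‖(t - y) + y‖ := by rw [sub_add_cancel]
        _ ≤ ‖t - y‖ + ‖y‖ := norm_add_le _ _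
        _ < 1 := by linarith)
  have h3 : ∀ t, fderiv ℝ (kern φ y) t (single i 1)
      = - fderiv ℝ (φ.normed (volume : Measure (E n))) (y - t) (single i 1) := by
    intro t
    have hd : HasFDerivAt (φ.normed (volume : Measure (E n)))
      (fderiv ℝ (φ.normed (volume : Measure (E n))) (y - t)) (y - t) :=
      ((hφ1.differentiable one_ne_zero) _).hasFDerivAt
    have := hd.comp t ((hasFDerivAt_id t).const_sub y)
    exact (congrArg (fun L : E n →L[ℝ] ℝ => L (single i 1)) this.fderiv).trans
      (by simp)
  simp only [h3, mul_neg, integral_neg, neg_inj] at h2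
  rw [molly, ← h2, convolution_def, ballMeasure, ← integral_indicator measurableSet_ball]
  refine integral_congr_ae (.of_forall fun t => ?_)
  by_cases ht : t ∈ ball (0 : E n) 1 <;> simp [ht]

theorem lintegral_comp_smul {n : ℕ} (f : E n → ℝ≥0∞) {l : ℝ} (hl : 0 < l) :
    ∫⁻ x, f (l • x) = ofReal ((l ^ n)⁻¹) * ∫⁻ x, f x := by
  have e := Measure.map_addHaar_smul (volume : Measure (E n)) hl.ne'
  have h := lintegral_map_equiv (μ := volume) f
    (Homeomorph.smulOfNeZero (α := E n) l hl.ne').toMeasurableEquiv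
  have h' : ∫⁻ x, f (l • x) = ∫⁻ x, f x ∂(Measure.map (fun x : E n => l • x) volume) := h.symm
  rw [h', e, lintegral_smul_measure, abs_of_nonneg (by positivity), finrank_euclideanSpace_fin]
  rfl

/-- The variance of `p` with respect to the kernel is nonnegative. -/
theorem sq_molly_le {n : ℕ} (φ : ContDiffBump (0 : E n)) {p : E n → ℝ}
    (hp : MemLp p 2 (𝔪 n)) (y : E n) :
    (molly φ p y) ^ 2 ≤ ∫ t, p t ^ 2 * kern φ y t ∂𝔪 n := by
  set c := molly φ p y with hc
  have i1 := integrable_mul_kern φ y hp.integrable_sq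
  have i2 := integrable_mul_kern φ y (hp.integrable (by norm_num))
  have i3 : Integrable (kern φ y) (𝔪 n) := (integrable_kern φ y).restrict
  have m : ∫ t, kern φ y t ∂𝔪 n ≤ 1 :=
    (setIntegral_le_integral (integrable_kern φ y) (.of_forall (kern_nonneg φ y))).trans
      (integral_kern φ y).le
  have h0 : 0 ≤ ∫ t, (p t - c) ^ 2 * kern φ y t ∂𝔪 n :=
    integral_nonneg fun t => mul_nonneg (sq_nonneg _) (kern_nonneg φ y t)
  have e : ∫ t, (p t - c) ^ 2 * kern φ y t ∂𝔪 n
      = ∫ t, p t ^ 2 * kern φ y t ∂𝔪 n - 2 * c * c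
        + c ^ 2 * ∫ t, kern φ y t ∂𝔪 n := by
    conv_rhs => rw [mul_assoc]; enter [1, 2, 2, 2]; rw [hc, molly]
    rw [← integral_const_mul, ← integral_const_mul, ← integral_const_mul, ← integral_sub i1,
      ← integral_add]
    · refine integral_congr_ae (.of_forall fun t => ?_)
      simp only; ring
    · exact i1.sub ((i2.const_mul _).const_mul _)
    · exact i3.const_mul _
    · exact (i2.const_mul _).const_mul _
  nlinarith [sq_nonneg c]

theorem eLpNorm_two_sq {n : ℕ} (f : E n → ℝ) (μ : Measure (E n)) :
    eLpNorm f 2 μ ^ (2 : ℝ) = ∫⁻ x, ofReal (f x ^ 2) ∂μ := by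
  have := eLpNorm_nnreal_pow_eq_lintegral (f := f) (μ := μ) (p := 2) two_ne_zero
  simp only [ENNReal.coe_ofNat, NNReal.coe_ofNat] at this
  rw [this]
  refine lintegral_congr fun x => ?_
  rw [← ofReal_norm, ENNReal.ofReal_rpow_of_nonneg (norm_nonneg _) zero_le_two]
  simp

theorem eLpNorm_molly_le {n : ℕ} (φ : ContDiffBump (0 : E n)) {p : E n → ℝ}
    (hp : MemLp p 2 (𝔪 n)) {l : ℝ} (hl : 1 / 2 ≤ l) :
    eLpNorm (fun x => molly φ p (l • x)) 2 (𝔪 n)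
      ≤ ofReal (2 ^ n) * eLpNorm p 2 (𝔪 n) := by
  have hl0 : 0 < l := by linarith
  have hφc : Continuous (φ.normed (volume : Measure (E n))) := φ.continuous_normed
  have hone : ∀ t, ∫⁻ y, ofReal (kern φ y t) = 1 := fun t =>
    (lintegral_sub_right_eq_self (fun y => ofReal (φ.normed volume y)) t).trans (by
      rw [← ofReal_integral_eq_lintegral_ofReal φ.integrable_normed
        (.of_forall fun t => φ.nonneg_normed _), φ.integral_normed, ENNReal.ofReal_one])
  obtain ⟨p', hp'm, hpp'⟩ := hp.1
  have hp'2 : MemLp p' 2 (𝔪 n) := hp.ae_eq hpp'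
  have hmeq : ∀ y, molly φ p y = molly φ p' y := fun y => integral_congr_ae
    (hpp'.mono fun t ht => show p t * _ = p' t * _ by rw [ht])
  have h1 : ∫⁻ x, ofReal (molly φ p (l • x) ^ 2) ∂𝔪 n
      ≤ ofReal ((l ^ n)⁻¹) * ∫⁻ t, ofReal (p t ^ 2) ∂𝔪 n := by
    calc ∫⁻ x, ofReal (molly φ p (l • x) ^ 2) ∂𝔪 n
        ≤ ∫⁻ x, ∫⁻ t, ofReal (p' t ^ 2) * ofReal (kern φ (l • x) t)
            ∂𝔪 n ∂(volume : Measure (E n)) := by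
          refine lintegral_mono' Measure.restrict_le_self fun x => ?_
          rw [hmeq]
          refine (ENNReal.ofReal_le_ofReal (sq_molly_le φ hp'2 (l • x))).trans ?_
          rw [ofReal_integral_eq_lintegral_ofReal]
          · refine lintegral_mono fun t => ?_
            rw [ENNReal.ofReal_mul (sq_nonneg _)]
          · exact integrable_mul_kern φ _ hp'2.integrable_sq
          · exact .of_forall fun t => mul_nonneg (sq_nonneg _) (kern_nonneg φ _ t)
      _ = ∫⁻ t, ∫⁻ x, ofReal (p' t ^ 2) * ofReal (kern φ (l • x) t)
            ∂(volume : Measure (E n)) ∂𝔪 n := by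
          refine lintegral_lintegral_swap (Measurable.aemeasurable ?_)
          have m1 : Measurable fun z : E n × E n => ofReal (p' z.2 ^ 2) :=
            ((hp'm.measurable.comp measurable_snd).pow_const 2).ennreal_ofReal
          have m2 : Measurable fun z : E n × E n => ofReal (kern φ (l • z.1) z.2) :=
            (hφc.comp ((continuous_fst.const_smul l).sub continuous_snd)).measurable.ennreal_ofReal
          exact m1.mul m2
      _ = ∫⁻ t, ofReal (p' t ^ 2) * ofReal ((l ^ n)⁻¹) ∂𝔪 n := by
          refine lintegral_congr fun t => ?_
          have m1 : Measurable fun x : E n => ofReal (kern φ (l • x) t) :=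
            (hφc.comp ((continuous_id.const_smul l).sub continuous_const)).measurable.ennreal_ofReal
          rw [lintegral_const_mul _ m1,
            lintegral_comp_smul (fun y => ofReal (kern φ y t)) hl0, hone, mul_one]
      _ = _ := by
          rw [lintegral_mul_const' _ _ ENNReal.ofReal_ne_top, mul_comm]
          congr 1
          exact lintegral_congr_ae (hpp'.mono fun t ht => show ofReal (p' t ^ 2)
            = ofReal (p t ^ 2) by rw [ht])
  have h2 : eLpNorm (fun x => molly φ p (l • x)) 2 (𝔪 n) ^ (2 : ℝ)
      ≤ (ofReal (2 ^ n) * eLpNorm p 2 (𝔪 n)) ^ (2 : ℝ) := by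
    rw [ENNReal.mul_rpow_of_nonneg _ _ zero_le_two, eLpNorm_two_sq, eLpNorm_two_sq]
    refine h1.trans ?_
    gcongr
    rw [ENNReal.ofReal_rpow_of_nonneg (by positivity) zero_le_two]
    refine ENNReal.ofReal_le_ofReal ?_
    calc (l ^ n)⁻¹ ≤ ((1 / 2 : ℝ) ^ n)⁻¹ := by gcongr
      _ = 2 ^ n := by simp
      _ ≤ (2 ^ n : ℝ) ^ (2 : ℝ) := by
        rw [Real.rpow_two]
        have : (1 : ℝ) ≤ 2 ^ n := one_le_pow₀ (by norm_num)
        nlinarith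
  exact (ENNReal.rpow_le_rpow_iff zero_lt_two).1 h2

/-- Mollifying and dilating slightly changes an `L²` function little. -/
theorem exists_eLpNorm_molly_sub_le {n : ℕ} {p : E n → ℝ} (hp : MemLp p 2 (𝔪 n)) (N : ℕ)
    {ε : ℝ≥0∞} (hε : ε ≠ 0) : ∃ δ₀ : ℝ, 0 < δ₀ ∧ ∀ φ : ContDiffBump (0 : E n), φ.rOut < δ₀ →
      eLpNorm (fun x => (1 - 2 * φ.rOut) ^ N * molly φ p ((1 - 2 * φ.rOut) • x) - p x) 2
        (𝔪 n) ≤ ε := by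
  rcases eq_or_ne ε ⊤ with rfl | hεt
  · exact ⟨1, one_pos, fun _ _ => le_top⟩
  set c : ℝ≥0∞ := ofReal (2 ^ n) with hc
  set K : ℝ≥0∞ := (𝔪 n) univ ^ (2 : ℝ≥0∞).toReal⁻¹ with hK
  have hKt : K ≠ ⊤ := ENNReal.rpow_ne_top_of_nonneg (by positivity) (measure_ne_top _ _)
  have hε2 : ε / 2 ≠ 0 := (ENNReal.half_pos hε).ne'
  have hct : c + 1 ≠ ⊤ := ENNReal.add_ne_top.2 ⟨ENNReal.ofReal_ne_top, ENNReal.one_ne_top⟩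
  have hKt' : K + 1 ≠ ⊤ := ENNReal.add_ne_top.2 ⟨hKt, ENNReal.one_ne_top⟩
  have hε2t : ε / 2 ≠ ⊤ := (ENNReal.half_lt_self hε hεt).ne_top
  obtain ⟨h, hcs, hh, hcont, hmem⟩ := hp.exists_hasCompactSupport_eLpNorm_sub_le
    (by simp) (ε := ε / 2 / (c + 1)) (ENNReal.div_ne_zero.2 ⟨hε2, hct⟩)
  set η : ℝ := (ε / 2 / (K + 1)).toReal with hη
  have hηpos : 0 < η := ENNReal.toReal_pos (ENNReal.div_ne_zero.2 ⟨hε2, hKt'⟩)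
    (ENNReal.div_ne_top hε2t (by simp))
  obtain ⟨M, hM⟩ := hcont.bounded_above_of_compact_support hcs
  have hM0 : 0 ≤ M := (norm_nonneg _).trans (hM 0)
  obtain ⟨r, hr, hrh⟩ := Metric.uniformContinuous_iff.1
    (hcont.uniformContinuous_of_tendsto_cocompact hcs.is_zero_at_infty) (η / 2) (by linarith)
  -- the factor `(1 - 2δ)^N` tends to `1`
  obtain ⟨s, hs, hsN⟩ : ∃ s : ℝ, 0 < s ∧ ∀ δ : ℝ, |δ| < s →
      |(1 - 2 * δ) ^ N - 1| ≤ η / (2 * (M + 1)) := by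
    have hcN : Continuous fun δ : ℝ => (1 - 2 * δ) ^ N := by fun_prop
    obtain ⟨s, hs, h⟩ := Metric.continuousAt_iff.1 (hcN.continuousAt (x := 0))
      (η / (2 * (M + 1))) (by positivity)
    refine ⟨s, hs, fun δ hδ => ?_⟩
    have := h (x := δ) (by simpa using hδ)
    simpa [Real.dist_eq] using this.le
  refine ⟨min (min (1 / 4) (r / 3)) s, by positivity, fun φ hφ => ?_⟩
  have hφ0 := φ.rOut_pos
  have hφ1 : φ.rOut < 1 / 4 := hφ.trans_le ((min_le_left _ _).trans (min_le_left _ _))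
  have hφ2 : φ.rOut < r / 3 := hφ.trans_le ((min_le_left _ _).trans (min_le_right _ _))
  have hφ3 : φ.rOut < s := hφ.trans_le (min_le_right _ _)
  set l := 1 - 2 * φ.rOut with hl
  have hl0 : 1 / 2 ≤ l := by linarith
  have hl1 : l ≤ 1 := by linarith
  have hln : 0 ≤ l ^ N := pow_nonneg (by linarith) _
  have hln1 : l ^ N ≤ 1 := pow_le_one₀ (by linarith) hl1
  have hd : MemLp (p - h) 2 (𝔪 n) := hp.sub hmem
  have hint {q : E n → ℝ} (hq : MemLp q 2 (𝔪 n)) (y : E n) :=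
    integrable_mul_kern φ y (hq.integrable (by norm_num))
  have hsub : ∀ y, molly φ p y = molly φ (p - h) y + molly φ h y := fun y => by
    simp only [molly]
    rw [← integral_add (hint hd y) (hint hmem y)]
    refine integral_congr_ae (.of_forall fun t => ?_)
    simp only [Pi.sub_apply]; ring
  have hmc {q : E n → ℝ} (hq : MemLp q 2 (𝔪 n)) :
      Continuous fun x => molly φ q (l • x) :=
    (contDiff_molly φ (hq.integrable (by norm_num))).continuous.comp (continuous_const_smul l)
  -- the error for the continuous function `h` is uniformly small
  have hmid : ∀ x ∈ ball (0 : E n) 1, ‖l ^ N * molly φ h (l • x) - h x‖ ≤ η := by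
    intro x hx
    rw [mem_ball_zero_iff] at hx
    have hnear : ∀ t, kern φ (l • x) t ≠ 0 →
        t ∈ ball (0 : E n) 1 ∧ ‖h t - h x‖ ≤ η / 2 := by
      intro t ht
      have := norm_sub_lt_of_kern_ne_zero φ _ ht
      have e1 : ‖l • x‖ ≤ l := by
        rw [norm_smul, Real.norm_of_nonneg (by linarith)]
        nlinarith
      have e2 : ‖l • x - x‖ ≤ 2 * φ.rOut := by
        rw [show l • x - x = -((2 * φ.rOut) • x) by rw [hl, sub_smul, one_smul]; abel, norm_neg,
          norm_smul, Real.norm_of_nonneg (by linarith)]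
        nlinarith [norm_nonneg x]
      constructor
      · rw [mem_ball_zero_iff]
        calc ‖t‖ = ‖l • x - (l • x - t)‖ := by rw [sub_sub_cancel]
          _ ≤ ‖l • x‖ + ‖l • x - t‖ := norm_sub_le _ _
          _ < 1 := by linarith
      · have : dist t x < r := by
          rw [dist_eq_norm]
          calc ‖t - x‖ = ‖(l • x - x) - (l • x - t)‖ := by congr 1; abel
            _ ≤ ‖l • x - x‖ + ‖l • x - t‖ := norm_sub_le _ _
            _ < r := by linarith
        have := hrh this
        rw [dist_eq_norm] at this
        exact this.le
    have hone : ∫ t, kern φ (l • x) t ∂𝔪 n = 1 := by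
      refine (setIntegral_eq_integral_of_forall_compl_eq_zero fun t ht => ?_).trans
        (integral_kern φ (l • x))
      by_contra h0
      exact ht (hnear t h0).1
    have hi1 : Integrable (kern φ (l • x)) (𝔪 n) := (integrable_kern φ _).restrict
    have e3 : ‖molly φ h (l • x) - h x‖ ≤ η / 2 := by
      have : molly φ h (l • x) - h x
          = ∫ t, (h t - h x) * kern φ (l • x) t ∂𝔪 n := by
        rw [molly]
        simp only [sub_mul]
        rw [integral_sub (hint hmem _) (hi1.const_mul _), integral_const_mul, hone, mul_one]
      rw [this]
      refine (norm_integral_le_of_norm_le (hi1.const_mul (η / 2))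
        (.of_forall fun t => ?_)).trans ?_
      · rw [norm_mul, Real.norm_of_nonneg (kern_nonneg φ _ t)]
        by_cases h0 : kern φ (l • x) t = 0
        · rw [h0]; simp
        · exact mul_le_mul_of_nonneg_right (hnear t h0).2 (kern_nonneg φ _ t)
      · rw [integral_const_mul, hone, mul_one]
    have e4 := hsN φ.rOut (by rwa [abs_of_pos hφ0])
    calc ‖l ^ N * molly φ h (l • x) - h x‖
        = ‖l ^ N * (molly φ h (l • x) - h x) + (l ^ N - 1) * h x‖ := by congr 1; ring
      _ ≤ ‖l ^ N * (molly φ h (l • x) - h x)‖ + ‖(l ^ N - 1) * h x‖ := norm_add_le _ _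
      _ ≤ 1 * (η / 2) + η / (2 * (M + 1)) * M := by
        rw [norm_mul, norm_mul, Real.norm_of_nonneg hln]
        gcongr
        · exact e4
        · exact hM x
      _ ≤ η := by
        have : η / (2 * (M + 1)) * M ≤ η / 2 := by
          rw [div_mul_eq_mul_div, div_le_div_iff₀ (by positivity) two_pos]
          nlinarith
        linarith
  have hdecomp : (fun x => l ^ N * molly φ p (l • x) - p x)
      = ((l ^ N) • fun x => molly φ (p - h) (l • x))
        + ((fun x => l ^ N * molly φ h (l • x) - h x) - (p - h)) := by
    funext x
    simp only [Pi.add_apply, Pi.sub_apply, Pi.smul_apply, smul_eq_mul, hsub]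
    ring
  have m1 : AEStronglyMeasurable ((l ^ N) • fun x => molly φ (p - h) (l • x)) (𝔪 n) :=
    ((hmc hd).const_smul _).aestronglyMeasurable
  have m2 : AEStronglyMeasurable (fun x => l ^ N * molly φ h (l • x) - h x) (𝔪 n) :=
    ((continuous_const.mul (hmc hmem)).sub hcont).aestronglyMeasurable
  rw [hdecomp]
  have b1 : eLpNorm ((l ^ N) • fun x => molly φ (p - h) (l • x)) 2 (𝔪 n)
      ≤ c * (ε / 2 / (c + 1)) := by
    refine (eLpNorm_const_smul_le).trans ?_
    have : ‖l ^ N‖ₑ ≤ 1 := by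
      rw [← ofReal_norm, Real.norm_of_nonneg hln]
      simpa using ENNReal.ofReal_le_ofReal hln1
    calc _ ≤ 1 * (c * eLpNorm (p - h) 2 (𝔪 n)) := by
          gcongr
          exact eLpNorm_molly_le φ hd hl0
      _ ≤ _ := by rw [one_mul]; gcongr
  have b2 : eLpNorm (fun x => l ^ N * molly φ h (l • x) - h x) 2 (𝔪 n) ≤ ε / 2 := by
    refine (eLpNorm_le_of_ae_bound (C := η) ?_).trans ?_
    · filter_upwards [ae_restrict_mem measurableSet_ball] with x hx using hmid x hx
    · rw [← hK, hη, ENNReal.ofReal_toReal (ENNReal.div_ne_top hε2t (by simp))]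
      calc K * (ε / 2 / (K + 1)) ≤ (K + 1) * (ε / 2 / (K + 1)) := by gcongr; exact le_self_add
        _ = ε / 2 := ENNReal.mul_div_cancel (by simp) hKt'
  calc _ ≤ eLpNorm ((l ^ N) • fun x => molly φ (p - h) (l • x)) 2 (𝔪 n)
        + (eLpNorm (fun x => l ^ N * molly φ h (l • x) - h x) 2 (𝔪 n)
          + eLpNorm (p - h) 2 (𝔪 n)) := by
        refine (eLpNorm_add_le m1 (m2.sub hd.1) (by norm_num)).trans ?_
        gcongr
        exact eLpNorm_sub_le m2 hd.1 (by norm_num)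
    _ ≤ c * (ε / 2 / (c + 1)) + (ε / 2 + ε / 2 / (c + 1)) := by gcongr
    _ = (c + 1) * (ε / 2 / (c + 1)) + ε / 2 := by ring
    _ = ε := by rw [ENNReal.mul_div_cancel (by simp) hct, ENNReal.add_halves]

theorem memLp_of_continuousOn {n : ℕ} {g : E n → ℝ} (hg : ContinuousOn g (𝔹 n)) :
    MemLp g 2 (𝔪 n) := by
  obtain ⟨C, hC⟩ := (isCompact_closedBall (0 : E n) 1).exists_bound_of_continuousOn hg
  refine MemLp.of_bound
    ((hg.mono ball_subset_closedBall).aestronglyMeasurable measurableSet_ball) C ?_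
  filter_upwards [ae_restrict_mem measurableSet_ball] with x hx
  exact hC x (ball_subset_closedBall hx)

/-- `f` is a smooth function on `ℝⁿ` that represents `u` on the ball. -/
def IsSmoothRep {n k : ℕ} (u : H n k) (f : E n → ℝ) : Prop :=
  ContDiff ℝ ∞ f ∧ u.fn =ᵐ[𝔪 n] f

/-- Smooth functions are dense in `H^k(B)`. -/
theorem H.exists_isSmoothRep_near {n k : ℕ} (u : H n k) {ε : ℝ} (hε : 0 < ε) :
    ∃ (w : H n k) (f : E n → ℝ), IsSmoothRep w f ∧ ‖w - u‖ < ε := by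
  set K : ℝ := (Fintype.card (MultiIdx n k) : ℝ)
  have hK : 0 ≤ K := Nat.cast_nonneg _
  have hε' : ofReal (ε / (K + 1)) ≠ 0 := (ENNReal.ofReal_pos.2 (by positivity)).ne'
  choose δ hδ hφδ using fun α : MultiIdx n k =>
    exists_eLpNorm_molly_sub_le (Lp.memLp (u.1 α)) (∑ j, (α.1 j : ℕ)) hε'
  obtain ⟨d, hd, hd'⟩ : ∃ d : ℝ, 0 < d ∧ ∀ α, d < δ α := by
    obtain ⟨d, hd⟩ : ∃ d : ℝ, 0 < d ∧ ∀ α, d ≤ δ α := by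
      have : ∀ᶠ d in nhdsWithin (0 : ℝ) (Ioi 0), 0 < d ∧ ∀ α, d ≤ δ α := by
        refine Eventually.and self_mem_nhdsWithin (eventually_all.2 fun α => ?_)
        exact nhdsWithin_le_nhds (eventually_le_nhds (hδ α))
      exact this.exists
    exact ⟨d / 2, by linarith, fun α => by linarith [hd.2 α]⟩
  let φ : ContDiffBump (0 : E n) := ⟨min d (1 / 4) / 2, min d (1 / 4), by positivity, by
    have : 0 < min d (1 / 4) := by positivity
    linarith⟩
  have hφ1 : φ.rOut ≤ 1 / 4 := min_le_right _ _
  have hφ0 := φ.rOut_pos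
  set l : ℝ := 1 - 2 * φ.rOut with hl
  let g : MultiIdx n k → E n → ℝ := fun α x =>
    l ^ (∑ j, (α.1 j : ℕ)) * molly φ (u.1 α) (l • x)
  have hg : ∀ α, ContDiff ℝ ∞ (g α) := fun α => contDiff_const.mul
    ((contDiff_molly φ (Lp_integrable _)).comp (contDiff_const_smul l))
  have hgm : ∀ α, MemLp (g α) 2 (𝔪 n) := fun α =>
    memLp_of_continuousOn (hg α).continuous.continuousOn
  have hgd : ∀ (α β : MultiIdx n k) (i : Fin n),
      (∀ j, (β.1 j : ℕ) = α.1 j + if j = i then 1 else 0) → IsWeakPartial i (g α) (g β) := by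
    intro α β i hαβ
    refine (isWeakPartial_of_contDiffOn i
      ((hg α).of_le (by simp)).contDiffOn).congr EventuallyEq.rfl ?_
    filter_upwards [ae_restrict_mem measurableSet_ball] with x hx
    rw [mem_ball_zero_iff] at hx
    have hsum : ∑ j, (β.1 j : ℕ) = ∑ j, (α.1 j : ℕ) + 1 := by
      rw [sum_congr rfl fun j _ => hαβ j, sum_add_distrib]
      simp
    have hm : HasFDerivAt (molly φ (u.1 α)) (fderiv ℝ (molly φ (u.1 α)) (l • x)) (l • x) :=
      ((contDiff_molly φ (Lp_integrable _)).differentiable (by simp) _).hasFDerivAt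
    have h1 : HasFDerivAt (g α) (l ^ (∑ j, (α.1 j : ℕ)) •
        (fderiv ℝ (molly φ (u.1 α)) (l • x)).comp (l • ContinuousLinearMap.id ℝ (E n))) x :=
      (hm.comp x ((hasFDerivAt_id x).const_smul l)).const_mul _
    have h2 : fderiv ℝ (molly φ (u.1 α)) (l • x) (single i 1)
        = molly φ (u.1 β) (l • x) := by
      refine fderiv_molly φ (Lp_integrable _) (u.2 α β i hαβ) ?_
      rw [norm_smul, Real.norm_of_nonneg (by linarith)]
      nlinarith
    rw [h1.fderiv]
    simp only [smul_apply, ContinuousLinearMap.comp_apply,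
      ContinuousLinearMap.id_apply, map_smul, smul_eq_mul, h2, g, hsum, pow_succ]
    ring
  let w : H n k := ⟨WithLp.toLp 2 fun α => (hgm α).toLp (g α), fun α β i hαβ =>
    (hgd α β i hαβ).congr (hgm α).coeFn_toLp.symm (hgm β).coeFn_toLp.symm⟩
  refine ⟨w, g ⟨fun _ => 0, by simp⟩, ⟨hg _, (hgm _).coeFn_toLp⟩, ?_⟩
  have hcomp : ∀ α, ‖(w - u).1 α‖ ≤ ε / (K + 1) := by
    intro α
    change ‖(hgm α).toLp (g α) - u.1 α‖ ≤ _
    have e : (hgm α).toLp (g α) - u.1 α = ((hgm α).sub (Lp.memLp (u.1 α))).toLp (g α - (u.1 α : E n → ℝ)) := by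
      rw [MemLp.toLp_sub (hgm α) (Lp.memLp _), Lp.toLp_coeFn]
    rw [e, Lp.norm_toLp]
    refine ENNReal.toReal_le_of_le_ofReal (by positivity) ?_
    exact hφδ α φ ((min_le_left _ _).trans_lt (hd' α))
  calc ‖w - u‖ ≤ K * (ε / (K + 1)) := (w - u).norm_le_of_forall hcomp
    _ < ε := by
        rw [mul_div_assoc', div_lt_iff₀ (by positivity)]
        nlinarith

/-! ### Weakly singular kernels -/

/-- The kernel `|x - z|^{-s}`. -/
def ker {n : ℕ} (s : ℝ) (x z : E n) : ℝ≥0∞ := ‖x - z‖ₑ ^ (-s)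

theorem ker_comm {n : ℕ} (s : ℝ) (x z : E n) : ker s x z = ker s z x := by
  rw [ker, ker, ← enorm_neg, neg_sub]

theorem measurable_ker {n : ℕ} (s : ℝ) : Measurable fun p : E n × E n => ker s p.1 p.2 :=
  ((measurable_fst.sub measurable_snd).enorm).pow_const _

theorem measurable_ker_right {n : ℕ} (s : ℝ) (x : E n) : Measurable fun z => ker s x z :=
  ((measurable_const.sub measurable_id).enorm).pow_const _

theorem ker_eq_ofReal {n : ℕ} (s : ℝ) {x z : E n} (h : x ≠ z) :
    ker s x z = ofReal (‖x - z‖ ^ (-s)) := by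
  rw [ker, ← ofReal_norm, ENNReal.ofReal_rpow_of_pos (norm_pos_iff.2 (sub_ne_zero.2 h))]

theorem lintegral_ker_zero_lt_top {n : ℕ} (hn : 1 ≤ n) {s : ℝ} (hs : s < n) :
    ∫⁻ z in ball (0 : E n) 1, ker s 0 z < ⊤ := by
  have : Nonempty (Fin n) := ⟨⟨0, hn⟩⟩
  have h1 : IntegrableOn (fun x : E n => ‖x‖ ^ (-s)) (ball 0 1) volume := by
    rw [integrableOn_fun_norm_addHaar volume (f := fun r : ℝ => r ^ (-s)),
      finrank_euclideanSpace_fin]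
    have h2 : IntegrableOn (fun y : ℝ => y ^ ((n : ℝ) - 1 - s)) (Ioo 0 1) :=
      (intervalIntegral.integrableOn_Ioo_rpow_iff one_pos).2 (by linarith)
    refine h2.congr_fun (fun y hy => ?_) measurableSet_Ioo
    have hy0 : 0 < y := hy.1
    simp only [smul_eq_mul]
    rw [← Real.rpow_natCast, ← Real.rpow_add hy0, Nat.cast_sub hn]
    congr 1
    push_cast; ring
  have h3 := h1.lintegral_lt_top
  refine lt_of_le_of_lt (lintegral_mono_ae ?_) h3
  filter_upwards [ae_restrict_of_ae (Measure.ae_ne volume (0 : E n))] with z hz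
  rw [ker_eq_ofReal s hz.symm, zero_sub, norm_neg]

/-- The kernel `|x - z|^{-s}` with `s < n` is integrable, uniformly in `x`. -/
theorem exists_lintegral_ker_le {n : ℕ} (hn : 1 ≤ n) {s : ℝ} (hs0 : 0 ≤ s) (hs : s < n) :
    ∃ C : ℝ≥0∞, C ≠ ⊤ ∧ ∀ x : E n, ∫⁻ z, ker s x z ∂𝔪 n ≤ C := by
  refine ⟨ballMeasure n univ + ∫⁻ z in ball (0 : E n) 1, ker s 0 z,
    ENNReal.add_ne_top.2 ⟨measure_ne_top _ _, (lintegral_ker_zero_lt_top hn hs).ne⟩, fun x => ?_⟩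
  have hpt : ∀ z, ker s x z ≤ 1 + (ball x 1).indicator (fun z => ker s x z) z := by
    intro z
    by_cases hz : z ∈ ball x 1
    · rw [indicator_of_mem hz]; exact le_add_self
    · refine le_add_right ?_
      rw [mem_ball, not_lt, dist_comm, dist_eq_norm] at hz
      rw [ker, ENNReal.rpow_neg, ENNReal.inv_le_one]
      rcases hs0.eq_or_lt with rfl | hs0
      · simp
      refine ENNReal.one_le_rpow ?_ hs0
      rw [← ofReal_norm]
      exact ENNReal.one_le_ofReal.2 hz
  calc ∫⁻ z, ker s x z ∂𝔪 n
      ≤ ∫⁻ z, 1 + (ball x 1).indicator (fun z => ker s x z) z ∂𝔪 n :=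
        lintegral_mono hpt
    _ = ballMeasure n univ + ∫⁻ z, (ball x 1).indicator (fun z => ker s x z) z ∂𝔪 n := by
        rw [lintegral_add_left measurable_const, lintegral_one]
    _ ≤ _ := by
        refine add_le_add le_rfl ?_
        calc _ ≤ ∫⁻ z, (ball x 1).indicator (fun z => ker s x z) z :=
              lintegral_mono' Measure.restrict_le_self le_rfl
          _ = ∫⁻ z, (ball x 1).indicator (fun z => ker s x z) (z + x) :=
              (lintegral_add_right_eq_self _ x).symm
          _ = ∫⁻ z, (ball (0 : E n) 1).indicator (fun z => ker s 0 z) z := by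
              refine lintegral_congr fun z => ?_
              have : z + x ∈ ball x 1 ↔ z ∈ ball (0 : E n) 1 := by
                simp [mem_ball, dist_eq_norm]
              by_cases hz : z ∈ ball (0 : E n) 1
              · rw [indicator_of_mem hz, indicator_of_mem (this.2 hz), ker, ker]
                congr 2; abel
              · rw [indicator_of_notMem hz, indicator_of_notMem (mt this.1 hz)]
          _ = _ := lintegral_indicator measurableSet_ball _

/-- Elementary inequality behind the composition of weakly singular kernels. -/
theorem rpow_mul_rpow_le {A B d s s₁ s₂ t : ℝ} (hA : 0 < A) (hAB : A ≤ B) (hB : B ≤ 2)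
    (hd : 0 < d) (hdB : d ≤ 2 * B) (hs : 0 ≤ s) (ht1 : s₁ ≤ t)
    (ht : s₁ + s₂ - s ≤ t) (hs1 : 0 ≤ s₁) (hs2 : 0 ≤ s₂) :
    A ^ (-s₁) * B ^ (-s₂) ≤ 2 ^ (s + s + t) * (d ^ (-s) * A ^ (-t)) := by
  have hB0 : 0 < B := hA.trans_le hAB
  have hA2 : A ≤ 2 := hAB.trans hB
  have e1 : B ^ (-s) ≤ 2 ^ s * d ^ (-s) := by
    rw [Real.rpow_neg hB0.le, Real.rpow_neg hd.le, ← div_eq_mul_inv, inv_eq_one_div,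
      div_le_div_iff₀ (by positivity) (by positivity), one_mul, ← Real.mul_rpow (by norm_num) hB0.le]
    exact Real.rpow_le_rpow hd.le hdB hs
  have e2 {p : ℝ} (hp0 : 0 ≤ p) (hp : p ≤ t) : A ^ (-p) ≤ 2 ^ t * A ^ (-t) := by
    have : A ^ (-p) = A ^ (t - p) * A ^ (-t) := by rw [← Real.rpow_add hA]; ring_nf
    rw [this]
    gcongr
    calc A ^ (t - p) ≤ 2 ^ (t - p) := Real.rpow_le_rpow hA.le hA2 (by linarith)
      _ ≤ 2 ^ t := Real.rpow_le_rpow_of_exponent_le (by norm_num) (by linarith)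
  have e3 : (2 : ℝ) ^ (s + s + t) = 2 ^ s * 2 ^ s * 2 ^ t := by
    rw [Real.rpow_add two_pos, Real.rpow_add two_pos]
  have one_le : (1 : ℝ) ≤ 2 ^ s := Real.one_le_rpow (by norm_num) hs
  have hsplit : B ^ (-s₂) = B ^ (-s) * B ^ (s - s₂) := by rw [← Real.rpow_add hB0]; ring_nf
  have main : A ^ (-s₁) * B ^ (s - s₂) ≤ 2 ^ s * (2 ^ t * A ^ (-t)) := by
    rcases le_total s s₂ with h | h
    · have : B ^ (s - s₂) ≤ A ^ (s - s₂) :=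
        Real.rpow_le_rpow_of_nonpos hA hAB (by linarith)
      calc A ^ (-s₁) * B ^ (s - s₂) ≤ A ^ (-s₁) * A ^ (s - s₂) := by gcongr
        _ = A ^ (-(s₁ + s₂ - s)) := by rw [← Real.rpow_add hA]; ring_nf
        _ ≤ 2 ^ t * A ^ (-t) := e2 (by linarith) ht
        _ ≤ _ := le_mul_of_one_le_left (by positivity) one_le
    · have : B ^ (s - s₂) ≤ 2 ^ s :=
        (Real.rpow_le_rpow hB0.le hB (by linarith)).trans
          (Real.rpow_le_rpow_of_exponent_le (by norm_num) (by linarith))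
      calc A ^ (-s₁) * B ^ (s - s₂) ≤ (2 ^ t * A ^ (-t)) * 2 ^ s := by
            gcongr
            exact e2 hs1 ht1
        _ = _ := by ring
  calc A ^ (-s₁) * B ^ (-s₂) = B ^ (-s) * (A ^ (-s₁) * B ^ (s - s₂)) := by rw [hsplit]; ring
    _ ≤ (2 ^ s * d ^ (-s)) * (2 ^ s * (2 ^ t * A ^ (-t))) := by gcongr
    _ = _ := by rw [e3]; ring

/-- Composition of weakly singular kernels: the singularity improves by `n`. -/
theorem exists_lintegral_ker_mul_ker_le {n : ℕ} (hn : 1 ≤ n) {s s₁ s₂ : ℝ} (hs : 0 ≤ s)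
    (h1 : 0 ≤ s₁) (h2 : 0 ≤ s₂) (h1n : s₁ < n) (h2n : s₂ < n) (h : s₁ + s₂ - n < s) :
    ∃ C : ℝ≥0∞, C ≠ ⊤ ∧ ∀ x ∈ 𝔹 n, ∀ w ∈ 𝔹 n, x ≠ w →
      ∫⁻ z, ker s₁ x z * ker s₂ z w ∂𝔪 n ≤ C * ker s x w := by
  have : Nonempty (Fin n) := ⟨⟨0, hn⟩⟩
  set t := max (s₁ + s₂ - s) (max s₁ s₂) with ht
  have ht1 : s₁ ≤ t := (le_max_left _ _).trans (le_max_right _ _)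
  have ht2 : s₂ ≤ t := (le_max_right _ _).trans (le_max_right _ _)
  have ht3 : s₁ + s₂ - s ≤ t := le_max_left _ _
  have ht0 : 0 ≤ t := h1.trans ht1
  have htn : t < n := max_lt (by linarith) (max_lt h1n h2n)
  obtain ⟨C, hC, hCx⟩ := exists_lintegral_ker_le hn ht0 htn
  set M : ℝ := 2 ^ (s + s + t)
  refine ⟨ofReal M * (C + C), by finiteness, fun x hx w hw hxw => ?_⟩
  have hd : 0 < ‖x - w‖ := norm_pos_iff.2 (sub_ne_zero.2 hxw)
  calc ∫⁻ z, ker s₁ x z * ker s₂ z w ∂𝔪 n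
      ≤ ∫⁻ z, ofReal M * ker s x w * (ker t x z + ker t w z) ∂𝔪 n := by
        refine lintegral_mono_ae ?_
        filter_upwards [ae_restrict_of_ae (Measure.ae_ne volume x),
          ae_restrict_of_ae (Measure.ae_ne volume w),
          ae_restrict_mem measurableSet_ball] with z hz hzw hzB
        rw [ker_comm s₂, ker_eq_ofReal _ hz.symm, ker_eq_ofReal _ hzw.symm, ker_eq_ofReal _ hxw,
          ker_eq_ofReal _ hz.symm, ker_eq_ofReal _ hzw.symm, ← ENNReal.ofReal_mul (by positivity),
          ← ENNReal.ofReal_mul (by positivity), ← ENNReal.ofReal_add (by positivity)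
            (by positivity), ← ENNReal.ofReal_mul (by positivity)]
        refine ENNReal.ofReal_le_ofReal ?_
        rw [mem_closedBall_zero_iff] at hx hw
        rw [mem_ball_zero_iff] at hzB
        have hpx : 0 < ‖x - z‖ := norm_pos_iff.2 (sub_ne_zero.2 hz.symm)
        have hpw : 0 < ‖w - z‖ := norm_pos_iff.2 (sub_ne_zero.2 hzw.symm)
        have hx2 : ‖x - z‖ ≤ 2 := by linarith [norm_sub_le x z]
        have hw2 : ‖w - z‖ ≤ 2 := by linarith [norm_sub_le w z]
        have htri : ‖x - w‖ ≤ ‖x - z‖ + ‖w - z‖ := by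
          calc ‖x - w‖ = ‖(x - z) - (w - z)‖ := by congr 1; abel
            _ ≤ _ := norm_sub_le _ _
        have hnn : 0 ≤ M * ‖x - w‖ ^ (-s) := by positivity
        rcases le_total ‖x - z‖ ‖w - z‖ with hle | hle
        · have := rpow_mul_rpow_le hpx hle hw2 hd (by linarith) hs ht1 ht3 h1 h2
          calc _ ≤ _ := this
            _ = M * ‖x - w‖ ^ (-s) * ‖x - z‖ ^ (-t) := by ring
            _ ≤ _ := by gcongr; exact le_add_of_nonneg_right (by positivity)
        · have := rpow_mul_rpow_le hpw hle hx2 hd (by linarith) hs ht2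
            (by linarith : s₂ + s₁ - s ≤ t) h2 h1
          calc _ = ‖w - z‖ ^ (-s₂) * ‖x - z‖ ^ (-s₁) := mul_comm _ _
            _ ≤ _ := this
            _ = M * ‖x - w‖ ^ (-s) * ‖w - z‖ ^ (-t) := by ring
            _ ≤ _ := by gcongr; exact le_add_of_nonneg_left (by positivity)
    _ = ofReal M * ker s x w * ∫⁻ z, (ker t x z + ker t w z) ∂𝔪 n := by
        refine lintegral_const_mul' _ _ (ENNReal.mul_ne_top ENNReal.ofReal_ne_top ?_)
        rw [ker_eq_ofReal _ hxw]
        exact ENNReal.ofReal_ne_top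
    _ ≤ ofReal M * ker s x w * (C + C) := by
        gcongr
        rw [lintegral_add_left (measurable_ker_right t x)]
        exact add_le_add (hCx x) (hCx w)
    _ = _ := mul_right_comm _ _ _

/-! ### Pointwise estimates by potentials of derivatives -/

/-- The sum of the squares of all iterated partial derivatives (with repetitions) up to order
`a`. -/
def energy {n : ℕ} : ℕ → (E n → ℝ) → E n → ℝ≥0∞
  | 0, f, x => ofReal (f x ^ 2)
  | a + 1, f, x => energy a f x
      + ∑ i, energy a (fun y => fderiv ℝ f y (single i 1)) x

theorem measurable_energy {n : ℕ} (a : ℕ) {f : E n → ℝ} (hf : ContDiff ℝ ∞ f) :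
    Measurable (energy a f) := by
  induction a generalizing f with
  | zero => exact (hf.continuous.measurable.pow_const 2).ennreal_ofReal
  | succ a ih =>
    exact (ih hf).add (Finset.measurable_sum _ fun i _ => ih (contDiff_partial hf _))

theorem clm_apply_eq_sum {n : ℕ} {F : Type*} [NormedAddCommGroup F] [NormedSpace ℝ F]
    (L : E n →L[ℝ] F) (v : E n) : L v = ∑ i, v i • L (single i 1) := by
  conv_lhs => rw [← (EuclideanSpace.basisFun (Fin n) ℝ).sum_repr v]
  simp

/-- The square of a function and of its differential are controlled by the energy of order one. -/
theorem sq_add_norm_fderiv_le {n : ℕ} (f : E n → ℝ) (x : E n) :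
    ofReal ((|f x| + 2 * ‖fderiv ℝ f x‖) ^ 2) ≤ 8 * energy 1 f x := by
  have h1 : ‖fderiv ℝ f x‖ ≤ √(∑ i, (fderiv ℝ f x (single i 1)) ^ 2) := by
    refine ContinuousLinearMap.opNorm_le_bound _ (Real.sqrt_nonneg _) fun v => ?_
    rw [clm_apply_eq_sum, Real.norm_eq_abs, EuclideanSpace.norm_eq, mul_comm,
      ← Real.sqrt_mul (Finset.sum_nonneg fun _ _ => sq_nonneg _)]
    refine Real.abs_le_sqrt ?_
    simpa using Finset.sum_mul_sq_le_sq_mul_sq Finset.univ v.ofLp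
      (fun i => fderiv ℝ f x (single i 1))
  have hS : 0 ≤ ∑ i, (fderiv ℝ f x (single i 1)) ^ 2 :=
    Finset.sum_nonneg fun _ _ => sq_nonneg _
  have e : (8 : ℝ≥0∞) * energy 1 f x = ofReal
      (8 * (f x ^ 2 + ∑ i, (fderiv ℝ f x (single i 1)) ^ 2)) := by
    rw [ENNReal.ofReal_mul (by norm_num), ENNReal.ofReal_add (sq_nonneg _) hS,
      ENNReal.ofReal_sum_of_nonneg fun _ _ => sq_nonneg _]
    simp [energy]
  rw [e]
  refine ENNReal.ofReal_le_ofReal ?_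
  have h2 : ‖fderiv ℝ f x‖ ^ 2 ≤ ∑ i, (fderiv ℝ f x (single i 1)) ^ 2 := by
    have := pow_le_pow_left₀ (norm_nonneg _) h1 2
    rwa [Real.sq_sqrt hS] at this
  nlinarith [sq_nonneg (|f x| - 2 * ‖fderiv ℝ f x‖), sq_abs (f x)]

/-- A value of a function is bounded by an integral along a segment. -/
theorem abs_le_integral_segment {n : ℕ} {f : E n → ℝ} (hf : ContDiff ℝ ∞ f) {x y : E n}
    (hxy : ‖y - x‖ ≤ 2) :
    |f x| ≤ ∫ t in (0 : ℝ)..1, (|f (x + t • (y - x))| + 2 * ‖fderiv ℝ f (x + t • (y - x))‖) := by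
  have hd : ∀ t : ℝ, HasDerivAt (fun t : ℝ => (1 - t) * f (x + t • (y - x)))
      (-f (x + t • (y - x)) + (1 - t) * fderiv ℝ f (x + t • (y - x)) (y - x)) t := by
    intro t
    have h1 : HasDerivAt (fun t : ℝ => x + t • (y - x)) (y - x) t := by
      simpa using ((hasDerivAt_id t).smul_const (y - x)).const_add x
    have h2 : HasDerivAt (fun t : ℝ => f (x + t • (y - x)))
        (fderiv ℝ f (x + t • (y - x)) (y - x)) t :=
      ((hf.differentiable (by simp)) _).hasFDerivAt.comp_hasDerivAt t h1
    have h3 : HasDerivAt (fun t : ℝ => 1 - t) (-1) t := by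
      simpa using (hasDerivAt_id t).const_sub 1
    exact (h3.mul h2).congr_deriv (by ring)
  have hc : Continuous fun t : ℝ => x + t • (y - x) := by fun_prop
  have hfc := hf.continuous.comp hc
  have hf'c := (hf.continuous_fderiv (by simp)).comp hc
  have hcont : Continuous fun t : ℝ =>
      -f (x + t • (y - x)) + (1 - t) * fderiv ℝ f (x + t • (y - x)) (y - x) :=
    hfc.neg.add ((continuous_const.sub continuous_id).mul (hf'c.clm_apply continuous_const))
  have hcont2 : Continuous fun t : ℝ =>
      |f (x + t • (y - x))| + 2 * ‖fderiv ℝ f (x + t • (y - x))‖ :=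
    hfc.abs.add (continuous_const.mul hf'c.norm)
  have h := intervalIntegral.integral_eq_sub_of_hasDerivAt (fun t _ => hd t)
    (hcont.intervalIntegrable 0 1)
  simp only [sub_self, zero_mul, sub_zero, one_mul, zero_smul, add_zero, zero_sub] at h
  rw [← abs_neg, ← h, ← Real.norm_eq_abs]
  refine intervalIntegral.norm_integral_le_of_norm_le zero_le_one
    (.of_forall fun t ht => ?_) (hcont2.intervalIntegrable 0 1)
  refine (norm_add_le _ _).trans ?_
  rw [norm_neg, norm_mul, Real.norm_eq_abs, Real.norm_of_nonneg (by linarith [ht.2])]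
  refine add_le_add le_rfl ?_
  have h4 := (fderiv ℝ f (x + t • (y - x))).le_opNorm (y - x)
  have h5 : 0 ≤ ‖fderiv ℝ f (x + t • (y - x))‖ := norm_nonneg _
  have h6 : 0 ≤ ‖fderiv ℝ f (x + t • (y - x)) (y - x)‖ := norm_nonneg _
  nlinarith [ht.1, ht.2]

/-- First order potential estimate: `f(x)² ≤ C ∫_B (f² + |∇f|²)(z) |x - z|^{-s} dz` for
`s > n - 2`. -/
theorem exists_sq_le_lintegral_energy_one {n : ℕ} {s : ℝ} (hs0 : 0 ≤ s)
    (hs : (n : ℝ) - 2 < s) : ∃ C : ℝ≥0∞, C ≠ ⊤ ∧ ∀ f : E n → ℝ, ContDiff ℝ ∞ f →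
      ∀ x ∈ 𝔹 n,
        ofReal (f x ^ 2) ≤ C * ∫⁻ z, energy 1 f z * ker s x z ∂𝔪 n := by
  -- `δ` leaves room for the Cauchy-Schwarz inequality with weights `t ^ (∓(1 - δ))`
  set δ : ℝ := min 1 ((s - n + 2) / 2) with hδ
  have hδ0 : 0 < δ := lt_min one_pos (by linarith)
  have hδ1 : δ ≤ 1 := min_le_left _ _
  have hδ2 : δ ≤ (s - n + 2) / 2 := min_le_right _ _
  set C₁ : ℝ≥0∞ := ∫⁻ t in Ioo (0 : ℝ) 1, ofReal (t ^ (δ - 1)) with hC1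
  set C₂ : ℝ≥0∞ := ∫⁻ t in Ioo (0 : ℝ) 1, ofReal (t ^ (1 - δ + s - n)) with hC2
  have hC1t : C₁ ≠ ⊤ :=
    (((intervalIntegral.integrableOn_Ioo_rpow_iff one_pos).2 (by linarith)).lintegral_lt_top).ne
  have hC2t : C₂ ≠ ⊤ :=
    (((intervalIntegral.integrableOn_Ioo_rpow_iff one_pos).2 (by linarith)).lintegral_lt_top).ne
  have hvol : volume (ball (0 : E n) 1) ≠ 0 := (measure_ball_pos _ _ one_pos).ne'
  have hvolt : volume (ball (0 : E n) 1) ≠ ⊤ := measure_ball_lt_top.ne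
  refine ⟨(volume (ball (0 : E n) 1))⁻¹ * (C₁ * (ofReal (2 ^ s) * C₂ * 8)), ?_,
    fun f hf x hx => ?_⟩
  · have := ENNReal.inv_ne_top.2 hvol
    finiteness
  rw [mem_closedBall_zero_iff] at hx
  set G : E n → ℝ≥0∞ := fun z => ofReal (|f z| + 2 * ‖fderiv ℝ f z‖) with hG
  have hGc : Continuous G := ENNReal.continuous_ofReal.comp
    (hf.continuous.abs.add (continuous_const.mul (hf.continuous_fderiv (by simp)).norm))
  set h : E n → ℝ≥0∞ := (ball (0 : E n) 1).indicator fun z => G z ^ (2 : ℝ) * ker s x z with hh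
  have hhm : Measurable h := ((hGc.measurable.pow_const _).mul (measurable_ker_right s x)).indicator
    measurableSet_ball
  -- Cauchy-Schwarz along the segments from `x` to `y`
  have hsegment : ∀ y ∈ ball (0 : E n) 1, ofReal (f x ^ 2)
      ≤ C₁ * ∫⁻ t in Ioo (0 : ℝ) 1, ofReal (t ^ (1 - δ)) * G (x + t • (y - x)) ^ (2 : ℝ) := by
    intro y hy
    rw [mem_ball_zero_iff] at hy
    have hGt : Continuous fun t : ℝ => G (x + t • (y - x)) := hGc.comp (by fun_prop)
    have a1 : ofReal |f x| ≤ ∫⁻ t in Ioo (0 : ℝ) 1, G (x + t • (y - x)) := by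
      refine (ENNReal.ofReal_le_ofReal (abs_le_integral_segment hf (x := x) (y := y)
        (by linarith [norm_sub_le y x]))).trans ?_
      rw [intervalIntegral.integral_of_le zero_le_one, integral_Ioc_eq_integral_Ioo]
      refine (ofReal_integral_eq_lintegral_ofReal ?_ (.of_forall fun t => by
        positivity)).le
      have hcf : Continuous fun t : ℝ => x + t • (y - x) := by fun_prop
      exact (((hf.continuous.comp hcf).abs.add (continuous_const.mul
        ((hf.continuous_fderiv (by simp)).comp hcf).norm)).integrableOn_Icc
          (a := 0) (b := 1)).mono_set Ioo_subset_Icc_self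
    have a2 := ENNReal.lintegral_mul_le_Lp_mul_Lq (volume.restrict (Ioo (0 : ℝ) 1))
      Real.HolderConjugate.two_two
      (f := fun t => ofReal (t ^ ((δ - 1) / 2)))
      (g := fun t => ofReal (t ^ ((1 - δ) / 2)) * G (x + t • (y - x)))
      (by fun_prop) ((by fun_prop : Measurable _).mul hGt.measurable).aemeasurable
    have a3 : ∫⁻ t in Ioo (0 : ℝ) 1, G (x + t • (y - x))
        = ∫⁻ t in Ioo (0 : ℝ) 1, ((fun t => ofReal (t ^ ((δ - 1) / 2)))
          * fun t => ofReal (t ^ ((1 - δ) / 2)) * G (x + t • (y - x))) t := by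
      refine setLIntegral_congr_fun measurableSet_Ioo fun t ht => ?_
      have ht0 : 0 < t := ht.1
      simp only [Pi.mul_apply]
      rw [← mul_assoc, ← ENNReal.ofReal_mul (by positivity), ← Real.rpow_add ht0]
      ring_nf
      simp
    have a4 : ∫⁻ t in Ioo (0 : ℝ) 1, ofReal (t ^ ((δ - 1) / 2)) ^ (2 : ℝ) = C₁ := by
      refine setLIntegral_congr_fun measurableSet_Ioo fun t ht => ?_
      have ht0 : 0 < t := ht.1
      rw [ENNReal.ofReal_rpow_of_nonneg (by positivity) zero_le_two, ← Real.rpow_mul ht0.le]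
      ring_nf
    have a5 : ∫⁻ t in Ioo (0 : ℝ) 1, (ofReal (t ^ ((1 - δ) / 2)) * G (x + t • (y - x))) ^ (2 : ℝ)
        = ∫⁻ t in Ioo (0 : ℝ) 1, ofReal (t ^ (1 - δ)) * G (x + t • (y - x)) ^ (2 : ℝ) := by
      refine setLIntegral_congr_fun measurableSet_Ioo fun t ht => ?_
      have ht0 : 0 < t := ht.1
      rw [ENNReal.mul_rpow_of_nonneg _ _ zero_le_two,
        ENNReal.ofReal_rpow_of_nonneg (by positivity) zero_le_two, ← Real.rpow_mul ht0.le]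
      ring_nf
    rw [← a3, a4, a5] at a2
    have a6 := ENNReal.rpow_le_rpow (a1.trans a2) zero_le_two
    rw [ENNReal.mul_rpow_of_nonneg _ _ zero_le_two, ← ENNReal.rpow_mul, ← ENNReal.rpow_mul,
      ENNReal.ofReal_rpow_of_nonneg (abs_nonneg _) zero_le_two] at a6
    simpa using a6
  -- the kernel is bounded below on the segments
  have hkernel : ∀ y ∈ ball (0 : E n) 1, ∀ t ∈ Ioo (0 : ℝ) 1, G (x + t • (y - x)) ^ (2 : ℝ)
      ≤ ofReal (2 ^ s * t ^ s) * h (x + t • (y - x)) := by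
    intro y hy t ht
    rw [mem_ball_zero_iff] at hy
    have ht0 : 0 < t := ht.1
    have hmem : x + t • (y - x) ∈ ball (0 : E n) 1 := by
      rw [mem_ball_zero_iff, show x + t • (y - x) = (1 - t) • x + t • y by
        rw [smul_sub, sub_smul, one_smul]; abel]
      refine (norm_add_le _ _).trans_lt ?_
      rw [norm_smul, norm_smul, Real.norm_of_nonneg ht0.le, Real.norm_of_nonneg (by linarith [ht.2])]
      nlinarith [ht.1, ht.2]
    have hk : 1 ≤ ofReal (2 ^ s * t ^ s) * ker s x (x + t • (y - x)) := by
      have e : x - (x + t • (y - x)) = -(t • (y - x)) := by abel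
      rcases eq_or_ne y x with rfl | hne
      · rcases hs0.eq_or_lt with rfl | hs0
        · simp [ker]
        · have : ker s y (y + t • (y - y)) = ⊤ := by simp [ker, hs0]
          rw [this, ENNReal.mul_top (ENNReal.ofReal_pos.2 (by positivity)).ne']
          exact le_top
      · have hpos : 0 < ‖y - x‖ := norm_pos_iff.2 (sub_ne_zero.2 hne)
        have hne' : x ≠ x + t • (y - x) := by
          intro h0
          have := sub_eq_zero.2 h0
          rw [e, neg_eq_zero, smul_eq_zero] at this
          rcases this with h | h
          · exact ht0.ne' h
          · exact hne (sub_eq_zero.1 h)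
        rw [ker_eq_ofReal s hne', ← ENNReal.ofReal_mul (by positivity), e, norm_neg, norm_smul,
          Real.norm_of_nonneg ht0.le, ENNReal.one_le_ofReal, Real.rpow_neg (by positivity),
          ← Real.mul_rpow zero_le_two ht0.le, ← div_eq_mul_inv, one_le_div (by positivity)]
        refine Real.rpow_le_rpow (by positivity) ?_ hs0
        nlinarith [norm_sub_le y x]
    rw [hh, indicator_of_mem hmem]
    calc G (x + t • (y - x)) ^ (2 : ℝ) = 1 * G (x + t • (y - x)) ^ (2 : ℝ) := (one_mul _).symm
      _ ≤ _ := mul_le_mul_left hk _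
      _ = _ := by ring
  -- translation and scaling
  have hscale : ∀ t ∈ Ioo (0 : ℝ) 1, ∫⁻ y in ball (0 : E n) 1, h (x + t • (y - x))
      ≤ ofReal (t ^ (-(n : ℝ))) * ∫⁻ z, h z := by
    intro t ht
    have ht0 : 0 < t := ht.1
    calc _ ≤ ∫⁻ y, h (x + t • (y - x)) := lintegral_mono' Measure.restrict_le_self le_rfl
      _ = ∫⁻ y, (fun w => h (w + (x - t • x))) (t • y) := by
          refine lintegral_congr fun y => ?_
          simp only
          congr 1
          rw [smul_sub]; abel
      _ = ofReal ((t ^ n)⁻¹) * ∫⁻ z, h z := by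
          rw [lintegral_comp_smul (fun w => h (w + (x - t • x))) ht0, lintegral_add_right_eq_self]
      _ = _ := by rw [Real.rpow_neg ht0.le, Real.rpow_natCast]
  -- the mean of the segment estimates over the end points `y`
  have haverage : volume (ball (0 : E n) 1) * ofReal (f x ^ 2)
      ≤ C₁ * (ofReal (2 ^ s) * C₂ * ∫⁻ z, h z) := by
    have mG : Measurable fun p : E n × ℝ => G (x + p.2 • (p.1 - x)) ^ (2 : ℝ) :=
      (hGc.comp (continuous_const.add (continuous_snd.smul
        (continuous_fst.sub continuous_const)))).measurable.pow_const _
    calc volume (ball (0 : E n) 1) * ofReal (f x ^ 2)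
        = ∫⁻ y in ball (0 : E n) 1, ofReal (f x ^ 2) := by
          rw [setLIntegral_const, mul_comm]
      _ ≤ ∫⁻ y in ball (0 : E n) 1, C₁ * ∫⁻ t in Ioo (0 : ℝ) 1,
            ofReal (t ^ (1 - δ)) * G (x + t • (y - x)) ^ (2 : ℝ) :=
          setLIntegral_mono' measurableSet_ball hsegment
      _ = C₁ * ∫⁻ t in Ioo (0 : ℝ) 1, ∫⁻ y in ball (0 : E n) 1,
            ofReal (t ^ (1 - δ)) * G (x + t • (y - x)) ^ (2 : ℝ) := by
          rw [lintegral_const_mul' _ _ hC1t, lintegral_lintegral_swap]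
          exact (Measurable.mul (by fun_prop) mG).aemeasurable
      _ ≤ C₁ * ∫⁻ t in Ioo (0 : ℝ) 1, ofReal (2 ^ s)
            * (ofReal (t ^ (1 - δ + s - n)) * ∫⁻ z, h z) := by
          refine mul_le_mul_right (setLIntegral_mono' measurableSet_Ioo fun t ht => ?_) _
          have ht0 : 0 < t := ht.1
          calc _ ≤ ∫⁻ y in ball (0 : E n) 1, ofReal (t ^ (1 - δ) * (2 ^ s * t ^ s))
                * h (x + t • (y - x)) := by
                refine setLIntegral_mono' measurableSet_ball fun y hy => ?_
                rw [ENNReal.ofReal_mul (by positivity), mul_assoc]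
                exact mul_le_mul_right (hkernel y hy t ht) _
            _ ≤ ofReal (t ^ (1 - δ) * (2 ^ s * t ^ s))
                * (ofReal (t ^ (-(n : ℝ))) * ∫⁻ z, h z) := by
                rw [lintegral_const_mul' _ _ ENNReal.ofReal_ne_top]
                exact mul_le_mul_right (hscale t ht) _
            _ = _ := by
                rw [← mul_assoc, ← ENNReal.ofReal_mul (by positivity),
                  ← mul_assoc (ofReal (2 ^ s)), ← ENNReal.ofReal_mul (by positivity)]
                congr 2
                rw [show 1 - δ + s - (n : ℝ) = (1 - δ) + (s + -(n : ℝ)) by ring,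
                  Real.rpow_add ht0, Real.rpow_add ht0]
                ring
      _ = _ := by
          rw [lintegral_const_mul' _ _ ENNReal.ofReal_ne_top, lintegral_mul_const, mul_assoc]
          fun_prop
  have henergy : ∫⁻ z, h z ≤ 8 * ∫⁻ z, energy 1 f z * ker s x z ∂𝔪 n := by
    rw [hh, lintegral_indicator measurableSet_ball, ← lintegral_const_mul' _ _ (by simp)]
    refine lintegral_mono fun z => ?_
    rw [← mul_assoc]
    refine mul_le_mul_left ?_ _
    rw [hG, ENNReal.ofReal_rpow_of_nonneg (by positivity) zero_le_two, Real.rpow_two]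
    exact sq_add_norm_fderiv_le f z
  calc ofReal (f x ^ 2) = (volume (ball (0 : E n) 1))⁻¹
        * (volume (ball (0 : E n) 1) * ofReal (f x ^ 2)) := by
        rw [← mul_assoc, ENNReal.inv_mul_cancel hvol hvolt, one_mul]
    _ ≤ (volume (ball (0 : E n) 1))⁻¹ * (C₁ * (ofReal (2 ^ s) * C₂
        * (8 * ∫⁻ z, energy 1 f z * ker s x z ∂𝔪 n))) := by
        refine mul_le_mul_right (haverage.trans ?_) _
        exact mul_le_mul_right (mul_le_mul_right henergy _) _
    _ = _ := by ring

theorem ker_zero {n : ℕ} (x z : E n) : ker 0 x z = 1 := by simp [ker]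

theorem lintegral_lintegral_mul_comm {n : ℕ} {μ ν : Measure (E n)} [SFinite μ] [SFinite ν]
    {e : E n → ℝ≥0∞} {k : E n → E n → ℝ≥0∞}
    (he : Measurable e) (hk : Measurable fun p : E n × E n => k p.1 p.2) :
    ∫⁻ w, ∫⁻ z, e z * k w z ∂μ ∂ν = ∫⁻ z, e z * ∫⁻ w, k w z ∂ν ∂μ := by
  have he2 : Measurable fun p : E n × E n => e p.2 := he.comp measurable_snd
  rw [lintegral_lintegral_swap (he2.fun_mul hk).aemeasurable]
  refine lintegral_congr fun z => ?_
  rw [lintegral_const_mul]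
  exact hk.comp (measurable_id.prodMk measurable_const)

theorem lintegral_lintegral_lintegral_mul_comm {n : ℕ} {μ : Measure (E n)} [SFinite μ]
    {e e' : E n → ℝ≥0∞} {k k' : E n → E n → ℝ≥0∞} (he : Measurable e) (he' : Measurable e')
    (hk : Measurable fun p : E n × E n => k p.1 p.2)
    (hk' : Measurable fun p : E n × E n => k' p.1 p.2) :
    ∫⁻ x, (∫⁻ y, e y * k x y ∂μ) * ∫⁻ z, e' z * k' x z ∂μ ∂μ
      = ∫⁻ y, ∫⁻ z, e y * e' z * ∫⁻ x, k x y * k' x z ∂μ ∂μ ∂μ := by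
  have hkx (x : E n) : Measurable (k x) := hk.comp (measurable_const.prodMk measurable_id)
  have hkx' (x : E n) : Measurable (k' x) := hk'.comp (measurable_const.prodMk measurable_id)
  have hky (y : E n) : Measurable fun x => k x y := hk.comp (measurable_id.prodMk measurable_const)
  have hI : Measurable fun x => ∫⁻ z, e' z * k' x z ∂μ := by
    refine Measurable.lintegral_prod_right' (f := fun p : E n × E n => e' p.2 * k' p.1 p.2) ?_
    exact (he'.comp measurable_snd).fun_mul hk'
  have e1 : ∀ x, (∫⁻ y, e y * k x y ∂μ) * ∫⁻ z, e' z * k' x z ∂μ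
      = ∫⁻ y, e y * (k x y * ∫⁻ z, e' z * k' x z ∂μ) ∂μ := by
    intro x
    rw [← lintegral_mul_const _ (he.fun_mul (hkx x))]
    exact lintegral_congr fun y => by ring
  simp only [e1]
  rw [lintegral_lintegral_mul_comm he (k := fun x y => k x y * ∫⁻ z, e' z * k' x z ∂μ)
    (hk.fun_mul (hI.comp measurable_fst))]
  refine lintegral_congr fun y => ?_
  have e2 : ∀ x, k x y * ∫⁻ z, e' z * k' x z ∂μ = ∫⁻ z, e' z * (k x y * k' x z) ∂μ := by
    intro x
    rw [← lintegral_const_mul _ (he'.fun_mul (hkx' x))]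
    exact lintegral_congr fun z => by ring
  simp only [e2]
  have hm : Measurable fun p : E n × E n => k p.1 y * k' p.1 p.2 :=
    ((hky y).comp measurable_fst).fun_mul hk'
  rw [lintegral_lintegral_mul_comm he' (k := fun x z => k x y * k' x z) hm,
    ← lintegral_const_mul]
  · exact lintegral_congr fun z => by ring
  · refine he'.fun_mul (Measurable.lintegral_prod_left' (f := fun p : E n × E n =>
      k p.1 y * k' p.1 p.2) hm)

theorem exists_exponents {N a b s : ℝ} (hN : 1 ≤ N) (ha : 1 ≤ a) (hb : 1 ≤ b) (hs0 : 0 ≤ s)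
    (hs : N - 2 * (a + b) < s) : ∃ s₁ s₂, 0 ≤ s₁ ∧ 0 ≤ s₂ ∧ N - 2 * a < s₁ ∧ N - 2 * b < s₂ ∧
      s₁ < N ∧ s₂ < N ∧ s₁ + s₂ - N < s := by
  obtain ⟨ε, hε0, hε1, hε⟩ : ∃ ε : ℝ, 0 < ε ∧ ε < 1 ∧ N - 2 * (a + b) + 2 * ε < s := by
    refine ⟨min (1 / 2) ((s - (N - 2 * (a + b))) / 4), lt_min (by norm_num) (by linarith),
      (min_le_left _ _).trans_lt (by norm_num), ?_⟩
    linarith [min_le_right (1 / 2 : ℝ) ((s - (N - 2 * (a + b))) / 4)]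
  refine ⟨max 0 (N - 2 * a + ε), max 0 (N - 2 * b + ε), le_max_left _ _, le_max_left _ _,
    lt_max_of_lt_right (by linarith), lt_max_of_lt_right (by linarith),
    max_lt (by linarith) (by linarith), max_lt (by linarith) (by linarith), ?_⟩
  rcases max_cases 0 (N - 2 * a + ε) with h | h <;>
    rcases max_cases 0 (N - 2 * b + ε) with h' | h' <;> rw [h.1, h'.1] <;> linarith

/-- Potential estimate of order `a`, by iteration of the estimate of order one: composition of the
kernels lowers the exponent. -/
theorem exists_sq_le_lintegral_energy {n : ℕ} (hn : 1 ≤ n) {a : ℕ} (ha : 1 ≤ a) :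
    ∀ s : ℝ, 0 ≤ s → (n : ℝ) - 2 * a < s → ∃ C : ℝ≥0∞, C ≠ ⊤ ∧ ∀ f : E n → ℝ, ContDiff ℝ ∞ f →
      ∀ x ∈ 𝔹 n,
        ofReal (f x ^ 2) ≤ C * ∫⁻ z, energy a f z * ker s x z ∂𝔪 n := by
  induction a, ha using Nat.le_induction with
  | base => exact fun s h0 h1 => exists_sq_le_lintegral_energy_one h0 (by simpa using h1)
  | succ a ha ih =>
    intro s hs0 hs
    have hn' : (1 : ℝ) ≤ n := by exact_mod_cast hn
    have ha' : (1 : ℝ) ≤ a := by exact_mod_cast ha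
    push_cast at hs
    obtain ⟨s₁, s₂, h1, h2, h1s, h2s, h1n, h2n, h12⟩ := exists_exponents hn' le_rfl ha' hs0
      (by linarith : (n : ℝ) - 2 * (1 + a) < s)
    obtain ⟨C₁, hC₁, H₁⟩ := exists_sq_le_lintegral_energy_one h1 (by simpa using h1s)
    obtain ⟨C₂, hC₂, H₂⟩ := ih s₂ h2 h2s
    obtain ⟨C₃, hC₃, H₃⟩ := exists_lintegral_ker_mul_ker_le hn hs0 h1 h2 h1n h2n h12
    refine ⟨C₁ * (C₂ * C₃), by finiteness, fun f hf x hx => ?_⟩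
    have hme := measurable_energy (a + 1) hf
    have hen : ∀ w ∈ 𝔹 n, energy 1 f w
        ≤ C₂ * ∫⁻ z, energy (a + 1) f z * ker s₂ w z ∂𝔪 n := by
      intro w hw
      have e : ∫⁻ z, energy (a + 1) f z * ker s₂ w z ∂𝔪 n
          = ∫⁻ z, energy a f z * ker s₂ w z ∂𝔪 n
            + ∑ i, ∫⁻ z, energy a (fun y => fderiv ℝ f y (single i 1)) z
              * ker s₂ w z ∂𝔪 n := by
        rw [← lintegral_finsetSum _ fun i _ => (measurable_energy a (contDiff_partial hf _)).fun_mul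
          (measurable_ker_right _ _), ← lintegral_add_left
            ((measurable_energy a hf).fun_mul (measurable_ker_right _ _))]
        refine lintegral_congr fun z => ?_
        rw [energy, add_mul, sum_mul]
      rw [e, mul_add, mul_sum]
      refine add_le_add (H₂ f hf w hw) (Finset.sum_le_sum fun i _ => ?_)
      exact H₂ _ (contDiff_partial hf _) w hw
    have hmk : Measurable fun p : E n × E n => ker s₁ x p.1 * ker s₂ p.1 p.2 :=
      ((measurable_ker_right s₁ x).comp measurable_fst).mul (measurable_ker s₂)
    calc ofReal (f x ^ 2)
        ≤ C₁ * ∫⁻ w, energy 1 f w * ker s₁ x w ∂𝔪 n := H₁ f hf x hx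
      _ ≤ C₁ * ∫⁻ w, C₂ * ∫⁻ z, energy (a + 1) f z * (ker s₁ x w * ker s₂ w z) ∂𝔪 n
            ∂𝔪 n := by
          refine mul_le_mul_right (setLIntegral_mono' measurableSet_ball fun w hw => ?_) _
          refine (mul_le_mul_left (hen w (ball_subset_closedBall hw)) _).trans_eq ?_
          rw [mul_assoc, ← lintegral_mul_const _ (hme.fun_mul (measurable_ker_right _ _))]
          congr 1
          refine lintegral_congr fun z => ?_
          ring
      _ = C₁ * (C₂ * ∫⁻ z, energy (a + 1) f z * ∫⁻ w, ker s₁ x w * ker s₂ w z ∂𝔪 n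
            ∂𝔪 n) := by
          rw [lintegral_const_mul' _ _ hC₂,
            lintegral_lintegral_mul_comm hme (k := fun w z => ker s₁ x w * ker s₂ w z) hmk]
      _ ≤ C₁ * (C₂ * ∫⁻ z, C₃ * (energy (a + 1) f z * ker s x z) ∂𝔪 n) := by
          refine mul_le_mul_right (mul_le_mul_right
            (lintegral_mono_ae ?_) _) _
          have : Nonempty (Fin n) := ⟨⟨0, hn⟩⟩
          filter_upwards [ae_restrict_of_ae (Measure.ae_ne volume x),
            ae_restrict_mem measurableSet_ball] with z hzx hz
          calc _ ≤ energy (a + 1) f z * (C₃ * ker s x z) :=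
                mul_le_mul_right (H₃ x hx z (ball_subset_closedBall hz) hzx.symm) _
            _ = _ := by ring
      _ = _ := by
          rw [lintegral_const_mul' _ _ (by finiteness)]
          ring

theorem H.lintegral_fn_sq_le {n k : ℕ} (u : H n k) :
    ∫⁻ x, ofReal (u.fn x ^ 2) ∂𝔪 n ≤ ofReal (‖u‖ ^ 2) := by
  rw [← eLpNorm_two_sq, ENNReal.ofReal_pow (norm_nonneg _), ENNReal.rpow_two]
  refine pow_le_pow_left₀ zero_le ?_ 2
  rw [H.fn, ← ENNReal.ofReal_toReal (Lp.eLpNorm_ne_top _)]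
  exact ENNReal.ofReal_le_ofReal (H.norm_apply_le u _)

theorem IsSmoothRep.D {n k : ℕ} {u : H n (k + 1)} {f : E n → ℝ} (h : IsSmoothRep u f) (i : Fin n) :
    IsSmoothRep (H.D i u) fun y => fderiv ℝ f y (single i 1) := by
  have hc := contDiff_partial h.1 (single i 1)
  refine ⟨hc, ?_⟩
  have h1 := (H.isWeakPartial i u).congr h.2 EventuallyEq.rfl
  have h2 := isWeakPartial_of_contDiffOn i (h.1.contDiffOn.of_le (by simp) :
    ContDiffOn ℝ 1 f (ball 0 1))
  exact h1.unique h2 (H.integrable_fn _)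
    ((memLp_of_continuousOn hc.continuous.continuousOn).integrable (by norm_num))

theorem IsSmoothRep.res {n k : ℕ} {u : H n (k + 1)} {f : E n → ℝ} (h : IsSmoothRep u f) :
    IsSmoothRep (H.res u) f := h

/-- The energy integral is bounded by the Sobolev norm. -/
theorem exists_lintegral_energy_le (n a : ℕ) : ∃ C : ℝ, 0 ≤ C ∧ ∀ (u : H n a) (f : E n → ℝ),
    IsSmoothRep u f → ∫⁻ x, energy a f x ∂𝔪 n ≤ ofReal (C * ‖u‖ ^ 2) := by
  induction a with
  | zero =>
    refine ⟨1, zero_le_one, fun u f h => ?_⟩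
    rw [one_mul]
    refine le_trans (le_of_eq ?_) u.lintegral_fn_sq_le
    refine lintegral_congr_ae ?_
    filter_upwards [h.2] with x hx
    rw [hx, energy]
  | succ a ih =>
    obtain ⟨C, hC, ih⟩ := ih
    refine ⟨C * ‖(H.res : H n (a+1) →L[ℝ] H n a)‖ ^ 2
      + ∑ i, C * ‖(H.D i : H n (a+1) →L[ℝ] H n a)‖ ^ 2, by positivity, fun u f h => ?_⟩
    simp only [energy]
    rw [lintegral_add_left (measurable_energy a h.1), lintegral_finsetSum _ fun i _ =>
      measurable_energy a (contDiff_partial h.1 _), add_mul, sum_mul,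
      ENNReal.ofReal_add (by positivity) (by positivity),
      ENNReal.ofReal_sum_of_nonneg fun i _ => by positivity]
    have hT (T : H n (a + 1) →L[ℝ] H n a) :
        ofReal (C * ‖T u‖ ^ 2) ≤ ofReal (C * ‖T‖ ^ 2 * ‖u‖ ^ 2) := by
      rw [mul_assoc, ← mul_pow]
      gcongr
      exact T.le_opNorm u
    exact add_le_add ((ih _ f h.res).trans (hT _))
      (Finset.sum_le_sum fun i _ => (ih _ _ (h.D i)).trans (hT _))

/-- Sobolev's inequality for smooth functions. -/
theorem exists_abs_le_of_isSmoothRep {n k : ℕ} (hn : 1 ≤ n) (hk : n < 2 * k) : ∃ C : ℝ, 0 ≤ C ∧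
    ∀ (u : H n k) (f : E n → ℝ), IsSmoothRep u f → ∀ x ∈ 𝔹 n,
      |f x| ≤ C * ‖u‖ := by
  have hk' : (n : ℝ) < 2 * k := by exact_mod_cast hk
  obtain ⟨C₁, hC₁, H₁⟩ := exists_sq_le_lintegral_energy hn (a := k) (by omega) 0 le_rfl
    (by linarith)
  obtain ⟨C₂, hC₂, H₂⟩ := exists_lintegral_energy_le n k
  refine ⟨√(C₁.toReal * C₂), Real.sqrt_nonneg _, fun u f h x hx => ?_⟩
  have h1 := H₁ f h.1 x hx
  simp only [ker_zero, mul_one] at h1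
  have h2 := h1.trans (mul_le_mul_right (H₂ u f h) _)
  rw [← ENNReal.ofReal_toReal hC₁, ← ENNReal.ofReal_mul ENNReal.toReal_nonneg,
    ENNReal.ofReal_le_ofReal_iff (by positivity), ← mul_assoc] at h2
  calc |f x| ≤ √(C₁.toReal * C₂ * ‖u‖ ^ 2) := Real.abs_le_sqrt h2
    _ = _ := by rw [Real.sqrt_mul (by positivity), Real.sqrt_sq (norm_nonneg _)]

/-- The product of smooth functions is bounded in `L²` by the product of Sobolev norms whose orders
add up to more than `n / 2`. -/
theorem exists_lintegral_mul_sq_le {n a b : ℕ} (hn : 1 ≤ n) (hab : n < 2 * (a + b)) :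
    ∃ C : ℝ, 0 ≤ C ∧ ∀ (u : H n a) (v : H n b) (f g : E n → ℝ), IsSmoothRep u f → IsSmoothRep v g →
      ∫⁻ x, ofReal ((f x * g x) ^ 2) ∂𝔪 n
        ≤ ofReal (C * (‖u‖ * ‖v‖) ^ 2) := by
  -- one factor in `L²`, the other one bounded
  have hcase : ∀ a b : ℕ, n < 2 * b → ∃ C : ℝ, 0 ≤ C ∧ ∀ (u : H n a) (v : H n b) (f g : E n → ℝ),
      IsSmoothRep u f → IsSmoothRep v g →
      ∫⁻ x, ofReal ((f x * g x) ^ 2) ∂𝔪 n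
        ≤ ofReal (C * (‖u‖ * ‖v‖) ^ 2) := by
    intro a b hb
    obtain ⟨C, hC, h⟩ := exists_abs_le_of_isSmoothRep hn hb
    refine ⟨C ^ 2, sq_nonneg _, fun u v f g hf hg => ?_⟩
    calc ∫⁻ x, ofReal ((f x * g x) ^ 2) ∂𝔪 n
        ≤ ∫⁻ x, ofReal ((C * ‖v‖) ^ 2) * ofReal (u.fn x ^ 2) ∂𝔪 n := by
          refine lintegral_mono_ae ?_
          filter_upwards [hf.2, ae_restrict_mem measurableSet_ball] with x hx hxb
          rw [← ENNReal.ofReal_mul (sq_nonneg _), hx, mul_pow, mul_comm]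
          refine ENNReal.ofReal_le_ofReal (mul_le_mul_of_nonneg_right ?_ (sq_nonneg _))
          rw [← sq_abs]
          exact pow_le_pow_left₀ (abs_nonneg _) (h v g hg x (ball_subset_closedBall hxb)) 2
      _ ≤ ofReal ((C * ‖v‖) ^ 2) * ofReal (‖u‖ ^ 2) := by
          rw [lintegral_const_mul' _ _ ENNReal.ofReal_ne_top]
          exact mul_le_mul_right u.lintegral_fn_sq_le _
      _ = _ := by
          rw [← ENNReal.ofReal_mul (sq_nonneg _)]
          congr 1; ring
  rcases Nat.eq_zero_or_pos a with rfl | ha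
  · exact hcase 0 b (by omega)
  rcases Nat.eq_zero_or_pos b with rfl | hb
  · obtain ⟨C, hC, h⟩ := hcase 0 a (by omega)
    refine ⟨C, hC, fun u v f g hf hg => ?_⟩
    have := h v u g f hg hf
    simpa only [mul_comm (g _), mul_comm ‖v‖] using this
  have ha' : (1 : ℝ) ≤ a := by exact_mod_cast ha
  have hb' : (1 : ℝ) ≤ b := by exact_mod_cast hb
  have hab' : (n : ℝ) < 2 * (a + b) := by exact_mod_cast hab
  have hn' : (1 : ℝ) ≤ n := by exact_mod_cast hn
  obtain ⟨s₁, s₂, h1, h2, h1s, h2s, h1n, h2n, h12⟩ := exists_exponents hn' ha' hb' le_rfl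
    (by linarith : (n : ℝ) - 2 * (a + b) < 0)
  obtain ⟨C₁, hC₁, H₁⟩ := exists_sq_le_lintegral_energy hn ha s₁ h1 h1s
  obtain ⟨C₂, hC₂, H₂⟩ := exists_sq_le_lintegral_energy hn hb s₂ h2 h2s
  obtain ⟨C₃, hC₃, H₃⟩ := exists_lintegral_ker_mul_ker_le hn le_rfl h1 h2 h1n h2n h12
  obtain ⟨Ka, hKa, ea⟩ := exists_lintegral_energy_le n a
  obtain ⟨Kb, hKb, eb⟩ := exists_lintegral_energy_le n b
  refine ⟨C₁.toReal * C₂.toReal * C₃.toReal * (Ka * Kb), by positivity, fun u v f g hf hg => ?_⟩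
  have hma := measurable_energy a hf.1
  have hmb := measurable_energy b hg.1
  calc ∫⁻ x, ofReal ((f x * g x) ^ 2) ∂𝔪 n
      ≤ ∫⁻ x, (C₁ * C₂) * ((∫⁻ y, energy a f y * ker s₁ x y ∂𝔪 n)
          * ∫⁻ z, energy b g z * ker s₂ x z ∂𝔪 n) ∂𝔪 n := by
        refine setLIntegral_mono' measurableSet_ball fun x hx => ?_
        have hx' := ball_subset_closedBall hx
        rw [mul_pow, ENNReal.ofReal_mul (sq_nonneg _)]
        refine (mul_le_mul' (H₁ f hf.1 x hx') (H₂ g hg.1 x hx')).trans_eq ?_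
        rw [mul_mul_mul_comm]
    _ = (C₁ * C₂) * ∫⁻ y, ∫⁻ z, energy a f y * energy b g z * ∫⁻ x, (ker s₁ x y * ker s₂ x z)
          ∂𝔪 n ∂𝔪 n ∂𝔪 n := by
        rw [lintegral_const_mul' _ _ (by finiteness), lintegral_lintegral_lintegral_mul_comm hma hmb
          (measurable_ker s₁) (measurable_ker s₂)]
    _ ≤ (C₁ * C₂) * ∫⁻ y, ∫⁻ z, C₃ * (energy a f y * energy b g z)
          ∂𝔪 n ∂𝔪 n := by
        have : Nonempty (Fin n) := ⟨⟨0, hn⟩⟩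
        refine mul_le_mul_right (setLIntegral_mono' measurableSet_ball fun y hy =>
          lintegral_mono_ae ?_) _
        filter_upwards [ae_restrict_of_ae (Measure.ae_ne volume y),
          ae_restrict_mem measurableSet_ball] with z hzy hz
        rw [mul_comm C₃]
        refine mul_le_mul_right ?_ _
        have := H₃ y (ball_subset_closedBall hy) z (ball_subset_closedBall hz) hzy.symm
        rw [ker_zero, mul_one] at this
        simpa only [ker_comm s₁ _ y] using this
    _ = C₁ * C₂ * C₃ * ((∫⁻ y, energy a f y ∂𝔪 n) * ∫⁻ z, energy b g z ∂𝔪 n) := by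
        rw [← lintegral_mul_const _ hma, mul_assoc (C₁ * C₂)]
        congr 1
        rw [← lintegral_const_mul' _ _ hC₃]
        refine lintegral_congr fun y => ?_
        rw [lintegral_const_mul' _ _ hC₃, lintegral_const_mul _ hmb]
    _ ≤ C₁ * C₂ * C₃ * (ofReal (Ka * ‖u‖ ^ 2) * ofReal (Kb * ‖v‖ ^ 2)) :=
        mul_le_mul_right (mul_le_mul' (ea u f hf) (eb v g hg)) _
    _ = _ := by
        rw [← ENNReal.ofReal_mul (by positivity)]
        conv_lhs => rw [← ENNReal.ofReal_toReal hC₁, ← ENNReal.ofReal_toReal hC₂,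
          ← ENNReal.ofReal_toReal hC₃]
        rw [← ENNReal.ofReal_mul (by positivity), ← ENNReal.ofReal_mul (by positivity),
          ← ENNReal.ofReal_mul (by positivity)]
        congr 1
        ring

section

variable {n : ℕ}

/-! ### Continuous representatives -/

theorem uniqueDiffOn_closedBall : UniqueDiffOn ℝ (𝔹 n) :=
  uniqueDiffOn_convex (convex_closedBall _ _) (by
    rw [interior_closedBall _ one_ne_zero]; exact ⟨0, mem_ball_self one_pos⟩)

theorem closure_unitBall : closure (ball (0 : E n) 1) = closedBall 0 1 :=
  closure_ball _ one_ne_zero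

/-- Continuous functions that agree almost everywhere on the ball agree on the closed ball. -/
theorem eqOn_closedBall_of_ae_eq {F : Type*} [TopologicalSpace F] [T2Space F] {f g : E n → F}
    (hf : ContinuousOn f (𝔹 n)) (hg : ContinuousOn g (𝔹 n))
    (h : f =ᵐ[𝔪 n] g) : EqOn f g (𝔹 n) := by
  have h1 : EqOn f g (ball 0 1) := Measure.eqOn_open_of_ae_eq h isOpen_ball
    (hf.mono ball_subset_closedBall) (hg.mono ball_subset_closedBall)
  exact h1.of_subset_closure hf hg ball_subset_closedBall closure_unitBall.ge

theorem ae_eq_of_eqOn_closedBall {F : Type*} {f g : E n → F} (h : EqOn f g (𝔹 n)) :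
    f =ᵐ[𝔪 n] g := by
  filter_upwards [ae_restrict_mem measurableSet_ball] with x hx
  exact h (ball_subset_closedBall hx)

theorem IsSmoothRep.sub {k : ℕ} {u v : H n k} {f g : E n → ℝ} (hf : IsSmoothRep u f)
    (hg : IsSmoothRep v g) : IsSmoothRep (u - v) fun x => f x - g x := by
  refine ⟨hf.1.sub hg.1, ?_⟩
  have h1 : (u - v).fn =ᵐ[𝔪 n] fun x => u.fn x - v.fn x := Lp.coeFn_sub _ _
  filter_upwards [h1, hf.2, hg.2] with x h h' h''
  rw [h, h', h'']

theorem tendstoUniformlyOn_of_abs_sub_le {Y : Type*} [NormedAddCommGroup Y] {S : Set (E n)}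
    {f : ℕ → E n → ℝ} {g : E n → ℝ} {w : ℕ → Y} {u : Y} {C : ℝ} (hw : Tendsto w atTop (𝓝 u))
    (h : ∀ j, ∀ x ∈ S, |f j x - g x| ≤ C * ‖w j - u‖) : TendstoUniformlyOn f g atTop S := by
  rw [Metric.tendstoUniformlyOn_iff]
  intro ε hε
  have h0 : Tendsto (fun j => C * ‖w j - u‖) atTop (𝓝 0) := by
    simpa using (tendsto_iff_norm_sub_tendsto_zero.1 hw).const_mul C
  filter_upwards [h0.eventually_lt_const hε] with j hj x hx
  rw [dist_comm, Real.dist_eq]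
  exact (h j x hx).trans_lt hj

/-- Every element of `H^k(B)` is a limit of smooth functions. -/
theorem H.exists_seq_isSmoothRep {k : ℕ} (u : H n k) :
    ∃ (w : ℕ → H n k) (f : ℕ → E n → ℝ), (∀ j, IsSmoothRep (w j) (f j)) ∧
      Tendsto w atTop (𝓝 u) := by
  choose w f h1 h2 using fun j : ℕ => u.exists_isSmoothRep_near (ε := 1 / (j + 1)) (by positivity)
  refine ⟨w, f, h1, tendsto_iff_norm_sub_tendsto_zero.2 ?_⟩
  exact squeeze_zero (fun _ => norm_nonneg _) (fun j => (h2 j).le)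
    tendsto_one_div_add_atTop_nhds_zero_nat

/-- Convergence in `H^k(B)` implies convergence almost everywhere along a subsequence. -/
theorem H.exists_subseq_tendsto_ae {k : ℕ} {u : H n k} {w : ℕ → H n k}
    (h : Tendsto w atTop (𝓝 u)) : ∃ ns : ℕ → ℕ, StrictMono ns ∧
      ∀ᵐ x ∂𝔪 n, Tendsto (fun j => (w (ns j)).fn x) atTop (𝓝 (u.fn x)) := by
  have hc : Continuous fun u : H n k => u.1 ⟨fun _ => 0, by simp⟩ :=
    (PiLp.continuous_apply 2 _ _).comp continuous_subtype_val
  exact (tendstoInMeasure_of_tendsto_Lp ((hc.tendsto u).comp h)).exists_seq_tendsto_ae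

/-- The linear form with coefficients `c`. -/
def linForm (c : Fin n → ℝ) : E n →L[ℝ] ℝ := ∑ i, c i • EuclideanSpace.proj i

theorem linForm_apply (c : Fin n → ℝ) (v : E n) : linForm c v = ∑ i, c i * v i := by
  simp [linForm]

theorem linForm_single (c : Fin n → ℝ) (i : Fin n) :
    linForm c (single i 1) = c i := by
  simp [linForm_apply]

/-- The linear form with given coefficients, as a linear function of the coefficients. -/
def linFormL : (Fin n → ℝ) →L[ℝ] (E n →L[ℝ] ℝ) :=
  LinearMap.toContinuousLinearMap
    { toFun := linForm
      map_add' := fun a b => by simp [linForm, add_smul, sum_add_distrib]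
      map_smul' := fun a b => by simp [linForm, mul_smul, Finset.smul_sum] }

theorem continuous_linForm : Continuous (linForm : (Fin n → ℝ) → E n →L[ℝ] ℝ) :=
  continuous_finsetSum _ fun i _ => (continuous_apply i).smul continuous_const

theorem eq_linForm (L : E n →L[ℝ] ℝ) : L = linForm fun i => L (single i 1) := by
  ext v
  rw [clm_apply_eq_sum, linForm_apply]
  simp [mul_comm]

theorem fderivWithin_congr_closedBall {F : Type*} [NormedAddCommGroup F] [NormedSpace ℝ F]
    {f g : E n → F} (h : EqOn f g (𝔹 n)) {x : E n} (hx : x ∈ 𝔹 n) :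
    fderivWithin ℝ f (𝔹 n) x = fderivWithin ℝ g (𝔹 n) x :=
  fderivWithin_congr h (h hx)

theorem H.contRep_res {k : ℕ} (u : H n (k + 1)) : (H.res u).contRep = u.contRep := rfl

/-- The trace operator as a continuous linear map. -/
def H.traceL (n k : ℕ) : H n k →L[ℝ] HTrace n k := (zeroTrace n k).mkQL

theorem H.trace_eq_iff {k : ℕ} (u v : H n k) : u.trace = v.trace ↔ u - v ∈ zeroTrace n k :=
  Submodule.Quotient.eq _

section

variable [NeZero n] {k : ℕ}

theorem one_le_dim (n : ℕ) [NeZero n] : 1 ≤ n := NeZero.one_le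

/-- Sobolev embedding: for `k > n / 2` the elements of `H^k(B)` have continuous representatives. -/
theorem exists_isContRep (hk : n < 2 * k) : ∃ C : ℝ, 0 ≤ C ∧ ∀ u : H n k, ∃ g, IsContRep u g ∧
    ∀ x ∈ 𝔹 n, |g x| ≤ C * ‖u‖ := by
  obtain ⟨C, hC, hb⟩ := exists_abs_le_of_isSmoothRep (one_le_dim n) hk
  refine ⟨C, hC, fun u => ?_⟩
  obtain ⟨w, f, hf, hw⟩ := u.exists_seq_isSmoothRep
  have hd : ∀ i j, ∀ x ∈ 𝔹 n, |f i x - f j x| ≤ C * ‖w i - w j‖ :=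
    fun i j x hx => hb _ _ ((hf i).sub (hf j)) x hx
  have hcau : ∀ x ∈ 𝔹 n, CauchySeq fun j => f j x := by
    intro x hx
    refine Metric.cauchySeq_iff.2 fun ε hε => ?_
    obtain ⟨N, hN⟩ := Metric.cauchySeq_iff.1 hw.cauchySeq (ε / (C + 1)) (by positivity)
    refine ⟨N, fun i hi j hj => ?_⟩
    rw [Real.dist_eq]
    refine (hd i j x hx).trans_lt ?_
    have h1 := hN i hi j hj
    rw [dist_eq_norm, lt_div_iff₀ (by positivity)] at h1
    nlinarith [norm_nonneg (w i - w j)]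
  choose! g hg using fun x (hx : x ∈ 𝔹 n) =>
    cauchySeq_tendsto_of_complete (hcau x hx)
  have hfg : ∀ j, ∀ x ∈ 𝔹 n, |f j x - g x| ≤ C * ‖w j - u‖ := by
    intro j x hx
    refine le_of_tendsto_of_tendsto' ((tendsto_const_nhds.sub (hg x hx)).abs)
      ((tendsto_const_nhds.sub hw).norm.const_mul C) fun i => hd j i x hx
  refine ⟨g, ⟨(tendstoUniformlyOn_of_abs_sub_le hw hfg).continuousOn (Frequently.of_forall fun j => (hf j).1.continuous.continuousOn),
    ?_⟩, fun x hx => ?_⟩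
  · obtain ⟨ns, hns, hae⟩ := H.exists_subseq_tendsto_ae hw
    filter_upwards [hae, ae_all_iff.2 fun j => (hf j).2, ae_restrict_mem measurableSet_ball]
      with x h1 h2 h3
    simp only [h2] at h1
    exact tendsto_nhds_unique h1 ((hg x (ball_subset_closedBall h3)).comp hns.tendsto_atTop)
  · exact le_of_tendsto_of_tendsto' (hg x hx).abs (hw.norm.const_mul C) fun j => hb _ _ (hf j) x hx

theorem H.contRep_spec (hk : n < 2 * k) (u : H n k) : IsContRep u u.contRep :=
  Classical.epsilon_spec (p := IsContRep u)
    (((exists_isContRep hk).choose_spec.2 u).imp fun _ h => h.1)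

theorem H.continuousOn_contRep (hk : n < 2 * k) (u : H n k) :
    ContinuousOn u.contRep (𝔹 n) := (H.contRep_spec hk u).1

theorem H.contRep_eqOn (hk : n < 2 * k) {u : H n k} {g : E n → ℝ} (h : IsContRep u g) :
    EqOn u.contRep g (𝔹 n) :=
  eqOn_closedBall_of_ae_eq (H.contRep_spec hk u).1 h.1 ((H.contRep_spec hk u).2.symm.trans h.2)

theorem H.contRep_add (hk : n < 2 * k) (u v : H n k) :
    EqOn (u + v).contRep (fun x => u.contRep x + v.contRep x) (𝔹 n) :=
  H.contRep_eqOn hk ⟨(H.continuousOn_contRep hk u).add (H.continuousOn_contRep hk v),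
    (H.fn_add u v).trans ((H.contRep_spec hk u).2.add (H.contRep_spec hk v).2)⟩

theorem H.contRep_smul (hk : n < 2 * k) (c : ℝ) (u : H n k) :
    EqOn (c • u).contRep (fun x => c * u.contRep x) (𝔹 n) :=
  H.contRep_eqOn hk ⟨(H.continuousOn_contRep hk u).const_smul c,
    (H.fn_smul c u).trans ((H.contRep_spec hk u).2.const_smul c)⟩

theorem H.exists_abs_contRep_le (hk : n < 2 * k) : ∃ C : ℝ, 0 ≤ C ∧ ∀ u : H n k,
    ∀ x ∈ 𝔹 n, |u.contRep x| ≤ C * ‖u‖ := by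
  obtain ⟨C, hC, h⟩ := exists_isContRep (n := n) hk
  refine ⟨C, hC, fun u x hx => ?_⟩
  obtain ⟨g, hg, hb⟩ := h u
  rw [H.contRep_eqOn hk hg hx]
  exact hb x hx

/-- Evaluation of the continuous representative at a point of the closed ball. -/
def H.eval (hk : n < 2 * k) {x : E n} (hx : x ∈ 𝔹 n) : H n k →L[ℝ] ℝ :=
  LinearMap.mkContinuous
    { toFun := fun u => u.contRep x
      map_add' := fun u v => H.contRep_add hk u v hx
      map_smul' := fun c u => H.contRep_smul hk c u hx }
    (H.exists_abs_contRep_le (n := n) hk).choose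
    fun u => (H.exists_abs_contRep_le (n := n) hk).choose_spec.2 u x hx

@[simp]
theorem H.eval_apply (hk : n < 2 * k) {x : E n} (hx : x ∈ 𝔹 n) (u : H n k) :
    H.eval hk hx u = u.contRep x := rfl

theorem H.contRep_sub (hk : n < 2 * k) (u v : H n k) :
    EqOn (u - v).contRep (fun x => u.contRep x - v.contRep x) (𝔹 n) :=
  fun _ hx => map_sub (H.eval hk hx) u v

theorem H.contRep_zero (hk : n < 2 * k) : EqOn (0 : H n k).contRep 0 (𝔹 n) :=
  fun _ hx => map_zero (H.eval hk hx)

/-- For `k > n / 2` the functions with zero trace are those that vanish on the sphere. -/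
theorem mem_zeroTrace_iff (hk : n < 2 * k) (u : H n k) :
    u ∈ zeroTrace n k ↔ ∀ x ∈ 𝕊 n, u.contRep x = 0 := by
  constructor
  · intro h x hx
    have hx' := sphere_subset_closedBall hx
    have hcl : IsClosed {v : H n k | H.eval hk hx' v = 0} :=
      isClosed_eq (H.eval hk hx').continuous continuous_const
    refine (closure_minimal ?_ hcl) h
    rintro v ⟨g, hg, hg0⟩
    exact (H.contRep_eqOn hk hg hx').trans (hg0 x hx)
  · intro h
    exact Submodule.le_topologicalClosure _ ⟨_, H.contRep_spec hk u, h⟩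

theorem H.val_trace (hk : n < 2 * k) (u : H n k) :
    EqOn u.trace.val u.contRep (sphere 0 1) := by
  intro x hx
  have h1 : (Classical.epsilon fun v : H n k => v.trace = u.trace).trace = u.trace :=
    Classical.epsilon_spec (p := fun v : H n k => v.trace = u.trace) ⟨u, rfl⟩
  have h2 := (mem_zeroTrace_iff hk _).1 ((H.trace_eq_iff _ _).1 h1) x hx
  rw [H.contRep_sub hk _ _ (sphere_subset_closedBall hx), sub_eq_zero] at h2
  exact h2

/-! ### Differentiability of continuous representatives -/

/-- A smooth function representing `u` is its continuous representative. -/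
theorem IsSmoothRep.eqOn (hk : n < 2 * k) {u : H n k} {f : E n → ℝ} (h : IsSmoothRep u f) :
    EqOn u.contRep f (𝔹 n) :=
  H.contRep_eqOn hk ⟨h.1.continuous.continuousOn, h.2⟩

theorem H.tendstoUniformlyOn_contRep (hk : n < 2 * k) {u : H n k} {w : ℕ → H n k}
    (h : Tendsto w atTop (𝓝 u)) :
    TendstoUniformlyOn (fun j => (w j).contRep) u.contRep atTop (𝔹 n) := by
  obtain ⟨C, hC, hb⟩ := H.exists_abs_contRep_le (n := n) hk
  refine tendstoUniformlyOn_of_abs_sub_le (C := C) h fun j x hx => ?_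
  have h1 := hb (w j - u) x hx
  rwa [H.contRep_sub hk (w j) u hx] at h1

/-- Elements of `H^{k+1}(B)`, `k > n / 2`, are continuously differentiable up to the boundary. -/
theorem H.hasFDerivWithinAt_contRep (hk : n < 2 * k) (u : H n (k + 1)) {x : E n}
    (hx : x ∈ 𝔹 n) :
    HasFDerivWithinAt u.contRep (linForm fun i => (H.D i u).contRep x) (𝔹 n) x := by
  have hk1 : n < 2 * (k + 1) := by omega
  obtain ⟨w, f, hf, hw⟩ := u.exists_seq_isSmoothRep
  have hint : ∀ y ∈ ball (0 : E n) 1,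
      HasFDerivAt u.contRep (linForm fun i => (H.D i u).contRep y) y := by
    intro y hy
    refine hasFDerivAt_of_tendstoUniformlyOn (l := atTop) (f := f) (f' := fun j => fderiv ℝ (f j))
      (g' := fun y => linForm fun i => (H.D i u).contRep y) isOpen_ball ?_
      (fun j y _ => ((hf j).1.differentiable (by simp) y).hasFDerivAt)
      (fun y hy => ?_) hy
    · have h1 : TendstoUniformlyOn (fun j y i => (H.D i (w j)).contRep y)
          (fun y i => (H.D i u).contRep y) atTop (ball 0 1) := by
        rw [Metric.tendstoUniformlyOn_iff]
        intro ε hε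
        have h0 : ∀ i : Fin n, ∀ᶠ j in atTop, ∀ y ∈ 𝔹 n,
            dist ((H.D i u).contRep y) ((H.D i (w j)).contRep y) < ε := fun i =>
          Metric.tendstoUniformlyOn_iff.1 (H.tendstoUniformlyOn_contRep hk
            (((H.D i).continuous.tendsto u).comp hw)) ε hε
        filter_upwards [eventually_all.2 h0] with j hj y hy
        exact (dist_pi_lt_iff hε).2 fun i => hj i y (ball_subset_closedBall hy)
      have h2 := linFormL.uniformContinuous.comp_tendstoUniformlyOn h1
      refine h2.congr (.of_forall fun j y hy => ?_)
      change linForm (fun i => (H.D i (w j)).contRep y) = fderiv ℝ (f j) y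
      rw [eq_linForm (fderiv ℝ (f j) y)]
      congr 1
      funext i
      exact ((hf j).D i).eqOn hk (ball_subset_closedBall hy)
    · have h3 := (H.tendstoUniformlyOn_contRep hk1 hw).tendsto_at (ball_subset_closedBall hy)
      refine h3.congr fun j => ?_
      exact (hf j).eqOn hk1 (ball_subset_closedBall hy)
  have := hasFDerivWithinAt_closure_of_tendsto_fderiv (f := u.contRep) (s := ball (0 : E n) 1)
    (x := x) (f' := linForm fun i => (H.D i u).contRep x)
    (fun y hy => (hint y hy).differentiableAt.differentiableWithinAt)
    (convex_ball _ _) isOpen_ball (fun y hy => by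
      rw [closure_unitBall] at hy
      exact (H.continuousOn_contRep hk1 u y hy).mono ball_subset_closedBall) (by
      have hc : ContinuousWithinAt (fun y => linForm fun i => (H.D i u).contRep y)
          (ball (0 : E n) 1) x :=
        continuous_linForm.continuousAt.comp_continuousWithinAt
          ((continuousWithinAt_pi.2 fun i => H.continuousOn_contRep hk _ x hx).mono
            ball_subset_closedBall)
      refine hc.congr' ?_
      filter_upwards [self_mem_nhdsWithin] with y hy
      exact (hint y hy).fderiv.symm)
  rwa [closure_unitBall] at this

theorem H.fderivWithin_contRep (hk : n < 2 * k) (u : H n (k + 1)) {x : E n}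
    (hx : x ∈ 𝔹 n) :
    fderivWithin ℝ u.contRep (𝔹 n) x = linForm fun i => (H.D i u).contRep x :=
  (H.hasFDerivWithinAt_contRep hk u hx).fderivWithin (uniqueDiffOn_closedBall x hx)

theorem H.pd_contRep (hk : n < 2 * k) (u : H n (k + 1)) (i : Fin n) :
    EqOn (pd i u.contRep) (H.D i u).contRep (𝔹 n) := fun x hx => by
  rw [pd, H.fderivWithin_contRep hk u hx, linForm_single]

end

/-- Functions that are smooth up to the boundary belong to `H^k(B)`. -/
theorem H.exists_of_contDiffOn {k : ℕ} {f : E n → ℝ} (hf : ContDiffOn ℝ ∞ f (𝔹 n)) :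
    ∃ u : H n k, u.fn =ᵐ[𝔪 n] f := by
  induction k generalizing f with
  | zero => exact H.exists_zero (memLp_of_continuousOn hf.continuousOn)
  | succ k ih =>
    have hp : ∀ i : Fin n, ContDiffOn ℝ ∞ (pd i f) (𝔹 n) := fun i =>
      (hf.fderivWithin uniqueDiffOn_closedBall (m := ∞) (by simp)).clm_apply contDiffOn_const
    obtain ⟨u, hu⟩ := ih hf
    choose v hv using fun i => ih (hp i)
    obtain ⟨w, hw, -⟩ := H.exists_of_partials u v fun i => by
      refine (isWeakPartial_of_contDiffOn i ((hf.mono ball_subset_closedBall).of_le (by simp))).congr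
        hu.symm ?_
      refine EventuallyEq.trans ?_ (hv i).symm
      filter_upwards [ae_restrict_mem measurableSet_ball] with x hx
      rw [pd, fderivWithin_of_mem_nhds (mem_of_superset (isOpen_ball.mem_nhds hx)
        ball_subset_closedBall)]
    exact ⟨w, by rw [← H.fn_res, hw]; exact hu⟩

end

section

variable {n : ℕ}

/-! ### Products of Sobolev functions -/

theorem H.norm_zero_sq_le (u : H n 0) :
    ofReal (‖u‖ ^ 2) = ∫⁻ x, ofReal (u.fn x ^ 2) ∂𝔪 n := by
  have h0 : ∀ α : MultiIdx n 0, α = ⟨fun _ => 0, by simp⟩ := fun α => MultiIdx.ext fun j => by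
    simp
  have h1 : ‖u‖ ^ 2 = ‖u.1 ⟨fun _ => 0, by simp⟩‖ ^ 2 := by
    change ‖u.1‖ ^ 2 = _
    rw [PiLp.norm_sq_eq_of_L2, Fintype.sum_eq_single ⟨fun _ => 0, by simp⟩
      fun α h => absurd (h0 α) h]
  rw [h1, ← eLpNorm_two_sq, H.fn, Lp.norm_def, ENNReal.ofReal_pow ENNReal.toReal_nonneg,
    ENNReal.ofReal_toReal (Lp.eLpNorm_ne_top _), ENNReal.rpow_two]

theorem fderiv_mul_single {f g : E n → ℝ} (hf : ContDiff ℝ ∞ f) (hg : ContDiff ℝ ∞ g) (i : Fin n)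
    (x : E n) : fderiv ℝ (fun x => f x * g x) x (single i 1)
      = fderiv ℝ f x (single i 1) * g x
        + f x * fderiv ℝ g x (single i 1) := by
  have h := ((hf.differentiable (by simp) x).hasFDerivAt.mul
    (hg.differentiable (by simp) x).hasFDerivAt).fderiv
  change fderiv ℝ (f * g) x _ = _
  rw [h]
  simp
  ring

theorem IsSmoothRep.add {k : ℕ} {u v : H n k} {f g : E n → ℝ} (hf : IsSmoothRep u f)
    (hg : IsSmoothRep v g) : IsSmoothRep (u + v) fun x => f x + g x :=
  ⟨hf.1.add hg.1, (H.fn_add u v).trans (hf.2.add hg.2)⟩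

theorem IsSmoothRep.ext {k : ℕ} {u v : H n k} {f : E n → ℝ} (hf : IsSmoothRep u f)
    (hg : IsSmoothRep v f) : u = v := H.ext_fn (hf.2.trans hg.2.symm)

section

variable [NeZero n]

/-- The product estimate for smooth functions; the induction differentiates the product. -/
theorem exists_mul_of_isSmoothRep (c : ℕ) : ∀ a b : ℕ, c ≤ a → c ≤ b → n + 2 * c < 2 * (a + b) →
    ∃ C : ℝ, 0 ≤ C ∧ ∀ (u : H n a) (v : H n b) (f g : E n → ℝ), IsSmoothRep u f → IsSmoothRep v g →
      ∃ w : H n c, IsSmoothRep w (fun x => f x * g x) ∧ ‖w‖ ≤ C * ‖u‖ * ‖v‖ := by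
  induction c with
  | zero =>
    intro a b _ _ hab
    obtain ⟨C, hC, hb⟩ := exists_lintegral_mul_sq_le (one_le_dim n) (show n < 2 * (a + b) by omega)
    refine ⟨√C, Real.sqrt_nonneg _, fun u v f g hf hg => ?_⟩
    have hc : ContDiff ℝ ∞ fun x => f x * g x := hf.1.mul hg.1
    obtain ⟨w, hw⟩ := H.exists_zero (memLp_of_continuousOn (n := n) hc.continuous.continuousOn)
    refine ⟨w, ⟨hc, hw⟩, ?_⟩
    have h1 := w.norm_zero_sq_le
    rw [lintegral_congr_ae (hw.mono fun x hx => by simp only [hx] :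
      (fun x => ofReal (w.fn x ^ 2)) =ᵐ[𝔪 n]
        fun x => ofReal ((f x * g x) ^ 2))] at h1
    have h2 := h1.trans_le (hb u v f g hf hg)
    rw [ENNReal.ofReal_le_ofReal_iff (by positivity)] at h2
    calc ‖w‖ ≤ √(C * (‖u‖ * ‖v‖) ^ 2) := Real.le_sqrt_of_sq_le h2
      _ = _ := by rw [Real.sqrt_mul hC, Real.sqrt_sq (by positivity), mul_assoc]
  | succ c ih =>
    intro a b ha hb hab
    obtain ⟨a, rfl⟩ : ∃ a', a = a' + 1 := ⟨a - 1, by omega⟩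
    obtain ⟨b, rfl⟩ : ∃ b', b = b' + 1 := ⟨b - 1, by omega⟩
    obtain ⟨C₁, hC₁, H₁⟩ := ih a (b + 1) (by omega) (by omega) (by omega)
    obtain ⟨C₂, hC₂, H₂⟩ := ih (a + 1) b (by omega) (by omega) (by omega)
    obtain ⟨K, hK, hKw⟩ := H.norm_le_of_D n c
    refine ⟨K * (C₁ * ‖(H.res : H n (a + 1) →L[ℝ] H n a)‖
      + ∑ i, (C₁ * ‖(H.D i : H n (a + 1) →L[ℝ] H n a)‖
        + C₂ * ‖(H.D i : H n (b + 1) →L[ℝ] H n b)‖)), by positivity, fun u v f g hf hg => ?_⟩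
    obtain ⟨w₀, hw₀, hn₀⟩ := H₁ (H.res u) v f g hf.res hg
    choose w₁ hw₁ hn₁ using fun i => H₁ (H.D i u) v _ g (hf.D i) hg
    choose w₂ hw₂ hn₂ using fun i => H₂ u (H.D i v) f _ hf (hg.D i)
    obtain ⟨w, hw, hwD⟩ := H.exists_of_partials w₀ (fun i => w₁ i + w₂ i) fun i => by
      refine (isWeakPartial_of_contDiffOn i (hw₀.1.contDiffOn.of_le (by simp))).congr
        hw₀.2.symm ?_
      refine EventuallyEq.trans ?_ ((hw₁ i).add (hw₂ i)).2.symm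
      exact .of_forall fun x => fderiv_mul_single hf.1 hg.1 i x
    refine ⟨w, ⟨hw₀.1, by rw [← H.fn_res, hw]; exact hw₀.2⟩, (hKw w).trans ?_⟩
    rw [mul_assoc K, mul_assoc K]
    refine mul_le_mul_of_nonneg_left ?_ hK
    rw [add_mul, add_mul, sum_mul, sum_mul, hw]
    have hu := norm_nonneg u
    have hv := norm_nonneg v
    refine add_le_add (hn₀.trans ?_) (Finset.sum_le_sum fun i _ => ?_)
    · rw [mul_assoc C₁ _ ‖u‖]
      exact mul_le_mul_of_nonneg_right (mul_le_mul_of_nonneg_left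
        (ContinuousLinearMap.le_opNorm _ _) hC₁) hv
    · rw [hwD i]
      refine (norm_add_le _ _).trans ?_
      rw [add_mul, add_mul]
      refine add_le_add ((hn₁ i).trans ?_) ((hn₂ i).trans ?_)
      · rw [mul_assoc C₁ _ ‖u‖]
        exact mul_le_mul_of_nonneg_right (mul_le_mul_of_nonneg_left
          (ContinuousLinearMap.le_opNorm _ _) hC₁) hv
      · calc C₂ * ‖u‖ * ‖H.D i v‖ ≤ C₂ * ‖u‖ * (‖(H.D i : H n (b + 1) →L[ℝ] H n b)‖ * ‖v‖) :=
              mul_le_mul_of_nonneg_left (ContinuousLinearMap.le_opNorm _ _) (by positivity)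
          _ = _ := by ring

theorem exists_mul {a b c : ℕ} (ha : c ≤ a) (hb : c ≤ b) (hab : n + 2 * c < 2 * (a + b)) :
    ∃ C : ℝ, 0 ≤ C ∧ ∀ (u : H n a) (v : H n b), ∃ w : H n c,
      w.fn =ᵐ[𝔪 n] (fun x => u.fn x * v.fn x) ∧ ‖w‖ ≤ C * ‖u‖ * ‖v‖ := by
  obtain ⟨C, hC, hm⟩ := exists_mul_of_isSmoothRep c a b ha hb hab
  refine ⟨C, hC, fun u v => ?_⟩
  obtain ⟨p, f, hf, hp⟩ := u.exists_seq_isSmoothRep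
  obtain ⟨q, g, hg, hq⟩ := v.exists_seq_isSmoothRep
  choose w hw hwn using fun j => hm (p j) (q j) _ _ (hf j) (hg j)
  have hdiff : ∀ i j, ‖w i - w j‖ ≤ C * ‖p i - p j‖ * ‖q i‖ + C * ‖p j‖ * ‖q i - q j‖ := by
    intro i j
    obtain ⟨w₁, h1, h1n⟩ := hm _ _ _ _ ((hf i).sub (hf j)) (hg i)
    obtain ⟨w₂, h2, h2n⟩ := hm _ _ _ _ (hf j) ((hg i).sub (hg j))
    have e : w i - w j = w₁ + w₂ := by
      have e1 := h1.add h2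
      have e2 := (hw i).sub (hw j)
      have e3 : (fun x => f i x * g i x - f j x * g j x)
          = fun x => (f i x - f j x) * g i x + f j x * (g i x - g j x) := by
        funext x; ring
      rw [e3] at e2
      exact e2.ext e1
    rw [e]
    exact (norm_add_le _ _).trans (add_le_add h1n h2n)
  have hcau : CauchySeq w := by
    rw [cauchySeq_iff_tendsto_dist_atTop_0]
    have t1 : Tendsto (Prod.fst : ℕ × ℕ → ℕ) atTop atTop := by
      rw [← prod_atTop_atTop_eq]; exact tendsto_fst
    have t2 : Tendsto (Prod.snd : ℕ × ℕ → ℕ) atTop atTop := by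
      rw [← prod_atTop_atTop_eq]; exact tendsto_snd
    have hlim : Tendsto (fun x : ℕ × ℕ => C * ‖p x.1 - p x.2‖ * ‖q x.1‖
        + C * ‖p x.2‖ * ‖q x.1 - q x.2‖) atTop (𝓝 0) := by
      simpa using (((((hp.comp t1).sub (hp.comp t2)).norm.const_mul C).mul (hq.comp t1).norm).add
        (((hp.comp t2).norm.const_mul C).mul ((hq.comp t1).sub (hq.comp t2)).norm))
    refine squeeze_zero (fun _ => dist_nonneg) (fun x => ?_) hlim
    rw [dist_eq_norm]
    exact hdiff x.1 x.2
  obtain ⟨w', hw'⟩ := cauchySeq_tendsto_of_complete hcau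
  refine ⟨w', ?_, ?_⟩
  · -- pass to almost everywhere convergent subsequences, one after the other
    obtain ⟨ns, hns, h1⟩ := H.exists_subseq_tendsto_ae hp
    obtain ⟨ms, hms, h2⟩ := H.exists_subseq_tendsto_ae (hq.comp hns.tendsto_atTop)
    obtain ⟨ls, hls, h3⟩ := H.exists_subseq_tendsto_ae
      (hw'.comp (hns.tendsto_atTop.comp hms.tendsto_atTop))
    filter_upwards [h1, h2, h3, ae_all_iff.2 fun j => (hw j).2, ae_all_iff.2 fun j => (hf j).2,
      ae_all_iff.2 fun j => (hg j).2] with x h1 h2 h3 h4 h5 h6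
    have h1' := h1.comp (hms.tendsto_atTop.comp hls.tendsto_atTop)
    have h2' := h2.comp hls.tendsto_atTop
    refine tendsto_nhds_unique h3 ((h1'.mul h2').congr fun j => ?_)
    simp only [Function.comp_apply]
    rw [h4, h5, h6]
  · exact le_of_tendsto_of_tendsto' hw'.norm ((hp.norm.const_mul C).mul hq.norm) hwn

theorem exists_mulL {a b c : ℕ} (ha : c ≤ a) (hb : c ≤ b) (hab : n + 2 * c < 2 * (a + b)) :
    ∃ M : H n a →L[ℝ] H n b →L[ℝ] H n c, ∀ u v,
      (M u v).fn =ᵐ[𝔪 n] fun x => u.fn x * v.fn x := by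
  obtain ⟨C, hC, hm⟩ := exists_mul ha hb hab
  choose M hM hMn using hm
  refine ⟨LinearMap.mkContinuous₂ (LinearMap.mk₂ ℝ M ?_ ?_ ?_ ?_) C hMn, hM⟩
  · intro u u' v
    refine H.ext_fn ((hM _ _).trans ?_)
    filter_upwards [H.fn_add u u', H.fn_add (M u v) (M u' v), hM u v, hM u' v] with x h1 h2 h3 h4
    rw [h1, h2, Pi.add_apply, Pi.add_apply, h3, h4, add_mul]
  · intro r u v
    refine H.ext_fn ((hM _ _).trans ?_)
    filter_upwards [H.fn_smul r u, H.fn_smul r (M u v), hM u v] with x h1 h2 h3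
    rw [h1, h2, Pi.smul_apply, Pi.smul_apply, h3, smul_eq_mul, smul_eq_mul, mul_assoc]
  · intro u v v'
    refine H.ext_fn ((hM _ _).trans ?_)
    filter_upwards [H.fn_add v v', H.fn_add (M u v) (M u v'), hM u v, hM u v'] with x h1 h2 h3 h4
    rw [h1, h2, Pi.add_apply, Pi.add_apply, h3, h4, mul_add]
  · intro r u v
    refine H.ext_fn ((hM _ _).trans ?_)
    filter_upwards [H.fn_smul r v, H.fn_smul r (M u v), hM u v] with x h1 h2 h3
    rw [h1, h2, Pi.smul_apply, Pi.smul_apply, h3, smul_eq_mul, smul_eq_mul]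
    ring

/-- Multiplication `H^a × H^b → H^c`, for `c ≤ a`, `c ≤ b` and `a + b - c > n / 2`. -/
def H.mulL {a b c : ℕ} (ha : c ≤ a) (hb : c ≤ b) (hab : n + 2 * c < 2 * (a + b)) :
    H n a →L[ℝ] H n b →L[ℝ] H n c := (exists_mulL ha hb hab).choose

theorem H.fn_mulL {a b c : ℕ} (ha : c ≤ a) (hb : c ≤ b) (hab : n + 2 * c < 2 * (a + b)) (u : H n a)
    (v : H n b) : (H.mulL ha hb hab u v).fn =ᵐ[𝔪 n] fun x => u.fn x * v.fn x :=
  (exists_mulL ha hb hab).choose_spec u v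

variable {k : ℕ}

/-- Multiplication in the algebra `H^k(B)`, `k > n / 2`. -/
def H.mul (hk : n < 2 * k) : H n k →L[ℝ] H n k →L[ℝ] H n k :=
  H.mulL le_rfl le_rfl (by omega)

theorem H.contRep_mul (hk : n < 2 * k) (u v : H n k) :
    EqOn (H.mul hk u v).contRep (fun x => u.contRep x * v.contRep x) (𝔹 n) :=
  H.contRep_eqOn hk ⟨(H.continuousOn_contRep hk u).mul (H.continuousOn_contRep hk v),
    (H.fn_mulL le_rfl le_rfl (by omega) u v).trans
      ((H.contRep_spec hk u).2.mul (H.contRep_spec hk v).2)⟩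

theorem H.ext_contRep (hk : n < 2 * k) {u v : H n k}
    (h : EqOn u.contRep v.contRep (𝔹 n)) : u = v :=
  H.ext_fn ((H.contRep_spec hk u).2.trans
    ((ae_eq_of_eqOn_closedBall h).trans (H.contRep_spec hk v).2.symm))

/-- The element of `H^k(B)` given by a function that is smooth up to the boundary. -/
theorem H.exists_contRep_eq (hk : n < 2 * k) {f : E n → ℝ}
    (hf : ContDiffOn ℝ ∞ f (𝔹 n)) :
    ∃ u : H n k, EqOn u.contRep f (𝔹 n) := by
  obtain ⟨u, hu⟩ := H.exists_of_contDiffOn (k := k) hf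
  exact ⟨u, H.contRep_eqOn hk ⟨hf.continuousOn, hu⟩⟩

end

end

section

/-! ### Inverses and square roots in commutative Banach algebras -/

section Abstract

variable {A : Type*} [NormedAddCommGroup A] [NormedSpace ℝ A]

/-- A continuous bilinear map is a commutative and associative multiplication with unit `e`. No
compatibility of the norm with the multiplication is required. -/
structure IsCommMul (m : A →L[ℝ] A →L[ℝ] A) (e : A) : Prop where
  comm : ∀ u v, m u v = m v u
  assoc : ∀ u v w, m (m u v) w = m u (m v w)
  one_mul : ∀ u, m e u = u

variable {m : A →L[ℝ] A →L[ℝ] A} {e : A}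

/-- Inversion is analytic near an invertible element. -/
theorem IsCommMul.exists_analytic_inv [CompleteSpace A] (hm : IsCommMul m e) {s t : A} (h : m s t = e) :
    ∃ T : A → A, AnalyticAt ℝ T s ∧ ∀ᶠ d in 𝓝 s, m (T d) d = e := by
  -- an element is inverted by inverting the operator of multiplication by it
  set a : (A →L[ℝ] A)ˣ := ⟨m s, m t,
    by ext1 u; exact (hm.assoc s t u).symm.trans (by rw [h, hm.one_mul]; rfl),
    by ext1 u; exact (hm.assoc t s u).symm.trans (by rw [hm.comm t s, h, hm.one_mul]; rfl)⟩
  refine ⟨fun d => Ring.inverse (m d) e, ?_, ?_⟩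
  · have h1 : AnalyticAt ℝ (fun d => Ring.inverse (m d)) s :=
      AnalyticAt.fun_comp (g := Ring.inverse) (f := fun d => m d) (analyticAt_inverse a)
        (m.analyticAt s)
    exact ((ContinuousLinearMap.apply ℝ A e).analyticAt _).fun_comp h1
  · have h2 : ∀ᶠ d in 𝓝 s, IsUnit (m d) :=
      m.continuous.continuousAt.eventually (Units.isOpen.mem_nhds a.isUnit)
    filter_upwards [h2] with d hd
    rw [hm.comm]
    exact congrArg (fun L : A →L[ℝ] A => L e) (Ring.mul_inverse_cancel _ hd)

/-- Square roots are analytic near the square of an invertible element, by the inverse function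
theorem. -/
theorem IsCommMul.exists_analytic_sqrt [CompleteSpace A] (hm : IsCommMul m e) {s t : A} (h : m s t = e) :
    ∃ S : A → A, AnalyticAt ℝ S (m s s) ∧ S (m s s) = s ∧ ∀ᶠ d in 𝓝 (m s s), m (S d) (S d) = d := by
  set f : A → A := fun u => m u u with hf
  have hfa : AnalyticAt ℝ f s := (m.analyticAt_bilinear (s, s)).comp₂ analyticAt_id analyticAt_id
  have ht : m t s = e := by rw [hm.comm, h]
  set L : A ≃L[ℝ] A := ContinuousLinearEquiv.equivOfInverse ((2 : ℝ) • m s)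
    ((1 / 2 : ℝ) • m t) (fun u => by
      simp [smul_smul, ← hm.assoc, ht, hm.one_mul]) (fun u => by
      simp [smul_smul, ← hm.assoc, h, hm.one_mul])
  have hd : HasFDerivAt f (L : A →L[ℝ] A) s := by
    have := m.hasFDerivAt_of_bilinear (hasFDerivAt_id s) (hasFDerivAt_id s)
    refine this.congr_fderiv ?_
    ext1 u
    change m s u + m u s = (2 : ℝ) • m s u
    rw [hm.comm u s, two_smul]
  have hc : ContDiffAt ℝ ω f s := hfa.contDiffAt
  refine ⟨hc.localInverse hd (by simp), ?_, ?_, ?_⟩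
  · exact (hc.to_localInverse hd (by simp)).analyticAt
  · exact (hc.hasStrictFDerivAt' hd (by simp)).localInverse_apply_image
  · exact (hc.hasStrictFDerivAt' hd (by simp)).eventually_right_inverse

/-! ### Local maps -/

variable {X : Type*} [NormedAddCommGroup X] [NormedSpace ℝ X] {U : Set X}

/-- The maps `F` into a commutative algebra that are analytic on `U`, and whose derivative is
`F'(ρ) σ = ∑_a P_a(ρ) Λ_a σ` with analytic coefficients `P_a`; the operators `Λ_a` will consist of
the components of `σ` and their first derivatives. -/
def IsLocalMap {ι : Type*} [Fintype ι] (m : A →L[ℝ] A →L[ℝ] A) (Λ : ι → X →L[ℝ] A) (U : Set X)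
    (F : X → A) : Prop :=
  AnalyticOnNhd ℝ F U ∧ ∃ P : ι → X → A, (∀ a, AnalyticOnNhd ℝ (P a) U) ∧
    ∀ ρ ∈ U, ∀ σ, fderiv ℝ F ρ σ = ∑ a, m (P a ρ) (Λ a σ)

theorem analyticOnNhd_mul (m : A →L[ℝ] A →L[ℝ] A) {F G : X → A} (hF : AnalyticOnNhd ℝ F U)
    (hG : AnalyticOnNhd ℝ G U) : AnalyticOnNhd ℝ (fun ρ => m (F ρ) (G ρ)) U :=
  fun ρ hρ => ((m).analyticAt_bilinear (F ρ, G ρ)).comp₂ (hF ρ hρ) (hG ρ hρ)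

theorem fderiv_mul_apply (hm : IsCommMul m e) {F G : X → A} {ρ : X} (hF : DifferentiableAt ℝ F ρ)
    (hG : DifferentiableAt ℝ G ρ) (σ : X) : fderiv ℝ (fun ρ => m (F ρ) (G ρ)) ρ σ
      = m (F ρ) (fderiv ℝ G ρ σ) + m (G ρ) (fderiv ℝ F ρ σ) := by
  rw [((m).hasFDerivAt_of_bilinear hF.hasFDerivAt hG.hasFDerivAt).fderiv]
  change m (F ρ) (fderiv ℝ G ρ σ) + m (fderiv ℝ F ρ σ) (G ρ) = _
  rw [hm.comm (fderiv ℝ F ρ σ)]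

section Local

variable {ι : Type*} [Fintype ι] {Λ : ι → X →L[ℝ] A}

theorem IsLocalMap.const (u : A) : IsLocalMap m Λ U fun _ => u :=
  ⟨analyticOnNhd_const, fun _ _ => 0, fun _ => analyticOnNhd_const, fun ρ _ σ => by simp⟩

theorem IsLocalMap.base [DecidableEq ι] (hm : IsCommMul m e) (a : ι) : IsLocalMap m Λ U (Λ a) := by
  refine ⟨(Λ a).analyticOnNhd _, fun b _ => if b = a then e else 0, fun b => analyticOnNhd_const,
    fun ρ _ σ => ?_⟩
  rw [ContinuousLinearMap.fderiv, Finset.sum_eq_single a]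
  · simp [hm.one_mul]
  · intro b _ hb
    simp [hb]
  · simp

theorem IsLocalMap.add {F G : X → A} (hF : IsLocalMap m Λ U F) (hG : IsLocalMap m Λ U G) :
    IsLocalMap m Λ U fun ρ => F ρ + G ρ := by
  obtain ⟨hF, P, hP, hFP⟩ := hF
  obtain ⟨hG, Q, hQ, hGQ⟩ := hG
  refine ⟨hF.add hG, fun a ρ => P a ρ + Q a ρ, fun a => (hP a).add (hQ a), fun ρ hρ σ => ?_⟩
  have h := ((hF ρ hρ).differentiableAt.hasFDerivAt.add (hG ρ hρ).differentiableAt.hasFDerivAt).fderiv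
  change fderiv ℝ (F + G) ρ σ = _
  rw [h]
  simp only [add_apply, map_add, hFP ρ hρ, hGQ ρ hρ, sum_add_distrib]

theorem IsLocalMap.mul (hm : IsCommMul m e) {F G : X → A} (hF : IsLocalMap m Λ U F) (hG : IsLocalMap m Λ U G) :
    IsLocalMap m Λ U fun ρ => m (F ρ) (G ρ) := by
  obtain ⟨hF, P, hP, hFP⟩ := hF
  obtain ⟨hG, Q, hQ, hGQ⟩ := hG
  refine ⟨analyticOnNhd_mul m hF hG,
    fun a ρ => m (F ρ) (Q a ρ) + m (G ρ) (P a ρ), fun a =>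
      (analyticOnNhd_mul m hF (hQ a)).add (analyticOnNhd_mul m hG (hP a)), fun ρ hρ σ => ?_⟩
  rw [fderiv_mul_apply hm (hF ρ hρ).differentiableAt (hG ρ hρ).differentiableAt, hFP ρ hρ,
    hGQ ρ hρ, map_sum, map_sum, ← sum_add_distrib]
  simp only [map_add, add_apply, hm.assoc]

theorem IsLocalMap.mono {F : X → A} {U' : Set X} (hF : IsLocalMap m Λ U F) (h : U' ⊆ U) :
    IsLocalMap m Λ U' F := by
  obtain ⟨hF, P, hP, hFP⟩ := hF
  exact ⟨hF.mono h, P, fun a => (hP a).mono h, fun ρ hρ => hFP ρ (h hρ)⟩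

/-- The square root of a local map is local: if `S² = F` and `E S = 1`, then `S' = E F' / 2`. -/
theorem IsLocalMap.sqrt (hm : IsCommMul m e) {F S T : X → A} (hU : IsOpen U) (hF : IsLocalMap m Λ U F)
    (hS : AnalyticOnNhd ℝ S U) (hT : AnalyticOnNhd ℝ T U)
    (hSF : ∀ ρ ∈ U, m (S ρ) (S ρ) = F ρ) (hTS : ∀ ρ ∈ U, m (T ρ) (S ρ) = e) :
    IsLocalMap m Λ U S := by
  obtain ⟨hF, P, hP, hFP⟩ := hF
  refine ⟨hS, fun a ρ => (1 / 2 : ℝ) • m (T ρ) (P a ρ), fun a =>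
    (analyticOnNhd_mul m hT (hP a)).fun_const_smul, fun ρ hρ σ => ?_⟩
  have h1 : fderiv ℝ F ρ = fderiv ℝ (fun ρ => m (S ρ) (S ρ)) ρ :=
    EventuallyEq.fderiv_eq (by
      filter_upwards [hU.mem_nhds hρ] with ρ' h'
      exact (hSF ρ' h').symm)
  have h2 := hFP ρ hρ σ
  rw [h1, fderiv_mul_apply hm (hS ρ hρ).differentiableAt (hS ρ hρ).differentiableAt, ← two_smul ℝ]
    at h2
  have h3 := congrArg (fun u => (1 / 2 : ℝ) • m (T ρ) u) h2
  simp only [map_smul, smul_smul, ← hm.assoc, hTS ρ hρ, hm.one_mul] at h3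
  norm_num at h3
  rw [h3, Finset.smul_sum]
  simp only [map_smul, smul_apply, hm.assoc]

/-- The inverse of a local map is local: if `T S = 1`, then `T' = -T² S'`. -/
theorem IsLocalMap.inv (hm : IsCommMul m e) {S T : X → A} (hU : IsOpen U) (hS : IsLocalMap m Λ U S)
    (hT : AnalyticOnNhd ℝ T U) (hTS : ∀ ρ ∈ U, m (T ρ) (S ρ) = e) :
    IsLocalMap m Λ U T := by
  obtain ⟨hS, P, hP, hSP⟩ := hS
  refine ⟨hT, fun a ρ => (-1 : ℝ) • m (T ρ) (m (T ρ) (P a ρ)), fun a =>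
    (analyticOnNhd_mul m hT (analyticOnNhd_mul m hT (hP a))).fun_const_smul, fun ρ hρ σ => ?_⟩
  have h1 : fderiv ℝ (fun ρ => m (T ρ) (S ρ)) ρ = fderiv ℝ (fun _ => e) ρ :=
    EventuallyEq.fderiv_eq (by
      filter_upwards [hU.mem_nhds hρ] with ρ' h'
      exact hTS ρ' h')
  have h2 := congrArg (fun L => L σ) h1
  simp only [fderiv_mul_apply hm (hT ρ hρ).differentiableAt (hS ρ hρ).differentiableAt,
    fderiv_const_apply, zero_apply] at h2
  have h3 := congrArg (fun u => m (T ρ) u) h2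
  simp only [map_add, map_zero, ← hm.assoc (T ρ) (S ρ), hTS ρ hρ, hm.one_mul] at h3
  rw [eq_neg_of_add_eq_zero_right h3, hSP ρ hρ]
  simp [hm.assoc]

end Local

end Abstract

/-! ### Analytic families of functions in the algebra `H^k(B)` -/

variable {n : ℕ} [NeZero n] {k : ℕ}

/-- The constant function `1` as an element of `H^k(B)`. -/
def H.one (hk : n < 2 * k) : H n k :=
  (H.exists_contRep_eq hk (f := fun _ => 1) contDiffOn_const).choose

theorem H.contRep_one (hk : n < 2 * k) : EqOn (H.one hk).contRep (fun _ => 1) (𝔹 n) :=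
  (H.exists_contRep_eq hk (f := fun _ => 1) contDiffOn_const).choose_spec

theorem H.isCommMul (hk : n < 2 * k) : IsCommMul (H.mul hk) (H.one hk) where
  comm u v := H.ext_contRep hk fun x hx => by
    rw [H.contRep_mul hk u v hx, H.contRep_mul hk v u hx]; exact mul_comm _ _
  assoc u v w := H.ext_contRep hk fun x hx => by
    rw [H.contRep_mul hk _ w hx, H.contRep_mul hk u _ hx]
    simp only [H.contRep_mul hk _ _ hx]
    exact mul_assoc _ _ _
  one_mul u := H.ext_contRep hk fun x hx => by
    rw [H.contRep_mul hk _ u hx]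
    simp only [H.contRep_one hk hx, one_mul]

theorem H.eventually_contRep_pos (hk : n < 2 * k) {s : H n k}
    (h : ∀ x ∈ 𝔹 n, 0 < s.contRep x) :
    ∀ᶠ d in 𝓝 s, ∀ x ∈ 𝔹 n, 0 < d.contRep x := by
  obtain ⟨C, hC, hb⟩ := H.exists_abs_contRep_le (n := n) hk
  obtain ⟨x₀, hx₀, hmin⟩ := (isCompact_closedBall (0 : E n) 1).exists_isMinOn
    ⟨0, mem_closedBall_self zero_le_one⟩ (H.continuousOn_contRep hk s)
  have hδ := h x₀ hx₀
  have : Tendsto (fun d => C * ‖d - s‖) (𝓝 s) (𝓝 0) := by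
    have h0 : Continuous fun d : H n k => C * ‖d - s‖ := by fun_prop
    simpa using h0.tendsto s
  filter_upwards [this.eventually_lt_const hδ] with d hd x hx
  have h1 := (hb (d - s) x hx).trans_lt hd
  rw [H.contRep_sub hk d s hx] at h1
  have h2 : s.contRep x₀ ≤ s.contRep x := hmin hx
  have h3 := (abs_lt.1 h1).1
  linarith

section Families

variable {X : Type*} [NormedAddCommGroup X] [NormedSpace ℝ X] {U : Set X}

/-- The families of functions on the closed ball that are given, for parameters in `U`, by maps in
a class `C` of maps into `H^k(B)` that is closed under the algebraic operations. -/
def familyAlg (hk : n < 2 * k) (C : Set (X → H n k)) (U : Set X)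
    (add : ∀ F ∈ C, ∀ G ∈ C, (fun ρ => F ρ + G ρ) ∈ C)
    (mul : ∀ F ∈ C, ∀ G ∈ C, (fun ρ => H.mul hk (F ρ) (G ρ)) ∈ C)
    (const : ∀ u, (fun _ => u) ∈ C) : Subalgebra ℝ (X → E n → ℝ) where
  carrier := {q | ∃ F ∈ C, ∀ ρ ∈ U, EqOn (F ρ).contRep (q ρ) (𝔹 n)}
  add_mem' := by
    rintro p q ⟨F, hF, hFp⟩ ⟨G, hG, hGq⟩
    refine ⟨_, add F hF G hG, fun ρ hρ x hx => (H.contRep_add hk _ _ hx).trans ?_⟩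
    simp only [hFp ρ hρ hx, hGq ρ hρ hx, Pi.add_apply]
  mul_mem' := by
    rintro p q ⟨F, hF, hFp⟩ ⟨G, hG, hGq⟩
    refine ⟨_, mul F hF G hG, fun ρ hρ x hx => (H.contRep_mul hk _ _ hx).trans ?_⟩
    simp only [hFp ρ hρ hx, hGq ρ hρ hx, Pi.mul_apply]
  algebraMap_mem' := fun c => by
    obtain ⟨u, hu⟩ := H.exists_contRep_eq hk (f := fun _ => c) contDiffOn_const
    exact ⟨_, const u, fun ρ _ x hx => hu hx⟩

section Local

variable {ι : Type*} [Fintype ι] {hk : n < 2 * k} {Λ : ι → X →L[ℝ] H n k}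

/-- The algebra of families of functions that are given by local maps into `H^k(B)`. -/
def localAlg (hk : n < 2 * k) (Λ : ι → X →L[ℝ] H n k) (U : Set X) :
    Subalgebra ℝ (X → E n → ℝ) :=
  familyAlg hk {F | IsLocalMap (H.mul hk) Λ U F} U (fun _ hF _ hG => hF.add hG)
    (fun _ hF _ hG => hF.mul (H.isCommMul hk) hG) fun u => .const u

theorem const_mem_localAlg {f : E n → ℝ} (hf : ContDiffOn ℝ ∞ f (𝔹 n)) :
    (fun _ => f) ∈ localAlg hk Λ U := by
  obtain ⟨u, hu⟩ := H.exists_contRep_eq hk hf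
  exact ⟨_, IsLocalMap.const u, fun ρ _ x hx => hu hx⟩

theorem localAlg_mono {U' : Set X} (h : U' ⊆ U) : localAlg hk Λ U ≤ localAlg hk Λ U' := by
  rintro q ⟨F, hF, hFq⟩
  exact ⟨F, hF.mono h, fun ρ hρ => hFq ρ (h hρ)⟩

theorem localAlg_congr {p q : X → E n → ℝ} (h : ∀ ρ ∈ U, EqOn (p ρ) (q ρ) (𝔹 n))
    (hp : p ∈ localAlg hk Λ U) : q ∈ localAlg hk Λ U := by
  obtain ⟨F, hF, hFp⟩ := hp
  exact ⟨F, hF, fun ρ hρ => (hFp ρ hρ).trans (h ρ hρ)⟩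

/-- Square roots of positive families, near a parameter at which the family is the square of a smooth
positive function. -/
theorem exists_sqrt_mem_localAlg {q : X → E n → ℝ} (hU : IsOpen U) {ρ₀ : X} (h0 : ρ₀ ∈ U)
    (hq : q ∈ localAlg hk Λ U) {f : E n → ℝ} (hf : ContDiffOn ℝ ∞ f (𝔹 n))
    (hpos : ∀ x ∈ 𝔹 n, 0 < f x)
    (hqf : ∀ x ∈ 𝔹 n, q ρ₀ x = f x ^ 2) :
    ∃ U' ⊆ U, IsOpen U' ∧ ρ₀ ∈ U' ∧ (∀ ρ ∈ U', ∀ x ∈ 𝔹 n, 0 < q ρ x) ∧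
      (fun ρ x => √(q ρ x)) ∈ localAlg hk Λ U' ∧ (fun ρ x => (√(q ρ x))⁻¹) ∈ localAlg hk Λ U' := by
  obtain ⟨F, hF, hFq⟩ := hq
  obtain ⟨s, hs⟩ := H.exists_contRep_eq hk hf
  obtain ⟨e, he⟩ := H.exists_contRep_eq hk (hf.inv fun x hx => (hpos x hx).ne')
  have hse : H.mul hk s e = H.one hk := H.ext_contRep hk fun x hx => by
    rw [H.contRep_mul hk s e hx, H.contRep_one hk hx]
    simp only [hs hx, he hx]
    exact mul_inv_cancel₀ (hpos x hx).ne'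
  have hF0 : F ρ₀ = H.mul hk s s := H.ext_contRep hk fun x hx => by
    rw [H.contRep_mul hk s s hx, hFq ρ₀ h0 hx, hqf x hx]
    simp only [hs hx]
    ring
  obtain ⟨S, hSa, hS0, hSS⟩ := (H.isCommMul hk).exists_analytic_sqrt hse
  obtain ⟨T, hTa, hTS⟩ := (H.isCommMul hk).exists_analytic_inv hse
  rw [← hF0] at hSa hS0 hSS
  have hFc : ContinuousAt F ρ₀ := (hF.1 ρ₀ h0).continuousAt
  have hSc : Tendsto (fun ρ => S (F ρ)) (𝓝 ρ₀) (𝓝 s) := by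
    have := hSa.continuousAt.tendsto.comp hFc.tendsto
    rwa [hS0] at this
  have hspos : ∀ x ∈ 𝔹 n, 0 < s.contRep x := fun x hx => by
    rw [hs hx]; exact hpos x hx
  have hev : ∀ᶠ ρ in 𝓝 ρ₀, ρ ∈ U ∧ AnalyticAt ℝ S (F ρ) ∧ AnalyticAt ℝ T (S (F ρ)) ∧
      H.mul hk (S (F ρ)) (S (F ρ)) = F ρ ∧ H.mul hk (T (S (F ρ))) (S (F ρ)) = H.one hk ∧
      ∀ x ∈ 𝔹 n, 0 < (S (F ρ)).contRep x := by
    filter_upwards [hU.mem_nhds h0, hFc.eventually hSa.eventually_analyticAt,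
      hSc.eventually hTa.eventually_analyticAt, hFc.eventually hSS, hSc.eventually hTS,
      hSc.eventually (H.eventually_contRep_pos hk hspos)] with ρ h1 h2 h3 h4 h5 h6
    exact ⟨h1, h2, h3, h4, h5, h6⟩
  obtain ⟨U', hU', hU'o, h0'⟩ := _root_.eventually_nhds_iff.1 hev
  have hsub : U' ⊆ U := fun ρ hρ => (hU' ρ hρ).1
  have hSan : AnalyticOnNhd ℝ (fun ρ => S (F ρ)) U' := fun ρ hρ =>
    (hU' ρ hρ).2.1.fun_comp (hF.1 ρ (hsub hρ))
  have hTan : AnalyticOnNhd ℝ (fun ρ => T (S (F ρ))) U' := fun ρ hρ =>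
    AnalyticAt.fun_comp (g := T) (f := fun ρ => S (F ρ)) (hU' ρ hρ).2.2.1 (hSan ρ hρ)
  have hSloc : IsLocalMap (H.mul hk) Λ U' fun ρ => S (F ρ) :=
    IsLocalMap.sqrt (H.isCommMul hk) hU'o (hF.mono hsub) hSan hTan (fun ρ hρ => (hU' ρ hρ).2.2.2.1)
      (fun ρ hρ => (hU' ρ hρ).2.2.2.2.1)
  have hTloc : IsLocalMap (H.mul hk) Λ U' fun ρ => T (S (F ρ)) :=
    IsLocalMap.inv (H.isCommMul hk) hU'o hSloc hTan (fun ρ hρ => (hU' ρ hρ).2.2.2.2.1)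
  have hq : ∀ ρ ∈ U', ∀ x ∈ 𝔹 n, q ρ x = (S (F ρ)).contRep x ^ 2 := by
    intro ρ hρ x hx
    rw [← hFq ρ (hsub hρ) hx, ← (hU' ρ hρ).2.2.2.1, H.contRep_mul hk _ _ hx,
      (hU' ρ hρ).2.2.2.1, sq]
  have hsq : ∀ ρ ∈ U', ∀ x ∈ 𝔹 n, √(q ρ x) = (S (F ρ)).contRep x := by
    intro ρ hρ x hx
    rw [hq ρ hρ x hx, Real.sqrt_sq ((hU' ρ hρ).2.2.2.2.2 x hx).le]
  refine ⟨U', hsub, hU'o, h0', fun ρ hρ x hx => ?_, ⟨_, hSloc, fun ρ hρ x hx => ?_⟩,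
    ⟨_, hTloc, fun ρ hρ x hx => ?_⟩⟩
  · rw [hq ρ hρ x hx]
    exact pow_pos ((hU' ρ hρ).2.2.2.2.2 x hx) 2
  · exact (hsq ρ hρ x hx).symm
  · have h1 := congrArg (fun u : H n k => u.contRep x) (hU' ρ hρ).2.2.2.2.1
    simp only [H.contRep_mul hk _ _ hx, H.contRep_one hk hx] at h1
    simp only [hsq ρ hρ x hx]
    exact eq_inv_of_mul_eq_one_left h1

end Local

/-- The algebra of families of functions that are given by analytic maps into `H^k(B)`. -/
def analyticAlg (hk : n < 2 * k) (U : Set X) : Subalgebra ℝ (X → E n → ℝ) :=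
  familyAlg hk {F | AnalyticOnNhd ℝ F U} U (fun _ hF _ hG => hF.add hG)
    (fun _ hF _ hG => analyticOnNhd_mul (H.mul hk) hF hG) fun _ => analyticOnNhd_const

variable {hk : n < 2 * k}

theorem const_mem_analyticAlg {f : E n → ℝ} (hf : ContDiffOn ℝ ∞ f (𝔹 n)) :
    (fun _ => f) ∈ analyticAlg (X := X) hk U := by
  obtain ⟨u, hu⟩ := H.exists_contRep_eq hk hf
  exact ⟨fun _ => u, analyticOnNhd_const, fun ρ _ x hx => hu hx⟩

theorem analyticAlg_congr {p q : X → E n → ℝ} (h : ∀ ρ ∈ U, EqOn (p ρ) (q ρ) (𝔹 n))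
    (hp : p ∈ analyticAlg hk U) : q ∈ analyticAlg hk U := by
  obtain ⟨F, hF, hFp⟩ := hp
  exact ⟨F, hF, fun ρ hρ => (hFp ρ hρ).trans (h ρ hρ)⟩

theorem analyticAlg_of_localAlg {ι : Type*} [Fintype ι] {Λ : ι → X →L[ℝ] H n k}
    {q : X → E n → ℝ} (h : q ∈ localAlg hk Λ U) : q ∈ analyticAlg hk U := by
  obtain ⟨F, hF, hFq⟩ := h
  exact ⟨F, hF.1, hFq⟩

theorem analyticAlg_of_succ {hk' : n < 2 * (k + 1)} {q : X → E n → ℝ}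
    (h : q ∈ analyticAlg hk' U) : q ∈ analyticAlg hk U := by
  obtain ⟨F, hF, hFq⟩ := h
  exact ⟨fun ρ => H.res (F ρ), fun ρ hρ => (H.res.analyticAt _).fun_comp (hF ρ hρ), hFq⟩

theorem analyticIntoH_of_mem {ι : Type*} [Fintype ι] {Q : X → ι → E n → ℝ}
    (h : ∀ i, (fun ρ => Q ρ i) ∈ analyticAlg hk U) : AnalyticIntoH k U Q := by
  choose F hF hFq using h
  refine ⟨fun ρ i => F i ρ, fun ρ hρ => AnalyticAt.pi fun i => hF i ρ hρ, fun ρ hρ i => ?_⟩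
  exact (H.contRep_spec hk _).2.trans (ae_eq_of_eqOn_closedBall (hFq i ρ hρ))

theorem analyticIntoTrace_of_mem {ι : Type*} [Fintype ι] {Q Q' : X → ι → E n → ℝ}
    (h : ∀ i, (fun ρ => Q' ρ i) ∈ analyticAlg hk U)
    (hQ : ∀ ρ ∈ U, ∀ i, EqOn (Q' ρ i) (Q ρ i) (sphere 0 1)) : AnalyticIntoTrace k U Q := by
  choose F hF hFq using h
  refine ⟨fun ρ i => H.traceL n k (F i ρ), fun ρ hρ => AnalyticAt.pi fun i =>
    ((H.traceL n k).analyticAt _).fun_comp (hF i ρ hρ), fun ρ hρ i x hx => ?_⟩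
  change (F i ρ).trace.val x = _
  exact ((H.val_trace hk _ hx).trans (hFq i ρ hρ (sphere_subset_closedBall hx))).trans
    (hQ ρ hρ i hx)

/-- Determinants of families of matrices with entries in an algebra of families. -/
theorem det_mem {ι α β : Type*} [Fintype ι] [DecidableEq ι] (S : Subalgebra ℝ (α → β → ℝ))
    {M : α → β → Matrix ι ι ℝ} (h : ∀ i j, (fun ρ x => M ρ x i j) ∈ S) :
    (fun ρ x => (M ρ x).det) ∈ S := by
  have e : (fun ρ x => (M ρ x).det) = ∑ σ : Equiv.Perm ι, ((Equiv.Perm.sign σ : ℤ) : ℝ) •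
      ∏ i, fun ρ x => M ρ x (σ i) i := by
    funext ρ x
    simp [Matrix.det_apply', Finset.sum_apply, Finset.prod_apply]
  rw [e]
  exact S.sum_mem fun σ _ => S.smul_mem (S.prod_mem fun i _ => h _ _) _

theorem adjugate_mem {ι α β : Type*} [Fintype ι] [DecidableEq ι] (S : Subalgebra ℝ (α → β → ℝ))
    {M : α → β → Matrix ι ι ℝ} (h : ∀ i j, (fun ρ x => M ρ x i j) ∈ S) (i j : ι) :
    (fun ρ x => (M ρ x).adjugate i j) ∈ S := by
  simp only [Matrix.adjugate_apply]
  refine det_mem S fun a b => ?_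
  by_cases hab : a = j
  · subst hab
    simp only [Matrix.updateRow_self]
    exact S.algebraMap_mem (Pi.single (M := fun _ => ℝ) i 1 b)
  · simp only [Matrix.updateRow_ne hab]
    exact h a b

theorem sum_mem_families {ι α β : Type*} [Fintype ι] (S : Subalgebra ℝ (α → β → ℝ))
    {q : ι → α → β → ℝ} (h : ∀ i, q i ∈ S) : (fun ρ x => ∑ i, q i ρ x) ∈ S := by
  have e : (fun ρ x => ∑ i, q i ρ x) = ∑ i, q i := by
    funext ρ x
    simp
  rw [e]
  exact S.sum_mem fun i _ => h i

end Families

end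

section

variable {n : ℕ}

/-! ### Linear algebra of hypersurfaces -/

theorem metric_eq_gram (X : E n → E (n + 1)) (x : E n) :
    metric X x = Matrix.gram ℝ fun j => pd j X x := rfl

theorem inner_eq_dotProduct {d : ℕ} (x y : E d) : ⟪x, y⟫ = ∑ l, x l * y l := by
  rw [PiLp.inner_apply]
  exact sum_congr rfl fun l _ => by simp [mul_comm]

theorem inner_cross (p : E (n + 1)) (v : Fin n → E (n + 1)) :
    ⟪p, cross v⟫ = (Matrix.of (Fin.cons p.ofLp fun j => (v j).ofLp) :
      Matrix (Fin (n + 1)) (Fin (n + 1)) ℝ).det := by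
  rw [inner_eq_dotProduct, Matrix.det_succ_row_zero]
  refine sum_congr rfl fun l _ => ?_
  have h : (cross v) l = (-1) ^ (l : ℕ) * ((Matrix.of (Fin.cons p.ofLp fun j => (v j).ofLp) :
      Matrix (Fin (n + 1)) (Fin (n + 1)) ℝ).submatrix Fin.succ l.succAbove).det := by
    change (Matrix.of (Fin.cons (Pi.single l 1) fun j => (v j).ofLp) :
      Matrix (Fin (n + 1)) (Fin (n + 1)) ℝ).det = _
    rw [Matrix.det_succ_row_zero, Finset.sum_eq_single l]
    · simp only [Matrix.of_apply, Fin.cons_zero, Pi.single_eq_same, mul_one]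
      congr 1
    · intro b _ hb
      simp [hb]
    · simp
  rw [h]
  simp only [Matrix.of_apply, Fin.cons_zero]
  ring

theorem inner_self_cross (v : Fin n → E (n + 1)) (j : Fin n) : ⟪v j, cross v⟫ = 0 := by
  rw [inner_cross]
  exact Matrix.det_zero_of_row_eq (i := 0) (j := j.succ) (Fin.succ_ne_zero j).symm rfl

/-- The volume spanned by `v` and a vector orthogonal to `v`. -/
theorem sq_inner_cross_of_orthogonal {p : E (n + 1)} {v : Fin n → E (n + 1)}
    (h : ∀ j, ⟪p, v j⟫ = 0) : ⟪p, cross v⟫ ^ 2 = ‖p‖ ^ 2 * (Matrix.gram ℝ v).det := by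
  rw [inner_cross]
  set M : Matrix (Fin (n + 1)) (Fin (n + 1)) ℝ := Matrix.of (Fin.cons p.ofLp fun j => (v j).ofLp)
    with hM
  have h0 : M * Mᵀ = Matrix.gram ℝ (Fin.cons p v : Fin (n + 1) → E (n + 1)) := by
    ext i j
    rw [Matrix.mul_apply, Matrix.gram_apply, inner_eq_dotProduct]
    refine sum_congr rfl fun l _ => ?_
    have e : ∀ i, M i l = (Fin.cons p v : Fin (n + 1) → E (n + 1)) i l := by
      intro i
      refine Fin.cases ?_ (fun i => ?_) i <;> simp [hM]
    rw [Matrix.transpose_apply, e, e]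
  have h1 : M.det ^ 2 = (M * Mᵀ).det := by rw [Matrix.det_mul, Matrix.det_transpose, sq]
  rw [h1, h0, Matrix.det_succ_row_zero, Finset.sum_eq_single 0]
  · have e : (Matrix.gram ℝ (Fin.cons p v : Fin (n + 1) → E (n + 1))).submatrix Fin.succ
        (Fin.succAbove 0) = Matrix.gram ℝ v := by
      ext i j
      simp [Matrix.gram_apply]
    rw [e, Matrix.gram_apply]
    simp
  · intro b _ hb
    obtain ⟨j, rfl⟩ := Fin.exists_succ_eq.2 hb
    rw [Matrix.gram_apply]
    simp [h j]
  · simp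

/-- The length of the cross product is the volume spanned by the vectors. -/
theorem norm_cross_sq (v : Fin n → E (n + 1)) : ‖cross v‖ ^ 2 = (Matrix.gram ℝ v).det := by
  by_cases hw : cross v = 0
  · -- a unit vector orthogonal to all `v j` spans zero volume with them
    let f : E (n + 1) →ₗ[ℝ] (Fin n → ℝ) := LinearMap.pi fun j => (innerSL ℝ (v j)).toLinearMap
    have hf : LinearMap.ker f ≠ ⊥ := LinearMap.ker_ne_bot_of_finrank_lt (by simp)
    obtain ⟨p, hp, hp0⟩ := Submodule.exists_mem_ne_zero_of_ne_bot hf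
    have h := sq_inner_cross_of_orthogonal (p := p) (v := v) fun j => by
      rw [real_inner_comm]
      exact congrFun (LinearMap.mem_ker.1 hp) j
    rw [hw, inner_zero_right] at h
    have : ‖p‖ ^ 2 ≠ 0 := by positivity
    have h2 : (Matrix.gram ℝ v).det = 0 := by
      have := h.symm
      simpa [hp0] using this
    rw [hw, h2]; simp
  · have h := sq_inner_cross_of_orthogonal (p := cross v) (v := v) fun j => by
      rw [real_inner_comm]; exact inner_self_cross v j
    rw [real_inner_self_eq_norm_sq] at h
    have h1 : ‖cross v‖ ^ 2 ≠ 0 := by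
      have := norm_ne_zero_iff.2 hw
      positivity
    refine mul_left_cancel₀ h1 ?_
    rw [← h]; ring

theorem areaDensity_eq_norm_cross (X : E n → E (n + 1)) (x : E n) :
    areaDensity X x = ‖cross fun j => pd j X x‖ := by
  rw [areaDensity, metric_eq_gram, ← norm_cross_sq, Real.sqrt_sq (norm_nonneg _)]

/-- A vector orthogonal to `n` linearly independent vectors is a multiple of their cross product. -/
theorem eq_smul_cross_of_orthogonal {p : E (n + 1)} {v : Fin n → E (n + 1)}
    (hv : 0 < (Matrix.gram ℝ v).det) (h : ∀ j, ⟪p, v j⟫ = 0) :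
    p = (⟪p, cross v⟫ / ‖cross v‖ ^ 2) • cross v := by
  have hw : ‖cross v‖ ^ 2 ≠ 0 := by rw [norm_cross_sq]; exact hv.ne'
  set q := p - (⟪p, cross v⟫ / ‖cross v‖ ^ 2) • cross v with hq
  have h1 := sq_inner_cross_of_orthogonal (p := q) (v := v) fun j => by
    rw [hq, inner_sub_left, inner_smul_left, h j, real_inner_comm (v j), inner_self_cross]; simp
  have h2 : ⟪q, cross v⟫ = 0 := by
    rw [hq, inner_sub_left, inner_smul_left, real_inner_self_eq_norm_sq]
    simp [div_mul_cancel₀ _ hw]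
  rw [h2] at h1
  have h3 : ‖q‖ = 0 := by
    have := h1.symm
    simpa [hv.ne'] using this
  exact sub_eq_zero.1 (norm_eq_zero.1 h3)

theorem det_gram_pos {ι : Type*} [Fintype ι] [DecidableEq ι] {F : Type*} [NormedAddCommGroup F]
    [InnerProductSpace ℝ F] {v : ι → F} (h : LinearIndependent ℝ v) :
    0 < (Matrix.gram ℝ v).det := (Matrix.posDef_gram_of_linearIndependent h).det_pos

theorem dotProduct_adjugate_pos {G : Matrix (Fin n) (Fin n) ℝ} (hG : G.PosDef) {x : Fin n → ℝ}
    (hx : x ≠ 0) : 0 < x ⬝ᵥ (G.adjugate *ᵥ x) := by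
  have h1 := hG.inv.dotProduct_mulVec_pos hx
  have h2 : G.adjugate = G.det • G⁻¹ := by
    rw [Matrix.inv_def, smul_smul, Ring.inverse_eq_inv', mul_inv_cancel₀ hG.det_pos.ne', one_smul]
  rw [h2, Matrix.smul_mulVec, dotProduct_smul]
  exact mul_pos hG.det_pos (by simpa using h1)

/-! ### Frames of the boundary sphere -/

/-- A vector orthogonal to a unit vector `x` and to a basis of the complement of `x` vanishes. -/
theorem eq_zero_of_orthogonal_frame (hn : 1 ≤ n) {t : Fin (n - 1) → E n} {x z : E n} (hx : x ≠ 0)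
    (ht : LinearIndependent ℝ t) (htx : ∀ j, ⟪t j, x⟫ = 0) (hz : ∀ j, ⟪t j, z⟫ = 0)
    (hxz : ⟪x, z⟫ = 0) : z = 0 := by
  have hxs : x ∉ Submodule.span ℝ (range t) := by
    intro h
    have h1 : Submodule.span ℝ (range t) ≤ (ℝ ∙ x)ᗮ := by
      rw [Submodule.span_le]
      rintro _ ⟨j, rfl⟩
      rw [SetLike.mem_coe, Submodule.mem_orthogonal_singleton_iff_inner_left]
      exact htx j
    have := Submodule.mem_orthogonal_singleton_iff_inner_left.1 (h1 h)
    exact hx (inner_self_eq_zero.1 this)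
  have hli : LinearIndependent ℝ (Fin.cons x t : Fin (n - 1 + 1) → E n) :=
    linearIndependent_finCons.2 ⟨ht, hxs⟩
  have hspan := hli.span_eq_top_of_card_eq_finrank (by simp; omega)
  have h2 : (⊤ : Submodule ℝ (E n)) ≤ (ℝ ∙ z)ᗮ := by
    rw [← hspan, Submodule.span_le]
    rintro _ ⟨j, rfl⟩
    rw [SetLike.mem_coe, Submodule.mem_orthogonal_singleton_iff_inner_left]
    refine Fin.cases ?_ (fun j => ?_) j
    · simpa using hxz
    · simpa using hz j
  exact inner_self_eq_zero.1 (Submodule.mem_orthogonal_singleton_iff_inner_left.1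
    (h2 (Submodule.mem_top (x := z))))

/-- The matrix whose columns are the vectors of a frame. -/
def frameMatrix (t : Fin (n - 1) → E n) : Matrix (Fin n) (Fin (n - 1)) ℝ :=
  Matrix.of fun a j => t j a

theorem transpose_mul_frameMatrix (t : Fin (n - 1) → E n) :
    (frameMatrix t)ᵀ * frameMatrix t = Matrix.gram ℝ t := by
  ext i j
  rw [Matrix.mul_apply, Matrix.gram_apply, inner_eq_dotProduct]
  rfl

theorem frameMatrix_projection (hn : 1 ≤ n) {t : Fin (n - 1) → E n} {x : E n} (hx : ‖x‖ = 1)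
    (ht : LinearIndependent ℝ t) (htx : ∀ j, ⟪t j, x⟫ = 0) :
    frameMatrix t * (Matrix.gram ℝ t)⁻¹ * (frameMatrix t)ᵀ
      = 1 - Matrix.vecMulVec x.ofLp x.ofLp := by
  have hx0 : x ≠ 0 := by rintro rfl; simp at hx
  have hdet := (det_gram_pos ht).ne'
  set T := frameMatrix t with hT
  have hTx : Tᵀ *ᵥ x.ofLp = 0 := by
    funext j
    have := htx j
    rw [inner_eq_dotProduct] at this
    exact this
  have hxT : x.ofLp ᵥ* T = 0 := by rw [← Matrix.mulVec_transpose, hTx]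
  have hxx : x.ofLp ⬝ᵥ x.ofLp = 1 := by
    have := real_inner_self_eq_norm_sq x
    rw [inner_eq_dotProduct, hx] at this
    simpa [dotProduct] using this
  set R := 1 - Matrix.vecMulVec x.ofLp x.ofLp - T * (Matrix.gram ℝ t)⁻¹ * Tᵀ with hR
  have h1 : Tᵀ * R = 0 := by
    rw [hR, Matrix.mul_sub, Matrix.mul_sub, Matrix.mul_one, Matrix.mul_vecMulVec, hTx,
      ← Matrix.mul_assoc, ← Matrix.mul_assoc, transpose_mul_frameMatrix,
      Matrix.mul_nonsing_inv _ hdet.isUnit, Matrix.one_mul]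
    simp
  have h2 : x.ofLp ᵥ* R = 0 := by
    rw [hR, Matrix.vecMul_sub, Matrix.vecMul_sub, ← Matrix.vecMul_vecMul, ← Matrix.vecMul_vecMul,
      hxT, Matrix.vecMul_vecMulVec, hxx]
    simp
  have h3 : R = 0 := by
    ext a b
    have hz : (WithLp.toLp 2 fun a => R a b : E n) = 0 := by
      refine eq_zero_of_orthogonal_frame hn hx0 ht htx (fun j => ?_) ?_
      · rw [inner_eq_dotProduct]
        exact congrFun (congrFun h1 j) b
      · rw [inner_eq_dotProduct]
        exact congrFun h2 b
    exact congrArg (fun z : E n => z a) hz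
  exact (sub_eq_zero.1 h3).symm

/-- The inverse of the restriction of a quadratic form to the complement of `x`, with respect to a
frame: it is obtained from the inverse `G⁻¹` of the form by projecting along `G⁻¹ x`. -/
theorem inv_transpose_mul_frameMatrix (hn : 1 ≤ n) {t : Fin (n - 1) → E n} {x : E n} (hx : ‖x‖ = 1)
    (ht : LinearIndependent ℝ t) (htx : ∀ j, ⟪t j, x⟫ = 0) {G : Matrix (Fin n) (Fin n) ℝ}
    (hG : G.det ≠ 0) (hq : x.ofLp ⬝ᵥ (G⁻¹ *ᵥ x.ofLp) ≠ 0) :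
    ((frameMatrix t)ᵀ * G * frameMatrix t)⁻¹
      = (frameMatrix t * (Matrix.gram ℝ t)⁻¹)ᵀ
        * (G⁻¹ - (x.ofLp ⬝ᵥ (G⁻¹ *ᵥ x.ofLp))⁻¹ •
          Matrix.vecMulVec (G⁻¹ *ᵥ x.ofLp) (x.ofLp ᵥ* G⁻¹))
        * (frameMatrix t * (Matrix.gram ℝ t)⁻¹) := by
  have hdet := (det_gram_pos ht).ne'
  have hproj := frameMatrix_projection hn hx ht htx
  have hTT := transpose_mul_frameMatrix t
  have hsymm : ((Matrix.gram ℝ t)⁻¹)ᵀ = (Matrix.gram ℝ t)⁻¹ := by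
    rw [Matrix.transpose_nonsing_inv, ← hTT, Matrix.transpose_mul, Matrix.transpose_transpose]
  set T := frameMatrix t with hT
  set q := x.ofLp ⬝ᵥ (G⁻¹ *ᵥ x.ofLp) with hqdef
  set K := G⁻¹ - q⁻¹ • Matrix.vecMulVec (G⁻¹ *ᵥ x.ofLp) (x.ofLp ᵥ* G⁻¹) with hK
  have hTx : Tᵀ *ᵥ x.ofLp = 0 := by
    funext j
    have := htx j
    rw [inner_eq_dotProduct] at this
    exact this
  refine Matrix.inv_eq_right_inv ?_
  have hxK : x.ofLp ᵥ* K = 0 := by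
    rw [hK, Matrix.vecMul_sub, Matrix.vecMul_smul, Matrix.vecMul_vecMulVec, ← hqdef, smul_smul,
      inv_mul_cancel₀ hq, one_smul, sub_self]
  have hGK : Tᵀ * G * K = Tᵀ := by
    rw [hK, Matrix.mul_sub, Matrix.mul_assoc, Matrix.mul_nonsing_inv _ hG.isUnit, Matrix.mul_one,
      Matrix.mul_smul, Matrix.mul_assoc, Matrix.mul_vecMulVec, Matrix.mulVec_mulVec, Matrix.mul_nonsing_inv _ hG.isUnit,
      Matrix.one_mulVec, Matrix.mul_vecMulVec, hTx]
    simp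
  calc Tᵀ * G * T * ((T * (Matrix.gram ℝ t)⁻¹)ᵀ * K * (T * (Matrix.gram ℝ t)⁻¹))
      = Tᵀ * G * (T * (Matrix.gram ℝ t)⁻¹ * Tᵀ) * K * (T * (Matrix.gram ℝ t)⁻¹) := by
        rw [Matrix.transpose_mul, hsymm]
        simp only [Matrix.mul_assoc]
    _ = Tᵀ * G * K * (T * (Matrix.gram ℝ t)⁻¹) := by
        rw [hproj]
        congr 1
        rw [Matrix.mul_assoc (Tᵀ * G), Matrix.sub_mul, Matrix.one_mul, Matrix.vecMulVec_mul, hxK]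
        simp
    _ = 1 := by
        rw [hGK, ← Matrix.mul_assoc, hTT, Matrix.mul_nonsing_inv _ hdet.isUnit]

/-- A smooth function on an open set, multiplied by a smooth function supported there. -/
theorem contDiff_mul_of_tsupport_subset {η h : E n → ℝ} {O : Set (E n)} (hO : IsOpen O)
    (hη : ContDiff ℝ ∞ η) (hs : tsupport η ⊆ O) (hh : ContDiffOn ℝ ∞ h O) :
    ContDiff ℝ ∞ fun x => η x * h x := by
  rw [contDiff_iff_contDiffAt]
  intro x
  by_cases hx : x ∈ O
  · exact hη.contDiffAt.mul (hh.contDiffAt (hO.mem_nhds hx))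
  · have h0 : (fun x => η x * h x) =ᶠ[𝓝 x] fun _ => 0 := by
      filter_upwards [(isClosed_tsupport η).isOpen_compl.mem_nhds fun h => hx (hs h)] with y hy
      rw [image_eq_zero_of_notMem_tsupport hy, zero_mul]
    exact contDiffAt_const.congr_of_eventuallyEq h0

/-- A smooth function that is `1` on a compact set and supported in a given neighborhood. -/
theorem exists_cutoff {K O : Set (E n)} (hK : IsCompact K) (hO : IsOpen O) (hKO : K ⊆ O) :
    ∃ χ : E n → ℝ, ContDiff ℝ ∞ χ ∧ (∀ x ∈ K, χ x = 1) ∧ tsupport χ ⊆ O := by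
  obtain ⟨L, hL, hKL, hLO⟩ := exists_compact_between hK hO hKO
  obtain ⟨f, hf1, hf0, -⟩ := exists_contMDiffMap_one_nhds_of_subset_interior
    (modelWithCornersSelf ℝ (E n)) (n := ⊤) hK.isClosed hKL
  refine ⟨f, f.contMDiff.contDiff, fun x hx => hf1.self_of_nhdsSet x hx, ?_⟩
  refine (closure_minimal ?_ hL.isClosed).trans hLO
  intro x hx
  by_contra h
  exact hx (hf0 x h)

end

section

variable {n : ℕ}

/-! ### Calculus on the closed ball -/

theorem hasFDerivWithinAt_coord {F : E n → E (n + 1)} {s : Set (E n)} {x : E n}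
    (h : DifferentiableWithinAt ℝ F s x) (l : Fin (n + 1)) :
    HasFDerivWithinAt (fun y => F y l)
      ((EuclideanSpace.proj (𝕜 := ℝ) l).comp (fderivWithin ℝ F s x)) s x :=
  (EuclideanSpace.proj (𝕜 := ℝ) l).hasFDerivAt.comp_hasFDerivWithinAt x h.hasFDerivWithinAt

theorem dirDeriv_coord {F : E n → E (n + 1)} {x : E n} (hx : x ∈ 𝔹 n)
    (h : DifferentiableWithinAt ℝ F (𝔹 n) x) (t : E n) (l : Fin (n + 1)) :
    dirDeriv t F x l = dirDeriv t (fun y => F y l) x := by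
  rw [dirDeriv, dirDeriv, (hasFDerivWithinAt_coord h l).fderivWithin (uniqueDiffOn_closedBall x hx)]
  rfl

theorem pd_coord {F : E n → E (n + 1)} {x : E n} (hx : x ∈ 𝔹 n)
    (h : DifferentiableWithinAt ℝ F (𝔹 n) x) (j : Fin n) (l : Fin (n + 1)) :
    pd j F x l = pd j (fun y => F y l) x := dirDeriv_coord hx h _ l

theorem dirDeriv_eq_sum {G : Type*} [NormedAddCommGroup G] [NormedSpace ℝ G] (t : E n) (F : E n → G)
    (x : E n) : dirDeriv t F x = ∑ a, t a • pd a F x := clm_apply_eq_sum _ _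

theorem pd_congr {G : Type*} [NormedAddCommGroup G] [NormedSpace ℝ G] {F F' : E n → G}
    (h : EqOn F F' (𝔹 n)) (j : Fin n) : EqOn (pd j F) (pd j F') (𝔹 n) :=
  fun x hx => by rw [pd, pd, fderivWithin_congr_closedBall h hx]

theorem pd_add {f g : E n → ℝ} {x : E n} (hx : x ∈ 𝔹 n)
    (hf : DifferentiableWithinAt ℝ f (𝔹 n) x)
    (hg : DifferentiableWithinAt ℝ g (𝔹 n) x) (j : Fin n) :
    pd j (fun y => f y + g y) x = pd j f x + pd j g x := by
  rw [pd, fderivWithin_fun_add (uniqueDiffOn_closedBall x hx) hf hg]; rfl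

theorem pd_mul {f g : E n → ℝ} {x : E n} (hx : x ∈ 𝔹 n)
    (hf : DifferentiableWithinAt ℝ f (𝔹 n) x)
    (hg : DifferentiableWithinAt ℝ g (𝔹 n) x) (j : Fin n) :
    pd j (fun y => f y * g y) x = f x * pd j g x + pd j f x * g x := by
  rw [pd, fderivWithin_fun_mul (uniqueDiffOn_closedBall x hx) hf hg]
  simp [pd, mul_comm]

theorem pd_sum {ι : Type*} (s : Finset ι) {f : ι → E n → ℝ} {x : E n}
    (hx : x ∈ 𝔹 n)
    (hf : ∀ i ∈ s, DifferentiableWithinAt ℝ (f i) (𝔹 n) x) (j : Fin n) :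
    pd j (fun y => ∑ i ∈ s, f i y) x = ∑ i ∈ s, pd j (f i) x := by
  rw [pd, fderivWithin_fun_sum (uniqueDiffOn_closedBall x hx) hf, sum_apply]
  rfl

theorem contDiffOn_pd {G : Type*} [NormedAddCommGroup G] [NormedSpace ℝ G] {f : E n → G}
    (hf : ContDiffOn ℝ ∞ f (𝔹 n)) (j : Fin n) :
    ContDiffOn ℝ ∞ (pd j f) (𝔹 n) :=
  (hf.fderivWithin uniqueDiffOn_closedBall (m := ∞) (by simp)).clm_apply contDiffOn_const

theorem contDiffOn_coord {d : ℕ} {s : Set (E n)} {F : E n → E d} (h : ContDiffOn ℝ ∞ F s)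
    (l : Fin d) : ContDiffOn ℝ ∞ (fun x => F x l) s :=
  (EuclideanSpace.proj (𝕜 := ℝ) l).contDiff.comp_contDiffOn h

/-- The algebra of families of functions that are smooth on a set. -/
def smoothAlg (α : Type*) (s : Set (E n)) : Subalgebra ℝ (α → E n → ℝ) where
  carrier := {q | ∀ a, ContDiffOn ℝ ∞ (q a) s}
  add_mem' hp hq a := (hp a).add (hq a)
  mul_mem' hp hq a := (hp a).mul (hq a)
  algebraMap_mem' _ _ := contDiffOn_const

theorem metric_apply_eq_sum (X : E n → E (n + 1)) (x : E n) (j k : Fin n) :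
    metric X x j k = ∑ l, pd j X x l * pd k X x l := inner_eq_dotProduct _ _

theorem metric_congr {X Y : E n → E (n + 1)} (h : EqOn X Y (𝔹 n)) :
    EqOn (metric X) (metric Y) (𝔹 n) := fun x hx => by
  ext j k
  simp only [metric, Matrix.of_apply, pd_congr h _ hx]

/-- A function of `x ∈ B` that is positive for immersions, and whose value on the unit sphere is the
determinant of the metric of the boundary. -/
def bdryForm (X : E n → E (n + 1)) (x : E n) : ℝ :=
  x.ofLp ⬝ᵥ ((metric X x).adjugate *ᵥ x.ofLp) + (1 - ∑ l, x l * x l)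

theorem sum_sq_eq_norm_sq (x : E n) : ∑ l, x l * x l = ‖x‖ ^ 2 := by
  rw [← inner_eq_dotProduct, real_inner_self_eq_norm_sq]

theorem bdryForm_of_mem_sphere (X : E n → E (n + 1)) {x : E n} (hx : x ∈ 𝕊 n) :
    bdryForm X x = x.ofLp ⬝ᵥ ((metric X x).adjugate *ᵥ x.ofLp) := by
  rw [bdryForm, sum_sq_eq_norm_sq, mem_sphere_zero_iff_norm.1 hx]; ring

theorem posDef_metric {X : E n → E (n + 1)} {x : E n} (h : (metric X x).det ≠ 0) :
    (metric X x).PosDef := by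
  rw [metric_eq_gram] at h ⊢
  exact Matrix.posDef_gram_of_linearIndependent (Matrix.linearIndependent_of_det_gram_ne_zero h)

theorem bdryForm_pos {X : E n → E (n + 1)} {x : E n} (hx : x ∈ 𝔹 n)
    (h : (metric X x).det ≠ 0) : 0 < bdryForm X x := by
  rw [bdryForm, sum_sq_eq_norm_sq]
  rw [mem_closedBall_zero_iff] at hx
  by_cases h0 : x = 0
  · subst h0; simp
  · have h1 := dotProduct_adjugate_pos (posDef_metric h) (x := x.ofLp) (by simpa using h0)
    nlinarith [norm_nonneg x]

theorem dotProduct_mulVec_eq_sum {M : Matrix (Fin n) (Fin n) ℝ} (x : Fin n → ℝ) :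
    x ⬝ᵥ (M *ᵥ x) = ∑ a, ∑ b, x a * (M a b * x b) := by
  simp [dotProduct, Matrix.mulVec, mul_sum]

section

variable {α : Type*} (S : Subalgebra ℝ (α → E n → ℝ)) {X : α → E n → E (n + 1)}

theorem metric_mem (h : ∀ j l, (fun ρ x => pd j (X ρ) x l) ∈ S) (j k : Fin n) :
    (fun ρ x => metric (X ρ) x j k) ∈ S := by
  simp only [metric_apply_eq_sum]
  exact sum_mem_families S fun l => S.mul_mem (h j l) (h k l)

theorem bdryForm_mem (h : ∀ j l, (fun ρ x => pd j (X ρ) x l) ∈ S)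
    (hc : ∀ l, (fun _ x => x l) ∈ S) : (fun ρ x => bdryForm (X ρ) x) ∈ S := by
  simp only [bdryForm, dotProduct_mulVec_eq_sum]
  refine S.add_mem (sum_mem_families S fun a => sum_mem_families S fun b => S.mul_mem (hc a)
    (S.mul_mem (adjugate_mem S (metric_mem S h) a b) (hc b))) ?_
  exact S.sub_mem (S.algebraMap_mem 1) (sum_mem_families S fun l => S.mul_mem (hc l) (hc l))

theorem cross_mem (h : ∀ j l, (fun ρ x => pd j (X ρ) x l) ∈ S) (l : Fin (n + 1)) :
    (fun ρ x => (cross fun j => pd j (X ρ) x) l) ∈ S := by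
  refine det_mem S fun a b => ?_
  refine Fin.cases ?_ (fun a => ?_) a
  · exact S.algebraMap_mem (Pi.single (M := fun _ => ℝ) l 1 b)
  · exact h a b

end

variable [NeZero n] {k : ℕ} {X : Type*} [NormedAddCommGroup X] [NormedSpace ℝ X] {U : Set X}

theorem pd_mem_analyticAlg {hk : n < 2 * k} {hk' : n < 2 * (k + 1)} {q : X → E n → ℝ}
    (hq : q ∈ analyticAlg hk' U) (j : Fin n) : (fun ρ => pd j (q ρ)) ∈ analyticAlg hk U := by
  obtain ⟨F, hF, hFq⟩ := hq
  refine ⟨fun ρ => H.D j (F ρ), fun ρ hρ => ((H.D j).analyticAt _).fun_comp (hF ρ hρ),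
    fun ρ hρ x hx => ?_⟩
  rw [← H.pd_contRep hk (F ρ) j hx, pd_congr (hFq ρ hρ) j hx]

theorem differentiableWithinAt_of_mem_analyticAlg (hk : n < 2 * k) {hk' : n < 2 * (k + 1)}
    {q : X → E n → ℝ} (hq : q ∈ analyticAlg hk' U) {ρ : X} (hρ : ρ ∈ U) {x : E n}
    (hx : x ∈ 𝔹 n) : DifferentiableWithinAt ℝ (q ρ) (𝔹 n) x := by
  obtain ⟨F, hF, hFq⟩ := hq
  exact (H.hasFDerivWithinAt_contRep hk (F ρ) hx).differentiableWithinAt.congr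
    (fun y hy => (hFq ρ hρ hy).symm) (hFq ρ hρ hx).symm

theorem base_mem_localAlg {ι : Type*} [Fintype ι] [DecidableEq ι] {hk : n < 2 * k}
    {Λ : ι → X →L[ℝ] H n k} (a : ι) : (fun ρ => (Λ a ρ).contRep) ∈ localAlg hk Λ U := by
  exact ⟨Λ a, IsLocalMap.base (H.isCommMul hk) a, fun ρ _ x _ => rfl⟩

/-! ### The reference surfaces -/

namespace StandardDoubleBubble

variable (Γ : StandardDoubleBubble n)

omit [NeZero n] in
theorem angle_mem (i : Fin 3) : Γ.angle i ∈ Ioo (-Real.pi) Real.pi := by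
  have h := Γ.θ_mem
  have hpi := Real.pi_pos
  fin_cases i <;> simp only [angle, mem_Ioo] at h ⊢ <;> constructor <;> simp <;> linarith [h.1, h.2]

omit [NeZero n] in
theorem sin_angle_ne_zero {i : Fin 3} (h : Γ.angle i ≠ 0) : sin (Γ.angle i) ≠ 0 := by
  intro h0
  exact h ((Real.sin_eq_zero_iff_of_lt_of_lt (Γ.angle_mem i).1 (Γ.angle_mem i).2).1 h0)

omit [NeZero n] in
theorem norm_normal {i : Fin 3} {p : E (n + 1)} (hp : p ∈ Γ.surface i) : ‖Γ.normal i p‖ = 1 := by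
  have hr := Γ.r_pos
  rcases hp with ⟨h0, -, -⟩ | ⟨h0, h1, -⟩
  · simp [normal, h0, Γ.norm_a]
  · have hs := Γ.sin_angle_ne_zero h0
    have e : Γ.normal i p = (-(sin (Γ.angle i) / Γ.r)) •
        (p - (Γ.c - (Γ.r * Real.cot (Γ.angle i)) • Γ.a)) := by
      rw [normal, Real.cot_eq_cos_div_sin, sub_sub_eq_add_sub, add_sub_right_comm, smul_add,
        smul_smul, neg_smul, neg_add]
      congr 1
      rw [← neg_smul]
      congr 1
      field_simp
    rw [e, norm_smul, h1, norm_neg, norm_div, Real.norm_eq_abs, Real.norm_of_nonneg hr.le]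
    have := abs_pos.2 hs
    field_simp

end StandardDoubleBubble

namespace ReferenceCluster

variable (D : ReferenceCluster n)

omit [NeZero n] in
theorem φ_mem {i : Fin 3} {x : E n} (hx : x ∈ 𝔹 n) : D.φ i x ∈ D.surface i := by
  rw [← D.φ_image i]; exact mem_image_of_mem _ hx

omit [NeZero n] in
theorem norm_N {i : Fin 3} {x : E n} (hx : x ∈ 𝔹 n) : ‖D.N i x‖ = 1 :=
  D.norm_normal (D.φ_mem hx)

omit [NeZero n] in
theorem contDiffOn_N (i : Fin 3) : ContDiffOn ℝ ∞ (D.N i) (𝔹 n) :=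
  (((D.φ_smooth i).sub contDiffOn_const).const_smul _ |>.add contDiffOn_const).neg

omit [NeZero n] in
theorem differentiableWithinAt_φ (i : Fin 3) {x : E n} (hx : x ∈ 𝔹 n) :
    DifferentiableWithinAt ℝ (D.φ i) (𝔹 n) x :=
  (D.φ_smooth i).differentiableOn (by simp) x hx

omit [NeZero n] in
theorem det_metric_φ_pos (i : Fin 3) {x : E n} (hx : x ∈ 𝔹 n) :
    0 < (metric (D.φ i) x).det := by
  rw [metric_eq_gram]
  refine det_gram_pos ?_
  have h := (EuclideanSpace.basisFun (Fin n) ℝ).toBasis.linearIndependent.map'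
    (fderivWithin ℝ (D.φ i) (𝔹 n) x).toLinearMap
    (LinearMap.ker_eq_bot.2 (D.φ_immersion i x hx))
  have e : (fun j => pd j (D.φ i) x) = (fderivWithin ℝ (D.φ i) (𝔹 n) x).toLinearMap ∘
      (EuclideanSpace.basisFun (Fin n) ℝ).toBasis := by
    funext j
    simp [pd]
  rw [e]
  exact h

omit [NeZero n] in
/-- The normals are orthogonal to the coordinate vectors, because the surfaces are level sets of
quadratic functions whose gradients are the normals. -/
theorem inner_N_pd (i : Fin 3) {x : E n} (hx : x ∈ 𝔹 n) (j : Fin n) :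
    ⟪D.N i x, pd j (D.φ i) x⟫ = 0 := by
  have hd := (D.differentiableWithinAt_φ i hx).hasFDerivWithinAt
  have hr := D.r_pos
  by_cases h0 : D.angle i = 0
  · have hc : ∀ y ∈ 𝔹 n, ⟪D.φ i y - D.c, D.a⟫ = 0 := by
      intro y hy
      rcases D.φ_mem (i := i) hy with ⟨-, h, -⟩ | ⟨h, -⟩
      · exact h
      · exact absurd h0 h
    have h1 : HasFDerivWithinAt (fun y => ⟪D.φ i y - D.c, D.a⟫)
        (0 : E n →L[ℝ] ℝ) (𝔹 n) x :=
      (hasFDerivWithinAt_const (0 : ℝ) x _).congr hc (hc x hx)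
    have h2 := (hd.sub_const D.c).inner ℝ (hasFDerivWithinAt_const D.a x _)
    have h3 := congrArg (fun L : E n →L[ℝ] ℝ => L (single j 1))
      ((uniqueDiffOn_closedBall x hx).eq h1 h2)
    simp only [zero_apply] at h3
    simp at h3
    rw [N, StandardDoubleBubble.normal, h0]
    simp only [Real.sin_zero, zero_div, zero_smul, Real.cos_zero, one_smul, zero_add,
      inner_neg_left, neg_eq_zero]
    rw [real_inner_comm]
    exact h3.symm
  · have hs := D.sin_angle_ne_zero h0
    set c' := D.c - (D.r * Real.cot (D.angle i)) • D.a with hc'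
    have hc : ∀ y ∈ 𝔹 n,
        ⟪D.φ i y - c', D.φ i y - c'⟫ = (D.r / |sin (D.angle i)|) ^ 2 := by
      intro y hy
      rcases D.φ_mem (i := i) hy with ⟨h, -⟩ | ⟨-, h, -⟩
      · exact absurd h h0
      · rw [real_inner_self_eq_norm_sq, h]
    have h1 : HasFDerivWithinAt (fun y => ⟪D.φ i y - c', D.φ i y - c'⟫)
        (0 : E n →L[ℝ] ℝ) (𝔹 n) x :=
      (hasFDerivWithinAt_const _ x _).congr hc (hc x hx)
    have h2 := (hd.sub_const c').inner ℝ (hd.sub_const c')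
    have h3 := congrArg (fun L : E n →L[ℝ] ℝ => L (single j 1))
      ((uniqueDiffOn_closedBall x hx).eq h1 h2)
    simp at h3
    have h4 : ⟪D.φ i x - c', pd j (D.φ i) x⟫ = 0 := by
      rw [real_inner_comm (D.φ i x - c') (fderivWithin ℝ (D.φ i) (𝔹 n) x _)] at h3
      change ⟪D.φ i x - c', fderivWithin ℝ (D.φ i) (𝔹 n) x _⟫ = 0
      linarith
    have e : D.N i x = (-(sin (D.angle i) / D.r)) • (D.φ i x - c') := by
      rw [N, StandardDoubleBubble.normal, hc', Real.cot_eq_cos_div_sin, sub_sub_eq_add_sub,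
        add_sub_right_comm, smul_add, smul_smul, neg_smul, neg_add]
      congr 1
      rw [← neg_smul]
      congr 1
      field_simp
    rw [e, inner_smul_left, h4, mul_zero]

end ReferenceCluster

end

section

variable {n : ℕ}

/-- The components of a triple of height functions. -/
def Height.comp {m : ℕ} (i : Fin 3) : Height n m →L[ℝ] H n m :=
  (ContinuousLinearMap.proj i).comp (heightSpace n m).subtypeL

/-- The components of a triple of height functions, and their first derivatives. -/
def jet {k : ℕ} : Fin 3 × Option (Fin n) → Height n (k + 2) →L[ℝ] H n (k + 1)
  | (i, none) => H.res.comp (Height.comp i)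
  | (i, some l) => (H.D l).comp (Height.comp i)

theorem graph_coord (D : ReferenceCluster n) (u : Fin 3 → E n → ℝ) (i : Fin 3) (x : E n)
    (l : Fin (n + 1)) : D.graph u i x l = D.φ i x l + u i x * D.N i x l
      + (∑ j, tangentialMatrix i j * u j x) * D.τ i x l := rfl

variable [NeZero n] {k : ℕ}

/-! ### The surfaces of nearby clusters as analytic families -/

section

/-- The algebra of families of functions that are given by local maps of the height functions and
their first derivatives. -/
abbrev jetAlg (hk1 : n < 2 * (k + 1)) (U : Set (Height n (k + 2))) :
    Subalgebra ℝ (Height n (k + 2) → E n → ℝ) := localAlg hk1 (jet (n := n) (k := k)) U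

variable (hk : n < 2 * k) {hk1 : n < 2 * (k + 1)} {U : Set (Height n (k + 2))}

theorem height_mem (i : Fin 3) :
    (fun ρ : Height n (k + 2) => (ρ.1 i).contRep) ∈ jetAlg hk1 U :=
  base_mem_localAlg (X := Height n (k + 2)) (hk := hk1) (Λ := jet (n := n) (k := k)) (i, none)

theorem pd_height_mem (i : Fin 3) (l : Fin n) :
    (fun ρ : Height n (k + 2) => pd l (ρ.1 i).contRep) ∈ jetAlg hk1 U :=
  localAlg_congr (fun ρ _ _ hx => (H.pd_contRep hk1 (ρ.1 i) l hx).symm)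
    (base_mem_localAlg (X := Height n (k + 2)) (hk := hk1) (Λ := jet (n := n) (k := k)) (i, some l))

include hk in
theorem differentiableWithinAt_height (ρ : Height n (k + 2)) (i : Fin 3) {x : E n}
    (hx : x ∈ 𝔹 n) :
    DifferentiableWithinAt ℝ (ρ.1 i).contRep (𝔹 n) x :=
  (H.hasFDerivWithinAt_contRep (k := k + 1) (by omega) (ρ.1 i) hx).differentiableWithinAt

variable (D : ReferenceCluster n)

theorem surf_mem (i : Fin 3) (l : Fin (n + 1)) :
    (fun ρ x => D.surf ρ i x l) ∈ jetAlg hk1 U := by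
  simp only [ReferenceCluster.surf, graph_coord]
  refine add_mem (add_mem (const_mem_localAlg (contDiffOn_coord (D.φ_smooth i) l))
    (mul_mem (height_mem i) (const_mem_localAlg (contDiffOn_coord (D.contDiffOn_N i) l))))
    (mul_mem (sum_mem_families _ fun j => mul_mem (const_mem_localAlg contDiffOn_const)
      (height_mem j)) (const_mem_localAlg (contDiffOn_coord (D.τ_smooth i) l)))

omit [NeZero n] in
theorem differentiableWithinAt_of_smooth {f : E n → ℝ} (hf : ContDiffOn ℝ ∞ f (𝔹 n))
    {x : E n} (hx : x ∈ 𝔹 n) :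
    DifferentiableWithinAt ℝ f (𝔹 n) x := hf.differentiableOn (by simp) x hx

include hk in
theorem differentiableWithinAt_surf (ρ : Height n (k + 2)) (i : Fin 3) {x : E n}
    (hx : x ∈ 𝔹 n) :
    DifferentiableWithinAt ℝ (D.surf ρ i) (𝔹 n) x := by
  have h1 := fun j => differentiableWithinAt_height hk ρ j hx
  have hN : DifferentiableWithinAt ℝ (D.N i) (𝔹 n) x :=
    (D.contDiffOn_N i).differentiableOn (by simp) x hx
  have hτ : DifferentiableWithinAt ℝ (D.τ i) (𝔹 n) x :=
    (D.τ_smooth i).differentiableOn (by simp) x hx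
  have h2 : DifferentiableWithinAt ℝ
      (fun x => (tangentialMatrix *ᵥ fun j => (ρ.1 j).contRep x) i) (𝔹 n) x :=
    DifferentiableWithinAt.fun_sum (u := Finset.univ)
      (A := fun j x => tangentialMatrix i j * (ρ.1 j).contRep x)
      fun j _ => (h1 j).const_mul (tangentialMatrix i j)
  exact ((D.differentiableWithinAt_φ i hx).fun_add ((h1 i).fun_smul hN)).fun_add (h2.fun_smul hτ)

include hk in
theorem pd_surf_mem (i : Fin 3) (j : Fin n) (l : Fin (n + 1)) :
    (fun ρ x => pd j (D.surf ρ i) x l) ∈ jetAlg hk1 U := by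
  have hφ := contDiffOn_coord (D.φ_smooth i) l
  have hN := contDiffOn_coord (D.contDiffOn_N i) l
  have hτ := contDiffOn_coord (D.τ_smooth i) l
  have hmem : (fun (ρ : Height n (k + 2)) x => pd j (fun x => D.φ i x l) x
      + ((ρ.1 i).contRep x * pd j (fun x => D.N i x l) x + pd j (ρ.1 i).contRep x * D.N i x l)
      + ((∑ a, tangentialMatrix i a * (ρ.1 a).contRep x) * pd j (fun x => D.τ i x l) x
        + (∑ a, tangentialMatrix i a * pd j (ρ.1 a).contRep x) * D.τ i x l))
      ∈ jetAlg hk1 U := by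
    refine add_mem (add_mem (const_mem_localAlg (contDiffOn_pd hφ j)) (add_mem
      (mul_mem (height_mem i) (const_mem_localAlg (contDiffOn_pd hN j)))
      (mul_mem (pd_height_mem i j) (const_mem_localAlg hN)))) (add_mem
      (mul_mem (sum_mem_families _ fun a => mul_mem (const_mem_localAlg contDiffOn_const)
        (height_mem a)) (const_mem_localAlg (contDiffOn_pd hτ j)))
      (mul_mem (sum_mem_families _ fun a => mul_mem (const_mem_localAlg contDiffOn_const)
        (pd_height_mem a j)) (const_mem_localAlg hτ)))
  refine localAlg_congr (fun ρ _ x hx => ?_) hmem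
  have h1 := fun j => differentiableWithinAt_height hk ρ j hx
  have hφ' := differentiableWithinAt_of_smooth hφ hx
  have hN' := differentiableWithinAt_of_smooth hN hx
  have hτ' := differentiableWithinAt_of_smooth hτ hx
  have hc : ∀ a, DifferentiableWithinAt ℝ (fun _ : E n => tangentialMatrix i a) (𝔹 n) x :=
    fun a => differentiableWithinAt_const _
  have h2 : DifferentiableWithinAt ℝ (fun x => ∑ a, tangentialMatrix i a * (ρ.1 a).contRep x)
      (𝔹 n) x := DifferentiableWithinAt.fun_sum fun a _ => (hc a).fun_mul (h1 a)
  have hpc : ∀ a, pd j (fun _ : E n => tangentialMatrix i a) x = 0 := fun a => by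
    simp [pd]
  rw [pd_coord hx (differentiableWithinAt_surf hk D ρ i hx)]
  simp only [ReferenceCluster.surf, graph_coord]
  rw [pd_add hx (hφ'.fun_add ((h1 i).fun_mul hN')) (h2.fun_mul hτ'), pd_add hx hφ' ((h1 i).fun_mul hN'),
    pd_mul hx (h1 i) hN', pd_mul hx h2 hτ', pd_sum _ hx fun a _ => (hc a).fun_mul (h1 a)]
  congr 3
  refine sum_congr rfl fun a _ => ?_
  rw [pd_mul hx (hc a) (h1 a), hpc]
  ring

theorem surf_zero (hk2 : n < 2 * (k + 2)) (i : Fin 3) :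
    EqOn (D.surf (0 : Height n (k + 2)) i) (D.φ i) (𝔹 n) := by
  intro x hx
  have h0 : ∀ j, ((0 : Height n (k + 2)).1 j).contRep x = 0 := fun j => H.contRep_zero hk2 hx
  have h1 : (fun j => ((0 : Height n (k + 2)).1 j).contRep x) = 0 := funext h0
  rw [ReferenceCluster.surf, ReferenceCluster.graph, h1, h0, Matrix.mulVec_zero, Pi.zero_apply,
    zero_smul, zero_smul, add_zero, add_zero]

/-- A neighborhood of `0` in which the area densities of the surfaces and of their boundaries do not
degenerate. -/
structure IsRegularNhd (hk1 : n < 2 * (k + 1)) (D : ReferenceCluster n) (U : Set (Height n (k + 2))) : Prop where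
  isOpen : IsOpen U
  zero_mem : 0 ∈ U
  det_pos : ∀ ρ ∈ U, ∀ i, ∀ x ∈ 𝔹 n, 0 < (metric (D.surf ρ i) x).det
  area_mem : ∀ i, (fun ρ => areaDensity (D.surf ρ i))
    ∈ jetAlg hk1 U
  area_inv_mem : ∀ i, (fun ρ x => (areaDensity (D.surf ρ i) x)⁻¹)
    ∈ jetAlg hk1 U
  bdry_mem : ∀ i, (fun ρ x => √(bdryForm (D.surf ρ i) x))
    ∈ jetAlg hk1 U
  bdry_inv_mem : ∀ i, (fun ρ x => (√(bdryForm (D.surf ρ i) x))⁻¹)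
    ∈ jetAlg hk1 U

theorem IsRegularNhd.mono {D : ReferenceCluster n} {U U' : Set (Height n (k + 2))}
    (h : IsRegularNhd hk1 D U) (hU : U' ⊆ U) (hU' : IsOpen U') (h0 : 0 ∈ U') :
    IsRegularNhd hk1 D U' where
  isOpen := hU'
  zero_mem := h0
  det_pos ρ hρ := h.det_pos ρ (hU hρ)
  area_mem i := localAlg_mono hU (h.area_mem i)
  area_inv_mem i := localAlg_mono hU (h.area_inv_mem i)
  bdry_mem i := localAlg_mono hU (h.bdry_mem i)
  bdry_inv_mem i := localAlg_mono hU (h.bdry_inv_mem i)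

omit [NeZero n] in
theorem pd_φ_smooth (i : Fin 3) (j : Fin n) (l : Fin (n + 1)) :
    (fun (_ : Unit) x => pd j (D.φ i) x l) ∈ smoothAlg Unit (𝔹 n) :=
  fun _ => contDiffOn_coord (contDiffOn_pd (D.φ_smooth i) j) l

omit [NeZero n] in
theorem contDiffOn_areaDensity_φ (i : Fin 3) :
    ContDiffOn ℝ ∞ (areaDensity (D.φ i)) (𝔹 n) :=
  ContDiffOn.sqrt (det_mem _ (metric_mem (smoothAlg Unit (𝔹 n))
    (X := fun _ => D.φ i) (pd_φ_smooth D i)) ()) fun _ hx => (D.det_metric_φ_pos i hx).ne'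

omit [NeZero n] in
theorem contDiffOn_bdryForm_φ (i : Fin 3) :
    ContDiffOn ℝ ∞ (fun x => √(bdryForm (D.φ i) x)) (𝔹 n) :=
  ContDiffOn.sqrt (bdryForm_mem (smoothAlg Unit (𝔹 n)) (X := fun _ => D.φ i)
    (pd_φ_smooth D i) (fun l _ => contDiffOn_coord contDiffOn_id l) ())
    fun _ hx => (bdryForm_pos hx (D.det_metric_φ_pos i hx).ne').ne'

include hk in
theorem exists_isRegularNhd : ∃ U, IsRegularNhd hk1 D U := by
  have hX := fun i => pd_surf_mem hk (hk1 := hk1) (U := univ) D i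
  have hm : ∀ i, EqOn (metric (D.surf (0 : Height n (k + 2)) i)) (metric (D.φ i)) (𝔹 n) :=
    fun i => metric_congr (surf_zero D (by omega) i)
  have h1 : ∀ i, ∃ U' ⊆ (univ : Set (Height n (k + 2))), IsOpen U' ∧ 0 ∈ U' ∧
      (∀ ρ ∈ U', ∀ x ∈ 𝔹 n, 0 < (metric (D.surf ρ i) x).det) ∧
      (fun ρ x => √(metric (D.surf ρ i) x).det) ∈ jetAlg hk1 U' ∧
      (fun ρ x => (√(metric (D.surf ρ i) x).det)⁻¹) ∈ jetAlg hk1 U' := fun i =>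
    exists_sqrt_mem_localAlg isOpen_univ (mem_univ 0) (det_mem _ (metric_mem _ (hX i)))
      (contDiffOn_areaDensity_φ D i) (fun x hx => Real.sqrt_pos.2 (D.det_metric_φ_pos i hx))
      fun x hx => by rw [hm i hx, areaDensity, Real.sq_sqrt (D.det_metric_φ_pos i hx).le]
  have h2 : ∀ i, ∃ U' ⊆ (univ : Set (Height n (k + 2))), IsOpen U' ∧ 0 ∈ U' ∧
      (∀ ρ ∈ U', ∀ x ∈ 𝔹 n, 0 < bdryForm (D.surf ρ i) x) ∧
      (fun ρ x => √(bdryForm (D.surf ρ i) x)) ∈ jetAlg hk1 U' ∧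
      (fun ρ x => (√(bdryForm (D.surf ρ i) x))⁻¹) ∈ jetAlg hk1 U' := fun i =>
    exists_sqrt_mem_localAlg isOpen_univ (mem_univ 0) (bdryForm_mem _ (hX i) fun l =>
        const_mem_localAlg (contDiffOn_coord contDiffOn_id l))
      (contDiffOn_bdryForm_φ D i)
      (fun x hx => Real.sqrt_pos.2 (bdryForm_pos hx (D.det_metric_φ_pos i hx).ne'))
      fun x hx => by
        rw [Real.sq_sqrt (bdryForm_pos hx (D.det_metric_φ_pos i hx).ne').le, bdryForm, hm i hx,
          bdryForm]
  choose A hA hAo hA0 hA1 hA2 hA3 using h1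
  choose B hB hBo hB0 hB1 hB2 hB3 using h2
  have hAi : ∀ i, (⋂ i, A i) ∩ (⋂ i, B i) ⊆ A i := fun i =>
    inter_subset_left.trans (iInter_subset _ i)
  have hBi : ∀ i, (⋂ i, A i) ∩ (⋂ i, B i) ⊆ B i := fun i =>
    inter_subset_right.trans (iInter_subset _ i)
  exact ⟨(⋂ i, A i) ∩ ⋂ i, B i,
    (isOpen_iInter_of_finite hAo).inter (isOpen_iInter_of_finite hBo),
    ⟨mem_iInter.2 hA0, mem_iInter.2 hB0⟩, fun ρ hρ i => hA1 i ρ (hAi i hρ),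
    fun i => localAlg_mono (hAi i) (hA2 i), fun i => localAlg_mono (hAi i) (hA3 i),
    fun i => localAlg_mono (hBi i) (hB2 i), fun i => localAlg_mono (hBi i) (hB3 i)⟩

end

end

section

variable {n : ℕ} [NeZero n] {k : ℕ}

/-! ### Geometric quantities as analytic families -/

section

variable {hk : n < 2 * k} {hk1 : n < 2 * (k + 1)} {U : Set (Height n (k + 2))}
  {D : ReferenceCluster n} (h : IsRegularNhd hk1 D U)

include hk in
theorem pd_surf_mem' (i : Fin 3) (j : Fin n) (l : Fin (n + 1)) :
    (fun ρ x => pd j (D.surf ρ i) x l) ∈ analyticAlg hk1 U :=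
  analyticAlg_of_localAlg (pd_surf_mem hk D i j l)

include hk in
theorem metric_surf_mem (i : Fin 3) (a b : Fin n) :
    (fun ρ x => metric (D.surf ρ i) x a b) ∈ analyticAlg hk1 U :=
  metric_mem _ (pd_surf_mem' (hk := hk) i) a b

omit [NeZero n] in
theorem sq_areaDensity {X : E n → E (n + 1)} {x : E n} (hd : 0 < (metric X x).det) :
    areaDensity X x ^ 2 = (metric X x).det := Real.sq_sqrt hd.le

include h hk in
theorem IsRegularNhd.metric_inv_mem (i : Fin 3) (a b : Fin n) :
    (fun ρ x => (metric (D.surf ρ i) x)⁻¹ a b) ∈ analyticAlg hk1 U := by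
  have h1 := analyticAlg_of_localAlg (h.area_inv_mem i)
  refine analyticAlg_congr (fun ρ hρ x hx => ?_) (mul_mem (mul_mem h1 h1)
    (adjugate_mem _ (metric_surf_mem (hk := hk) (D := D) i) a b))
  have hd := h.det_pos ρ hρ i x hx
  simp only [Pi.mul_apply]
  rw [Matrix.inv_def, Ring.inverse_eq_inv', Matrix.smul_apply, smul_eq_mul, ← sq_areaDensity hd]
  ring

include h in
theorem IsRegularNhd.J_mem (i : Fin 3) : (fun ρ => D.J ρ i) ∈ analyticAlg hk1 U := by
  have hs := (contDiffOn_areaDensity_φ D i).inv fun x hx =>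
    (Real.sqrt_pos.2 (D.det_metric_φ_pos i hx)).ne'
  refine analyticAlg_congr (fun ρ hρ x hx => ?_)
    (mul_mem (analyticAlg_of_localAlg (h.area_mem i)) (const_mem_analyticAlg hs))
  exact (div_eq_mul_inv _ _).symm

include h in
theorem IsRegularNhd.JBdry_mem (i : Fin 3) : ∃ q : Height n (k + 2) → E n → ℝ,
    q ∈ analyticAlg hk1 U ∧ ∀ ρ ∈ U, EqOn (q ρ) (D.JBdry ρ i) (sphere 0 1) := by
  have hs := (contDiffOn_bdryForm_φ D i).inv fun x hx =>
    (Real.sqrt_pos.2 (bdryForm_pos hx (D.det_metric_φ_pos i hx).ne')).ne'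
  refine ⟨_, mul_mem (analyticAlg_of_localAlg (h.bdry_mem i)) (const_mem_analyticAlg hs),
    fun ρ hρ x hx => ?_⟩
  rw [ReferenceCluster.JBdry, bdryDensity, bdryDensity, ← bdryForm_of_mem_sphere _ hx,
    ← bdryForm_of_mem_sphere _ hx, div_eq_mul_inv]
  rfl

omit [NeZero n] in
theorem inner_cross_φ_sq (D : ReferenceCluster n) (i : Fin 3) {x : E n}
    (hx : x ∈ 𝔹 n) :
    ⟪cross fun j => pd j (D.φ i) x, D.N i x⟫ ^ 2 = (metric (D.φ i) x).det := by
  rw [real_inner_comm, sq_inner_cross_of_orthogonal (D.inner_N_pd i hx), D.norm_N hx, one_pow,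
    one_mul, metric_eq_gram]

omit [NeZero n] in
/-- The orientation of a parametrization with respect to the normal does not depend on the point. -/
theorem exists_orientation (D : ReferenceCluster n) (i : Fin 3) : ∃ s : ℝ, (s = 1 ∨ s = -1) ∧
    ∀ x ∈ 𝔹 n, ⟪cross fun j => pd j (D.φ i) x, D.N i x⟫
      = s * areaDensity (D.φ i) x := by
  set f : E n → ℝ := fun x => ⟪cross fun j => pd j (D.φ i) x, D.N i x⟫ with hf
  have hfc : ContinuousOn f (𝔹 n) := by
    have h1 : ContDiffOn ℝ ∞ f (𝔹 n) := by
      simp only [hf, inner_eq_dotProduct]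
      exact ContDiffOn.sum fun l _ => (cross_mem (smoothAlg Unit (𝔹 n))
        (X := fun _ => D.φ i) (pd_φ_smooth D i) l ()).mul (contDiffOn_coord (D.contDiffOn_N i) l)
    exact h1.continuousOn
  have hpos : ∀ x ∈ 𝔹 n, 0 < areaDensity (D.φ i) x := fun x hx =>
    Real.sqrt_pos.2 (D.det_metric_φ_pos i hx)
  have hsq : EqOn (f ^ 2) (areaDensity (D.φ i) ^ 2) (𝔹 n) := fun x hx =>
    (inner_cross_φ_sq D i hx).trans (sq_areaDensity (D.det_metric_φ_pos i hx)).symm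
  rcases (convex_closedBall (0 : E n) 1).isPreconnected.eq_or_eq_neg_of_sq_eq hfc
    (contDiffOn_areaDensity_φ D i).continuousOn hsq fun hx => (hpos _ hx).ne' with h | h
  · exact ⟨1, Or.inl rfl, fun x hx => (h hx).trans (one_mul _).symm⟩
  · exact ⟨-1, Or.inr rfl, fun x hx => (h hx).trans (neg_one_mul _).symm⟩

include h hk in
theorem IsRegularNhd.unitNormal_mem (i : Fin 3) (l : Fin (n + 1)) :
    (fun ρ x => D.unitNormal ρ i x l) ∈ analyticAlg hk1 U := by
  obtain ⟨s, hs, hsx⟩ := exists_orientation D i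
  refine analyticAlg_congr (fun ρ hρ x hx => ?_) (mul_mem (mul_mem
    (const_mem_analyticAlg (f := fun _ => s) contDiffOn_const)
    (analyticAlg_of_localAlg (h.area_inv_mem i)))
    (cross_mem _ (X := fun ρ => D.surf ρ i) (pd_surf_mem' (hk := hk) i) l))
  have hpos : 0 < areaDensity (D.φ i) x := Real.sqrt_pos.2 (D.det_metric_φ_pos i hx)
  have hsign : Real.sign ⟪cross fun j => pd j (D.φ i) x, D.N i x⟫ = s := by
    rw [hsx x hx]
    rcases hs with rfl | rfl
    · rw [one_mul, Real.sign_of_pos hpos]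
    · rw [neg_one_mul, Real.sign_of_neg (neg_lt_zero.2 hpos)]
  simp only [Pi.mul_apply, ReferenceCluster.unitNormal, PiLp.smul_apply, smul_eq_mul, hsign,
    areaDensity_eq_norm_cross]

theorem inner_mem {U : Set (Height n (k + 2))} {F : Height n (k + 2) → E n → E (n + 1)}
    {G : E n → E (n + 1)} (hF : ∀ l, (fun ρ x => F ρ x l) ∈ analyticAlg hk1 U)
    (hG : ContDiffOn ℝ ∞ G (𝔹 n)) :
    (fun ρ x => ⟪F ρ x, G x⟫) ∈ analyticAlg hk1 U := by
  simp only [inner_eq_dotProduct]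
  exact sum_mem_families _ fun l => mul_mem (hF l) (const_mem_analyticAlg (contDiffOn_coord hG l))

omit [NeZero n] in
theorem norm_conormal_vector_sq {X : E n → E (n + 1)} {x : E n} (hd : 0 < (metric X x).det) :
    ‖∑ j, ((metric X x)⁻¹ *ᵥ x.ofLp) j • pd j X x‖ ^ 2
      = x.ofLp ⬝ᵥ ((metric X x)⁻¹ *ᵥ x.ofLp) := by
  have h1 := Matrix.star_dotProduct_gram_mulVec (𝕜 := ℝ) (fun j => pd j X x)
    ((metric X x)⁻¹ *ᵥ x.ofLp) ((metric X x)⁻¹ *ᵥ x.ofLp)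
  rw [← metric_eq_gram, Matrix.mulVec_mulVec, Matrix.mul_nonsing_inv _ hd.ne'.isUnit,
    Matrix.one_mulVec] at h1
  rw [← real_inner_self_eq_norm_sq, ← h1, dotProduct_comm]
  simp

omit [NeZero n] in
theorem dotProduct_inv_eq {X : E n → E (n + 1)} {x : E n} (hx : x ∈ 𝕊 n)
    (hd : 0 < (metric X x).det) : x.ofLp ⬝ᵥ ((metric X x)⁻¹ *ᵥ x.ofLp)
      = bdryForm X x / areaDensity X x ^ 2 := by
  rw [sq_areaDensity hd, bdryForm_of_mem_sphere _ hx, Matrix.inv_def, Ring.inverse_eq_inv',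
    Matrix.smul_mulVec, dotProduct_smul, smul_eq_mul, div_eq_inv_mul]

include h hk in
theorem IsRegularNhd.unitConormal_mem (i : Fin 3) :
    ∃ q : Fin (n + 1) → Height n (k + 2) → E n → ℝ,
    (∀ l, q l ∈ analyticAlg hk1 U) ∧
      ∀ l, ∀ ρ ∈ U, EqOn (q l ρ) (fun x => D.unitConormal ρ i x l) (sphere 0 1) := by
  refine ⟨fun l => (fun ρ => areaDensity (D.surf ρ i)) * (fun ρ x => (√(bdryForm (D.surf ρ i) x))⁻¹)
    * fun ρ x => ∑ j, (∑ a, (metric (D.surf ρ i) x)⁻¹ j a * x a) * pd j (D.surf ρ i) x l,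
    fun l => mul_mem (mul_mem (analyticAlg_of_localAlg (h.area_mem i))
    (analyticAlg_of_localAlg (h.bdry_inv_mem i))) (sum_mem_families _ fun j => mul_mem
      (sum_mem_families _ fun a => mul_mem (h.metric_inv_mem (hk := hk) i j a)
        (const_mem_analyticAlg (contDiffOn_coord contDiffOn_id a)))
      (pd_surf_mem' (hk := hk) i j l)), fun l ρ hρ x hx => ?_⟩
  have hx' := sphere_subset_closedBall hx
  have hd := h.det_pos ρ hρ i x hx'
  have ha : 0 < areaDensity (D.surf ρ i) x := Real.sqrt_pos.2 hd
  have hn := norm_conormal_vector_sq hd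
  rw [dotProduct_inv_eq hx hd] at hn
  have hn' : ‖∑ j, ((metric (D.surf ρ i) x)⁻¹ *ᵥ x.ofLp) j • pd j (D.surf ρ i) x‖
      = √(bdryForm (D.surf ρ i) x) / areaDensity (D.surf ρ i) x := by
    rw [← Real.sqrt_sq (norm_nonneg _), hn, Real.sqrt_div' _ (sq_nonneg _), Real.sqrt_sq ha.le]
  simp only [Pi.mul_apply, ReferenceCluster.unitConormal, outerConormal, hn', PiLp.smul_apply,
    smul_eq_mul, inv_div]
  rw [div_eq_mul_inv]
  congr 1
  simp [Matrix.mulVec, dotProduct]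

include h hk in
theorem IsRegularNhd.inner_unitConormal_mem {G : Fin 3 → E n → E (n + 1)}
    (hG : ∀ i, ContDiffOn ℝ ∞ (G i) (𝔹 n)) (i : Fin 3) :
    ∃ q : Height n (k + 2) → E n → ℝ, q ∈ analyticAlg hk1 U ∧ ∀ ρ ∈ U,
      EqOn (q ρ) (fun x => inner ℝ (D.unitConormal ρ i x) (G i x)) (sphere 0 1) := by
  obtain ⟨q, hq, hqx⟩ := h.unitConormal_mem (hk := hk) i
  refine ⟨fun ρ x => ∑ l, q l ρ x * G i x l, sum_mem_families _ fun l => mul_mem (hq l)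
    (const_mem_analyticAlg (contDiffOn_coord (hG i) l)), fun ρ hρ x hx => ?_⟩
  refine Eq.trans ?_ (inner_eq_dotProduct _ _).symm
  exact sum_congr rfl fun l _ => congrArg (· * G i x l) (hqx l ρ hρ hx)

include h hk in
theorem IsRegularNhd.secondFundamentalForm_mem (i : Fin 3) (a b : Fin n) :
    (fun ρ => D.secondFundamentalForm ρ i a b) ∈ analyticAlg hk U := by
  have hpp : ∀ l, (fun ρ x => pd a (pd b (D.surf ρ i)) x l) ∈ analyticAlg hk U := by
    intro l
    have h1 := pd_mem_analyticAlg (hk := hk) (pd_surf_mem' (hk := hk) (hk1 := hk1) (U := U)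
      (D := D) i b l) a
    refine analyticAlg_congr (fun ρ hρ x hx => ?_) h1
    refine (pd_coord hx ?_ a l).symm
    refine differentiableWithinAt_euclidean.2 fun l => ?_
    exact differentiableWithinAt_of_mem_analyticAlg hk
      (pd_surf_mem' (hk := hk) (hk1 := hk1) (U := U) (D := D) i b l) hρ hx
  have hN := h.unitNormal_mem (hk := hk) i
  have h1 : (fun ρ x => ∑ l, pd a (pd b (D.surf ρ i)) x l * D.unitNormal ρ i x l) ∈
      analyticAlg hk U :=
    sum_mem_families _ fun l => mul_mem (hpp l) (analyticAlg_of_succ (hN l))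
  exact analyticAlg_congr (fun ρ hρ x hx => (inner_eq_dotProduct _ _).symm) h1

include h in
theorem IsRegularNhd.meanCurvature_mem (i : Fin 3) :
    (fun ρ => D.meanCurvature ρ i) ∈ analyticAlg hk U := by
  change (fun ρ x => ∑ a, ∑ b, (metric (D.surf ρ i) x)⁻¹ a b * D.secondFundamentalForm ρ i a b x) ∈ _
  exact sum_mem_families _ fun a => sum_mem_families _ fun b => mul_mem
    (analyticAlg_of_succ (h.metric_inv_mem (hk := hk) i a b))
    (h.secondFundamentalForm_mem (hk := hk) i a b)

/-! ### Quantities on the triple junction with respect to local frames -/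

variable {O : Set (E n)} {t : Fin (n - 1) → E n → E n} {η : E n → ℝ} (ht : IsLocalFrame O t η)

omit [NeZero n] in
include ht in
theorem IsLocalFrame.contDiff_mul_coord (j : Fin (n - 1)) (a : Fin n) :
    ContDiff ℝ ∞ fun x => η x * t j x a :=
  contDiff_mul_of_tsupport_subset ht.isOpen ht.cutoff_smooth ht.cutoff_support
    (contDiffOn_coord (ht.smooth j) a)

include hk ht in
theorem IsLocalFrame.dirDeriv_mem (i : Fin 3) (j : Fin (n - 1)) (l : Fin (n + 1)) :
    (fun ρ x => η x * dirDeriv (t j x) (D.surf ρ i) x l) ∈ analyticAlg hk1 U := by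
  have h1 : (fun ρ x => ∑ a, (η x * t j x a) * pd a (D.surf ρ i) x l) ∈ analyticAlg hk1 U :=
    sum_mem_families _ fun a => mul_mem
      (const_mem_analyticAlg (ht.contDiff_mul_coord j a).contDiffOn) (pd_surf_mem' (hk := hk) i a l)
  refine analyticAlg_congr (fun ρ hρ x hx => ?_) h1
  simp [dirDeriv_eq_sum, mul_sum, mul_assoc]

omit [NeZero n] in
theorem bdryMetric_eq (X : E n → E (n + 1)) (t : Fin (n - 1) → E n → E n) (x : E n) :
    bdryMetric X t x = (frameMatrix fun j => t j x)ᵀ * metric X x * frameMatrix fun j => t j x := by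
  ext j l
  simp only [bdryMetric, Matrix.of_apply, dirDeriv_eq_sum, sum_inner, inner_sum, inner_smul_left,
    inner_smul_right, Matrix.mul_apply, sum_mul]
  simp only [mul_sum]
  refine sum_congr rfl fun b _ => sum_congr rfl fun a _ => ?_
  simp [frameMatrix, metric]
  ring

include hk ht in
theorem IsLocalFrame.bdryMetric_mem (i : Fin 3) (j l : Fin (n - 1)) :
    (fun ρ x => η x * bdryMetric (D.surf ρ i) t x j l) ∈ analyticAlg hk1 U := by
  have hc : ∀ a b, ContDiff ℝ ∞ fun x => η x * (t j x a * t l x b) := fun a b =>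
    contDiff_mul_of_tsupport_subset ht.isOpen ht.cutoff_smooth ht.cutoff_support
      ((contDiffOn_coord (ht.smooth j) a).mul (contDiffOn_coord (ht.smooth l) b))
  have h1 : (fun ρ x => ∑ b, ∑ a, (η x * (t j x a * t l x b)) * metric (D.surf ρ i) x a b)
      ∈ analyticAlg hk1 U :=
    sum_mem_families _ fun b => sum_mem_families _ fun a => mul_mem
      (const_mem_analyticAlg (hc a b).contDiffOn) (metric_surf_mem (hk := hk) i a b)
  refine analyticAlg_congr (fun ρ hρ x hx => ?_) h1
  simp only [bdryMetric_eq, Matrix.mul_apply, sum_mul, mul_sum]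
  refine sum_congr rfl fun a _ => sum_congr rfl fun b _ => ?_
  simp [frameMatrix]
  ring

omit [NeZero n] in
include ht in
/-- The coefficients of the dual frame are smooth on the sphere, after multiplication with a cut-off
function. -/
theorem IsLocalFrame.exists_dual : ∃ c : Fin (n - 1) → Fin (n - 1) → Fin n → Fin n → E n → ℝ,
    (∀ j l a b, ContDiff ℝ ∞ (c j l a b)) ∧ ∀ j l a b, ∀ x ∈ 𝕊 n, c j l a b x
      = η x * ((frameMatrix fun j => t j x) * (Matrix.gram ℝ fun j => t j x)⁻¹) a j
        * ((frameMatrix fun j => t j x) * (Matrix.gram ℝ fun j => t j x)⁻¹) b l := by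
  set g : E n → ℝ := fun x => (Matrix.gram ℝ fun j => t j x).det with hg
  have htm : ∀ j a, (fun (_ : Unit) x => t j x a) ∈ smoothAlg Unit O := fun j a _ =>
    contDiffOn_coord (ht.smooth j) a
  have hgram : ∀ j l, (fun (_ : Unit) x => (Matrix.gram ℝ fun j => t j x) j l) ∈ smoothAlg Unit O := by
    intro j l
    simp only [Matrix.gram_apply, inner_eq_dotProduct]
    exact sum_mem_families _ fun a => mul_mem (htm j a) (htm l a)
  have hgs : ContDiffOn ℝ ∞ g O := det_mem _ hgram ()
  set O' : Set (E n) := O ∩ g ⁻¹' {0}ᶜ with hO'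
  have hO'o : IsOpen O' := hgs.continuousOn.isOpen_inter_preimage ht.isOpen isOpen_compl_singleton
  have hK : tsupport η ∩ sphere 0 1 ⊆ O' := fun x hx =>
    ⟨ht.cutoff_support hx.1, (det_gram_pos
      (ht.linearIndependent x ⟨ht.cutoff_support hx.1, hx.2⟩)).ne'⟩
  obtain ⟨χ, hχ, hχ1, hχs⟩ := exists_cutoff
    ((isCompact_sphere (0 : E n) 1).inter_left (isClosed_tsupport η)) hO'o hK
  have hS : ∀ a j, ContDiffOn ℝ ∞ (fun x => ((frameMatrix fun j => t j x)
      * (Matrix.gram ℝ fun j => t j x)⁻¹) a j) O' := by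
    intro a j
    have h1 : ContDiffOn ℝ ∞ (fun x => ∑ b, t b x a * ((g x)⁻¹
        * (Matrix.gram ℝ fun j => t j x).adjugate b j)) O' := by
      refine ContDiffOn.sum fun b _ => ((htm b a ()).mono inter_subset_left).mul
        (((hgs.mono inter_subset_left).inv fun x hx => hx.2).mul
          (ContDiffOn.mono (adjugate_mem _ hgram b j ()) inter_subset_left))
    refine h1.congr fun x hx => ?_
    rw [Matrix.mul_apply]
    refine sum_congr rfl fun b _ => ?_
    rw [Matrix.inv_def, Ring.inverse_eq_inv', Matrix.smul_apply, smul_eq_mul]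
    rfl
  refine ⟨fun j l a b x => η x * (χ x * (((frameMatrix fun j => t j x)
      * (Matrix.gram ℝ fun j => t j x)⁻¹) a j * ((frameMatrix fun j => t j x)
      * (Matrix.gram ℝ fun j => t j x)⁻¹) b l)), fun j l a b => ?_, fun j l a b x hx => ?_⟩
  · exact ht.cutoff_smooth.mul (contDiff_mul_of_tsupport_subset hO'o hχ hχs ((hS a j).mul (hS b l)))
  · by_cases hη : x ∈ tsupport η
    · have := hχ1 x ⟨hη, hx⟩
      simp only [this, one_mul, mul_assoc]
    · simp only [image_eq_zero_of_notMem_tsupport hη, zero_mul]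

include h hk in
include ht in
theorem IsLocalFrame.bdryMetric_inv_mem (i : Fin 3) (j l : Fin (n - 1)) :
    ∃ q : Height n (k + 2) → E n → ℝ, q ∈ analyticAlg hk1 U ∧
      ∀ ρ ∈ U, EqOn (q ρ) (fun x => η x * (bdryMetric (D.surf ρ i) t x)⁻¹ j l) (sphere 0 1) := by
  obtain ⟨c, hc, hcx⟩ := ht.exists_dual
  have hx : ∀ a, (fun (_ : Height n (k + 2)) (x : E n) => x a) ∈ analyticAlg hk1 U := fun a =>
    const_mem_analyticAlg (contDiffOn_coord contDiffOn_id a)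
  have hG := h.metric_inv_mem (hk := hk) i
  have hA := analyticAlg_of_localAlg (h.area_mem i)
  have hB := analyticAlg_of_localAlg (h.bdry_inv_mem i)
  refine ⟨fun ρ x => ∑ b, ∑ a, c j l a b x * ((metric (D.surf ρ i) x)⁻¹ a b
      - (areaDensity (D.surf ρ i) x * areaDensity (D.surf ρ i) x)
        * ((√(bdryForm (D.surf ρ i) x))⁻¹ * (√(bdryForm (D.surf ρ i) x))⁻¹)
        * ((∑ p, (metric (D.surf ρ i) x)⁻¹ a p * x p)
          * ∑ p, x p * (metric (D.surf ρ i) x)⁻¹ p b)),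
    sum_mem_families _ fun b => sum_mem_families _ fun a => mul_mem
      (const_mem_analyticAlg (hc j l a b).contDiffOn) (sub_mem (hG a b) (mul_mem (mul_mem
        (mul_mem hA hA) (mul_mem hB hB)) (mul_mem
          (sum_mem_families _ fun p => mul_mem (hG a p) (hx p))
          (sum_mem_families _ fun p => mul_mem (hx p) (hG p b))))), fun ρ hρ x hxs => ?_⟩
  have hx' := sphere_subset_closedBall hxs
  have hd := h.det_pos ρ hρ i x hx'
  have hb := bdryForm_pos hx' hd.ne'
  have ha : 0 < areaDensity (D.surf ρ i) x := Real.sqrt_pos.2 hd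
  have hq := dotProduct_inv_eq hxs hd
  simp only [hcx _ _ _ _ x hxs]
  by_cases hη : x ∈ O
  · have hinv := inv_transpose_mul_frameMatrix (one_le_dim n) (mem_sphere_zero_iff_norm.1 hxs)
      (ht.linearIndependent x ⟨hη, hxs⟩) (fun j => ht.tangent j x ⟨hη, hxs⟩) hd.ne'
      (by rw [hq]; positivity)
    have e1 : ∀ a, ∑ p, (metric (D.surf ρ i) x)⁻¹ a p * x p
        = ((metric (D.surf ρ i) x)⁻¹ *ᵥ x.ofLp) a := fun _ => rfl
    have e2 : ∀ b, ∑ p, x p * (metric (D.surf ρ i) x)⁻¹ p b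
        = (x.ofLp ᵥ* (metric (D.surf ρ i) x)⁻¹) b := fun _ => rfl
    simp only [e1, e2]
    rw [bdryMetric_eq, hinv, hq, Matrix.mul_apply]
    simp only [Matrix.mul_apply (M := (_ * _)ᵀ), sum_mul, mul_sum]
    refine sum_congr rfl fun b _ => sum_congr rfl fun a _ => ?_
    rw [Matrix.transpose_apply, Matrix.sub_apply, Matrix.smul_apply, Matrix.vecMulVec_apply,
      smul_eq_mul, inv_div, ← mul_inv, Real.mul_self_sqrt hb.le]
    ring
  · have h0 : η x = 0 := image_eq_zero_of_notMem_tsupport fun hc => hη (ht.cutoff_support hc)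
    simp [h0]

end

end

section

/-! ### The divergence theorem on the ball -/

variable {n : ℕ} [NeZero n]

theorem integral_eq_integral_sphere {G : E n → ℝ} (hG : Integrable G) :
    ∫ x, G x = ∫ r in Ioi (0 : ℝ), r ^ (n - 1) *
      ∫ y : 𝕊 n, G (r • y.1) ∂(volume.toSphere) := by
  have : Nontrivial (E n) := inferInstance
  have hmp := (volume : Measure (E n)).measurePreserving_homeomorphUnitSphereProd
  have hemb := (homeomorphUnitSphereProd (E n)).measurableEmbedding
  have hcomp : ∀ x : ({0}ᶜ : Set (E n)),
      ((homeomorphUnitSphereProd (E n) x).2.1 • (homeomorphUnitSphereProd (E n) x).1.1) = x.1 := by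
    intro x
    rw [homeomorphUnitSphereProd_apply_snd_coe, homeomorphUnitSphereProd_apply_fst_coe, smul_smul,
      mul_inv_cancel₀ (norm_ne_zero_iff.2 x.2), one_smul]
  have hi : Integrable (fun p : 𝕊 n × Ioi (0 : ℝ) => G (p.2.1 • p.1.1))
      ((volume : Measure (E n)).toSphere.prod
        (Measure.volumeIoiPow (Module.finrank ℝ (E n) - 1))) := by
    rw [← hmp.integrable_comp_emb hemb]
    simp only [Function.comp_def, hcomp]
    have h2 : IntegrableOn G ({0}ᶜ : Set (E n)) := hG.integrableOn
    rwa [integrableOn_iff_comap_subtypeVal (measurableSet_singleton _).compl] at h2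
  calc ∫ x, G x = ∫ x : ({0}ᶜ : Set (E n)), G x.1 ∂(volume.comap Subtype.val) := by
        rw [integral_subtype_comap (measurableSet_singleton _).compl G, restrict_compl_singleton]
    _ = ∫ p : 𝕊 n × Ioi (0 : ℝ), G (p.2.1 • p.1.1) ∂(volume.toSphere.prod
        (Measure.volumeIoiPow (Module.finrank ℝ (E n) - 1))) := by
        rw [← hmp.integral_comp hemb]
        simp only [hcomp]
    _ = ∫ r : Ioi (0 : ℝ), (∫ y : 𝕊 n, G (r.1 • y.1) ∂(volume.toSphere))
          ∂(Measure.volumeIoiPow (Module.finrank ℝ (E n) - 1)) := integral_prod_symm _ hi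
    _ = _ := by
        simp only [Measure.volumeIoiPow, ofReal]
        rw [integral_withDensity_eq_integral_smul (by fun_prop),
          integral_subtype_comap measurableSet_Ioi fun r => Real.toNNReal
            (r ^ (Module.finrank ℝ (E n) - 1)) •
              ∫ y : 𝕊 n, G (r • y.1) ∂(volume.toSphere)]
        refine setIntegral_congr_fun measurableSet_Ioi fun r hr => ?_
        simp only [NNReal.smul_def, Real.coe_toNNReal _ (pow_nonneg (le_of_lt hr) _), smul_eq_mul,
          finrank_euclideanSpace, Fintype.card_fin]

omit [NeZero n] in
theorem smul_mem_closedBall {r : ℝ} (hr : r ∈ Icc (0 : ℝ) 1) (y : 𝕊 n) :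
    r • y.1 ∈ 𝔹 n := by
  rw [mem_closedBall_zero_iff, norm_smul, mem_sphere_zero_iff_norm.1 y.2, mul_one, Real.norm_eq_abs,
    abs_of_nonneg hr.1]
  exact hr.2

omit [NeZero n] in
theorem continuousOn_integral_sphere {h w : E n → ℝ} (hh : ContinuousOn h (𝔹 n))
    (hw : Continuous w) :
    ContinuousOn (fun r : ℝ => ∫ y : 𝕊 n, h (r • y.1) * w y ∂(volume.toSphere))
      (Icc 0 1) := by
  obtain ⟨C, hC⟩ := (isCompact_closedBall (0 : E n) 1).exists_bound_of_continuousOn hh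
  obtain ⟨C', hC'⟩ := (isCompact_sphere (0 : E n) 1).exists_bound_of_continuousOn hw.continuousOn
  refine continuousOn_of_dominated (bound := fun _ => C * C') (fun r hr => ?_)
    (fun r hr => .of_forall fun y => ?_)
    (integrable_const _) (.of_forall fun y => ?_)
  · refine Continuous.aestronglyMeasurable (Continuous.mul ?_ (hw.comp continuous_subtype_val))
    exact hh.comp_continuous (by fun_prop) (smul_mem_closedBall hr)
  · rw [norm_mul]
    have h1 := hC _ (smul_mem_closedBall hr y)
    exact mul_le_mul h1 (hC' _ y.2) (norm_nonneg _) ((norm_nonneg _).trans h1)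
  · exact (hh.comp (by fun_prop) fun r hr => smul_mem_closedBall hr y).mul continuousOn_const

omit [NeZero n] in
theorem ball_ae_eq_closedBall : (ball (0 : E n) 1 : Set (E n)) =ᵐ[volume] 𝔹 n := by
  refine ae_eq_set.2 ⟨by rw [sdiff_eq_empty.2 ball_subset_closedBall, measure_empty], ?_⟩
  rw [closedBall_sdiff_ball]
  exact Measure.addHaar_sphere_of_ne_zero _ _ one_ne_zero

theorem setIntegral_ball_eq_integral_sphere {h : E n → ℝ} (hh : ContinuousOn h (𝔹 n)) :
    ∫ x, h x ∂𝔪 n = ∫ r in Icc (0 : ℝ) 1, r ^ (n - 1) *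
      ∫ y : 𝕊 n, h (r • y.1) ∂(volume.toSphere) := by
  have hi : Integrable ((𝔹 n).indicator h) :=
    (hh.integrableOn_compact (isCompact_closedBall _ _)).integrable_indicator
      measurableSet_closedBall
  rw [ballMeasure, setIntegral_congr_set ball_ae_eq_closedBall,
    ← integral_indicator measurableSet_closedBall, integral_eq_integral_sphere hi,
    integral_Icc_eq_integral_Ioc]
  refine (setIntegral_eq_of_subset_of_forall_sdiff_eq_zero measurableSet_Ioi
    (fun r hr => hr.1) fun r hr => ?_).trans (setIntegral_congr_fun measurableSet_Ioc fun r hr => ?_)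
  · have h1 : 1 < r := by
      by_contra hc
      exact hr.2 ⟨hr.1, not_lt.1 hc⟩
    have h2 : ∀ y : 𝕊 n, (𝔹 n).indicator h (r • y.1) = 0 := by
      intro y
      refine indicator_of_notMem (fun hc => ?_) _
      rw [mem_closedBall_zero_iff, norm_smul, mem_sphere_zero_iff_norm.1 y.2, mul_one,
        Real.norm_eq_abs, abs_of_pos (by linarith)] at hc
      linarith
    simp [h2]
  · have h2 : ∀ y : 𝕊 n,
        (𝔹 n).indicator h (r • y.1) = h (r • y.1) := fun y =>
      indicator_of_mem (smul_mem_closedBall ⟨hr.1.le, hr.2⟩ y) _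
    simp [h2]

theorem deriv_smoothTransition_eq_zero {x : ℝ} (hx : 1 < x) :
    deriv Real.smoothTransition x = 0 := by
  have h : Real.smoothTransition =ᶠ[𝓝 x] fun _ => 1 := by
    filter_upwards [lt_mem_nhds hx] with y hy using Real.smoothTransition.one_of_one_le hy.le
  rw [h.deriv_eq, deriv_const]

theorem hasDerivAt_smoothTransition (x : ℝ) :
    HasDerivAt Real.smoothTransition (deriv Real.smoothTransition x) x :=
  ((Real.smoothTransition.contDiff (n := 1)).differentiable (by simp)).differentiableAt.hasDerivAt

theorem continuous_deriv_smoothTransition : Continuous (deriv Real.smoothTransition) :=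
  (Real.smoothTransition.contDiff (n := 1)).continuous_deriv (by simp)

/-- The derivatives of the radial cut-off functions concentrate at the boundary. -/
theorem tendsto_integral_deriv_cutoff {g : ℝ → ℝ} (hg : ContinuousOn g (Icc 0 1)) :
    Tendsto (fun j : ℕ => ∫ r in Icc (0 : ℝ) 1, (deriv Real.smoothTransition
      ((j + 2) * (1 - r ^ 2) - 1) * (2 * (j + 2) * r)) * g r) atTop (𝓝 (g 1)) := by
  have h1 : (1 : ℝ) ∈ Icc (0 : ℝ) 1 := ⟨zero_le_one, le_rfl⟩
  have hcont : ∀ j : ℕ, Continuous fun r : ℝ => deriv Real.smoothTransition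
      ((j + 2) * (1 - r ^ 2) - 1) * (2 * (j + 2) * r) := fun j =>
    (continuous_deriv_smoothTransition.comp (by fun_prop)).mul (by fun_prop)
  refine tendsto_setIntegral_peak_smul_of_integrableOn_of_tendsto (t := Icc 0 1) (x₀ := 1)
    (φ := fun (j : ℕ) r => deriv Real.smoothTransition
      ((j + 2) * (1 - r ^ 2) - 1) * (2 * (j + 2) * r)) measurableSet_Icc measurableSet_Icc
    subset_rfl self_mem_nhdsWithin (by simp) (.of_forall fun j r hr => ?_)
    (fun u hu h1u => ?_) ?_ (.of_forall fun j => (hcont j).aestronglyMeasurable)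
    (hg.integrableOn_compact isCompact_Icc) (hg 1 h1)
  · exact mul_nonneg Real.smoothTransition.monotone.deriv_nonneg
      (mul_nonneg (by positivity) hr.1)
  · obtain ⟨δ, hδ, hball⟩ := Metric.isOpen_iff.1 hu 1 h1u
    obtain ⟨J, hJ⟩ := exists_nat_gt (2 / δ)
    rw [Metric.tendstoUniformlyOn_iff]
    intro ε hε
    filter_upwards [eventually_ge_atTop J] with j hj r hr
    have hr1 : r ≤ 1 - δ := by
      by_contra hc
      refine hr.2 (hball ?_)
      rw [mem_ball, Real.dist_eq, abs_lt]
      constructor <;> linarith [hr.1.2]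
    have hj' : 2 / δ < j := hJ.trans_le (by exact_mod_cast hj)
    rw [div_lt_iff₀ hδ] at hj'
    have h2 : 1 < ((j : ℝ) + 2) * (1 - r ^ 2) - 1 := by
      have h3 : δ ≤ 1 - r ^ 2 := by nlinarith [hr.1.1, hr.1.2]
      nlinarith
    simp only [deriv_smoothTransition_eq_zero h2, zero_mul, Pi.zero_apply, dist_self]
    exact hε
  · refine tendsto_const_nhds.congr fun j => ?_
    have hd : ∀ r ∈ uIcc (0 : ℝ) 1, HasDerivAt
        (fun r : ℝ => -Real.smoothTransition ((j + 2) * (1 - r ^ 2) - 1))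
        (deriv Real.smoothTransition ((j + 2) * (1 - r ^ 2) - 1) * (2 * (j + 2) * r)) r := by
      intro r _
      have h2 : HasDerivAt (fun r : ℝ => ((j : ℝ) + 2) * (1 - r ^ 2) - 1) (-(2 * (j + 2) * r)) r := by
        have := (((hasDerivAt_pow 2 r).const_sub 1).const_mul ((j : ℝ) + 2)).sub_const 1
        refine this.congr_deriv ?_
        push_cast
        ring
      exact ((hasDerivAt_smoothTransition _).comp r h2).neg.congr_deriv (by ring)
    rw [integral_Icc_eq_integral_Ioc, ← intervalIntegral.integral_of_le zero_le_one,
      intervalIntegral.integral_eq_sub_of_hasDerivAt hd ((hcont j).intervalIntegrable _ _)]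
    rw [Real.smoothTransition.zero_of_nonpos (by norm_num),
      Real.smoothTransition.one_of_one_le (by norm_num; linarith [(Nat.cast_nonneg j : (0:ℝ) ≤ j)])]
    norm_num

/-- The divergence theorem on the ball: `∫_B ∂_i f = ∫_{∂B} f x_i`. It follows from the definition
of weak derivatives with radial cut-off functions. -/
theorem IsWeakPartial.integral_eq {i : Fin n} {f g : E n → ℝ} (h : IsWeakPartial i f g)
    (hf : ContinuousOn f (𝔹 n)) (hg : Integrable g (𝔪 n)) :
    ∫ x, g x ∂𝔪 n = ∫ y : 𝕊 n, f y * y.1 i ∂(volume.toSphere) := by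
  set ψ : ℕ → E n → ℝ := fun j x => Real.smoothTransition ((j + 2) * (1 - ‖x‖ ^ 2) - 1) with hψ
  have hψs : ∀ j, ContDiff ℝ ∞ (ψ j) := fun j => Real.smoothTransition.contDiff.comp
    (((contDiff_const.mul (contDiff_const.sub (contDiff_norm_sq ℝ))).sub contDiff_const))
  have hψd : ∀ j x, fderiv ℝ (ψ j) x (single i 1)
      = -(deriv Real.smoothTransition ((j + 2) * (1 - ‖x‖ ^ 2) - 1) * (2 * (j + 2) * x i)) := by
    intro j x
    have h2 : HasFDerivAt (fun x : E n => ((j : ℝ) + 2) * (1 - ‖x‖ ^ 2) - 1)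
        (((j : ℝ) + 2) • (-((2 : ℕ) • (innerSL ℝ x : E n →L[ℝ] ℝ)))) x :=
      (((hasStrictFDerivAt_norm_sq x).hasFDerivAt.const_sub 1).const_mul _).sub_const 1
    have h3 := ((hasDerivAt_smoothTransition (((j : ℝ) + 2) * (1 - ‖x‖ ^ 2) - 1)).comp_hasFDerivAt
      x h2).fderiv
    change fderiv ℝ (Real.smoothTransition ∘ _) x _ = _
    rw [h3]
    simp only [smul_apply, neg_apply, innerSL_apply_apply,
      EuclideanSpace.inner_single_right, smul_eq_mul, nsmul_eq_mul, conj_trivial]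
    push_cast
    ring
  have hψt : ∀ j, tsupport (ψ j) ⊆ ball (0 : E n) 1 := by
    intro j
    have hcl : IsClosed {x : E n | 1 ≤ ((j : ℝ) + 2) * (1 - ‖x‖ ^ 2)} :=
      isClosed_le continuous_const (by fun_prop)
    refine (closure_minimal (fun x hx => ?_) hcl).trans fun x hx => ?_
    · by_contra hc
      exact hx (Real.smoothTransition.zero_of_nonpos (by simp only [mem_ofPred_eq, not_le] at hc; linarith))
    · rw [mem_ball_zero_iff]
      by_contra hc
      have h1 : 1 ≤ ‖x‖ := not_lt.1 hc
      have h2 : ((j : ℝ) + 2) * (1 - ‖x‖ ^ 2) ≤ 0 :=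
        mul_nonpos_of_nonneg_of_nonpos (by positivity) (by nlinarith)
      have h3 : 1 ≤ ((j : ℝ) + 2) * (1 - ‖x‖ ^ 2) := hx
      linarith
  have hpart : ∀ j, ∫ x, g x * ψ j x ∂𝔪 n = ∫ r in Icc (0 : ℝ) 1,
      (deriv Real.smoothTransition ((j + 2) * (1 - r ^ 2) - 1) * (2 * (j + 2) * r)) *
        (r ^ (n - 1) * ∫ y : 𝕊 n, f (r • y.1) * y.1 i ∂(volume.toSphere)) := by
    intro j
    have h1 := h (ψ j) (hψs j) (hψt j)
    simp only [hψd] at h1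
    rw [← neg_eq_iff_eq_neg, ← integral_neg] at h1
    rw [← h1, setIntegral_ball_eq_integral_sphere]
    · refine setIntegral_congr_fun measurableSet_Icc fun r hr => ?_
      simp only [mul_neg, neg_neg]
      rw [mul_left_comm]
      congr 1
      rw [← integral_const_mul]
      refine integral_congr_ae (.of_forall fun y => ?_)
      simp only [norm_smul, mem_sphere_zero_iff_norm.1 y.2, mul_one, Real.norm_eq_abs, sq_abs,
        PiLp.smul_apply, smul_eq_mul]
      ring
    · refine (hf.mul (Continuous.continuousOn ?_)).neg
      exact ((continuous_deriv_smoothTransition.comp (by fun_prop)).mul (by fun_prop)).neg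
  have hlim1 : Tendsto (fun j => ∫ x, g x * ψ j x ∂𝔪 n) atTop
      (𝓝 (∫ x, g x ∂𝔪 n)) := by
    refine tendsto_integral_of_dominated_convergence (fun x => ‖g x‖)
      (fun j => hg.1.mul (hψs j).continuous.aestronglyMeasurable) hg.norm
      (fun j => .of_forall fun x => ?_) ?_
    · rw [norm_mul]
      refine mul_le_of_le_one_right (norm_nonneg _) ?_
      rw [Real.norm_eq_abs, abs_of_nonneg (Real.smoothTransition.nonneg _)]
      exact Real.smoothTransition.le_one _
    · filter_upwards [ae_restrict_mem measurableSet_ball] with x hx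
      have hx' : ‖x‖ < 1 := mem_ball_zero_iff.1 hx
      have hpos : 0 < 1 - ‖x‖ ^ 2 := by nlinarith [norm_nonneg x]
      obtain ⟨J, hJ⟩ := exists_nat_gt (2 / (1 - ‖x‖ ^ 2))
      refine tendsto_const_nhds.congr' ?_
      filter_upwards [eventually_ge_atTop J] with j hj
      have hj' : 2 / (1 - ‖x‖ ^ 2) < j := hJ.trans_le (by exact_mod_cast hj)
      rw [div_lt_iff₀ hpos] at hj'
      simp only [hψ]
      rw [Real.smoothTransition.one_of_one_le (by nlinarith), mul_one]
  have hlim2 := tendsto_integral_deriv_cutoff (g := fun r => r ^ (n - 1) *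
    ∫ y : 𝕊 n, f (r • y.1) * y.1 i ∂(volume.toSphere)) ?_
  · simp only [hpart] at hlim1
    have := tendsto_nhds_unique hlim1 hlim2
    simpa using this
  · exact (by fun_prop : ContinuousOn (fun r : ℝ => r ^ (n - 1)) _).mul
      (continuousOn_integral_sphere hf (w := fun x => x i) (by fun_prop))

end

section

/-! ### Integration by parts and representation of functionals -/

variable {n : ℕ} {k : ℕ}

theorem integrable_of_continuousOn {f : E n → ℝ} (hf : ContinuousOn f (𝔹 n)) :
    Integrable f (𝔪 n) :=
  (hf.integrableOn_compact (isCompact_closedBall _ _)).mono_set ball_subset_closedBall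

theorem integrable_mul_of_continuousOn {f g : E n → ℝ} (hf : ContinuousOn f (𝔹 n))
    (hg : ContinuousOn g (𝔹 n)) : Integrable (fun x => f x * g x) (𝔪 n) :=
  integrable_of_continuousOn (hf.mul hg)

theorem integrable_sphere_of_continuousOn {f : E n → ℝ} (hf : ContinuousOn f (sphere 0 1)) :
    Integrable (fun y : 𝕊 n => f y) (volume : Measure (E n)).toSphere :=
  (hf.comp_continuous continuous_subtype_val fun y => y.2).integrable_of_hasCompactSupport
    (HasCompactSupport.of_compactSpace _)

variable [NeZero n]

theorem integral_mul_D (hk : n < 2 * k) (p : H n (k + 1)) (u : H n (k + 2)) (l : Fin n) :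
    ∫ x, p.contRep x * (H.D l u).contRep x ∂𝔪 n
      = ∫ y : 𝕊 n, p.contRep y * u.contRep y * y.1 l ∂(volume.toSphere)
        - ∫ x, (H.D l p).contRep x * u.contRep x ∂𝔪 n := by
  have hk1 : n < 2 * (k + 1) := by omega
  have hk2 : n < 2 * (k + 2) := by omega
  have cp := H.continuousOn_contRep hk1 p
  have cu := H.continuousOn_contRep hk2 u
  have cdp := H.continuousOn_contRep hk (H.D l p)
  have cdu := H.continuousOn_contRep hk1 (H.D l u)
  set w := H.mul hk1 p (H.res u) with hw
  have h1 : EqOn w.contRep (fun x => p.contRep x * u.contRep x) (𝔹 n) :=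
    H.contRep_mul hk1 p (H.res u)
  have h2 : EqOn (H.D l w).contRep (fun x => (H.D l p).contRep x * u.contRep x
      + p.contRep x * (H.D l u).contRep x) (𝔹 n) := by
    intro x hx
    rw [← H.pd_contRep hk w l hx, pd_congr h1 l hx, pd_mul hx
      (H.hasFDerivWithinAt_contRep hk p hx).differentiableWithinAt
      (H.hasFDerivWithinAt_contRep hk1 u hx).differentiableWithinAt l,
      H.pd_contRep hk p l hx, H.pd_contRep hk1 u l hx]
    ring
  have h3 := ((H.isWeakPartial l w).congr ((H.contRep_spec hk1 w).2.trans
    (ae_eq_of_eqOn_closedBall h1)) ((H.contRep_spec hk _).2.trans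
    (ae_eq_of_eqOn_closedBall h2))).integral_eq (cp.mul cu)
    (integrable_of_continuousOn ((cdp.mul cu).add (cp.mul cdu)))
  rw [integral_add (integrable_mul_of_continuousOn cdp cu)
    (integrable_mul_of_continuousOn cp cdu)] at h3
  linarith

theorem Height.sum_contRep_eq_zero {m : ℕ} (hm : n < 2 * m) (σ : Height n m) {x : E n}
    (hx : x ∈ 𝕊 n) :
    (σ.1 0).contRep x + (σ.1 1).contRep x + (σ.1 2).contRep x = 0 := by
  have h1 : (∑ i, σ.1 i) ∈ zeroTrace n m := by simpa [heightSpace] using σ.2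
  have h2 := (mem_zeroTrace_iff hm _).1 h1 x hx
  have hx' := sphere_subset_closedBall hx
  rw [← H.eval_apply hm hx', map_sum, Fin.sum_univ_three] at h2
  exact h2

set_option maxHeartbeats 1000000 in
/-- Every functional `σ ↦ ∑_i ∫_B (P_{i,0} σ^i + ∑_l P_{i,l} ∂_l σ^i)` is represented by an element of
`W`, which depends linearly and continuously on the coefficients. -/
theorem exists_pairing_eq (hk : n < 2 * k) (D : ReferenceCluster n) :
    ∃ R : (Fin 3 × Option (Fin n) → H n (k + 1)) →L[ℝ] ReferenceCluster.W n (k + 2),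
      ∀ (P : Fin 3 × Option (Fin n) → H n (k + 1)) (σ : D.V (k + 2)),
        ∑ a, ∫ x, (P a).contRep x * (jet a σ.1).contRep x ∂𝔪 n
          = D.pairing (R P) σ := by
  have hk1 : n < 2 * (k + 1) := by omega
  have hk2 : n < 2 * (k + 2) := by omega
  choose s hs using fun i => H.exists_contRep_eq hk ((contDiffOn_areaDensity_φ D i).inv fun x hx =>
    (Real.sqrt_pos.2 (D.det_metric_φ_pos i hx)).ne')
  choose q hq using fun l : Fin n => H.exists_contRep_eq hk1
    (((contDiffOn_bdryForm_φ D 0).inv fun x hx =>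
    (Real.sqrt_pos.2 (bdryForm_pos hx (D.det_metric_φ_pos 0 hx).ne')).ne').mul
      (contDiffOn_coord contDiffOn_id l))
  let R1 : (Fin 3 × Option (Fin n) → H n (k + 1)) →L[ℝ] (Fin 3 → H n k) :=
    ContinuousLinearMap.pi fun i => (H.mul hk (s i)).comp
      (H.res.comp (ContinuousLinearMap.proj (i, none))
        - ∑ l, (H.D l).comp (ContinuousLinearMap.proj (i, some l)))
  let B : Fin 2 → (Fin 3 × Option (Fin n) → H n (k + 1)) →L[ℝ] H n (k + 1) := fun j =>
    ∑ l, (H.mul hk1 (q l)).comp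
      (ContinuousLinearMap.proj (R := ℝ) (φ := fun _ => H n (k + 1)) (j.succ, some l)
        - ContinuousLinearMap.proj (0, some l))
  let R2 : (Fin 3 × Option (Fin n) → H n (k + 1)) →L[ℝ] (Fin 2 → HTrace n (k + 1)) :=
    ContinuousLinearMap.pi fun j => (H.traceL n (k + 1)).comp (B j)
  refine ⟨R1.prod R2, fun P σ => ?_⟩
  have hR1 : ∀ i, EqOn (R1 P i).contRep (fun x => (areaDensity (D.φ i) x)⁻¹ *
      ((P (i, none)).contRep x - ∑ l, (H.D l (P (i, some l))).contRep x)) (𝔹 n) := by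
    intro i x hx
    have e : R1 P i = H.mul hk (s i) (H.res (P (i, none)) - ∑ l, H.D l (P (i, some l))) := by
      simp [R1]
    have e2 : (H.res (P (i, none)) - ∑ l, H.D l (P (i, some l))).contRep x
        = (P (i, none)).contRep x - ∑ l, (H.D l (P (i, some l))).contRep x := by
      simp only [← H.eval_apply hk hx, ← H.contRep_res (P (i, none)), map_sub, map_sum]
    rw [e, H.contRep_mul hk _ _ hx]
    simp only [e2, hs i hx]
    rfl
  have hB : ∀ j, EqOn (B j P).contRep (fun x => (√(bdryForm (D.φ 0) x))⁻¹ * ∑ l, x l *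
      ((P (j.succ, some l)).contRep x - (P (0, some l)).contRep x)) (𝔹 n) := by
    intro j x hx
    have e : B j P = ∑ l, H.mul hk1 (q l) (P (j.succ, some l) - P (0, some l)) := by simp [B]
    rw [e, ← H.eval_apply hk1 hx, map_sum]
    refine Eq.trans ?_ (mul_sum _ _ _).symm
    refine sum_congr rfl fun l _ => ?_
    rw [H.eval_apply, H.contRep_mul hk1 _ _ hx]
    simp only [hq l hx, H.contRep_sub hk1 _ _ hx]
    simp only [Pi.inv_apply, id]
    ring
  have cP := fun a => H.continuousOn_contRep hk1 (P a)
  have cD := fun i l => H.continuousOn_contRep hk (H.D l (P (i, some l)))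
  have cσ := fun i => H.continuousOn_contRep hk2 (σ.1.1 i)
  have hint : ∀ i, D.refIntegral i (fun x => (R1 P i).fn x * (σ.1.1 i).fn x)
      = ∫ x, (P (i, none)).contRep x * (σ.1.1 i).contRep x ∂𝔪 n
        - ∑ l, ∫ x, (H.D l (P (i, some l))).contRep x * (σ.1.1 i).contRep x ∂𝔪 n := by
    intro i
    rw [← integral_finsetSum _ fun l _ => integrable_mul_of_continuousOn (cD i l) (cσ i),
      ← integral_sub (integrable_mul_of_continuousOn (cP _) (cσ i))
        (integrable_finsetSum _ fun l _ => integrable_mul_of_continuousOn (cD i l) (cσ i))]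
    refine integral_congr_ae ?_
    filter_upwards [(H.contRep_spec hk (R1 P i)).2, (H.contRep_spec hk2 (σ.1.1 i)).2,
      ae_restrict_mem measurableSet_ball] with x h1 h2 hx
    have hx' := ball_subset_closedBall hx
    have hpos : 0 < areaDensity (D.φ i) x := Real.sqrt_pos.2 (D.det_metric_φ_pos i hx')
    rw [h1, h2, hR1 i hx', ← sum_mul]
    field_simp
  have hbd : ∀ i l, Integrable (fun y : 𝕊 n => (P (i, some l)).contRep y *
      (σ.1.1 i).contRep y * y.1 l) (volume.toSphere) := fun i l =>
    integrable_sphere_of_continuousOn (f := fun y => (P (i, some l)).contRep y *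
      (σ.1.1 i).contRep y * y l) ((((cP (i, some l)).mul (cσ i)).mul
      (contDiffOn_coord contDiffOn_id l).continuousOn).mono sphere_subset_closedBall)
  have hbdry : ∫ y : 𝕊 n, (((R1.prod R2 P).2 0).val y * (σ.1.1 1).contRep y
      + ((R1.prod R2 P).2 1).val y * (σ.1.1 2).contRep y) * bdryDensity (D.φ 0) y ∂(volume.toSphere)
      = ∑ i, ∑ l, ∫ y : 𝕊 n, (P (i, some l)).contRep y * (σ.1.1 i).contRep y * y.1 l
        ∂(volume.toSphere) := by
    simp only [← integral_finsetSum _ fun l _ => hbd _ l]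
    rw [← integral_finsetSum _ fun i _ => integrable_finsetSum _ fun l _ => hbd i l]
    refine integral_congr_ae (.of_forall fun y => ?_)
    have hy := sphere_subset_closedBall y.2
    have hsum := Height.sum_contRep_eq_zero hk2 σ.1 y.2
    have hpos : 0 < √(bdryForm (D.φ 0) y) :=
      Real.sqrt_pos.2 (bdryForm_pos hy (D.det_metric_φ_pos 0 hy).ne')
    have e : ∀ j, ((R1.prod R2 P).2 j).val y = (√(bdryForm (D.φ 0) y))⁻¹ * ∑ l, y.1 l *
      ((P (j.succ, some l)).contRep y - (P (0, some l)).contRep y) := fun j =>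
      (H.val_trace hk1 (B j P) y.2).trans (hB j hy)
    simp only [e, bdryDensity, ← bdryForm_of_mem_sphere _ y.2, Fin.sum_univ_three]
    have e0 : (σ.1.1 0).contRep y = -((σ.1.1 1).contRep y + (σ.1.1 2).contRep y) := by linarith
    rw [e0]
    have e3 : ∀ a b c : ℝ, c ≠ 0 → (c⁻¹ * a + c⁻¹ * b) * c = a + b := by
      intro a b c hc; field_simp
    rw [mul_assoc _ _ ((σ.1.1 1).contRep y), mul_assoc _ _ ((σ.1.1 2).contRep y),
      e3 _ _ _ hpos.ne', sum_mul, sum_mul, ← sum_add_distrib,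
      ← sum_add_distrib, ← sum_add_distrib]
    refine sum_congr rfl fun l _ => ?_
    simp only [Fin.succ_zero_eq_one, Fin.succ_one_eq_two]
    ring
  have hpair : D.pairing (R1.prod R2 P) σ = (∑ i, D.refIntegral i
      (fun x => (R1 P i).fn x * (σ.1.1 i).fn x)) + ∫ y : 𝕊 n,
      (((R1.prod R2 P).2 0).val y * (σ.1.1 1).contRep y
      + ((R1.prod R2 P).2 1).val y * (σ.1.1 2).contRep y) * bdryDensity (D.φ 0) y
        ∂(volume.toSphere) := rfl
  rw [hpair, hbdry, ← sum_add_distrib, Fintype.sum_prod_type]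
  refine sum_congr rfl fun i _ => ?_
  rw [Fintype.sum_option, hint i]
  have h5 : ∀ l, ∫ x, (P (i, some l)).contRep x * (jet (i, some l) σ.1).contRep x ∂𝔪 n
      = _ := fun l => integral_mul_D hk (P (i, some l)) (σ.1.1 i) l
  simp only [h5, Finset.sum_sub_distrib]
  have h6 : (jet (i, none) σ.1).contRep = (σ.1.1 i).contRep := rfl
  rw [h6]
  ring

end

/-! ### Analytic parametrization of a constraint, and Lagrange multipliers -/

section

variable {X : Type*} [NormedAddCommGroup X] [NormedSpace ℝ X] {V : Submodule ℝ X}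
  {κ : Type*} [Fintype κ] [DecidableEq κ]

/-- A finite system `b` of vectors that spans a complement of `V`, with the dual functionals `l`. -/
structure IsComplementFrame (V : Submodule ℝ X) (b : κ → X) (l : κ → X →L[ℝ] ℝ) : Prop where
  apply_eq : ∀ i j, l i (b j) = if i = j then 1 else 0
  mem_iff : ∀ u, u ∈ V ↔ ∀ i, l i u = 0

variable {b : κ → X} {l : κ → X →L[ℝ] ℝ} (hb : IsComplementFrame V b l)

include hb in
theorem IsComplementFrame.apply_sum (c : κ → ℝ) (i : κ) : l i (∑ k, c k • b k) = c i := by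
  simp [hb.apply_eq]

/-- The projection onto `V` along the span of `b`. -/
def IsComplementFrame.proj : X →L[ℝ] V :=
  ContinuousLinearMap.codRestrict
    (ContinuousLinearMap.id ℝ X - ∑ k, (l k).smulRight (b k)) V fun u => by
    rw [hb.mem_iff]
    intro i
    have : (ContinuousLinearMap.id ℝ X - ∑ k, (l k).smulRight (b k)) u
        = u - ∑ k, l k u • b k := by simp
    rw [this, map_sub, hb.apply_sum, sub_self]

theorem IsComplementFrame.coe_proj (u : X) : (hb.proj u : X) = u - ∑ k, l k u • b k := by
  simp [IsComplementFrame.proj]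

theorem IsComplementFrame.eq_add (u : X) : u = hb.proj u + ∑ k, l k u • b k := by
  rw [hb.coe_proj, sub_add_cancel]

theorem IsComplementFrame.proj_add (w : V) (c : κ → ℝ) : hb.proj (w + ∑ k, c k • b k) = w := by
  refine Subtype.ext ?_
  rw [hb.coe_proj]
  have : ∀ k, l k (w + ∑ k, c k • b k) = c k := fun k => by
    rw [map_add, hb.apply_sum, (hb.mem_iff _).1 w.2 k, zero_add]
  simp only [this, add_sub_cancel_right]

/-- The matrix of the derivatives of the constraints `v` in the directions `b`. -/
def constraintMatrix (v : κ → X → ℝ) (b : κ → X) (u : X) : Matrix κ κ ℝ :=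
  Matrix.of fun i j => fderiv ℝ (v i) u (b j)

/-- The inverse of the derivative of `u ↦ (proj u, v u)`. -/
def constraintInverse (V : Submodule ℝ X) (v : κ → X → ℝ) (b : κ → X) (u : X) :
    V × (κ → ℝ) →L[ℝ] X :=
  V.subtypeL.comp (ContinuousLinearMap.fst ℝ V (κ → ℝ)) +
    ∑ k, ((ContinuousLinearMap.proj (R := ℝ) (φ := fun _ : κ => ℝ) k).comp
      ((LinearMap.toContinuousLinearMap (Matrix.mulVecLin (constraintMatrix v b u)⁻¹)).comp
        (ContinuousLinearMap.snd ℝ V (κ → ℝ) - (ContinuousLinearMap.pi fun i =>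
          fderiv ℝ (v i) u).comp (V.subtypeL.comp
            (ContinuousLinearMap.fst ℝ V (κ → ℝ)))))).smulRight (b k)

theorem constraintInverse_apply (v : κ → X → ℝ) (u : X) (p : V × (κ → ℝ)) :
    constraintInverse V v b u p = p.1 + ∑ k, ((constraintMatrix v b u)⁻¹ *ᵥ
      (p.2 - fun i => fderiv ℝ (v i) u (p.1 : X))) k • b k := by
  simp [constraintInverse, Matrix.mulVec_sub]

/-- The derivative of `u ↦ (proj u, v u)` is invertible if the matrix of derivatives is. -/
def IsComplementFrame.equiv (v : κ → X → ℝ) {u : X} (h : (constraintMatrix v b u).det ≠ 0) :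
    X ≃L[ℝ] V × (κ → ℝ) :=
  ContinuousLinearEquiv.equivOfInverse
    (hb.proj.prod (ContinuousLinearMap.pi fun i => fderiv ℝ (v i) u)) (constraintInverse V v b u)
    (fun σ => by
      have e1 : (fun i => fderiv ℝ (v i) u σ) - (fun i => fderiv ℝ (v i) u (hb.proj σ : X))
          = constraintMatrix v b u *ᵥ fun k => l k σ := by
        funext i
        simp only [Pi.sub_apply, hb.coe_proj, map_sub, map_sum, map_smul, sub_sub_cancel,
          Matrix.mulVec, dotProduct, constraintMatrix, Matrix.of_apply, smul_eq_mul, mul_comm]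
      rw [constraintInverse_apply]
      change (hb.proj σ : X) + ∑ k, ((constraintMatrix v b u)⁻¹ *ᵥ ((fun i => fderiv ℝ (v i) u σ)
        - fun i => fderiv ℝ (v i) u (hb.proj σ : X))) k • b k = σ
      rw [e1, Matrix.mulVec_mulVec, Matrix.nonsing_inv_mul _ h.isUnit, Matrix.one_mulVec,
        ← hb.eq_add])
    (fun p => by
      rw [constraintInverse_apply]
      set c := (constraintMatrix v b u)⁻¹ *ᵥ (p.2 - fun i => fderiv ℝ (v i) u (p.1 : X)) with hc
      have e1 : constraintMatrix v b u *ᵥ c = p.2 - fun i => fderiv ℝ (v i) u (p.1 : X) := by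
        rw [hc, Matrix.mulVec_mulVec, Matrix.mul_nonsing_inv _ h.isUnit, Matrix.one_mulVec]
      refine Prod.ext (hb.proj_add p.1 c) (funext fun i => ?_)
      have e3 := congrFun e1 i
      simp only [Matrix.mulVec, dotProduct, constraintMatrix, Matrix.of_apply, Pi.sub_apply] at e3
      change fderiv ℝ (v i) u ((p.1 : X) + ∑ k, c k • b k) = p.2 i
      simp only [map_add, map_sum, map_smul, smul_eq_mul, mul_comm (c _)]
      linarith)

theorem IsComplementFrame.equiv_apply (v : κ → X → ℝ) {u : X}
    (h : (constraintMatrix v b u).det ≠ 0) :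
    (hb.equiv v h : X →L[ℝ] V × (κ → ℝ))
      = hb.proj.prod (ContinuousLinearMap.pi fun i => fderiv ℝ (v i) u) := rfl

omit [Fintype κ] [DecidableEq κ] in
theorem analyticOnNhd_constraintMatrix {v : κ → X → ℝ} {Ω : Set X}
    (hv : ∀ i, AnalyticOnNhd ℝ (v i) Ω) (i j : κ) :
    AnalyticOnNhd ℝ (fun u => constraintMatrix v b u i j) Ω := fun u hu =>
  ((ContinuousLinearMap.apply ℝ ℝ (b j)).analyticAt _).fun_comp ((hv i).fderiv u hu)

theorem analyticAt_det {M : X → Matrix κ κ ℝ} {u : X}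
    (hM : ∀ i j, AnalyticAt ℝ (fun u => M u i j) u) : AnalyticAt ℝ (fun u => (M u).det) u := by
  simp only [Matrix.det_apply]
  refine Finset.analyticAt_fun_sum _ fun σ _ => ?_
  simp only [Units.smul_def, zsmul_eq_mul]
  exact analyticAt_const.mul (Finset.analyticAt_fun_prod _ fun i _ => hM _ _)

include hb in
/-- Near a regular point, the solution set of finitely many analytic equations is an analytic graph
over `V`. -/
theorem IsComplementFrame.exists_param [CompleteSpace X] {v : κ → X → ℝ} {Ω : Set X}
    (hΩ : IsOpen Ω) (h0 : (0 : X) ∈ Ω) (hv : ∀ i, AnalyticOnNhd ℝ (v i) Ω)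
    (hdet : (constraintMatrix v b 0).det ≠ 0) :
    ∃ (U : Set V) (U' : Set X) (γ : V → X), IsOpen U ∧ 0 ∈ U ∧ IsOpen U' ∧ 0 ∈ U' ∧ U' ⊆ Ω ∧
      (∀ u ∈ U', (constraintMatrix v b u).det ≠ 0) ∧
      γ '' U = {u ∈ U' | ∀ i, v i u = v i 0} ∧ (∀ ρ ∈ U, γ ρ = ρ + ∑ k, l k (γ ρ) • b k) ∧
      AnalyticOnNhd ℝ γ U := by
  have hVc : IsClosed (V : Set X) := by
    have : (V : Set X) = ⋂ i, {u | l i u = 0} := by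
      ext u
      simp only [SetLike.mem_coe, hb.mem_iff, mem_iInter, mem_ofPred_eq]
    rw [this]
    exact isClosed_iInter fun i => isClosed_eq (l i).continuous continuous_const
  have : CompleteSpace V := hVc.completeSpace_coe
  -- the inverse function theorem for the projection together with the constraints
  set T : X → V × (κ → ℝ) := fun u => (hb.proj u, fun i => v i u - v i 0) with hT
  have hTa : AnalyticAt ℝ T 0 := (hb.proj.analyticAt 0).prod
    (AnalyticAt.pi fun i => (hv i 0 h0).sub analyticAt_const)
  have hTd : HasFDerivAt T (hb.equiv v hdet : X →L[ℝ] V × (κ → ℝ)) 0 := by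
    rw [hb.equiv_apply]
    exact hb.proj.hasFDerivAt.prodMk (hasFDerivAt_pi.2 fun i =>
      (hv i 0 h0).differentiableAt.hasFDerivAt.sub_const _)
  have hTc : ContDiffAt ℝ ω T 0 := hTa.contDiffAt
  set e := hTc.toOpenPartialHomeomorph T hTd (by simp) with he
  have hSa : AnalyticAt ℝ e.symm (T 0) :=
    (hTc.to_localInverse hTd (by simp)).analyticAt
  have heT : ∀ u, e u = T u := fun u => rfl
  have hT0 : T 0 = (0, 0) := Prod.ext (map_zero _) (funext fun i => sub_self _)
  set O : Set (V × (κ → ℝ)) := {y | AnalyticAt ℝ e.symm y} with hO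
  have hOo : IsOpen O := isOpen_analyticAt ℝ e.symm
  set Ω1 := Ω ∩ (fun u => (constraintMatrix v b u).det) ⁻¹' {0}ᶜ with hΩ1
  have hΩ1o : IsOpen Ω1 := ContinuousOn.isOpen_inter_preimage (fun u hu =>
    (analyticAt_det fun i j => analyticOnNhd_constraintMatrix hv i j u hu).continuousAt.continuousWithinAt)
    hΩ isOpen_compl_singleton
  set U' := e.source ∩ e ⁻¹' O ∩ Ω1 with hU'
  have hU'o : IsOpen U' := (e.isOpen_inter_preimage hOo).inter hΩ1o
  have h0U' : (0 : X) ∈ U' :=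
    ⟨⟨hTc.mem_toOpenPartialHomeomorph_source hTd (by simp), hSa⟩, h0, hdet⟩
  have hsub : U' ⊆ e.source := fun u hu => hu.1.1
  set ι : V → V × (κ → ℝ) := fun ρ => (ρ, 0) with hι
  have hιc : Continuous ι := by fun_prop
  have hUo : IsOpen (ι ⁻¹' (e '' U')) :=
    (e.isOpen_image_of_subset_source hU'o hsub).preimage hιc
  have key : ∀ ρ ∈ ι ⁻¹' (e '' U'), ∃ u ∈ U', e.symm (ι ρ) = u ∧ T u = ι ρ := by
    rintro ρ ⟨u, hu, hue⟩
    exact ⟨u, hu, by rw [← hue, e.left_inv (hsub hu)], hue⟩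
  refine ⟨ι ⁻¹' (e '' U'), U', fun ρ => e.symm (ι ρ), hUo, ⟨0, h0U', hT0⟩, hU'o, h0U',
    fun u hu => hu.2.1, fun u hu => hu.2.2, ?_, ?_, ?_⟩
  · ext u
    constructor
    · rintro ⟨ρ, hρ, rfl⟩
      obtain ⟨u, hu, h1, h2⟩ := key ρ hρ
      simp only [h1]
      refine ⟨hu, fun i => ?_⟩
      have := congrFun (congrArg Prod.snd h2) i
      exact sub_eq_zero.1 this
    · rintro ⟨hu, hui⟩
      have h1 : T u = ι (hb.proj u) := Prod.ext rfl (funext fun i => sub_eq_zero.2 (hui i))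
      refine ⟨hb.proj u, ⟨u, hu, h1⟩, ?_⟩
      simp only [← h1, ← heT]
      exact e.left_inv (hsub hu)
  · intro ρ hρ
    obtain ⟨u, hu, h1, h2⟩ := key ρ hρ
    have h3 : hb.proj u = ρ := congrArg Prod.fst h2
    simp only [h1]
    rw [← h3]
    exact hb.eq_add u
  · intro ρ hρ
    obtain ⟨u, hu, h1, h2⟩ := key ρ hρ
    have h3 : AnalyticAt ℝ e.symm (ι ρ) := by
      rw [← h2]; exact hu.1.2
    exact h3.comp (analyticAt_id.prod analyticAt_const)

/-- The derivative of a function along the parametrization of the constraint, with analytic Lagrange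
multipliers. -/
theorem IsComplementFrame.exists_multipliers [CompleteSpace X] {v : κ → X → ℝ} {U : Set V} {U' : Set X}
    {γ : V → X} (hU : IsOpen U) (hv : ∀ i, AnalyticOnNhd ℝ (v i) U')
    (hdet : ∀ u ∈ U', (constraintMatrix v b u).det ≠ 0)
    (hγU : ∀ ρ ∈ U, γ ρ ∈ U' ∧ ∀ i, v i (γ ρ) = v i 0)
    (hγ : ∀ ρ ∈ U, γ ρ = ρ + ∑ k, l k (γ ρ) • b k) (hγa : AnalyticOnNhd ℝ γ U)
    {a : X → ℝ} (ha : AnalyticOnNhd ℝ a U') :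
    ∃ c : κ → X → ℝ, (∀ i, AnalyticOnNhd ℝ (c i) U') ∧ ∀ ρ ∈ U, ∃ L : V →L[ℝ] ℝ,
      HasFDerivAt (fun σ => a (γ σ)) L ρ ∧
      ∀ σ : V, L σ = fderiv ℝ a (γ ρ) σ + ∑ i, c i (γ ρ) * fderiv ℝ (v i) (γ ρ) σ := by
  -- the multipliers make the combination vanish on the span of `b`
  refine ⟨fun i u => -((constraintMatrix v b u).det)⁻¹ * ∑ j, fderiv ℝ a u (b j)
    * (constraintMatrix v b u).adjugate j i, fun i u hu => ?_, fun ρ hρ => ?_⟩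
  · have hA := fun i j => analyticOnNhd_constraintMatrix (b := b) hv i j u hu
    refine ((analyticAt_det hA).inv (hdet u hu)).neg.mul
      (Finset.analyticAt_fun_sum _ fun j _ => AnalyticAt.mul
        (((ContinuousLinearMap.apply ℝ ℝ (b j)).analyticAt _).fun_comp (ha.fderiv u hu)) ?_)
    simp only [Matrix.adjugate_apply]
    refine analyticAt_det fun p q => ?_
    by_cases hp : p = i
    · subst hp
      simp only [Matrix.updateRow_self]
      exact analyticAt_const
    · simp only [Matrix.updateRow_ne hp]
      exact hA p q
  · obtain ⟨hγ', hvγ⟩ := hγU ρ hρ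
    have hγd := (hγa ρ hρ).differentiableAt.hasFDerivAt
    have had := (ha _ hγ').differentiableAt.hasFDerivAt
    refine ⟨_, had.comp ρ hγd, fun σ => ?_⟩
    set dγ := fderiv ℝ γ ρ with hdγ
    -- the derivative of the parametrization is the identity up to the span of `b`
    have h1 : dγ σ = σ + ∑ k, l k (dγ σ) • b k := by
      have h2 : HasFDerivAt (fun ρ : V => (ρ : X) + ∑ k, l k (γ ρ) • b k)
          (V.subtypeL + ∑ k, ((l k).comp dγ).smulRight (b k)) ρ :=
        V.subtypeL.hasFDerivAt.add (HasFDerivAt.fun_sum fun k _ =>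
          (((l k).hasFDerivAt.comp ρ hγd).smul_const (b k)))
      have h3 : HasFDerivAt γ (V.subtypeL + ∑ k, ((l k).comp dγ).smulRight (b k)) ρ :=
        h2.congr_of_eventuallyEq (by filter_upwards [hU.mem_nhds hρ] with ρ hρ using hγ ρ hρ)
      have h4 := congrArg (fun L : V →L[ℝ] X => L σ) (hγd.unique h3)
      simpa using h4
    have h5 : ∀ i, fderiv ℝ (v i) (γ ρ) (dγ σ) = 0 := by
      intro i
      have h6 : HasFDerivAt (fun ρ => v i (γ ρ)) ((fderiv ℝ (v i) (γ ρ)).comp dγ) ρ :=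
        ((hv i _ hγ').differentiableAt.hasFDerivAt).comp ρ hγd
      have h7 : HasFDerivAt (fun ρ => v i (γ ρ)) (0 : V →L[ℝ] ℝ) ρ :=
        (hasFDerivAt_const (v i 0) ρ).congr_of_eventuallyEq
          (by filter_upwards [hU.mem_nhds hρ] with ρ hρ using (hγU ρ hρ).2 i)
      exact congrArg (fun L : V →L[ℝ] ℝ => L σ) (h6.unique h7)
    set A := constraintMatrix v b (γ ρ) with hA
    set β : κ → ℝ := fun k => l k (dγ σ) with hβ
    have h8 : A *ᵥ β = fun i => -fderiv ℝ (v i) (γ ρ) σ := by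
      funext i
      have h9 := h5 i
      rw [h1] at h9
      simp only [map_add, map_sum, map_smul, smul_eq_mul] at h9
      simp only [Matrix.mulVec, dotProduct, hA, constraintMatrix, Matrix.of_apply, mul_comm _ (β _)]
      linarith
    have h10 : A.adjugate *ᵥ (fun i => -fderiv ℝ (v i) (γ ρ) σ) = A.det • β := by
      rw [← h8, Matrix.mulVec_mulVec, Matrix.adjugate_mul, Matrix.smul_mulVec, Matrix.one_mulVec]
    change fderiv ℝ a (γ ρ) (dγ σ) = _
    rw [h1]
    simp only [map_add, map_sum, map_smul, smul_eq_mul]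
    congr 1
    have hd := hdet _ hγ'
    have h11 : ∀ k, l k (dγ σ) = A.det⁻¹ * ∑ i, A.adjugate k i * (-fderiv ℝ (v i) (γ ρ) σ) := by
      intro k
      have := congrFun h10 k
      simp only [Matrix.mulVec, dotProduct, Pi.smul_apply, smul_eq_mul] at this
      rw [this, inv_mul_cancel_left₀ hd]
    simp only [h11, mul_sum, sum_mul]
    rw [Finset.sum_comm]
    refine sum_congr rfl fun i _ => sum_congr rfl fun k _ => ?_
    ring

end

/-! ### The complement of the space of admissible height functions -/

section

variable {n : ℕ} {m : ℕ}

instance Height.instCompleteSpace : CompleteSpace (Height n m) := by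
  have h : IsClosed (heightSpace n m : Set (Fin 3 → H n m)) :=
    (zeroTrace_isClosed n m).preimage (f := fun ρ : Fin 3 → H n m => (∑ i, LinearMap.proj (R := ℝ)
      (φ := fun _ : Fin 3 => H n m) i : (Fin 3 → H n m) →ₗ[ℝ] H n m) ρ) (by
        simp only [LinearMap.sum_apply, LinearMap.proj_apply]; fun_prop)
  exact h.completeSpace_coe

/-- Integration against a square integrable function as a continuous linear functional. -/
def H.integralMulL {h : E n → ℝ} (hm : MemLp h 2 (𝔪 n)) : H n m →L[ℝ] ℝ where
  toFun u := ∫ x, u.fn x * h x ∂𝔪 n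
  map_add' u v := by
    have hi (w : H n m) : Integrable (fun x => w.fn x * h x) (𝔪 n) :=
      (Lp.memLp _).integrable_mul hm
    rw [← integral_add (hi u) (hi v)]
    refine integral_congr_ae ?_
    filter_upwards [H.fn_add u v] with x hx
    rw [hx, Pi.add_apply, add_mul]
  map_smul' c u := by
    rw [smul_eq_mul, RingHom.id_apply, ← integral_const_mul]
    refine integral_congr_ae ?_
    filter_upwards [H.fn_smul c u] with x hx
    rw [hx, Pi.smul_apply, smul_eq_mul, mul_assoc]
  cont := (continuous_integral_mul_Lp hm).comp
    ((PiLp.continuous_apply 2 _ _).comp continuous_subtype_val)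

namespace ReferenceCluster

variable (D : ReferenceCluster n)

/-- The integral over a reference surface as a continuous linear functional. -/
def refIntegralL (i : Fin 3) : H n m →L[ℝ] ℝ :=
  H.integralMulL (memLp_of_continuousOn (D.continuousOn_areaDensity i))

theorem exists_third : ∃ i₀, (∀ j, D.s j ≠ i₀) ∧ ∀ i, i = i₀ ∨ ∃ j, D.s j = i := by
  have key : ∀ a b : Fin 3, a ≠ b → ∃ c, (a ≠ c ∧ b ≠ c) ∧ ∀ i, i = c ∨ a = i ∨ b = i := by decide
  obtain ⟨c, h1, h2⟩ := key (D.s 0) (D.s 1) (D.s_injective.ne (by decide))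
  refine ⟨c, fun j => ?_, fun i => (h2 i).imp_right ?_⟩
  · fin_cases j
    exacts [h1.1, h1.2]
  · rintro (h | h)
    exacts [⟨0, h⟩, ⟨1, h⟩]

variable [NeZero n]

theorem exists_bump (hm : n < 2 * m) (j : Fin 2) : ∃ b : Height n m,
    ∀ i, EqOn (b.1 i).contRep (fun x => if D.s j = i then D.f j x else 0) (𝔹 n) := by
  obtain ⟨F, hF⟩ := H.exists_contRep_eq hm (D.f_smooth j).contDiffOn
  have h0 : F ∈ zeroTrace n m := by
    rw [mem_zeroTrace_iff hm]
    intro x hx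
    rw [hF (sphere_subset_closedBall hx)]
    refine image_eq_zero_of_notMem_tsupport fun h => ?_
    have := D.f_support j h
    rw [mem_ball_zero_iff, mem_sphere_zero_iff_norm.1 hx] at this
    exact lt_irrefl _ this
  refine ⟨⟨fun i => if D.s j = i then F else 0, ?_⟩, fun i x hx => ?_⟩
  · simpa [heightSpace] using h0
  · by_cases h : D.s j = i
    · simp only [h, if_true]; exact hF hx
    · simp only [h, if_false]; exact H.contRep_zero hm hx

/-- The bump functions as triples of height functions. -/
def bump (hm : n < 2 * m) (j : Fin 2) : Height n m := (D.exists_bump hm j).choose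

theorem contRep_bump (hm : n < 2 * m) (j : Fin 2) (i : Fin 3) :
    EqOn ((D.bump hm j).1 i).contRep (fun x => if D.s j = i then D.f j x else 0) (𝔹 n) :=
  (D.exists_bump hm j).choose_spec i

theorem fn_bump (hm : n < 2 * m) (j : Fin 2) (i : Fin 3) :
    ((D.bump hm j).1 i).fn =ᵐ[𝔪 n] fun x => if D.s j = i then D.f j x else 0 :=
  (H.contRep_spec hm _).2.trans (ae_eq_of_eqOn_closedBall (D.contRep_bump hm j i))

theorem refIntegral_bump (hm : n < 2 * m) (j : Fin 2) (i : Fin 3) :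
    D.refIntegral i ((D.bump hm j).1 i).fn = if D.s j = i then 1 else 0 := by
  have h1 : D.refIntegral i ((D.bump hm j).1 i).fn
      = ∫ x, (if D.s j = i then D.f j x else 0) * areaDensity (D.φ i) x ∂𝔪 n := by
    refine integral_congr_ae ?_
    filter_upwards [D.fn_bump hm j i] with x hx
    rw [hx]
  rw [h1]
  split_ifs with h
  · rw [← h]; exact D.f_integral j
  · simp

/-- The bump functions span a complement of the space `V`. -/
theorem exists_isComplementFrame (hm : n < 2 * m) :
    ∃ l : Fin 2 → Height n m →L[ℝ] ℝ, IsComplementFrame (D.V m) (D.bump hm) l := by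
  obtain ⟨i₀, h1, h2⟩ := D.exists_third
  refine ⟨fun j => (D.refIntegralL (D.s j)).comp (Height.comp (D.s j))
    - (D.refIntegralL i₀).comp (Height.comp i₀), fun i j => ?_, fun u => ?_⟩
  · change D.refIntegral (D.s i) ((D.bump hm j).1 (D.s i)).fn
      - D.refIntegral i₀ ((D.bump hm j).1 i₀).fn = _
    rw [refIntegral_bump, refIntegral_bump, if_neg (h1 j), sub_zero]
    simp only [D.s_injective.eq_iff, eq_comm]
  · constructor
    · intro h j
      exact sub_eq_zero.2 (h (D.s j) i₀)
    · intro h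
      have h3 : ∀ i, D.refIntegral i (u.1 i).fn = D.refIntegral i₀ (u.1 i₀).fn := by
        intro i
        rcases h2 i with rfl | ⟨j, rfl⟩
        · rfl
        · exact sub_eq_zero.1 (h j)
      exact fun i j => (h3 i).trans (h3 j).symm

end ReferenceCluster

end

/-! ### Functionals with derivatives in `W` -/

section

variable {n : ℕ} [NeZero n] {k : ℕ}

/-- The integral over the ball as a continuous linear functional. -/
def H.integralL (k : ℕ) : H n k →L[ℝ] ℝ := H.integralMulL (h := fun _ => 1) (memLp_const 1)

theorem H.integralL_apply (hk : n < 2 * k) {u : H n k} {f : E n → ℝ}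
    (h : EqOn u.contRep f (𝔹 n)) : H.integralL k u = ∫ x, f x ∂𝔪 n :=
  integral_congr_ae (((H.contRep_spec hk u).2.trans (ae_eq_of_eqOn_closedBall h)).mono fun x hx => by
    simp only [hx, mul_one])

/-- An analytic functional on the space of height functions whose derivative is of the form
`σ ↦ ∑_a ∫_B P_a Λ_a σ`, where `Λ_a σ` are the components of `σ` and their first derivatives, and the
coefficients `P_a` depend analytically on the point. -/
def HasLocalDeriv (hk1 : n < 2 * (k + 1)) (U : Set (Height n (k + 2)))
    (I : Height n (k + 2) → ℝ) : Prop :=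
  AnalyticOnNhd ℝ I U ∧ ∃ P : Height n (k + 2) → Fin 3 × Option (Fin n) → H n (k + 1),
    AnalyticOnNhd ℝ P U ∧ ∀ ρ ∈ U, ∀ σ,
      fderiv ℝ I ρ σ = ∑ a, H.integralL (k + 1) (H.mul hk1 (P ρ a) (jet a σ))

variable {hk1 : n < 2 * (k + 1)} {U U' : Set (Height n (k + 2))} {I : Height n (k + 2) → ℝ}

theorem HasLocalDeriv.mono (h : HasLocalDeriv hk1 U I) (hU : U' ⊆ U) : HasLocalDeriv hk1 U' I := by
  obtain ⟨h1, P, h2, h3⟩ := h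
  exact ⟨h1.mono hU, P, h2.mono hU, fun ρ hρ => h3 ρ (hU hρ)⟩

/-- Integrals of local expressions in the height functions and their first derivatives have
local derivatives. -/
theorem hasLocalDeriv_of_integral (hU : IsOpen U) {q : Height n (k + 2) → E n → ℝ}
    (hq : q ∈ jetAlg hk1 U) (hI : ∀ ρ ∈ U, I ρ = ∫ x, q ρ x ∂𝔪 n) :
    HasLocalDeriv hk1 U I := by
  obtain ⟨F, ⟨hF, P, hP, hFP⟩, hFq⟩ := hq
  have hloc : ∀ ρ ∈ U, (fun ρ => H.integralL (k + 1) (F ρ)) =ᶠ[𝓝 ρ] I := fun ρ hρ => by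
    filter_upwards [hU.mem_nhds hρ] with ρ' hρ'
    rw [hI ρ' hρ', H.integralL_apply hk1 (hFq ρ' hρ')]
  refine ⟨fun ρ hρ => (((H.integralL (k + 1)).analyticAt _).fun_comp (hF ρ hρ)).congr (hloc ρ hρ),
    fun ρ a => P a ρ, fun ρ hρ => AnalyticAt.pi fun a => hP a ρ hρ, fun ρ hρ σ => ?_⟩
  rw [← (hloc ρ hρ).fderiv_eq]
  have h1 := ((H.integralL (k + 1)).hasFDerivAt.comp ρ (hF ρ hρ).differentiableAt.hasFDerivAt).fderiv
  have h2 : fderiv ℝ (fun ρ => H.integralL (k + 1) (F ρ)) ρ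
      = (H.integralL (k + 1)).comp (fderiv ℝ F ρ) := h1
  rw [h2, ContinuousLinearMap.comp_apply, hFP ρ hρ, map_sum]

theorem integrable_of_mem_jetAlg {q : Height n (k + 2) → E n → ℝ} (hq : q ∈ jetAlg hk1 U)
    {ρ : Height n (k + 2)} (hρ : ρ ∈ U) : Integrable (q ρ) (𝔪 n) := by
  obtain ⟨F, -, hFq⟩ := hq
  exact (F ρ).integrable_fn.congr
    ((H.contRep_spec hk1 _).2.trans (ae_eq_of_eqOn_closedBall (hFq ρ hρ)))

theorem hasLocalDeriv_sum_integral {ι : Type*} (s : Finset ι) (hU : IsOpen U)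
    {q : ι → Height n (k + 2) → E n → ℝ} (hq : ∀ i ∈ s, q i ∈ jetAlg hk1 U) :
    HasLocalDeriv hk1 U fun ρ => ∑ i ∈ s, ∫ x, q i ρ x ∂𝔪 n := by
  refine hasLocalDeriv_of_integral hU (sum_mem hq) fun ρ hρ => ?_
  rw [← integral_finsetSum _ fun i hi => integrable_of_mem_jetAlg (hq i hi) hρ]
  refine integral_congr_ae (.of_forall fun x => ?_)
  simp

omit [NeZero n] in
theorem map_add_sum_smul {P κ : Type*} [NormedAddCommGroup P] [NormedSpace ℝ P] [Fintype κ]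
    (Φ : P →L[ℝ] ℝ) (p : P) (c : κ → ℝ) (g : κ → P) :
    Φ (p + ∑ i, c i • g i) = Φ p + ∑ i, c i * Φ (g i) := by simp

omit [NeZero n] in
theorem analyticOnNhd_clm_add_sum {X Y P Z κ : Type*} [NormedAddCommGroup X] [NormedSpace ℝ X]
    [NormedAddCommGroup Y] [NormedSpace ℝ Y] [NormedAddCommGroup P] [NormedSpace ℝ P]
    [NormedAddCommGroup Z] [NormedSpace ℝ Z] [Fintype κ] (R : P →L[ℝ] Z) {S : Set X} {S' : Set Y}
    {γ : X → Y} {f : Y → P} {c : κ → Y → ℝ} {g : κ → Y → P} (hγ : AnalyticOnNhd ℝ γ S)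
    (hS : ∀ x ∈ S, γ x ∈ S') (hf : AnalyticOnNhd ℝ f S') (hc : ∀ i, AnalyticOnNhd ℝ (c i) S')
    (hg : ∀ i, AnalyticOnNhd ℝ (g i) S') :
    AnalyticOnNhd ℝ (fun x => R (f (γ x) + ∑ i, c i (γ x) • g i (γ x))) S := fun x hx =>
  (R.analyticAt _).fun_comp (AnalyticAt.fun_comp (g := fun u => f u + ∑ i, c i u • g i u)
    ((hf _ (hS x hx)).add (Finset.analyticAt_fun_sum _ fun i _ =>
      (hc i _ (hS x hx)).smul (hg i _ (hS x hx)))) (hγ x hx))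

theorem exists_pairing_clm (hk : n < 2 * k) (hk1 : n < 2 * (k + 1)) (D : ReferenceCluster n) :
    ∃ (R : (Fin 3 × Option (Fin n) → H n (k + 1)) →L[ℝ] ReferenceCluster.W n (k + 2))
      (Φ : D.V (k + 2) → (Fin 3 × Option (Fin n) → H n (k + 1)) →L[ℝ] ℝ),
        (∀ P σ, D.pairing (R P) σ = Φ σ P) ∧
        ∀ P σ, Φ σ P = ∑ a, H.integralL (k + 1) (H.mul hk1 (P a) (jet a σ.1)) := by
  obtain ⟨R, hR⟩ := exists_pairing_eq hk D
  refine ⟨R, fun σ => ∑ a, (H.integralL (k + 1)).comp (((H.mul hk1).flip (jet a σ.1)).comp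
    (ContinuousLinearMap.proj a)), fun P σ => ?_, fun P σ => ?_⟩
  · rw [← hR, sum_apply]
    exact sum_congr rfl fun a _ =>
      (H.integralL_apply hk1 (H.contRep_mul hk1 (P a) (jet a σ.1))).symm
  · rw [sum_apply]
    rfl

theorem fn_add_sum_bump {m : ℕ} (hm : n < 2 * m) (D : ReferenceCluster n) (ρ : Height n m)
    (c : Fin 2 → ℝ) (i : Fin 3) : ((ρ + ∑ j, c j • D.bump hm j).1 i).fn =ᵐ[𝔪 n]
      fun x => (ρ.1 i).fn x + ∑ j, if D.s j = i then c j * D.f j x else 0 := by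
  have h1 : (ρ + ∑ j, c j • D.bump hm j).1 i = ρ.1 i + ∑ j, c j • (D.bump hm j).1 i := by
    have := map_add (Height.comp i) ρ (∑ j, c j • D.bump hm j)
    simp only [map_sum, map_smul] at this
    exact this
  rw [h1]
  filter_upwards [(H.contRep_spec hm (ρ.1 i + ∑ j, c j • (D.bump hm j).1 i)).2,
    (H.contRep_spec hm (ρ.1 i)).2, ae_restrict_mem measurableSet_ball] with x e1 e2 hx
  have hx' := ball_subset_closedBall hx
  rw [e1, e2, ← H.eval_apply hm hx', ← H.eval_apply hm hx', map_add, map_sum]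
  congr 1
  refine sum_congr rfl fun j _ => ?_
  rw [map_smul, H.eval_apply, D.contRep_bump hm j i hx']
  simp

set_option maxHeartbeats 1000000 in
/-- The volume constraints can be parametrized over `V`, and the derivative of the area along this
parametrization is represented by an element of `W`. -/
theorem exists_volume_param (hk : n < 2 * k) (hk2 : n < 2 * (k + 2)) {D : ReferenceCluster n}
    (h : IsRegularNhd hk1 D U) {v : Fin 2 → Height n (k + 2) → ℝ}
    (hv : ∀ j, HasLocalDeriv hk1 U (v j))
    (hvol : ∀ u ∈ U, D.VolumeConstraint u ↔ ∀ j, v j u = v j 0)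
    (hdet : (constraintMatrix v (D.bump hk2) 0).det ≠ 0) :
    ∃ (Ω : Set (D.V (k + 2))) (U' : Set (Height n (k + 2))), IsOpen Ω ∧ 0 ∈ Ω ∧ IsOpen U' ∧ 0 ∈ U' ∧
      U' ⊆ U ∧ ∃ γ : D.V (k + 2) → Height n (k + 2), D.IsVolumeParametrization Ω U' γ ∧
      AnalyticOnNhd ℝ γ Ω ∧ ∃ dE : D.V (k + 2) → ReferenceCluster.W n (k + 2),
      AnalyticOnNhd ℝ dE Ω ∧ ∀ ρ ∈ Ω, ∃ L : D.V (k + 2) →L[ℝ] ℝ,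
        HasFDerivAt (fun σ => D.area (γ σ)) L ρ ∧ ∀ σ, L σ = D.pairing (dE ρ) σ := by
  obtain ⟨l, hl⟩ := D.exists_isComplementFrame hk2
  obtain ⟨Ω, U', γ, hΩ, h0Ω, hU', h0U', hUU', hdet', hγim, hγ, hγa⟩ :=
    hl.exists_param h.isOpen h.zero_mem (fun i => (hv i).1) hdet
  have hγU : ∀ ρ ∈ Ω, γ ρ ∈ U' ∧ ∀ i, v i (γ ρ) = v i 0 := fun ρ hρ => by
    have h1 : γ ρ ∈ γ '' Ω := mem_image_of_mem γ hρ
    rw [hγim] at h1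
    exact h1
  have hv' := fun i => (hv i).mono hUU'
  have hA : HasLocalDeriv hk1 U' D.area :=
    (hasLocalDeriv_sum_integral Finset.univ h.isOpen fun i _ => h.area_mem i).mono hUU'
  obtain ⟨hA1, PA, hPA, hPAd⟩ := hA
  obtain ⟨c, hc, hcL⟩ := IsComplementFrame.exists_multipliers hΩ (fun i => (hv' i).1) hdet' hγU hγ
    hγa hA1
  choose Pv hPv hPvd using fun i => (hv' i).2
  obtain ⟨R, Φ, hΦ, hΦP⟩ := exists_pairing_clm hk hk1 D
  refine ⟨Ω, U', hΩ, h0Ω, hU', h0U', hUU', γ, ⟨fun ρ hρ => ⟨fun j => l j (γ ρ), fun i => ?_⟩, ?_⟩, hγa,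
    fun ρ => R (PA (γ ρ) + ∑ i, c i (γ ρ) • Pv i (γ ρ)),
    analyticOnNhd_clm_add_sum R hγa (fun ρ hρ => (hγU ρ hρ).1) hPA hc hPv, fun ρ hρ => ?_⟩
  · have h1 := fn_add_sum_bump hk2 D ρ.1 (fun j => l j (γ ρ)) i
    rwa [← hγ ρ hρ] at h1
  · rw [hγim]
    ext u
    exact and_congr_right fun hu => (hvol u (hUU' hu)).symm
  · obtain ⟨hγ', -⟩ := hγU ρ hρ
    obtain ⟨L, hL, hLσ⟩ := hcL ρ hρ
    refine ⟨L, hL, fun σ => ?_⟩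
    have e2 : fderiv ℝ D.area (γ ρ) σ = Φ σ (PA (γ ρ)) := (hPAd _ hγ' σ).trans (hΦP _ σ).symm
    have e3 : ∀ i, fderiv ℝ (v i) (γ ρ) σ = Φ σ (Pv i (γ ρ)) := fun i =>
      (hPvd i _ hγ' σ).trans (hΦP _ σ).symm
    exact (hLσ σ).trans ((congrArg₂ (· + ·) e2 (sum_congr rfl fun i _ =>
      congrArg _ (e3 i))).trans ((map_add_sum_smul (Φ σ) _ _ _).symm.trans (hΦ _ σ).symm))

end

section

/-! ### Surfaces that are star-shaped about the origin -/

variable {n : ℕ}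

/-- The two surfaces `Y 0`, `Y 1` have the same boundary values, and every ray that starts at the
origin meets their union in exactly one point. -/
structure IsStarSurface (Y : Fin 2 → E n → E (n + 1)) : Prop where
  continuousOn : ∀ i, ContinuousOn (Y i) (𝔹 n)
  boundary : ∀ x ∈ 𝕊 n, ∀ i j, Y i x = Y j x
  cover : ∀ q, q ≠ 0 → ∃ s : ℝ, 0 < s ∧ ∃ i, ∃ x ∈ 𝔹 n, q = s • Y i x
  unique : ∀ i j, ∀ x ∈ 𝔹 n, ∀ x' ∈ 𝔹 n, ∀ s s' : ℝ, 0 < s →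
    0 < s' → s • Y i x = s' • Y j x' → s = s' ∧ x = x' ∧ (i = j ∨ x ∈ 𝕊 n)

namespace IsStarSurface

variable {Y : Fin 2 → E n → E (n + 1)} (hY : IsStarSurface Y)

include hY

theorem ne_zero (i : Fin 2) {x : E n} (hx : x ∈ 𝔹 n) : Y i x ≠ 0 := by
  intro h
  have := (hY.unique i i x hx x hx 1 2 one_pos two_pos (by simp [h])).1
  norm_num at this

/-- The part of a cone over the surface that is cut out by a closed condition on the scaling factor
is closed: the condition `q = s • y` with `s ≥ 0` says `‖y‖ q = ‖q‖ y` and `s = ‖q‖ / ‖y‖`. -/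
theorem isClosed_cone (i : Fin 2) {I : Set ℝ} (hI : IsClosed I) (h0 : I ⊆ Ici 0) :
    IsClosed {q | ∃ x ∈ 𝔹 n, ∃ s ∈ I, q = s • Y i x} := by
  have : CompactSpace (𝔹 n) := isCompact_iff_compactSpace.1 (isCompact_closedBall _ _)
  have hZ : Continuous fun p : 𝔹 n × E (n + 1) => Y i p.1 :=
    ((hY.continuousOn i).comp_continuous continuous_subtype_val fun x => x.2).comp continuous_fst
  have hne : ∀ p : 𝔹 n × E (n + 1), ‖Y i p.1‖ ≠ 0 := fun p =>
    norm_ne_zero_iff.2 (hY.ne_zero i p.1.2)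
  have hc : IsClosed {p : 𝔹 n × E (n + 1) |
      ‖Y i p.1‖ • p.2 = ‖p.2‖ • Y i p.1 ∧ ‖p.2‖ / ‖Y i p.1‖ ∈ I} :=
    (isClosed_eq (hZ.norm.smul continuous_snd) (continuous_snd.norm.smul hZ)).inter
      (hI.preimage (continuous_snd.norm.div hZ.norm hne))
  convert isClosedMap_snd_of_compactSpace _ hc using 1
  ext q
  constructor
  · rintro ⟨x, hx, s, hs, rfl⟩
    have h := hne (⟨x, hx⟩, 0)
    have e : ‖s • Y i x‖ = s * ‖Y i x‖ := by
      rw [norm_smul, Real.norm_of_nonneg (h0 hs)]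
    refine ⟨(⟨x, hx⟩, s • Y i x), ⟨?_, ?_⟩, rfl⟩
    · simp only [e, smul_smul, mul_comm]
    · simpa only [e, mul_div_cancel_right₀ _ h] using hs
  · rintro ⟨⟨x, q'⟩, ⟨h, hs⟩, rfl⟩
    exact ⟨x, x.2, _, hs, by rw [div_eq_inv_mul, mul_smul, ← h, inv_smul_smul₀ (hne (x, 0))]⟩

/-- The open set enclosed by a star-shaped surface. -/
theorem enclosed_eq : enclosed (Y 0 '' 𝔹 n ∪ Y 1 '' 𝔹 n)
    = {q | ∃ i, ∃ x ∈ 𝔹 n, ∃ s : ℝ, 0 ≤ s ∧ s < 1 ∧ q = s • Y i x} := by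
  set S := Y 0 '' 𝔹 n ∪ Y 1 '' 𝔹 n with hS
  set A := {q | ∃ i, ∃ x ∈ 𝔹 n, ∃ s : ℝ, 0 ≤ s ∧ s < 1 ∧ q = s • Y i x} with hA
  set B := {q | ∃ i, ∃ x ∈ 𝔹 n, ∃ s : ℝ, 1 < s ∧ q = s • Y i x} with hB
  have hmemS : ∀ q, q ∈ S ↔ ∃ i, ∃ x ∈ 𝔹 n, q = Y i x := by
    intro q
    simp only [hS, mem_union, mem_image, Fin.exists_fin_two, eq_comm]
  have h0 : (0 : E (n + 1)) ∈ A :=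
    ⟨0, 0, mem_closedBall_self zero_le_one, 0, le_rfl, zero_lt_one, (zero_smul _ _).symm⟩
  -- the factor by which a point is scaled is determined by the point
  have huniq : ∀ i j, ∀ x ∈ 𝔹 n, ∀ x' ∈ 𝔹 n, ∀ s s' : ℝ,
      0 ≤ s → 0 < s' → s • Y i x = s' • Y j x' → s = s' := by
    intro i j x hx x' hx' s s' hs hs' h
    rcases hs.eq_or_lt with rfl | hs
    · rw [zero_smul] at h
      exact absurd h.symm (smul_ne_zero hs'.ne' (hY.ne_zero j hx'))
    · exact (hY.unique i j x hx x' hx' s s' hs hs' h).1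
  have hcov : ∀ q, q ∈ A ∨ q ∈ S ∨ q ∈ B := by
    intro q
    by_cases hq : q = 0
    · exact Or.inl (hq ▸ h0)
    · obtain ⟨s, hs, i, x, hx, rfl⟩ := hY.cover q hq
      rcases lt_trichotomy s 1 with h | rfl | h
      · exact Or.inl ⟨i, x, hx, s, hs.le, h, rfl⟩
      · exact Or.inr (Or.inl ((hmemS _).2 ⟨i, x, hx, one_smul _ _⟩))
      · exact Or.inr (Or.inr ⟨i, x, hx, s, h, rfl⟩)
  have hAS : ∀ q ∈ A, q ∉ S := by
    rintro q ⟨i, x, hx, s, hs, hs1, rfl⟩ hq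
    obtain ⟨j, x', hx', h⟩ := (hmemS _).1 hq
    exact hs1.ne (huniq i j x hx x' hx' s 1 hs one_pos (by rw [h, one_smul]))
  have hBS : ∀ q ∈ B, q ∉ S := by
    rintro q ⟨i, x, hx, s, hs, rfl⟩ hq
    obtain ⟨j, x', hx', h⟩ := (hmemS _).1 hq
    exact hs.ne' (huniq i j x hx x' hx' s 1 (by linarith) one_pos (by rw [h, one_smul]))
  have hAB : Disjoint A B := by
    rw [Set.disjoint_left]
    rintro q ⟨i, x, hx, s, hs, hs1, rfl⟩ ⟨j, x', hx', s', hs', h⟩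
    have := huniq i j x hx x' hx' s s' hs (by linarith) h
    linarith
  have hAo : IsOpen A := by
    convert (isClosed_iUnion_of_finite fun i => hY.isClosed_cone i isClosed_Ici
      (Ici_subset_Ici.2 zero_le_one)).isOpen_compl using 1
    ext q
    simp only [mem_compl_iff, mem_iUnion, mem_ofPred_eq]
    constructor
    · rintro ⟨i, x, hx, s, hs, hs1, rfl⟩ ⟨j, x', hx', s', hs', h⟩
      have hs' : 1 ≤ s' := hs'
      linarith [huniq i j x hx x' hx' s s' hs (by linarith) h]
    · intro h
      rcases hcov q with h' | h' | ⟨i, x, hx, s, hs, hq⟩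
      · exact h'
      · obtain ⟨i, x, hx, hq⟩ := (hmemS _).1 h'
        exact absurd ⟨i, x, hx, 1, self_mem_Ici, by rw [hq, one_smul]⟩ h
      · exact absurd ⟨i, x, hx, s, hs.le, hq⟩ h
  have hBo : IsOpen B := by
    convert (isClosed_iUnion_of_finite fun i => hY.isClosed_cone i isClosed_Icc
      (Icc_subset_Ici_self (a := (1 : ℝ)) (b := 0))).isOpen_compl using 1
    ext q
    simp only [mem_compl_iff, mem_iUnion, mem_ofPred_eq]
    constructor
    · rintro ⟨i, x, hx, s, hs, rfl⟩ ⟨j, x', hx', s', hs', h⟩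
      linarith [huniq j i x' hx' x hx s' s hs'.1 (by linarith) h.symm, hs'.2]
    · intro h
      rcases hcov q with ⟨i, x, hx, s, hs, hs1, hq⟩ | h' | h'
      · exact absurd ⟨i, x, hx, s, ⟨hs, hs1.le⟩, hq⟩ h
      · obtain ⟨i, x, hx, hq⟩ := (hmemS _).1 h'
        exact absurd ⟨i, x, hx, 1, ⟨zero_le_one, le_rfl⟩, by rw [hq, one_smul]⟩ h
      · exact h'
  have hAb : Bornology.IsBounded A := by
    choose C hC using fun i =>
      (isCompact_closedBall (0 : E n) 1).exists_bound_of_continuousOn (hY.continuousOn i)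
    refine (isBounded_iff_forall_norm_le).2 ⟨max (C 0) (C 1), ?_⟩
    rintro q ⟨i, x, hx, s, hs, hs1, rfl⟩
    rw [norm_smul, Real.norm_eq_abs, abs_of_nonneg hs]
    refine (mul_le_of_le_one_left (norm_nonneg _) hs1.le).trans ((hC i x hx).trans ?_)
    fin_cases i
    exacts [le_max_left _ _, le_max_right _ _]
  ext q
  constructor
  · rintro ⟨hqS, hqb⟩
    rcases hcov q with h | h | ⟨i, x, hx, s, hs, rfl⟩
    · exact h
    · exact absurd h hqS
    · -- outside, the component of a point contains an unbounded ray
      exfalso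
      set L : Set (E (n + 1)) := (fun t : ℝ => t • Y i x) '' Ici s with hL
      have hLc : IsPreconnected L := isPreconnected_Ici.image _ (by fun_prop)
      have hLS : L ⊆ Sᶜ := by
        rintro _ ⟨t, ht, rfl⟩
        exact hBS _ ⟨i, x, hx, t, hs.trans_le ht, rfl⟩
      have hsub := hLc.subset_connectedComponentIn (mem_image_of_mem _ self_mem_Ici) hLS
      obtain ⟨C, hC⟩ := isBounded_iff_forall_norm_le.1 (hqb.subset hsub)
      have hpos := norm_pos_iff.2 (hY.ne_zero i hx)
      have h2 := hC ((max s (C / ‖Y i x‖ + 1)) • Y i x) (mem_image_of_mem (fun t : ℝ => t • Y i x) (mem_Ici.2 (le_max_left _ _)))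
      rw [norm_smul, Real.norm_eq_abs, abs_of_pos (lt_max_of_lt_left (by linarith))] at h2
      have h3 : (C / ‖Y i x‖ + 1) * ‖Y i x‖ ≤ max s (C / ‖Y i x‖ + 1) * ‖Y i x‖ :=
        mul_le_mul_of_nonneg_right (le_max_right _ _) hpos.le
      rw [add_mul, div_mul_cancel₀ _ hpos.ne'] at h3
      linarith
  · intro hq
    refine ⟨hAS q hq, hAb.subset ?_⟩
    have hcompl : connectedComponentIn Sᶜ q ⊆ A ∪ B :=
      (connectedComponentIn_subset _ _).trans fun p hp => by
        rcases hcov p with h | h | h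
        exacts [Or.inl h, absurd h hp, Or.inr h]
    exact isPreconnected_connectedComponentIn.subset_left_of_subset_union hAo hBo hAB hcompl
      ⟨q, mem_connectedComponentIn (hAS q hq), hq⟩

/-- Different points of a regular star-shaped surface lie on quantitatively different rays. -/
theorem exists_bound {i : Fin 2} (hd : ContDiffOn ℝ 1 (Y i) (𝔹 n))
    (hinj : ∀ x ∈ 𝔹 n, ∀ (h : E n) (t : ℝ),
      fderivWithin ℝ (Y i) (𝔹 n) x h + t • Y i x = 0 → h = 0 ∧ t = 0) :
    ∃ c : ℝ, 0 < c ∧ ∀ x ∈ 𝔹 n, ∀ x' ∈ 𝔹 n, ∀ t ∈ Icc (0 : ℝ) 1,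
      c * (‖x - x'‖ + |1 - t|) ≤ ‖Y i x - t • Y i x'‖ := by
  set cb := 𝔹 n with hcb
  set C := cb ×ˢ cb ×ˢ Icc (0 : ℝ) 1 with hC
  let P : Set (E n × E n × ℝ) → Prop := fun S => ∃ c : ℝ, 0 < c ∧ ∀ p ∈ S,
    c * (‖p.1 - p.2.1‖ + |1 - p.2.2|) ≤ ‖Y i p.1 - p.2.2 • Y i p.2.1‖
  suffices P C by
    obtain ⟨c, hc, h⟩ := this
    exact ⟨c, hc, fun x hx x' hx' t ht => h (x, x', t) ⟨hx, hx', ht⟩⟩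
  refine ((isCompact_closedBall _ _).prod ((isCompact_closedBall _ _).prod isCompact_Icc)
    : IsCompact C).induction_on (p := P) ⟨1, one_pos, fun p hp => hp.elim⟩ ?_ ?_ ?_
  · rintro S T hST ⟨c, hc, h⟩
    exact ⟨c, hc, fun p hp => h p (hST hp)⟩
  · rintro S T ⟨c, hc, h⟩ ⟨c', hc', h'⟩
    refine ⟨min c c', lt_min hc hc', ?_⟩
    rintro p (hp | hp)
    · exact (mul_le_mul_of_nonneg_right (min_le_left _ _) (by positivity)).trans (h p hp)
    · exact (mul_le_mul_of_nonneg_right (min_le_right _ _) (by positivity)).trans (h' p hp)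
  · rintro ⟨x₀, x₀', t₀⟩ ⟨hx₀, hx₀', ht₀⟩
    suffices ∃ c : ℝ, 0 < c ∧ ∀ᶠ p in 𝓝[C] (x₀, x₀', t₀),
        c * (‖p.1 - p.2.1‖ + |1 - p.2.2|) ≤ ‖Y i p.1 - p.2.2 • Y i p.2.1‖ by
      obtain ⟨c, hc, h⟩ := this
      exact ⟨_, h, c, hc, fun p hp => hp⟩
    have hYc := hY.continuousOn i
    have t1 : Tendsto (fun p : E n × E n × ℝ => p.1) (𝓝[C] (x₀, x₀', t₀)) (𝓝[cb] x₀) :=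
      continuous_fst.continuousWithinAt.tendsto_nhdsWithin fun p hp => hp.1
    have t2 : Tendsto (fun p : E n × E n × ℝ => p.2.1) (𝓝[C] (x₀, x₀', t₀)) (𝓝[cb] x₀') :=
      continuous_snd.fst.continuousWithinAt.tendsto_nhdsWithin fun p hp => hp.2.1
    have t3 : Tendsto (fun p : E n × E n × ℝ => p.2.2) (𝓝[C] (x₀, x₀', t₀)) (𝓝 t₀) :=
      continuous_snd.snd.continuousWithinAt
    have y1 := (hYc x₀ hx₀).tendsto.comp t1
    have y2 := (hYc x₀' hx₀').tendsto.comp t2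
    by_cases he : Y i x₀ = t₀ • Y i x₀'
    · -- near the diagonal, the derivative decides
      have ht₀0 : 0 < t₀ := by
        refine ht₀.1.lt_of_ne fun h => hY.ne_zero i hx₀ ?_
        have h : 0 = t₀ := h
        rw [he, ← h, zero_smul]
      obtain ⟨h1, h2, -⟩ := hY.unique i i x₀ hx₀ x₀' hx₀' 1 t₀ one_pos ht₀0 (by rw [one_smul, he])
      subst h1 h2
      set L := fderivWithin ℝ (Y i) cb x₀ with hL
      let M : E n × ℝ →L[ℝ] E (n + 1) := L.coprod (ContinuousLinearMap.toSpanSingleton ℝ (Y i x₀))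
      obtain ⟨K, hK0, hM⟩ : ∃ K > 0, AntilipschitzWith K M := by
        refine LinearMap.exists_antilipschitzWith (M : E n × ℝ →ₗ[ℝ] E (n + 1)) ?_
        rw [LinearMap.ker_eq_bot']
        rintro ⟨h, t⟩ hm
        obtain ⟨rfl, rfl⟩ := hinj x₀ hx₀ h t (by simpa [M] using hm)
        rfl
      have hKr : (0 : ℝ) < K := hK0
      have hML : ∀ (h : E n) (t : ℝ), ‖h‖ + |t| ≤ 2 * K * ‖L h + t • Y i x₀‖ := by
        intro h t
        have h3 := hM.le_mul_norm (map_zero M) (h, t)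
        have h4 : M (h, t) = L h + t • Y i x₀ := by simp [M]
        rw [h4] at h3
        have h5 : ‖h‖ ≤ ‖(h, t)‖ := norm_fst_le (h, t)
        have h6 : |t| ≤ ‖(h, t)‖ := norm_snd_le (h, t)
        linarith
      obtain ⟨δ, hδ, hδL⟩ : ∃ δ > 0, ∀ x ∈ ball x₀ δ ∩ cb,
          ‖fderivWithin ℝ (Y i) cb x - L‖ ≤ 1 / (4 * K) := by
        have hc := (hd.continuousOn_fderivWithin uniqueDiffOn_closedBall le_rfl) x₀ hx₀
        obtain ⟨δ, hδ, h⟩ := Metric.continuousWithinAt_iff.1 hc (1 / (4 * K)) (by positivity)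
        refine ⟨δ, hδ, fun x hx => ?_⟩
        rw [← dist_eq_norm]
        exact (h hx.2 hx.1).le
      have hstrict : ∀ x ∈ ball x₀ δ ∩ cb, ∀ x' ∈ ball x₀ δ ∩ cb,
          ‖Y i x - Y i x' - L (x - x')‖ ≤ 1 / (4 * K) * ‖x - x'‖ := by
        intro x hx x' hx'
        refine ((convex_ball x₀ δ).inter (convex_closedBall _ _)).norm_image_sub_le_of_norm_hasFDerivWithin_le'
          (f' := fun x => fderivWithin ℝ (Y i) cb x) (fun z hz => ?_) hδL hx' hx
        exact ((hd.differentiableOn one_ne_zero z hz.2).hasFDerivWithinAt).mono inter_subset_right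
      refine ⟨1 / (4 * K), by positivity, ?_⟩
      have e1 := t1.eventually (inter_mem (mem_nhdsWithin_of_mem_nhds (ball_mem_nhds x₀ hδ))
        self_mem_nhdsWithin)
      have e2 := t2.eventually (inter_mem (mem_nhdsWithin_of_mem_nhds (ball_mem_nhds x₀ hδ))
        self_mem_nhdsWithin)
      have e3 := Metric.tendsto_nhds.1 y2 (1 / (4 * K)) (by positivity)
      filter_upwards [e1, e2, e3] with ⟨x, x', t⟩ h1 h2 h3
      simp only [Function.comp_apply, dist_eq_norm] at h1 h2 h3 ⊢
      have h4 := hML (x - x') (1 - t)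
      have h5 : L (x - x') + (1 - t) • Y i x₀ = (Y i x - t • Y i x')
          - (Y i x - Y i x' - L (x - x')) - (1 - t) • (Y i x' - Y i x₀) := by
        module
      have h6 := (norm_sub_le ((Y i x - t • Y i x') - (Y i x - Y i x' - L (x - x')))
        ((1 - t) • (Y i x' - Y i x₀))).trans (add_le_add_left (norm_sub_le _ _) _)
      rw [← h5, norm_smul, Real.norm_eq_abs] at h6
      have h7 := hstrict x h1 x' h2
      have h8 := mul_le_mul_of_nonneg_left h3.le (abs_nonneg (1 - t))
      have h9 : 2 * (K : ℝ) * (1 / (4 * K) * (‖x - x'‖ + |1 - t|)) = (‖x - x'‖ + |1 - t|) / 2 := by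
        field_simp
        norm_num
      have h10 : ‖L (x - x') + (1 - t) • Y i x₀‖
          ≤ ‖Y i x - t • Y i x'‖ + 1 / (4 * K) * (‖x - x'‖ + |1 - t|) := by linarith
      have h11 := mul_le_mul_of_nonneg_left h10 (by positivity : 0 ≤ 2 * (K : ℝ))
      rw [mul_add, h9] at h11
      have h12 : (‖x - x'‖ + |1 - t|) ≤ 4 * K * ‖Y i x - t • Y i x'‖ := by linarith
      rw [div_mul_eq_mul_div, one_mul, div_le_iff₀ (by positivity)]
      linarith
    · have hpos : 0 < ‖Y i x₀ - t₀ • Y i x₀'‖ := norm_pos_iff.2 (sub_ne_zero.2 he)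
      refine ⟨‖Y i x₀ - t₀ • Y i x₀'‖ / 2 / 3, by positivity, ?_⟩
      have hev := ((y1.sub (t3.smul y2)).norm).eventually (lt_mem_nhds (half_lt_self hpos))
      filter_upwards [hev, self_mem_nhdsWithin] with ⟨x, x', t⟩ h1 ⟨hx, hx', ht⟩
      refine le_trans ?_ h1.le
      have h2 : ‖x - x'‖ ≤ 2 := by
        have := norm_sub_le x x'
        have h3 := mem_closedBall_zero_iff.1 hx
        have h4 := mem_closedBall_zero_iff.1 hx'
        linarith
      have h3 : |1 - t| ≤ 1 := by
        rw [abs_of_nonneg (by linarith [ht.2])]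
        linarith [ht.1]
      have h4 : ‖x - x'‖ + |1 - t| ≤ 3 := by linarith
      calc _ ≤ ‖Y i x₀ - t₀ • Y i x₀'‖ / 2 / 3 * 3 := mul_le_mul_of_nonneg_left h4 (by positivity)
        _ = _ := by ring

/-- Star-shapedness is stable under perturbations that are small in the Lipschitz norm: the
homogeneous map that takes one surface to the other is a Lipschitz perturbation of the identity,
and hence a bijection. -/
theorem exists_stable (hd : ∀ i, ContDiffOn ℝ 1 (Y i) (𝔹 n))
    (hinj : ∀ i, ∀ x ∈ 𝔹 n, ∀ (h : E n) (t : ℝ),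
      fderivWithin ℝ (Y i) (𝔹 n) x h + t • Y i x = 0 → h = 0 ∧ t = 0) :
    ∃ ε : ℝ, 0 < ε ∧ ∀ Z : Fin 2 → E n → E (n + 1),
      (∀ i, ContinuousOn (Z i) (𝔹 n)) →
      (∀ x ∈ 𝕊 n, ∀ i j, Z i x = Z j x) →
      (∀ i, ∀ x ∈ 𝔹 n, ‖Z i x - Y i x‖ ≤ ε) →
      (∀ i, ∀ x ∈ 𝔹 n, ∀ x' ∈ 𝔹 n,
        ‖(Z i x - Y i x) - (Z i x' - Y i x')‖ ≤ ε * ‖x - x'‖) → IsStarSurface Z := by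
  choose c hc hb using fun i => hY.exists_bound (hd i) (hinj i)
  refine ⟨min (c 0) (c 1) / 2, half_pos (lt_min (hc 0) (hc 1)), fun Z hZc hZb hZ0 hZ1 => ?_⟩
  set ε := min (c 0) (c 1) / 2 with hε
  have hεc : ∀ i, ε ≤ c i / 2 := by
    intro i
    fin_cases i
    exacts [div_le_div_of_nonneg_right (min_le_left _ _) zero_le_two,
      div_le_div_of_nonneg_right (min_le_right _ _) zero_le_two]
  have hex : ∀ q : E (n + 1), ∃ s : ℝ, 0 ≤ s ∧ ∃ i, ∃ x ∈ 𝔹 n, q = s • Y i x := by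
    intro q
    by_cases hq : q = 0
    · exact ⟨0, le_rfl, 0, 0, mem_closedBall_self zero_le_one, by rw [hq, zero_smul]⟩
    · obtain ⟨s, hs, i, x, hx, h⟩ := hY.cover q hq
      exact ⟨s, hs.le, i, x, hx, h⟩
  choose S hS I X hX hq using hex
  let w : E (n + 1) → E (n + 1) := fun q => S q • (Z (I q) (X q) - Y (I q) (X q))
  have hw : ∀ i, ∀ x ∈ 𝔹 n, ∀ s : ℝ, 0 ≤ s →
      w (s • Y i x) = s • (Z i x - Y i x) := by
    intro i x hx s hs
    have h := hq (s • Y i x)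
    simp only [w]
    set q := s • Y i x with hqdef
    rcases hs.eq_or_lt with rfl | hs
    · have h0 : S q = 0 := by
        by_contra h0
        rw [hqdef, zero_smul] at h
        exact smul_ne_zero h0 (hY.ne_zero _ (hX q)) (by rw [hqdef, zero_smul]; exact h.symm)
      rw [h0, zero_smul, zero_smul]
    · have h0 : 0 < S q := (hS q).lt_of_ne fun h0 => by
        rw [← h0, zero_smul] at h
        exact smul_ne_zero hs.ne' (hY.ne_zero _ hx) h
      obtain ⟨h1, h2, h3⟩ := hY.unique i (I q) x hx (X q) (hX q) s (S q) hs h0 h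
      rw [← h1, ← h2]
      rcases h3 with h3 | h3
      · rw [← h3]
      · rw [hZb x h3 (I q) i, hY.boundary x h3 (I q) i]
  -- the Lipschitz estimate on one cone
  have hcone1 : ∀ i, ∀ x ∈ 𝔹 n, ∀ x' ∈ 𝔹 n, ∀ s s' : ℝ,
      0 ≤ s' → s' ≤ s →
      ‖w (s • Y i x) - w (s' • Y i x')‖ ≤ 1 / 2 * ‖s • Y i x - s' • Y i x'‖ := by
    intro i x hx x' hx' s s' hs' hss
    rcases (hs'.trans hss).eq_or_lt with h0 | hs
    · have h0' : s' = 0 := le_antisymm (h0 ▸ hss) hs'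
      simp [← h0, h0']
    have ht : s' / s ∈ Icc (0 : ℝ) 1 := ⟨by positivity, (div_le_one hs).2 hss⟩
    have hs1 : s' = s * (s' / s) := by field_simp
    rw [hw i x hx s hs.le, hw i x' hx' s' hs']
    set t := s' / s
    have e1 : s • (Z i x - Y i x) - s' • (Z i x' - Y i x')
        = s • (((Z i x - Y i x) - (Z i x' - Y i x')) + (1 - t) • (Z i x' - Y i x')) := by
      rw [hs1]; module
    have e2 : s • Y i x - s' • Y i x' = s • (Y i x - t • Y i x') := by
      rw [hs1]; module
    rw [e1, e2, norm_smul, norm_smul, Real.norm_eq_abs, abs_of_pos hs]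
    have h1 := hb i x hx x' hx' t ht
    have h2 := hZ1 i x hx x' hx'
    have h3 : ‖(1 - t) • (Z i x' - Y i x')‖ ≤ |1 - t| * ε := by
      rw [norm_smul, Real.norm_eq_abs]
      exact mul_le_mul_of_nonneg_left (hZ0 i x' hx') (abs_nonneg _)
    have h4 := (norm_add_le ((Z i x - Y i x) - (Z i x' - Y i x')) ((1 - t) • (Z i x' - Y i x'))).trans
      (add_le_add h2 h3)
    have h5 := mul_le_mul_of_nonneg_right (hεc i) (by positivity : 0 ≤ ‖x - x'‖ + |1 - t|)
    have h6 : ‖((Z i x - Y i x) - (Z i x' - Y i x')) + (1 - t) • (Z i x' - Y i x')‖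
        ≤ 1 / 2 * ‖Y i x - t • Y i x'‖ := by linarith
    calc _ ≤ s * (1 / 2 * ‖Y i x - t • Y i x'‖) := mul_le_mul_of_nonneg_left h6 hs.le
      _ = _ := by ring
  have hcone : ∀ i, ∀ x ∈ 𝔹 n, ∀ x' ∈ 𝔹 n, ∀ s s' : ℝ,
      0 ≤ s → 0 ≤ s' →
      ‖w (s • Y i x) - w (s' • Y i x')‖ ≤ 1 / 2 * ‖s • Y i x - s' • Y i x'‖ := by
    intro i x hx x' hx' s s' hs hs'
    rcases le_total s' s with h | h
    · exact hcone1 i x hx x' hx' s s' hs' h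
    · rw [norm_sub_rev, norm_sub_rev (s • Y i x)]
      exact hcone1 i x' hx' x hx s' s hs h
  -- a segment between the two cones meets their intersection
  have hlip : LipschitzWith (1 / 2) w := by
    refine LipschitzWith.of_dist_le_mul fun p q => ?_
    rw [dist_eq_norm, dist_eq_norm]
    rw [NNReal.coe_div, NNReal.coe_one, NNReal.coe_two]
    have hcl := fun i => hY.isClosed_cone i isClosed_Ici subset_rfl
    have hseg : (segment ℝ p q ∩ ({z | ∃ x ∈ 𝔹 n, ∃ s ∈ Ici (0 : ℝ), z = s • Y (I p) x}
        ∩ {z | ∃ x ∈ 𝔹 n, ∃ s ∈ Ici (0 : ℝ), z = s • Y (I q) x})).Nonempty := by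
      by_cases hI : I p = I q
      · exact ⟨p, left_mem_segment ℝ p q, ⟨X p, hX p, S p, hS p, hq p⟩,
          ⟨X p, hX p, S p, hS p, hI ▸ hq p⟩⟩
      · refine isPreconnected_closed_iff.1 (convex_segment p q).isPreconnected _ _ (hcl (I p))
          (hcl (I q)) (fun z _ => ?_) ⟨p, left_mem_segment ℝ p q, X p, hX p, S p, hS p, hq p⟩
          ⟨q, right_mem_segment ℝ p q, X q, hX q, S q, hS q, hq q⟩
        have : I z = I p ∨ I z = I q := by
          generalize I z = a at *
          generalize I p = b at *
          generalize I q = d at *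
          omega
        rcases this with h | h
        · exact Or.inl ⟨X z, hX z, S z, hS z, h ▸ hq z⟩
        · exact Or.inr ⟨X z, hX z, S z, hS z, h ▸ hq z⟩
    obtain ⟨z, hz, ⟨x, hx, s, hs, hzp⟩, x', hx', s', hs', hzq⟩ := hseg
    have h1 : ‖w p - w z‖ ≤ 1 / 2 * ‖p - z‖ := by
      have := hcone (I p) (X p) (hX p) x hx (S p) s (hS p) hs
      rwa [← hq p, ← hzp] at this
    have h2 : ‖w z - w q‖ ≤ 1 / 2 * ‖z - q‖ := by
      have := hcone (I q) x' hx' (X q) (hX q) s' (S q) hs' (hS q)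
      rwa [← hq q, ← hzq] at this
    have h3 := dist_add_dist_of_mem_segment hz
    rw [dist_eq_norm, dist_eq_norm, dist_eq_norm] at h3
    have h4 := norm_sub_le_norm_sub_add_norm_sub (w p) (w z) (w q)
    linarith
  have hinjΦ : ∀ p q, p + w p = q + w q → p = q := by
    intro p q h
    have h1 := hlip.dist_le_mul p q
    rw [dist_eq_norm, dist_eq_norm] at h1
    have h2 : p - q = -(w p - w q) := by
      rw [neg_sub, sub_eq_sub_iff_add_eq_add, h]; abel
    have h3 : ‖p - q‖ = ‖w p - w q‖ := by rw [h2, norm_neg]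
    rw [← h3] at h1
    rw [NNReal.coe_div, NNReal.coe_one, NNReal.coe_two] at h1
    have h4 := norm_nonneg (p - q)
    exact sub_eq_zero.1 (norm_eq_zero.1 (by linarith))
  have hsurjΦ : ∀ q, ∃ p, p + w p = q := by
    intro q
    have hcw : ContractingWith (1 / 2) fun p => q - w p :=
      ⟨by rw [div_lt_one two_pos]; exact one_lt_two, by
        refine LipschitzWith.of_dist_le_mul fun p p' => ?_
        rw [dist_sub_left]
        exact hlip.dist_le_mul p p'⟩
    exact ⟨hcw.fixedPoint, by
      have := hcw.fixedPoint_isFixedPt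
      exact (sub_eq_iff_eq_add.1 this).symm⟩
  have hΦ : ∀ i, ∀ x ∈ 𝔹 n, ∀ s : ℝ, 0 ≤ s →
      s • Y i x + w (s • Y i x) = s • Z i x := by
    intro i x hx s hs
    rw [hw i x hx s hs]
    module
  refine ⟨hZc, hZb, fun q hq0 => ?_, fun i j x hx x' hx' s s' hs hs' h => ?_⟩
  · obtain ⟨p, rfl⟩ := hsurjΦ q
    have h := hΦ (I p) (X p) (hX p) (S p) (hS p)
    rw [← hq p] at h
    refine ⟨S p, (hS p).lt_of_ne fun h0 => hq0 ?_, I p, X p, hX p, h⟩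
    rw [h, ← h0, zero_smul]
  · rw [← hΦ i x hx s hs.le, ← hΦ j x' hx' s' hs'.le] at h
    exact hY.unique i j x hx x' hx' s s' hs hs' (hinjΦ _ _ h)

end IsStarSurface

end

section

variable {n : ℕ}

/-! ### The volume enclosed by a star-shaped surface -/

/-- `n + 1` times the density of the signed volume of the cone over the surface `Z`, with vertex at
the origin. -/
def coneDensity (Z : E n → E (n + 1)) (x : E n) : ℝ := ⟪Z x, cross fun j => pd j Z x⟫

/-- The last `n` coordinates. -/
def tailL (n : ℕ) : E (n + 1) →L[ℝ] E n :=
  LinearMap.toContinuousLinearMap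
    { toFun := fun y => WithLp.toLp 2 fun j => y j.succ
      map_add' := fun _ _ => rfl
      map_smul' := fun _ _ => rfl }

theorem tailL_apply (y : E (n + 1)) (j : Fin n) : tailL n y j = y j.succ := rfl

theorem measurePreserving_tail :
    MeasurePreserving (fun y : E (n + 1) => (y 0, tailL n y)) volume (volume.prod volume) := by
  have h1 := PiLp.volume_preserving_ofLp (Fin (n + 1))
  have h2 := volume_preserving_piFinSuccAbove (fun _ : Fin (n + 1) => ℝ) 0
  have h3 := (MeasurePreserving.id (volume : Measure ℝ)).prod (PiLp.volume_preserving_toLp (Fin n))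
  exact h3.comp (h2.comp h1)

/-- The cone over the surface `Z`, in the coordinates `(s, x) ↦ s Z(x)`. -/
def conePolar (Z : E n → E (n + 1)) (y : E (n + 1)) : E (n + 1) := y 0 • Z (tailL n y)

/-- The derivative of `conePolar`. -/
def conePolarDeriv (Z : E n → E (n + 1)) (y : E (n + 1)) : E (n + 1) →L[ℝ] E (n + 1) :=
  y 0 • (fderivWithin ℝ Z (𝔹 n) (tailL n y)).comp (tailL n) +
    (EuclideanSpace.proj (𝕜 := ℝ) (0 : Fin (n + 1))).smulRight (Z (tailL n y))

theorem hasFDerivWithinAt_conePolar {Z : E n → E (n + 1)}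
    (hd : DifferentiableOn ℝ Z (𝔹 n)) {y : E (n + 1)}
    (hy : tailL n y ∈ 𝔹 n) :
    HasFDerivWithinAt (conePolar Z) (conePolarDeriv Z y) (tailL n ⁻¹' 𝔹 n) y := by
  have h1 : HasFDerivWithinAt (fun y : E (n + 1) => y 0) (EuclideanSpace.proj (𝕜 := ℝ) (0 : Fin (n + 1)))
      (tailL n ⁻¹' 𝔹 n) y := (EuclideanSpace.proj (𝕜 := ℝ) (0 : Fin (n + 1))).hasFDerivWithinAt
  have h2 : HasFDerivWithinAt (fun y : E (n + 1) => Z (tailL n y))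
      ((fderivWithin ℝ Z (𝔹 n) (tailL n y)).comp (tailL n))
      (tailL n ⁻¹' 𝔹 n) y :=
    (hd _ hy).hasFDerivWithinAt.comp y (tailL n).hasFDerivWithinAt (mapsTo_preimage _ _)
  exact h1.smul h2

theorem det_conePolarDeriv (Z : E n → E (n + 1)) (y : E (n + 1)) :
    (conePolarDeriv Z y).det = y 0 ^ n * coneDensity Z (tailL n y) := by
  rw [coneDensity, inner_cross, ContinuousLinearMap.det,
    ← LinearMap.det_toMatrix (EuclideanSpace.basisFun (Fin (n + 1)) ℝ).toBasis,
    ← Matrix.det_transpose]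
  have h0 : tailL n (single 0 1) = 0 := by
    ext j
    simp [tailL_apply]
  have hs : ∀ a : Fin n, tailL n (single a.succ 1) = single a 1 := by
    intro a
    ext j
    simp [tailL_apply, PiLp.single_apply]
  have key : (LinearMap.toMatrix (EuclideanSpace.basisFun (Fin (n + 1)) ℝ).toBasis
      (EuclideanSpace.basisFun (Fin (n + 1)) ℝ).toBasis
      (conePolarDeriv Z y : E (n + 1) →ₗ[ℝ] E (n + 1)))ᵀ = Matrix.of fun a b =>
      (Fin.cons 1 fun _ => y 0 : Fin (n + 1) → ℝ) a * (Matrix.of (Fin.cons (Z (tailL n y)).ofLp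
        fun j => (pd j Z (tailL n y)).ofLp) : Matrix (Fin (n + 1)) (Fin (n + 1)) ℝ) a b := by
    ext a b
    rw [Matrix.transpose_apply, LinearMap.toMatrix_apply]
    refine Fin.cases ?_ (fun a => ?_) a
    · simp [conePolarDeriv, h0]
    · simp [conePolarDeriv, hs, pd]
  rw [key, Matrix.det_mul_column]
  simp [Fin.prod_univ_succ]

theorem continuousOn_coneDensity {Z : E n → E (n + 1)} (hd : ContDiffOn ℝ 1 Z (𝔹 n)) :
    ContinuousOn (coneDensity Z) (𝔹 n) := by
  have hp (j : Fin n) : ContinuousOn (pd j Z) (𝔹 n) :=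
    (hd.continuousOn_fderivWithin uniqueDiffOn_closedBall le_rfl).clm_apply continuousOn_const
  have hM : ContinuousOn (fun x => (Matrix.of (Fin.cons (Z x).ofLp fun j => (pd j Z x).ofLp) :
      Matrix (Fin (n + 1)) (Fin (n + 1)) ℝ)) (𝔹 n) := by
    refine continuousOn_pi.2 fun a => continuousOn_pi.2 fun b => ?_
    refine Fin.cases ?_ (fun a => ?_) a
    · exact (EuclideanSpace.proj (𝕜 := ℝ) b).continuous.comp_continuousOn hd.continuousOn
    · exact (EuclideanSpace.proj (𝕜 := ℝ) b).continuous.comp_continuousOn (hp a)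
  refine ((Continuous.matrix_det continuous_id).comp_continuousOn hM).congr fun x _ => ?_
  exact inner_cross _ _

/-- The volume of the part of the cone over `Z` that lies below the surface. -/
theorem volume_conePolar {Z : E n → E (n + 1)} (hd : ContDiffOn ℝ 1 Z (𝔹 n))
    (hinj : InjOn (conePolar Z) {y | y 0 ∈ Ioo (0 : ℝ) 1 ∧ tailL n y ∈ ball (0 : E n) 1}) :
    MeasurableSet (conePolar Z '' {y | y 0 ∈ Ioo (0 : ℝ) 1 ∧ tailL n y ∈ ball (0 : E n) 1}) ∧
    volume (conePolar Z '' {y | y 0 ∈ Ioo (0 : ℝ) 1 ∧ tailL n y ∈ ball (0 : E n) 1})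
      = ofReal ((∫ x, |coneDensity Z x| ∂𝔪 n) / (n + 1)) := by
  set T : Set (E (n + 1)) := {y | y 0 ∈ Ioo (0 : ℝ) 1 ∧ tailL n y ∈ ball (0 : E n) 1} with hT
  have hTp : T = (fun y : E (n + 1) => (y 0, tailL n y)) ⁻¹' (Ioo (0 : ℝ) 1 ×ˢ ball (0 : E n) 1) := rfl
  have hpm : MeasurableSet (Ioo (0 : ℝ) 1 ×ˢ ball (0 : E n) 1) :=
    measurableSet_Ioo.prod measurableSet_ball
  have hTm : MeasurableSet T := measurePreserving_tail.measurable hpm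
  have hder : ∀ y ∈ T, HasFDerivWithinAt (conePolar Z) (conePolarDeriv Z y) T y := fun y hy =>
    (hasFDerivWithinAt_conePolar (hd.differentiableOn one_ne_zero) (ball_subset_closedBall hy.2)).mono
      fun z hz => ball_subset_closedBall hz.2
  refine ⟨measurable_image_of_fderivWithin hTm hder hinj, ?_⟩
  rw [← lintegral_abs_det_fderiv_eq_addHaar_image volume hTm hder hinj]
  have hcd := continuousOn_coneDensity hd
  have hmeas : AEMeasurable (fun x => ofReal |coneDensity Z x|) (𝔪 n) :=
    (((hcd.mono ball_subset_closedBall).aemeasurable measurableSet_ball).norm).ennreal_ofReal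
  have e1 : ∫⁻ y in T, ofReal |(conePolarDeriv Z y).det|
      = ∫⁻ p in Ioo (0 : ℝ) 1 ×ˢ ball (0 : E n) 1,
        ofReal (p.1 ^ n) * ofReal |coneDensity Z p.2| ∂(volume.prod volume) := by
    have hmp := measurePreserving_tail (n := n).restrict_preimage hpm
    rw [← hTp] at hmp
    rw [← hmp.map_eq, lintegral_map']
    · refine setLIntegral_congr_fun hTm fun y hy => ?_
      simp only
      rw [det_conePolarDeriv, abs_mul, abs_of_nonneg (pow_nonneg hy.1.1.le n),
        ENNReal.ofReal_mul (pow_nonneg hy.1.1.le n)]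
    · rw [hmp.map_eq, ← Measure.prod_restrict]
      exact ((continuous_pow n).measurable.ennreal_ofReal.comp measurable_fst).aemeasurable.mul
        (hmeas.comp_quasiMeasurePreserving Measure.quasiMeasurePreserving_snd)
    · exact measurePreserving_tail.measurable.aemeasurable
  rw [e1, ← Measure.prod_restrict, lintegral_prod_mul (f := fun s : ℝ => ofReal (s ^ n))
    (g := fun x => ofReal |coneDensity Z x|)
    (continuous_pow n).measurable.ennreal_ofReal.aemeasurable hmeas]
  have e2 : ∫⁻ s in Ioo (0 : ℝ) 1, ofReal (s ^ n) = ofReal (1 / (n + 1)) := by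
    have hint : IntegrableOn (fun s : ℝ => s ^ n) (Ioo 0 1) :=
      ((continuous_pow n).continuousOn.integrableOn_Icc).mono_set Ioo_subset_Icc_self
    rw [← ofReal_integral_eq_lintegral_ofReal hint (by
      filter_upwards [ae_restrict_mem measurableSet_Ioo] with s hs using pow_nonneg hs.1.le n),
      ← integral_Ioc_eq_integral_Ioo, ← intervalIntegral.integral_of_le zero_le_one, integral_pow]
    simp
  have e3 : ∫⁻ x, ofReal |coneDensity Z x| ∂𝔪 n
      = ofReal (∫ x, |coneDensity Z x| ∂𝔪 n) :=
    (ofReal_integral_eq_lintegral_ofReal (integrable_of_continuousOn hcd.abs)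
      (.of_forall fun x => abs_nonneg _)).symm
  rw [e2, e3, ← ENNReal.ofReal_mul (by positivity)]
  congr 1
  ring

/-- The volume enclosed by a regular star-shaped surface. -/
theorem IsStarSurface.volume_enclosed {Z : Fin 2 → E n → E (n + 1)} (hZ : IsStarSurface Z)
    (hd : ∀ i, ContDiffOn ℝ 1 (Z i) (𝔹 n)) :
    volume (enclosed (Z 0 '' 𝔹 n ∪ Z 1 '' 𝔹 n))
      = ofReal (∑ i, (∫ x, |coneDensity (Z i) x| ∂𝔪 n) / (n + 1)) := by
  set T : Set (E (n + 1)) := {y | y 0 ∈ Ioo (0 : ℝ) 1 ∧ tailL n y ∈ ball (0 : E n) 1} with hT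
  set S : Set (E (n + 1)) := {y | y 0 ∈ Ioo (0 : ℝ) 1 ∧ tailL n y ∈ 𝕊 n} with hS
  have hpt : ∀ y y' : E (n + 1), y 0 = y' 0 → tailL n y = tailL n y' → y = y' := by
    intro y y' h0 h1
    ext j
    refine Fin.cases h0 (fun j => ?_) j
    rw [← tailL_apply, h1, tailL_apply]
  have hinj : ∀ i, InjOn (conePolar (Z i)) T := by
    intro i y hy y' hy' h
    obtain ⟨h1, h2, -⟩ := hZ.unique i i _ (ball_subset_closedBall hy.2) _
      (ball_subset_closedBall hy'.2) _ _ hy.1.1 hy'.1.1 h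
    exact hpt y y' h1 h2
  have hv := fun i => volume_conePolar (hd i) (hinj i)
  have hSnull : ∀ i, volume (conePolar (Z i) '' S) = 0 := by
    intro i
    refine addHaar_image_eq_zero_of_differentiableOn_of_addHaar_eq_zero volume (fun y hy => ?_) ?_
    · exact ((hasFDerivWithinAt_conePolar ((hd i).differentiableOn one_ne_zero)
        (sphere_subset_closedBall hy.2)).mono
          fun z hz => sphere_subset_closedBall hz.2).differentiableWithinAt
    · have : S = (fun y : E (n + 1) => (y 0, tailL n y)) ⁻¹' (Ioo (0 : ℝ) 1 ×ˢ 𝕊 n) := rfl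
      rw [this, measurePreserving_tail.measure_preimage
        (measurableSet_Ioo.prod isClosed_sphere.measurableSet).nullMeasurableSet, Measure.prod_prod,
        Measure.addHaar_sphere_of_ne_zero _ _ one_ne_zero, mul_zero]
  have hset : enclosed (Z 0 '' 𝔹 n ∪ Z 1 '' 𝔹 n)
      = (conePolar (Z 0) '' T ∪ conePolar (Z 1) '' T)
        ∪ ({0} ∪ (conePolar (Z 0) '' S ∪ conePolar (Z 1) '' S)) := by
    rw [hZ.enclosed_eq]
    ext q
    constructor
    · rintro ⟨i, x, hx, s, hs0, hs1, rfl⟩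
      rcases hs0.eq_or_lt with rfl | hs0
      · exact Or.inr (Or.inl (zero_smul _ _))
      · let y : E (n + 1) := WithLp.toLp 2 (Fin.cons s x.ofLp)
        have hy0 : y 0 = s := rfl
        have hyt : tailL n y = x := by ext j; rfl
        have himg : conePolar (Z i) y = s • Z i x := by rw [conePolar, hy0, hyt]
        rw [← himg]
        rcases (mem_closedBall_zero_iff.1 hx).eq_or_lt with hx1 | hx1
        · have hyS : y ∈ S := ⟨by rw [hy0]; exact ⟨hs0, hs1⟩, by
            rw [hyt]; exact mem_sphere_zero_iff_norm.2 hx1⟩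
          refine Or.inr (Or.inr ?_)
          fin_cases i
          exacts [Or.inl (mem_image_of_mem _ hyS), Or.inr (mem_image_of_mem _ hyS)]
        · have hyT : y ∈ T := ⟨by rw [hy0]; exact ⟨hs0, hs1⟩, by
            rw [hyt]; exact mem_ball_zero_iff.2 hx1⟩
          refine Or.inl ?_
          fin_cases i
          exacts [Or.inl (mem_image_of_mem _ hyT), Or.inr (mem_image_of_mem _ hyT)]
    · rintro ((⟨y, hy, rfl⟩ | ⟨y, hy, rfl⟩) | rfl | (⟨y, hy, rfl⟩ | ⟨y, hy, rfl⟩))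
      · exact ⟨0, _, ball_subset_closedBall hy.2, _, hy.1.1.le, hy.1.2, rfl⟩
      · exact ⟨1, _, ball_subset_closedBall hy.2, _, hy.1.1.le, hy.1.2, rfl⟩
      · exact ⟨0, 0, mem_closedBall_self zero_le_one, 0, le_rfl, one_pos, (zero_smul _ _).symm⟩
      · exact ⟨0, _, sphere_subset_closedBall hy.2, _, hy.1.1.le, hy.1.2, rfl⟩
      · exact ⟨1, _, sphere_subset_closedBall hy.2, _, hy.1.1.le, hy.1.2, rfl⟩
  have hnull : volume ({0} ∪ (conePolar (Z 0) '' S ∪ conePolar (Z 1) '' S) : Set (E (n + 1))) = 0 :=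
    measure_union_null (measure_singleton _) (measure_union_null (hSnull 0) (hSnull 1))
  have hdisj : Disjoint (conePolar (Z 0) '' T) (conePolar (Z 1) '' T) := by
    rw [Set.disjoint_left]
    rintro _ ⟨y, hy, rfl⟩ ⟨y', hy', h⟩
    obtain ⟨-, -, h3⟩ := hZ.unique 1 0 _ (ball_subset_closedBall hy'.2) _
      (ball_subset_closedBall hy.2) _ _ hy'.1.1 hy.1.1 h
    rcases h3 with h3 | h3
    · exact absurd h3 (by decide)
    · exact (mem_ball_zero_iff.1 hy'.2).ne (mem_sphere_zero_iff_norm.1 h3)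
  rw [hset, measure_congr (union_ae_eq_left_of_ae_eq_empty (ae_eq_empty.2 hnull)), measure_union hdisj (hv 1).1, (hv 0).2, (hv 1).2,
    Fin.sum_univ_two, ENNReal.ofReal_add]
  all_goals exact div_nonneg (integral_nonneg fun x => abs_nonneg _) (by positivity)

end

section

variable {n : ℕ}

/-! ### The chambers of a standard double bubble are star-shaped -/

/-- For two quadratic polynomials `f`, `g` that are positive at `0`, no point of the boundary of
`{f ≥ 0, g ≥ 0}` at which the boundary is crossed outwards is followed by another one. -/
theorem quadratic_pair_aux {f g : ℝ → ℝ} {f₀ f₁ f₂ g₀ g₁ g₂ s s' : ℝ}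
    (hf : ∀ x, f x = f₀ + f₁ * x + f₂ * x ^ 2) (hg : ∀ x, g x = g₀ + g₁ * x + g₂ * x ^ 2)
    (hg0 : 0 < g₀) (T1 : ∀ x, 0 < x → f x = 0 → 0 ≤ g x → f₁ + 2 * f₂ * x < 0)
    (T2 : ∀ x, 0 < x → g x = 0 → 0 ≤ f x → g₁ + 2 * g₂ * x < 0)
    (hs : 0 < s) (hss : s < s') (hfs : f s = 0) (hgs : 0 ≤ g s) (hf' : 0 ≤ f s') (hg' : 0 ≤ g s')
    (h' : f s' = 0 ∨ g s' = 0) : False := by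
  have hd := T1 s hs hfs hgs
  have hfac : ∀ x, f x = (x - s) * (f₁ + f₂ * s + f₂ * x) := fun x => by
    rw [hf] at hfs ⊢
    linear_combination hfs
  have h1 : 0 ≤ f₁ + f₂ * s + f₂ * s' := by
    rw [hfac] at hf'
    exact nonneg_of_mul_nonneg_right hf' (by linarith)
  have hf2 : 0 < f₂ := by by_contra h; nlinarith
  -- `t` is the second zero of `f`
  obtain ⟨t, ht⟩ : ∃ t, f₁ + f₂ * s + f₂ * t = 0 :=
    ⟨-(f₁ + f₂ * s) / f₂, by field_simp; ring⟩
  have hst : s < t := by by_contra h; nlinarith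
  have hts : t ≤ s' := by by_contra h; nlinarith
  have hft : f t = 0 := by rw [hfac, ht, mul_zero]
  have hdt : 0 < f₁ + 2 * f₂ * t := by nlinarith
  have hgt : g t < 0 := by
    by_contra h
    exact (T1 t (hs.trans hst) hft (not_lt.1 h)).not_gt hdt
  have hts' : t < s' := hts.lt_of_ne (by rintro rfl; linarith)
  have hg0' : g s' = 0 := h'.resolve_left fun h' => by
    rw [hfac] at h'
    rcases mul_eq_zero.1 h' with h' | h'
    · linarith
    · nlinarith
  have hd' := T2 s' (hs.trans hss) hg0' hf'
  have hgfac : ∀ x, g x = (x - s') * (g₁ + g₂ * s' + g₂ * x) := fun x => by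
    rw [hg] at hg0' ⊢
    linear_combination hg0'
  have h2 : g₁ + g₂ * s' < 0 := by
    have := (hgfac 0).symm.trans (hg 0)
    by_contra h
    nlinarith
  have h3 : 0 < g₁ + g₂ * s' + g₂ * t := by
    rw [hgfac] at hgt
    by_contra h
    nlinarith
  have hg2 : 0 < g₂ := by by_contra h; nlinarith
  nlinarith

/-- A ray from an interior point crosses the boundary of `{f ≥ 0, g ≥ 0}` only once, if it always
crosses it outwards. -/
theorem quadratic_pair_unique {f g : ℝ → ℝ} {f₀ f₁ f₂ g₀ g₁ g₂ s s' : ℝ}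
    (hf : ∀ x, f x = f₀ + f₁ * x + f₂ * x ^ 2) (hg : ∀ x, g x = g₀ + g₁ * x + g₂ * x ^ 2)
    (hf0 : 0 < f₀) (hg0 : 0 < g₀) (T1 : ∀ x, 0 < x → f x = 0 → 0 ≤ g x → f₁ + 2 * f₂ * x < 0)
    (T2 : ∀ x, 0 < x → g x = 0 → 0 ≤ f x → g₁ + 2 * g₂ * x < 0) (hs : 0 < s) (hs' : 0 < s')
    (h : f s = 0 ∧ 0 ≤ g s ∨ g s = 0 ∧ 0 ≤ f s) (h' : f s' = 0 ∧ 0 ≤ g s' ∨ g s' = 0 ∧ 0 ≤ f s') :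
    s = s' := by
  wlog hss : s < s' generalizing s s'
  · exact (not_lt.1 hss).eq_or_lt.elim Eq.symm fun h1 => (this hs' hs h' h h1).symm
  have hf' : 0 ≤ f s' := h'.elim (fun h => h.1.ge) fun h => h.2
  have hg' : 0 ≤ g s' := h'.elim (fun h => h.2) fun h => h.1.ge
  have hor := h'.imp And.left And.left
  rcases h with h | h
  · exact (quadratic_pair_aux hf hg hg0 T1 T2 hs hss h.1 h.2 hf' hg' hor).elim
  · exact (quadratic_pair_aux hg hf hf0 T2 T1 hs hss h.1 h.2 hg' hf' hor.symm).elim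

theorem exists_quadratic_neg {f : ℝ → ℝ} {f₀ f₁ f₂ : ℝ} (hf : ∀ x, f x = f₀ + f₁ * x + f₂ * x ^ 2)
    (h : f₂ < 0) : ∃ s, 0 < s ∧ f s < 0 := by
  set c := (|f₀| + |f₁|) / (-f₂) with hc
  have hc0 : 0 ≤ c := div_nonneg (by positivity) (by linarith)
  have hcf : c * (-f₂) = |f₀| + |f₁| := div_mul_cancel₀ _ (by linarith)
  refine ⟨1 + c, by linarith, ?_⟩
  have h1 := le_abs_self f₀
  have h2 : f₁ * (1 + c) ≤ |f₁| * (1 + c) := mul_le_mul_of_nonneg_right (le_abs_self _) (by linarith)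
  have h3 : |f₀| ≤ |f₀| * (1 + c) := le_mul_of_one_le_right (abs_nonneg _) (by linarith)
  have h4 : f₂ * (1 + c) ^ 2 = -(|f₀| + |f₁|) * (1 + c) + f₂ * (1 + c) := by
    rw [← hcf]; ring
  have h5 : f₂ * (1 + c) < 0 := mul_neg_of_neg_of_pos h (by linarith)
  rw [hf, h4]
  linarith

/-- Transversality of the rays from the point at height `r tan μ` on the axis to the spherical cap
with angle `η`, in terms of the distance `√A` of a point of the cap from the centre and its height
`y`. -/
theorem transversality {r A y η μ e : ℝ} (hr : 0 < r) (hμ : 0 < cos μ)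
    (hη : 0 < cos (η / 2)) (hyA : y ^ 2 ≤ A)
    (hP : sin η * (A - r ^ 2) + 2 * r * cos η * y = 0)
    (hQ : 0 ≤ (r ^ 2 - A) * cos η + 2 * r * sin η * y)
    (h1 : 0 < e * sin (η - μ)) (h2 : 0 < e * sin (η / 2 - μ)) :
    0 < e * (sin η * (r ^ 2 - r * tan μ * y)
      - r * cos η * (y + r * tan μ)) := by
  have hs : sin η = 2 * sin (η / 2) * cos (η / 2) := by
    rw [← Real.sin_two_mul]; congr 1; ring
  have hc : cos η = 2 * cos (η / 2) ^ 2 - 1 := by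
    rw [← Real.cos_two_mul]; congr 1; ring
  have hη1 := Real.sin_sq_add_cos_sq (η / 2)
  have hη2 := Real.sin_sq_add_cos_sq η
  have hsub : cos (η / 2) * sin (η - μ) - sin (η / 2) * cos (η - μ)
      = sin (η / 2 - μ) := by
    have : η / 2 - μ = (η - μ) - η / 2 := by ring
    rw [this, Real.sin_sub (η - μ) (η / 2)]; ring
  set Q := (r ^ 2 - A) * cos η + 2 * r * sin η * y with hQdef
  have hy : 2 * r * y = Q * sin η := by
    rw [hQdef]; linear_combination (-2 * r * y) * hη2 + cos η * hP
  have hA : r ^ 2 - A = Q * cos η := by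
    rw [hQdef]; linear_combination (-(r ^ 2 - A)) * hη2 - sin η * hP
  set c1 := cos (η / 2)
  set s1 := sin (η / 2)
  have hy' : r * y = Q * s1 * c1 := by
    rw [hs] at hy; linear_combination hy / 2
  -- the bound for `Q` is attained on the axis
  have hQc : Q * c1 ^ 2 ≤ r ^ 2 := by
    have h3 : r ^ 2 * y ^ 2 ≤ r ^ 2 * A := mul_le_mul_of_nonneg_left hyA (by positivity)
    have h4 : r ^ 2 * A = r ^ 2 * (r ^ 2 - Q * (2 * c1 ^ 2 - 1)) := by
      rw [← hc]; linear_combination (-r ^ 2) * hA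
    have h5 : r ^ 2 * y ^ 2 = Q ^ 2 * (1 - c1 ^ 2) * c1 ^ 2 := by
      have : s1 ^ 2 = 1 - c1 ^ 2 := by linarith
      rw [← this]
      linear_combination (r * y + Q * s1 * c1) * hy'
    have h6 : (Q * c1 ^ 2 - r ^ 2) * (Q * (1 - c1 ^ 2) + r ^ 2) ≤ 0 := by
      rw [h4, h5] at h3
      linear_combination h3
    have h7 : 0 < Q * (1 - c1 ^ 2) + r ^ 2 := by
      have : 0 ≤ 1 - c1 ^ 2 := by nlinarith [sq_nonneg s1]
      positivity
    by_contra h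
    exact absurd (mul_pos (sub_pos.2 (not_le.1 h)) h7) h6.not_gt
  have hmain : c1 * cos μ * (sin η * (r ^ 2 - r * tan μ * y)
      - r * cos η * (y + r * tan μ))
      = (r ^ 2 - Q * c1 ^ 2) * (c1 * sin (η - μ)) + Q * c1 ^ 2 * sin (η / 2 - μ) := by
    rw [← hsub]
    have htan : cos μ * tan μ = sin μ := by
      rw [mul_comm]; exact Real.tan_mul_cos hμ.ne'
    rw [Real.sin_sub, Real.cos_sub]
    linear_combination (c1 * (-(sin η * (r * y)) - r ^ 2 * cos η)) * htan
      - c1 * (sin η * sin μ + cos η * cos μ) * hy'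
  have hpos : 0 < (r ^ 2 - Q * c1 ^ 2) * (c1 * (e * sin (η - μ)))
      + Q * c1 ^ 2 * (e * sin (η / 2 - μ)) := by
    rcases hQ.eq_or_lt with h0 | h0
    · rw [← h0]
      simp only [zero_mul, sub_zero, add_zero]
      positivity
    · have h3 : 0 ≤ (r ^ 2 - Q * c1 ^ 2) * (c1 * (e * sin (η - μ))) :=
        mul_nonneg (by linarith) (by positivity)
      have h4 : 0 < Q * c1 ^ 2 * (e * sin (η / 2 - μ)) := by positivity
      linarith
  have hfin : 0 < c1 * cos μ * (e * (sin η * (r ^ 2 - r * tan μ * y)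
      - r * cos η * (y + r * tan μ))) := by
    calc _ < _ := hpos
      _ = _ := by linear_combination (-e) * hmain
  exact pos_of_mul_pos_right hfin (by positivity)

namespace StandardDoubleBubble

variable (Γ : StandardDoubleBubble n)

/-- With `W(q) = r² - |q - c|² + 2i r (q - c)·a`, the function `Im (e^{-iη} W)`, whose zero set is
the sphere containing the cap with angle `η`. -/
def capIm (η : ℝ) (q : E (n + 1)) : ℝ :=
  sin η * (‖q - Γ.c‖ ^ 2 - Γ.r ^ 2) + 2 * Γ.r * cos η * ⟪q - Γ.c, Γ.a⟫

/-- With `W(q) = r² - |q - c|² + 2i r (q - c)·a`, the function `Re (e^{-iη} W)`, which is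
nonnegative on the cap with angle `η`. -/
def capRe (η : ℝ) (q : E (n + 1)) : ℝ :=
  (Γ.r ^ 2 - ‖q - Γ.c‖ ^ 2) * cos η + 2 * Γ.r * sin η * ⟪q - Γ.c, Γ.a⟫

theorem capIm_add (η δ : ℝ) (q : E (n + 1)) :
    Γ.capIm (η + δ) q = Γ.capIm η q * cos δ - Γ.capRe η q * sin δ := by
  simp only [capIm, capRe, Real.sin_add, Real.cos_add]; ring

theorem mem_sphericalCap_iff {η : ℝ} (hη : η ∈ Ioo (-Real.pi) Real.pi) (q : E (n + 1)) :
    q ∈ sphericalCap Γ.c Γ.a Γ.r η ↔ Γ.capIm η q = 0 ∧ 0 ≤ Γ.capRe η q := by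
  have hr := Γ.r_pos
  rw [sphericalCap, mem_ofPred_eq, capIm, capRe]
  by_cases h0 : η = 0
  · subst h0
    simp only [Real.sin_zero, Real.cos_zero, ne_eq, not_true_eq_false, false_and, or_false,
      true_and, zero_mul, zero_add, mul_zero, add_zero, mul_one]
    refine and_congr ⟨fun h => by rw [h, mul_zero], fun h => ?_⟩ ?_
    · exact (mul_eq_zero.1 h).resolve_left (by positivity)
    · rw [sub_nonneg, sq_le_sq₀ (norm_nonneg _) hr.le]
  · have hs : sin η ≠ 0 := fun h => h0
      ((Real.sin_eq_zero_iff_of_lt_of_lt hη.1 hη.2).1 h)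
    simp only [h0, false_and, ne_eq, not_false_eq_true, true_and, false_or]
    set y := ⟪q - Γ.c, Γ.a⟫ with hy
    have e1 : q - (Γ.c - (Γ.r * Real.cot η) • Γ.a) = (q - Γ.c) + (Γ.r * Real.cot η) • Γ.a := by abel
    have e2 : ‖q - (Γ.c - (Γ.r * Real.cot η) • Γ.a)‖ ^ 2
        = ‖q - Γ.c‖ ^ 2 + 2 * (Γ.r * Real.cot η) * y + (Γ.r * Real.cot η) ^ 2 := by
      rw [e1, norm_add_sq_real, inner_smul_right, norm_smul, Γ.norm_a, mul_one, Real.norm_eq_abs,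
        sq_abs]
      ring
    have e3 : ‖q - (Γ.c - (Γ.r * Real.cot η) • Γ.a)‖ = Γ.r / |sin η|
        ↔ sin η * (‖q - Γ.c‖ ^ 2 - Γ.r ^ 2) + 2 * Γ.r * cos η * y = 0 := by
      rw [← sq_eq_sq₀ (norm_nonneg _) (by positivity), e2, div_pow, sq_abs,
        Real.cot_eq_cos_div_sin, eq_div_iff (by positivity)]
      have e4 : (‖q - Γ.c‖ ^ 2 + 2 * (Γ.r * (cos η / sin η)) * y
          + (Γ.r * (cos η / sin η)) ^ 2) * sin η ^ 2
          = sin η * (sin η * (‖q - Γ.c‖ ^ 2 - Γ.r ^ 2) + 2 * Γ.r * cos η * y)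
            + Γ.r ^ 2 := by
        field_simp
        linear_combination Γ.r ^ 2 * Real.sin_sq_add_cos_sq η
      rw [e4]
      constructor
      · intro h
        exact (mul_eq_zero.1 (by linarith)).resolve_left hs
      · intro h
        rw [h]; ring
    rw [e3]
    refine and_congr_right fun h => ?_
    have h1 : ((Γ.r ^ 2 - ‖q - Γ.c‖ ^ 2) * cos η + 2 * Γ.r * sin η * y) * sin η
        = 2 * Γ.r * y := by
      linear_combination (2 * Γ.r * y) * Real.sin_sq_add_cos_sq η - cos η * h
    rcases lt_or_gt_of_ne h0 with hn | hp
    · have hsn : sin η < 0 := Real.sin_neg_of_neg_of_neg_pi_lt hn hη.1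
      refine ⟨fun h2 => ?_, fun h2 => ?_⟩
      all_goals have : y ≤ 0 := by by_contra h3; nlinarith
      · by_contra h3
        nlinarith
      · nlinarith
    · have hsn : 0 < sin η := Real.sin_pos_of_pos_of_lt_pi hp hη.2
      refine ⟨fun h2 => ?_, fun h2 => ?_⟩
      all_goals have : 0 ≤ y := by by_contra h3; nlinarith
      · by_contra h3
        nlinarith
      · nlinarith

theorem sin_two_pi_div_three_pos : 0 < sin (2 * Real.pi / 3) :=
  Real.sin_pos_of_pos_of_lt_pi (by positivity) (by linarith [Real.pi_pos])

/-- The caps with angles `α` and `α + 2π/3` bound the set where `capIm α ≥ 0` and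
`capIm (α + 2π/3) ≤ 0`. -/
theorem mem_cap_left_iff {α : ℝ} (hα : α ∈ Ioo (-Real.pi) (Real.pi / 3)) (q : E (n + 1)) :
    q ∈ sphericalCap Γ.c Γ.a Γ.r α ↔
      Γ.capIm α q = 0 ∧ 0 ≤ -Γ.capIm (α + 2 * Real.pi / 3) q := by
  rw [Γ.mem_sphericalCap_iff ⟨hα.1, by linarith [hα.2, Real.pi_pos]⟩]
  refine and_congr_right fun h => ?_
  rw [Γ.capIm_add, h, zero_mul, zero_sub, neg_neg]
  exact ⟨fun h => mul_nonneg h sin_two_pi_div_three_pos.le, fun h =>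
    nonneg_of_mul_nonneg_left h sin_two_pi_div_three_pos⟩

theorem mem_cap_right_iff {α : ℝ} (hα : α ∈ Ioo (-Real.pi) (Real.pi / 3)) (q : E (n + 1)) :
    q ∈ sphericalCap Γ.c Γ.a Γ.r (α + 2 * Real.pi / 3) ↔
      -Γ.capIm (α + 2 * Real.pi / 3) q = 0 ∧ 0 ≤ Γ.capIm α q := by
  rw [Γ.mem_sphericalCap_iff ⟨by linarith [hα.1, Real.pi_pos], by linarith [hα.2]⟩, neg_eq_zero]
  refine and_congr_right fun h => ?_
  have h1 := Γ.capIm_add (α + 2 * Real.pi / 3) (-(2 * Real.pi / 3)) q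
  rw [add_neg_cancel_right, h, Real.sin_neg, zero_mul, zero_sub, mul_neg, neg_neg] at h1
  rw [h1]
  exact ⟨fun h => mul_nonneg h sin_two_pi_div_three_pos.le, fun h =>
    nonneg_of_mul_nonneg_left h sin_two_pi_div_three_pos⟩

/-- The region between two neighbouring caps is star-shaped with respect to the point of the axis
that is seen from the triple junction halfway between the caps. -/
theorem exists_star_center {α : ℝ} (hα : α ∈ Ioo (-Real.pi) (Real.pi / 3)) :
    ∃ p : E (n + 1),
      (∀ d, d ≠ 0 → ∃ s : ℝ, 0 < s ∧ p + s • d ∈ sphericalCap Γ.c Γ.a Γ.r α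
        ∪ sphericalCap Γ.c Γ.a Γ.r (α + 2 * Real.pi / 3)) ∧
      (∀ d, ∀ s s' : ℝ, 0 < s → 0 < s' → p + s • d ∈ sphericalCap Γ.c Γ.a Γ.r α
        ∪ sphericalCap Γ.c Γ.a Γ.r (α + 2 * Real.pi / 3) →
        p + s' • d ∈ sphericalCap Γ.c Γ.a Γ.r α
          ∪ sphericalCap Γ.c Γ.a Γ.r (α + 2 * Real.pi / 3) → s = s') ∧
      (∀ q ∈ sphericalCap Γ.c Γ.a Γ.r α,
        0 < ⟪q - p, -((sin α / Γ.r) • (q - Γ.c) + cos α • Γ.a)⟫) ∧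
      ∀ q ∈ sphericalCap Γ.c Γ.a Γ.r (α + 2 * Real.pi / 3),
        ⟪q - p, -((sin (α + 2 * Real.pi / 3) / Γ.r) • (q - Γ.c)
          + cos (α + 2 * Real.pi / 3) • Γ.a)⟫ < 0 := by
  have hr := Γ.r_pos
  have hpi := Real.pi_pos
  obtain ⟨hα1, hα2⟩ := hα
  set β := α + 2 * Real.pi / 3 with hβ
  set μ := α / 2 + Real.pi / 6 with hμ
  set h := Γ.r * tan μ with hh
  have hcμ : 0 < cos μ := Real.cos_pos_of_mem_Ioo ⟨by linarith, by linarith⟩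
  have haa : ⟪Γ.a, Γ.a⟫ = 1 := by rw [real_inner_self_eq_norm_sq, Γ.norm_a, one_pow]
  -- transversality at the two caps
  have hyA : ∀ q, ⟪q - Γ.c, Γ.a⟫ ^ 2 ≤ ‖q - Γ.c‖ ^ 2 := fun q => by
    rw [sq_le_sq, abs_norm]
    simpa [Γ.norm_a] using abs_real_inner_le_norm (q - Γ.c) Γ.a
  have hTα : ∀ q, Γ.capIm α q = 0 → 0 ≤ -Γ.capIm β q →
      sin α * (Γ.r ^ 2 - h * ⟪q - Γ.c, Γ.a⟫)
        - Γ.r * cos α * (⟪q - Γ.c, Γ.a⟫ + h) < 0 := by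
    intro q h1 h2
    have h3 := (Γ.mem_sphericalCap_iff (η := α) ⟨hα1, by linarith⟩ q).1
      ((Γ.mem_cap_left_iff ⟨hα1, hα2⟩ q).2 ⟨h1, h2⟩)
    have h4 := transversality (e := -1) (μ := μ) hr hcμ
      (Real.cos_pos_of_mem_Ioo ⟨by linarith, by linarith⟩) (hyA q) h3.1 h3.2
      (mul_pos_of_neg_of_neg neg_one_lt_zero
        (Real.sin_neg_of_neg_of_neg_pi_lt (by linarith) (by linarith)))
      (mul_pos_of_neg_of_neg neg_one_lt_zero
        (Real.sin_neg_of_neg_of_neg_pi_lt (by linarith) (by linarith)))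
    linarith
  have hTβ : ∀ q, -Γ.capIm β q = 0 → 0 ≤ Γ.capIm α q →
      0 < sin β * (Γ.r ^ 2 - h * ⟪q - Γ.c, Γ.a⟫)
        - Γ.r * cos β * (⟪q - Γ.c, Γ.a⟫ + h) := by
    intro q h1 h2
    have h3 := (Γ.mem_sphericalCap_iff (η := β) ⟨by linarith, by linarith⟩ q).1
      ((Γ.mem_cap_right_iff ⟨hα1, hα2⟩ q).2 ⟨h1, h2⟩)
    have h4 := transversality (e := 1) (μ := μ) hr hcμ
      (Real.cos_pos_of_mem_Ioo ⟨by linarith, by linarith⟩) (hyA q) h3.1 h3.2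
      (mul_pos one_pos (Real.sin_pos_of_pos_of_lt_pi (by linarith) (by linarith)))
      (mul_pos one_pos (Real.sin_pos_of_pos_of_lt_pi (by linarith) (by linarith)))
    linarith
  set p := Γ.c + h • Γ.a with hp
  have he : ∀ (d : E (n + 1)) (s : ℝ), p + s • d - Γ.c = h • Γ.a + s • d := fun d s => by
    rw [hp]; abel
  have hy : ∀ (d : E (n + 1)) (s : ℝ), ⟪p + s • d - Γ.c, Γ.a⟫ = h + s * ⟪d, Γ.a⟫ := fun d s => by
    rw [he, inner_add_left, real_inner_smul_left, real_inner_smul_left, haa, mul_one]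
  have hray : ∀ (η : ℝ) (d : E (n + 1)) (s : ℝ), Γ.capIm η (p + s • d)
      = (sin η * (h ^ 2 - Γ.r ^ 2) + 2 * Γ.r * cos η * h)
        + (2 * ⟪d, Γ.a⟫ * (h * sin η + Γ.r * cos η)) * s
        + (sin η * ‖d‖ ^ 2) * s ^ 2 := by
    intro η d s
    have e2 : ‖h • Γ.a + s • d‖ ^ 2 = h ^ 2 + 2 * (h * s * ⟪d, Γ.a⟫) + s ^ 2 * ‖d‖ ^ 2 := by
      rw [norm_add_sq_real, norm_smul, norm_smul, Γ.norm_a, real_inner_smul_left,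
        real_inner_smul_right, real_inner_comm, mul_pow, mul_pow, Real.norm_eq_abs, Real.norm_eq_abs,
        sq_abs, sq_abs]
      ring
    rw [capIm, hy, he, e2]
    ring
  have h0 : ∀ η, (sin η * (h ^ 2 - Γ.r ^ 2) + 2 * Γ.r * cos η * h) * cos μ ^ 2
      = Γ.r ^ 2 * sin (2 * μ - η) := by
    intro η
    have ht : h * cos μ = Γ.r * sin μ := by
      rw [hh, mul_assoc, Real.tan_mul_cos hcμ.ne']
    rw [Real.sin_sub, Real.sin_two_mul, Real.cos_two_mul']
    linear_combination (sin η * (h * cos μ + Γ.r * sin μ)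
      + 2 * Γ.r * cos η * cos μ) * ht
  have hf0 : 0 < sin α * (h ^ 2 - Γ.r ^ 2) + 2 * Γ.r * cos α * h := by
    have h1 : 0 < Γ.r ^ 2 * sin (2 * μ - α) := mul_pos (by positivity)
      (Real.sin_pos_of_pos_of_lt_pi (by linarith) (by linarith))
    rw [← h0] at h1
    exact pos_of_mul_pos_left h1 (by positivity)
  have hg0 : 0 < -(sin β * (h ^ 2 - Γ.r ^ 2) + 2 * Γ.r * cos β * h) := by
    have h1 : Γ.r ^ 2 * sin (2 * μ - β) < 0 := mul_neg_of_pos_of_neg (by positivity)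
      (Real.sin_neg_of_neg_of_neg_pi_lt (by linarith) (by linarith))
    rw [← h0] at h1
    by_contra h2
    nlinarith [sq_nonneg (cos μ)]
  have hmem : ∀ (d : E (n + 1)) (s : ℝ), p + s • d ∈ sphericalCap Γ.c Γ.a Γ.r α
        ∪ sphericalCap Γ.c Γ.a Γ.r β ↔
      (Γ.capIm α (p + s • d) = 0 ∧ 0 ≤ -Γ.capIm β (p + s • d)) ∨
        (-Γ.capIm β (p + s • d) = 0 ∧ 0 ≤ Γ.capIm α (p + s • d)) := fun d s => by
    rw [mem_union, Γ.mem_cap_left_iff ⟨hα1, hα2⟩, Γ.mem_cap_right_iff ⟨hα1, hα2⟩]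
  have hneg : ∀ (d : E (n + 1)) (s : ℝ), -Γ.capIm β (p + s • d)
      = -(sin β * (h ^ 2 - Γ.r ^ 2) + 2 * Γ.r * cos β * h)
        + (-(2 * ⟪d, Γ.a⟫ * (h * sin β + Γ.r * cos β))) * s
        + (-(sin β * ‖d‖ ^ 2)) * s ^ 2 := fun d s => by rw [hray]; ring
  refine ⟨p, fun d hd => ?_, fun d s s' hs hs' h1 h2 => ?_, fun q hq => ?_, fun q hq => ?_⟩
  · -- the ray leaves the region
    obtain ⟨s, hs, hs1⟩ : ∃ s : ℝ, 0 < s ∧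
        min (Γ.capIm α (p + s • d)) (-Γ.capIm β (p + s • d)) < 0 := by
      have hdn : 0 < ‖d‖ ^ 2 := by have := norm_pos_iff.2 hd; positivity
      rcases lt_or_ge α 0 with hneg0 | hnn
      · obtain ⟨s, hs, h1⟩ := exists_quadratic_neg (hray α d) (mul_neg_of_neg_of_pos (Real.sin_neg_of_neg_of_neg_pi_lt hneg0 hα1) hdn)
        exact ⟨s, hs, min_lt_iff.2 (Or.inl h1)⟩
      · obtain ⟨s, hs, h1⟩ := exists_quadratic_neg (hneg d)
          (neg_neg_of_pos (mul_pos (Real.sin_pos_of_pos_of_lt_pi (by linarith) (by linarith)) hdn))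
        exact ⟨s, hs, min_lt_iff.2 (Or.inr h1)⟩
    have hcont : ContinuousOn (fun s : ℝ => min (Γ.capIm α (p + s • d)) (-Γ.capIm β (p + s • d)))
        (Icc 0 s) := by
      simp only [hray]
      fun_prop
    have h00 : 0 < min (Γ.capIm α (p + (0 : ℝ) • d)) (-Γ.capIm β (p + (0 : ℝ) • d)) := by
      rw [hneg, hray]
      simp only [mul_zero, add_zero, ne_eq, OfNat.ofNat_ne_zero, not_false_eq_true, zero_pow]
      exact lt_min hf0 hg0
    obtain ⟨t, ht, ht0⟩ := intermediate_value_Icc' hs.le hcont ⟨hs1.le, h00.le⟩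
    simp only at ht0
    refine ⟨t, ht.1.lt_of_ne ?_, (hmem d t).2 ?_⟩
    · rintro rfl
      rw [ht0] at h00
      exact h00.false
    · rcases min_choice (Γ.capIm α (p + t • d)) (-Γ.capIm β (p + t • d)) with h1 | h1
      · rw [ht0] at h1
        exact Or.inl ⟨h1.symm, ht0 ▸ min_le_right _ _⟩
      · rw [ht0] at h1
        exact Or.inr ⟨h1.symm, ht0 ▸ min_le_left _ _⟩
  · rw [hmem] at h1 h2
    refine quadratic_pair_unique (hray α d) (hneg d) hf0 hg0 (fun x hx h3 h4 => ?_)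
      (fun x hx h3 h4 => ?_) hs hs' h1 h2
    · have h5 := hTα _ h3 h4
      rw [hray] at h3
      rw [hy] at h5
      by_contra h6
      have h7 := mul_nonneg hx.le (not_lt.1 h6)
      nlinarith
    · have h5 := hTβ _ h3 h4
      rw [hneg] at h3
      rw [hy] at h5
      by_contra h6
      have h7 := mul_nonneg hx.le (not_lt.1 h6)
      nlinarith
  all_goals
    have hq1 : ∀ η, ⟪q - p, -((sin η / Γ.r) • (q - Γ.c) + cos η • Γ.a)⟫
        = -((sin η * (‖q - Γ.c‖ ^ 2 - h * ⟪q - Γ.c, Γ.a⟫)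
          + Γ.r * cos η * (⟪q - Γ.c, Γ.a⟫ - h)) / Γ.r) := by
      intro η
      have e : q - p = (q - Γ.c) - h • Γ.a := by rw [hp]; abel
      rw [e]
      generalize q - Γ.c = z
      rw [inner_neg_right, inner_add_right, real_inner_smul_right, real_inner_smul_right,
        inner_sub_left, inner_sub_left, real_inner_smul_left, real_inner_smul_left, haa,
        real_inner_self_eq_norm_sq, real_inner_comm Γ.a]
      field_simp
    rw [hq1]
  · obtain ⟨h1, h2⟩ := (Γ.mem_cap_left_iff ⟨hα1, hα2⟩ q).1 hq
    have h3 := hTα q h1 h2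
    rw [capIm] at h1
    rw [← neg_div]
    exact div_pos (by linarith) hr
  · obtain ⟨h1, h2⟩ := (Γ.mem_cap_right_iff ⟨hα1, hα2⟩ q).1 hq
    have h3 := hTβ q h1 h2
    rw [neg_eq_zero, capIm] at h1
    rw [← neg_div]
    exact div_neg_of_neg_of_pos (by linarith) hr

end StandardDoubleBubble

end

section

variable {n : ℕ}

/-! ### The volumes enclosed by nearby clusters -/

theorem enclosed_image_sub (S : Set (E n)) (p : E n) :
    enclosed ((fun q => q - p) '' S) = (fun q => q - p) '' enclosed S := by
  have hc : ((fun q => q - p) '' S)ᶜ = (fun q => q - p) '' Sᶜ :=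
    (image_compl_eq (Homeomorph.subRight p).bijective).symm
  have hb (A : Set (E n)) : Bornology.IsBounded ((fun q => q - p) '' A) ↔ Bornology.IsBounded A := by
    refine ⟨fun h => ?_, (IsometryEquiv.subRight p).isometry.lipschitz.isBounded_image⟩
    have h1 := (IsometryEquiv.subRight p).symm.isometry.lipschitz.isBounded_image h
    have e : (fun q => (IsometryEquiv.subRight p).symm (q - p)) = id :=
      funext fun q => (IsometryEquiv.subRight p).symm_apply_apply q
    rwa [image_image, e, image_id] at h1
  ext q
  constructor
  · rintro ⟨h1, h2⟩
    have h3 : q ∈ (fun q => q - p) '' Sᶜ := hc ▸ h1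
    obtain ⟨q, hq, rfl⟩ := h3
    refine ⟨q, ⟨hq, ?_⟩, rfl⟩
    rw [hc] at h2
    have h4 := (Homeomorph.subRight p).image_connectedComponentIn (s := Sᶜ) hq
    exact (hb _).1 (h4 ▸ h2)
  · rintro ⟨q, ⟨hq, h2⟩, rfl⟩
    have h3 : q - p ∈ ((fun q => q - p) '' S)ᶜ := hc ▸ mem_image_of_mem _ hq
    refine ⟨h3, ?_⟩
    rw [hc]
    have h4 := (Homeomorph.subRight p).image_connectedComponentIn (s := Sᶜ) hq
    exact h4 ▸ (hb _).2 h2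

theorem volume_enclosed_image_sub (S : Set (E n)) (p : E n) :
    volume (enclosed ((fun q => q - p) '' S)) = volume (enclosed S) := by
  have h : (fun q => q - p) '' enclosed S = (fun q => q + p) ⁻¹' enclosed S := by
    ext q
    simp [sub_eq_iff_eq_add]
  rw [enclosed_image_sub, h, measure_preimage_add_right]

theorem norm_le_sum_coord (v : E n) : ‖v‖ ≤ ∑ l, |v l| := by
  have h : v = ∑ l, v l • single l (1 : ℝ) := clm_apply_eq_sum (ContinuousLinearMap.id ℝ (E n)) v
  conv_lhs => rw [h]
  exact (norm_sum_le _ _).trans_eq (by simp [norm_smul])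

theorem clm_norm_le_sum {G : Type*} [NormedAddCommGroup G] [NormedSpace ℝ G] (L : E n →L[ℝ] G) :
    ‖L‖ ≤ ∑ j, ‖L (single j 1)‖ := by
  refine L.opNorm_le_bound (by positivity) fun h => ?_
  rw [clm_apply_eq_sum, sum_mul]
  refine (norm_sum_le _ _).trans (Finset.sum_le_sum fun j _ => ?_)
  rw [norm_smul, mul_comm]
  exact mul_le_mul_of_nonneg_left (PiLp.norm_apply_le h j) (norm_nonneg _)

/-- A map that is differentiable on the closed ball, with continuous partial derivatives. -/
theorem contDiffOn_one_of_pd {G : Type*} [NormedAddCommGroup G] [NormedSpace ℝ G] {X : E n → G}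
    (hd : DifferentiableOn ℝ X (𝔹 n))
    (hc : ∀ j, ContinuousOn (pd j X) (𝔹 n)) : ContDiffOn ℝ 1 X (𝔹 n) := by
  rw [show (1 : WithTop ℕ∞) = 0 + 1 from rfl, contDiffOn_succ_iff_fderivWithin uniqueDiffOn_closedBall,
    contDiffOn_zero]
  refine ⟨hd, by simp, continuousOn_clm_apply.2 fun h => ?_⟩
  have : (fun x => fderivWithin ℝ X (𝔹 n) x h) = fun x => ∑ j, h j • pd j X x := by
    funext x
    exact clm_apply_eq_sum _ _
  rw [this]
  exact continuousOn_finsetSum _ fun j _ => (hc j).const_smul (h j)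

theorem pd_sub_const {G : Type*} [NormedAddCommGroup G] [NormedSpace ℝ G] (X : E n → G) (p : G)
    (j : Fin n) : pd j (fun y => X y - p) = pd j X := by
  funext x
  rw [pd, pd, fderivWithin_sub_const]

variable [NeZero n] {k : ℕ} {hk1 : n < 2 * (k + 1)}

/-- Local expressions in the height functions depend continuously on the height functions,
uniformly on the closed ball. -/
theorem eventually_abs_sub_le {q : Height n (k + 2) → E n → ℝ} (hq : q ∈ jetAlg hk1 univ) {ε : ℝ}
    (hε : 0 < ε) : ∀ᶠ u in 𝓝 (0 : Height n (k + 2)), ∀ x ∈ 𝔹 n,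
      |q u x - q 0 x| ≤ ε := by
  obtain ⟨F, ⟨hF, -⟩, hFq⟩ := hq
  obtain ⟨C, hC, hb⟩ := H.exists_abs_contRep_le (n := n) hk1
  have h0 : Tendsto (fun u => C * ‖F u - F 0‖) (𝓝 0) (𝓝 0) := by
    have h1 := (hF 0 (mem_univ _)).continuousAt
    simpa using (tendsto_iff_norm_sub_tendsto_zero.1 h1).const_mul C
  filter_upwards [h0.eventually (ge_mem_nhds hε)] with u hu x hx
  have h1 := hb (F u - F 0) x hx
  rw [H.contRep_sub hk1 _ _ hx] at h1
  simp only [hFq u (mem_univ _) hx, hFq 0 (mem_univ _) hx] at h1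
  exact h1.trans hu

theorem continuousOn_of_mem_jetAlg {q : Height n (k + 2) → E n → ℝ} (hq : q ∈ jetAlg hk1 univ)
    (u : Height n (k + 2)) : ContinuousOn (q u) (𝔹 n) := by
  obtain ⟨F, -, hFq⟩ := hq
  exact (H.continuousOn_contRep hk1 (F u)).congr fun x hx => (hFq u (mem_univ _) hx).symm

section

variable (hk : n < 2 * k) (D : ReferenceCluster n)

include hk hk1 in
theorem contDiffOn_surf (u : Height n (k + 2)) (i : Fin 3) :
    ContDiffOn ℝ 1 (D.surf u i) (𝔹 n) := by
  have hd : DifferentiableOn ℝ (D.surf u i) (𝔹 n) := fun x hx =>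
    (differentiableWithinAt_euclidean).2 fun l =>
      differentiableWithinAt_of_mem_analyticAlg (U := univ) hk (analyticAlg_of_localAlg
        (surf_mem (hk1 := hk1) D i l)) (mem_univ u) hx
  refine contDiffOn_one_of_pd hd fun j => ?_
  have h1 : ContinuousOn (fun x => WithLp.toLp 2 fun l => pd j (D.surf u i) x l) (𝔹 n) :=
    (PiLp.continuous_toLp 2 _).comp_continuousOn (continuousOn_pi.2 fun l =>
      continuousOn_of_mem_jetAlg (pd_surf_mem hk (hk1 := hk1) D i j l) u)
  exact h1

include hk hk1 in
/-- Surfaces with small height functions are close to the reference surface in the `C¹` norm. -/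
theorem eventually_surf_close (hk2 : n < 2 * (k + 2)) (i : Fin 3) {ε : ℝ} (hε : 0 < ε) :
    ∀ᶠ u in 𝓝 (0 : Height n (k + 2)),
      (∀ x ∈ 𝔹 n, ‖D.surf u i x - D.φ i x‖ ≤ ε) ∧
      ∀ x ∈ 𝔹 n, ∀ x' ∈ 𝔹 n,
        ‖(D.surf u i x - D.φ i x) - (D.surf u i x' - D.φ i x')‖ ≤ ε * ‖x - x'‖ := by
  set ε' := ε / ((n + 1) * (n + 1)) with hε'
  have hε0 : 0 < ε' := by positivity
  have hφ := fun x (hx : x ∈ 𝔹 n) => (surf_zero D hk2 i hx).symm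
  have hpφ := fun j x (hx : x ∈ 𝔹 n) => (pd_congr (surf_zero D hk2 i) j hx).symm
  have e1 : ∀ᶠ u in 𝓝 (0 : Height n (k + 2)), ∀ l, ∀ x ∈ 𝔹 n,
      |D.surf u i x l - D.surf 0 i x l| ≤ ε' :=
    eventually_all.2 fun l => eventually_abs_sub_le (surf_mem (hk1 := hk1) D i l) hε0
  have e2 : ∀ᶠ u in 𝓝 (0 : Height n (k + 2)), ∀ j l, ∀ x ∈ 𝔹 n,
      |pd j (D.surf u i) x l - pd j (D.surf 0 i) x l| ≤ ε' :=
    eventually_all.2 fun j => eventually_all.2 fun l =>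
      eventually_abs_sub_le (pd_surf_mem hk (hk1 := hk1) D i j l) hε0
  have hsum : ∀ v : E (n + 1), (∀ l, |v l| ≤ ε') → ‖v‖ ≤ (n + 1) * ε' := fun v hv =>
    (norm_le_sum_coord v).trans ((Finset.sum_le_card_nsmul _ _ ε' fun l _ => hv l).trans (by simp))
  have hε1 : (n + 1) * ((n + 1) * ε') = ε := by rw [hε']; field_simp
  have hn1 : (n + 1) * ε' ≤ ε := by
    rw [← hε1]
    exact le_mul_of_one_le_left (by positivity) (by linarith [(Nat.cast_nonneg n : (0 : ℝ) ≤ n)])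
  filter_upwards [e1, e2] with u h1 h2
  constructor
  · intro x hx
    refine (hsum _ fun l => ?_).trans hn1
    rw [hφ x hx]
    exact h1 l x hx
  · intro x hx x' hx'
    have hd1 := (contDiffOn_surf hk (hk1 := hk1) D u i).differentiableOn one_ne_zero
    have hd2 : DifferentiableOn ℝ (D.φ i) (𝔹 n) := (D.φ_smooth i).differentiableOn (by simp)
    refine (convex_closedBall (0 : E n) 1).norm_image_sub_le_of_norm_fderivWithin_le (𝕜 := ℝ)
      (f := fun x => D.surf u i x - D.φ i x) (hd1.sub hd2) (fun y hy => ?_) hx' hx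
    refine (clm_norm_le_sum _).trans ?_
    have h3 : ∀ j, ‖fderivWithin ℝ (fun x => D.surf u i x - D.φ i x) (𝔹 n) y
        (single j 1)‖ ≤ (n + 1) * ε' := by
      intro j
      rw [fderivWithin_fun_sub (uniqueDiffOn_closedBall y hy) (hd1 y hy) (hd2 y hy)]
      refine hsum _ fun l => ?_
      have h4 := h2 j l y hy
      rw [← hpφ j y hy] at h4
      exact h4
    refine (Finset.sum_le_card_nsmul _ _ _ fun j _ => h3 j).trans ?_
    rw [Finset.card_univ, Fintype.card_fin, nsmul_eq_mul, ← hε1]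
    exact mul_le_mul_of_nonneg_right (by linarith) (by positivity)

end

namespace ReferenceCluster

variable (D : ReferenceCluster n)

omit [NeZero n] in
/-- The interior of the ball does not meet the triple junction, because there the cap is crossed. -/
theorem mem_sphere_of_capRe_eq_zero {i : Fin 3} {x : E n} (hx : x ∈ 𝔹 n)
    (h0 : D.capRe (D.angle i) (D.φ i x) = 0) : x ∈ 𝕊 n := by
  by_contra hxs
  have hxb : x ∈ ball (0 : E n) 1 := mem_ball_zero_iff.2
    ((mem_closedBall_zero_iff.1 hx).lt_of_ne fun h => hxs (mem_sphere_zero_iff_norm.2 h))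
  have hcap : ∀ y ∈ 𝔹 n, D.capIm (D.angle i) (D.φ i y) = 0 ∧
      0 ≤ D.capRe (D.angle i) (D.φ i y) := fun y hy =>
    (D.mem_sphericalCap_iff (D.angle_mem i) _).1 (D.φ_mem hy)
  set η := D.angle i
  set v : E (n + 1) := (-2 * cos η) • (D.φ i x - D.c) + (2 * D.r * sin η) • D.a with hv
  have hder := (D.differentiableWithinAt_φ i hx).hasFDerivWithinAt
  have hnb : 𝔹 n ∈ 𝓝 x :=
    mem_of_superset (isOpen_ball.mem_nhds hxb) ball_subset_closedBall
  have hder' := hder.hasFDerivAt hnb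
  have hz := hder'.sub_const D.c
  -- `capRe` has a minimum at `x`, so its gradient `v` is normal to the surface there; but `v` is
  -- orthogonal to the normal, and does not vanish
  have hmin : IsLocalMin (fun y => D.capRe η (D.φ i y)) x := by
    filter_upwards [hnb] with y hy
    rw [h0]
    exact (hcap y hy).2
  have hcr := (((hasFDerivAt_const (D.r ^ 2) x).sub hz.norm_sq).mul_const (cos η)).add
    ((hz.inner ℝ (hasFDerivAt_const D.a x)).const_mul (2 * D.r * sin η))
  have hzero := hmin.hasFDerivAt_eq_zero hcr
  have hperp : ∀ j, ⟪v, pd j (D.φ i) x⟫ = 0 := by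
    intro j
    have h1 := congrArg (fun L : E n →L[ℝ] ℝ => L (single j 1)) hzero
    simp [fderivInnerCLM_apply] at h1
    rw [hv, inner_add_left, real_inner_smul_left, real_inner_smul_left, real_inner_comm _ D.a]
    simp only [pd, inner_sub_left]
    linear_combination h1
  have hA := (hcap x hx).1
  rw [StandardDoubleBubble.capRe] at h0
  rw [StandardDoubleBubble.capIm] at hA
  have hcs := Real.sin_sq_add_cos_sq η
  have hr := D.r_pos
  have hA1 : ‖D.φ i x - D.c‖ ^ 2 = D.r ^ 2 := by
    linear_combination (-‖D.φ i x - D.c‖ ^ 2 + D.r ^ 2) * hcs + sin η * hA - cos η * h0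
  have hy1 : ⟪D.φ i x - D.c, D.a⟫ = 0 := by
    have : 2 * D.r * ⟪D.φ i x - D.c, D.a⟫ = 0 := by
      linear_combination (-2 * D.r * ⟪D.φ i x - D.c, D.a⟫) * hcs + cos η * hA + sin η * h0
    exact (mul_eq_zero.1 this).resolve_left (by positivity)
  have haa : ⟪D.a, D.a⟫ = 1 := by rw [real_inner_self_eq_norm_sq, D.norm_a, one_pow]
  obtain ⟨hvN, hvv⟩ : ⟪v, D.N i x⟫ = 0 ∧ ⟪v, v⟫ = 4 * D.r ^ 2 := by
    change ⟪v, -((sin η / D.r) • (D.φ i x - D.c) + cos η • D.a)⟫ = 0 ∧ _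
    rw [hv]
    generalize D.φ i x - D.c = z at *
    have hz1 : ⟪D.a, z⟫ = 0 := by rw [real_inner_comm, hy1]
    have hz2 : ⟪z, z⟫ = D.r ^ 2 := by rw [real_inner_self_eq_norm_sq, hA1]
    simp only [inner_neg_right, inner_add_right, inner_add_left, real_inner_smul_left,
      real_inner_smul_right, haa, hz1, hz2, hy1]
    constructor
    · field_simp
      ring
    · linear_combination (4 * D.r ^ 2) * hcs
  have hgram := D.det_metric_φ_pos i hx
  rw [metric_eq_gram] at hgram
  have e1 := eq_smul_cross_of_orthogonal hgram hperp
  have e2 := eq_smul_cross_of_orthogonal hgram (D.inner_N_pd i hx)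
  have hN := D.norm_N (i := i) hx
  set w := cross fun j => pd j (D.φ i) x
  rw [e1, e2, real_inner_smul_left, real_inner_smul_right] at hvN
  rcases mul_eq_zero.1 hvN with h | h
  · rw [h, zero_smul] at e1
    rw [e1, inner_zero_left] at hvv
    nlinarith
  · rcases mul_eq_zero.1 h with h | h
    · rw [h, zero_smul] at e2
      rw [e2, norm_zero] at hN
      norm_num at hN
    · rw [inner_self_eq_zero.1 h, smul_zero] at e2
      rw [e2, norm_zero] at hN
      norm_num at hN

end ReferenceCluster

end

section

variable {n : ℕ}

namespace ReferenceCluster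

variable (D : ReferenceCluster n)

/-- Two neighbouring surfaces of the reference cluster form a star-shaped surface. -/
theorem exists_isStarSurface {ι : Fin 2 → Fin 3} (hα : D.angle (ι 0) ∈ Ioo (-Real.pi) (Real.pi / 3))
    (hβ : D.angle (ι 1) = D.angle (ι 0) + 2 * Real.pi / 3) :
    ∃ p : E (n + 1), IsStarSurface (fun l x => D.φ (ι l) x - p) ∧
      (∀ x ∈ 𝔹 n, 0 < ⟪D.φ (ι 0) x - p, D.N (ι 0) x⟫) ∧
      ∀ x ∈ 𝔹 n, ⟪D.φ (ι 1) x - p, D.N (ι 1) x⟫ < 0 := by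
  obtain ⟨p, hcov, huniq, h0, h1⟩ := D.exists_star_center hα
  rw [← hβ] at hcov huniq h1
  have hmem : ∀ z, z ∈ sphericalCap D.c D.a D.r (D.angle (ι 0)) ∪ sphericalCap D.c D.a D.r (D.angle (ι 1))
      ↔ ∃ l, ∃ x ∈ 𝔹 n, D.φ (ι l) x = z := by
    intro z
    have h : ∀ l, z ∈ sphericalCap D.c D.a D.r (D.angle (ι l)) ↔
        ∃ x ∈ 𝔹 n, D.φ (ι l) x = z := fun l => by
      change z ∈ D.surface (ι l) ↔ _
      rw [← D.φ_image]; rfl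
    rw [mem_union, h, h, Fin.exists_fin_two]
  have hjunction : ∀ z, z ∈ sphericalCap D.c D.a D.r (D.angle (ι 0)) →
      z ∈ sphericalCap D.c D.a D.r (D.angle (ι 1)) →
      ∀ l, ∀ x ∈ 𝔹 n, D.φ (ι l) x = z → x ∈ 𝕊 n := by
    intro z hz0 hz1 l x hx hxz
    have e0 := ((D.mem_sphericalCap_iff (D.angle_mem _) z).1 hz0).1
    have e1 := ((D.mem_sphericalCap_iff (D.angle_mem _) z).1 hz1).1
    have e2 : D.capRe (D.angle (ι 0)) z = 0 := by
      have h := e1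
      rw [hβ, D.capIm_add, e0, zero_mul, zero_sub, neg_eq_zero] at h
      exact (mul_eq_zero.1 h).resolve_right
        StandardDoubleBubble.sin_two_pi_div_three_pos.ne'
    have e3 : D.capRe (D.angle (ι 1)) z = 0 := by
      have h := e0
      rw [← add_neg_cancel_right (D.angle (ι 0)) (2 * Real.pi / 3), ← hβ, D.capIm_add, e1, zero_mul,
        zero_sub, neg_eq_zero, Real.sin_neg, mul_neg, neg_eq_zero] at h
      exact (mul_eq_zero.1 h).resolve_right
        StandardDoubleBubble.sin_two_pi_div_three_pos.ne'
    refine D.mem_sphere_of_capRe_eq_zero (i := ι l) hx ?_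
    rw [hxz]
    fin_cases l
    exacts [e2, e3]
  have hcap : ∀ l, ∀ x ∈ 𝔹 n,
      D.φ (ι l) x ∈ sphericalCap D.c D.a D.r (D.angle (ι l)) := fun l x hx => D.φ_mem hx
  refine ⟨p, ⟨fun l => (D.φ_smooth _).continuousOn.sub continuousOn_const, fun x hx l l' => by
    simp only [D.φ_boundary (ι l) (ι l') x hx], fun q hq => ?_,
    fun l l' x hx x' hx' s s' hs hs' h => ?_⟩, fun x hx => h0 _ (hcap 0 x hx),
    fun x hx => h1 _ (hcap 1 x hx)⟩
  · obtain ⟨s, hs, hsm⟩ := hcov q hq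
    obtain ⟨l, x, hx, hxs⟩ := (hmem _).1 hsm
    refine ⟨s⁻¹, inv_pos.2 hs, l, x, hx, ?_⟩
    rw [hxs, add_sub_cancel_left, inv_smul_smul₀ hs.ne']
  · have h2 : p + (s / s') • (D.φ (ι l) x - p) = D.φ (ι l') x' := by
      rw [div_eq_inv_mul, mul_smul, h, inv_smul_smul₀ hs'.ne', add_sub_cancel]
    have h3 : 1 = s / s' := by
      refine huniq (D.φ (ι l) x - p) 1 (s / s') one_pos (by positivity) ?_ ?_
      · rw [one_smul, add_sub_cancel]
        exact (hmem _).2 ⟨l, x, hx, rfl⟩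
      · rw [h2]
        exact (hmem _).2 ⟨l', x', hx', rfl⟩
    have h4 : s = s' := ((div_eq_one_iff_eq hs'.ne').1 h3.symm)
    have h5 : D.φ (ι l) x = D.φ (ι l') x' := by
      rw [← h2, ← h3, one_smul, add_sub_cancel]
    refine ⟨h4, ?_⟩
    by_cases hll : l = l'
    · subst hll
      exact ⟨D.φ_injOn _ hx hx' h5, Or.inl rfl⟩
    · have hz : D.φ (ι l) x ∈ sphericalCap D.c D.a D.r (D.angle (ι 0)) ∧
          D.φ (ι l) x ∈ sphericalCap D.c D.a D.r (D.angle (ι 1)) := by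
        have hl := hcap l x hx
        have hl' := h5 ▸ hcap l' x' hx'
        rcases (by omega : (l = 0 ∧ l' = 1) ∨ (l = 1 ∧ l' = 0)) with ⟨rfl, rfl⟩ | ⟨rfl, rfl⟩
        exacts [⟨hl, hl'⟩, ⟨hl', hl⟩]
      have hxs := hjunction _ hz.1 hz.2 l x hx rfl
      have hxs' := hjunction _ hz.1 hz.2 l' x' hx' h5.symm
      refine ⟨D.φ_injOn (ι l) hx hx' ?_, Or.inr hxs⟩
      rw [h5]
      exact D.φ_boundary _ _ x' hxs'

/-- The orientation of a parametrization with respect to the normal. -/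
def orient (i : Fin 3) : ℝ := (exists_orientation D i).choose

theorem sq_orient (i : Fin 3) : D.orient i ^ 2 = 1 := by
  rcases (exists_orientation D i).choose_spec.1 with h | h <;> rw [orient, h] <;> norm_num

theorem cross_φ (i : Fin 3) {x : E n} (hx : x ∈ 𝔹 n) :
    (cross fun j => pd j (D.φ i) x) = (D.orient i * areaDensity (D.φ i) x) • D.N i x := by
  have h1 := (exists_orientation D i).choose_spec.2 x hx
  have hgram := D.det_metric_φ_pos i hx
  have hpos : 0 < areaDensity (D.φ i) x := Real.sqrt_pos.2 hgram
  rw [metric_eq_gram] at hgram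
  have h2 := eq_smul_cross_of_orthogonal hgram (D.inner_N_pd i hx)
  have h3 := areaDensity_eq_norm_cross (D.φ i) x
  have hs := D.sq_orient i
  change _ = D.orient i * _ at h1
  rw [real_inner_comm] at h1
  set w := cross fun j => pd j (D.φ i) x
  rw [h1, ← h3] at h2
  rw [h2, smul_smul]
  have : D.orient i * areaDensity (D.φ i) x * (D.orient i * areaDensity (D.φ i) x
      / areaDensity (D.φ i) x ^ 2) = 1 := by
    field_simp
    exact hs
  rw [this, one_smul]

theorem coneDensity_φ (p : E (n + 1)) (i : Fin 3) {x : E n} (hx : x ∈ 𝔹 n) :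
    coneDensity (fun y => D.φ i y - p) x
      = D.orient i * areaDensity (D.φ i) x * ⟪D.φ i x - p, D.N i x⟫ := by
  simp only [coneDensity, pd_sub_const]
  rw [D.cross_φ i hx, real_inner_smul_right]

end ReferenceCluster

variable [NeZero n] {k : ℕ} (hk : n < 2 * k) {hk1 : n < 2 * (k + 1)} (D : ReferenceCluster n)

/-- The three surfaces of a cluster have the same boundary. -/
theorem surf_boundary (hk2 : n < 2 * (k + 2)) (u : Height n (k + 2)) (i i' : Fin 3) {x : E n}
    (hx : x ∈ 𝕊 n) : D.surf u i x = D.surf u i' x := by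
  suffices ∀ i, D.surf u i x = D.surf u 0 x from (this i).trans (this i').symm
  intro i
  have hsum := Height.sum_contRep_eq_zero hk2 u hx
  have h3 : √3 ^ 2 = 3 := Real.sq_sqrt (by norm_num)
  have h30 : √3 ≠ 0 := by positivity
  have hr := D.r_pos
  have hs : sin (2 * Real.pi / 3) = √3 / 2 := by
    rw [show 2 * Real.pi / 3 = Real.pi - Real.pi / 3 by ring, Real.sin_pi_sub, Real.sin_pi_div_three]
  have hc : cos (2 * Real.pi / 3) = -(1 / 2) := by
    rw [show 2 * Real.pi / 3 = Real.pi - Real.pi / 3 by ring, Real.cos_pi_sub, Real.cos_pi_div_three]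
  set μ : Fin 3 → ℝ := tangentialMatrix *ᵥ fun j => (u.1 j).contRep x with hμ
  have key : ∀ i, D.surf u i x = D.φ 0 x
      + (-((u.1 i).contRep x * sin (D.angle i)) + μ i * cos (D.angle i))
        • ((1 / D.r) • (D.φ 0 x - D.c))
      + (-((u.1 i).contRep x * cos (D.angle i)) - μ i * sin (D.angle i)) • D.a := by
    intro i
    rw [ReferenceCluster.surf, ReferenceCluster.graph, D.τ_boundary i x hx, ReferenceCluster.N,
      StandardDoubleBubble.normal, StandardDoubleBubble.conormal, D.φ_boundary i 0 x hx, ← hμ]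
    module
  -- the coefficients agree because the normals are at angles `2π/3` and the heights add up to zero
  rw [key, key]
  obtain ⟨hμ0, hμ1, hμ2⟩ : μ 0 = -(1 / √3) * ((u.1 1).contRep x - (u.1 2).contRep x) ∧
      μ 1 = -(1 / √3) * ((u.1 2).contRep x - (u.1 0).contRep x) ∧
      μ 2 = -(1 / √3) * ((u.1 0).contRep x - (u.1 1).contRep x) := by
    refine ⟨?_, ?_, ?_⟩ <;> (simp [hμ, tangentialMatrix, dotProduct, Fin.sum_univ_three]; ring)
  have hu2 : (u.1 2).contRep x = -(u.1 0).contRep x - (u.1 1).contRep x := by linarith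
  have ha0 : D.angle 0 = D.θ := rfl
  have ha1 : D.angle 1 = D.θ + 2 * Real.pi / 3 := rfl
  have ha2 : D.angle 2 = D.θ - 2 * Real.pi / 3 := rfl
  fin_cases i
  · rfl
  · simp only [Fin.mk_one, ha0, ha1, hμ0, hμ1, hu2, Real.sin_add, Real.cos_add, hs, hc]
    refine congrArg₂ (· + ·) (congrArg₂ (· + ·) rfl (congrArg (· • _) ?_)) (congrArg (· • _) ?_)
    all_goals (field_simp; ring_nf; rw [h3]; ring)
  · simp only [Fin.reduceFinMk, ha0, ha2, hμ0, hμ2, hu2, Real.sin_sub, Real.cos_sub, hs, hc]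
    refine congrArg₂ (· + ·) (congrArg₂ (· + ·) rfl (congrArg (· • _) ?_)) (congrArg (· • _) ?_)
    all_goals (field_simp; ring_nf; rw [h3]; ring)

include hk in
theorem coneDensity_surf_mem {U : Set (Height n (k + 2))} (p : E (n + 1)) (i : Fin 3) :
    (fun u => coneDensity (fun y => D.surf u i y - p)) ∈ jetAlg hk1 U := by
  have e : (fun u : Height n (k + 2) => coneDensity (fun y => D.surf u i y - p))
      = fun u x => (Matrix.of (Fin.cons (D.surf u i x - p).ofLp fun j => (pd j (D.surf u i) x).ofLp) :
        Matrix (Fin (n + 1)) (Fin (n + 1)) ℝ).det := by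
    funext u x
    simp only [coneDensity, pd_sub_const]
    exact inner_cross _ _
  rw [e]
  refine det_mem _ fun a b => ?_
  refine Fin.cases ?_ (fun a => ?_) a
  · exact sub_mem (surf_mem (hk1 := hk1) D i b)
      (const_mem_localAlg (f := fun _ => p b) contDiffOn_const)
  · exact pd_surf_mem hk D i a b

/-- The signed volume of the cone over the `i`-th surface of a cluster, with vertex `p`. -/
def ReferenceCluster.coneVolume (p : E (n + 1)) (i : Fin 3) (u : Height n k) : ℝ :=
  ∫ x, ((n + 1 : ℝ)⁻¹ * D.orient i) * coneDensity (fun y => D.surf u i y - p) x ∂𝔪 n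

include hk hk1 in
/-- The volume between two neighbouring surfaces of a cluster near the reference cluster. -/
theorem exists_volume_eq (hk2 : n < 2 * (k + 2)) {ι : Fin 2 → Fin 3}
    (hα : D.angle (ι 0) ∈ Ioo (-Real.pi) (Real.pi / 3))
    (hβ : D.angle (ι 1) = D.angle (ι 0) + 2 * Real.pi / 3) :
    ∃ p : E (n + 1), ∀ᶠ u in 𝓝 (0 : Height n (k + 2)),
      0 ≤ D.coneVolume p (ι 0) u - D.coneVolume p (ι 1) u ∧
      volume (enclosed (D.surf u (ι 0) '' 𝔹 n ∪ D.surf u (ι 1) '' 𝔹 n))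
        = ofReal (D.coneVolume p (ι 0) u - D.coneVolume p (ι 1) u) := by
  obtain ⟨p, hstar, h0, h1⟩ := D.exists_isStarSurface hα hβ
  refine ⟨p, ?_⟩
  have hNne : ∀ l, ∀ x ∈ 𝔹 n, ⟪D.φ (ι l) x - p, D.N (ι l) x⟫ ≠ 0 := by
    intro l x hx
    fin_cases l
    exacts [(h0 x hx).ne', (h1 x hx).ne]
  obtain ⟨ε, hε, hstable⟩ := hstar.exists_stable
    (fun l => ((D.φ_smooth (ι l)).of_le (by simp)).sub contDiffOn_const) fun l x hx v t hvt => by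
    simp only [fderivWithin_sub_const] at hvt
    have hD : ⟪fderivWithin ℝ (D.φ (ι l)) (𝔹 n) x v, D.N (ι l) x⟫ = 0 := by
      rw [clm_apply_eq_sum, sum_inner]
      refine Finset.sum_eq_zero fun j _ => ?_
      have := D.inner_N_pd (ι l) hx j
      rw [pd] at this
      rw [real_inner_smul_left, real_inner_comm, this, mul_zero]
    have ht : t = 0 := by
      have h := congrArg (fun z => ⟪z, D.N (ι l) x⟫) hvt
      simp only [inner_add_left, hD, zero_add, real_inner_smul_left, inner_zero_left] at h
      exact (mul_eq_zero.1 h).resolve_right (hNne l x hx)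
    subst ht
    rw [zero_smul, add_zero] at hvt
    exact ⟨(D.φ_immersion (ι l) x hx) (by rw [hvt, map_zero]), rfl⟩
  -- the sign of the density of the cones
  let e : Fin 2 → ℝ := ![1, -1]
  have hsign0 : ∀ l, ∀ x ∈ 𝔹 n,
      0 < e l * D.orient (ι l) * coneDensity (fun y => D.φ (ι l) y - p) x := by
    intro l x hx
    have hpos : 0 < areaDensity (D.φ (ι l)) x := Real.sqrt_pos.2 (D.det_metric_φ_pos _ hx)
    have hs := D.sq_orient (ι l)
    have h2 : e l * D.orient (ι l) * coneDensity (fun y => D.φ (ι l) y - p) x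
        = areaDensity (D.φ (ι l)) x * (e l * ⟪D.φ (ι l) x - p, D.N (ι l) x⟫) := by
      rw [D.coneDensity_φ p _ hx]
      linear_combination (e l * areaDensity (D.φ (ι l)) x * ⟪D.φ (ι l) x - p, D.N (ι l) x⟫) * hs
    rw [h2]
    refine mul_pos hpos ?_
    fin_cases l
    · simpa [e] using h0 x hx
    · simpa [e] using h1 x hx
  have hsign : ∀ᶠ u in 𝓝 (0 : Height n (k + 2)), ∀ l, ∀ x ∈ 𝔹 n,
      0 < e l * D.orient (ι l) * coneDensity (fun y => D.surf u (ι l) y - p) x := by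
    refine eventually_all.2 fun l => ?_
    have hmem : (fun (u : Height n (k + 2)) x => e l * D.orient (ι l)
        * coneDensity (fun y => D.surf u (ι l) y - p) x) ∈ jetAlg hk1 univ :=
      (jetAlg hk1 univ).smul_mem (coneDensity_surf_mem hk D p (ι l)) (e l * D.orient (ι l))
    have hc := continuousOn_of_mem_jetAlg hmem 0
    obtain ⟨x₀, hx₀, hmin⟩ := (isCompact_closedBall (0 : E n) 1).exists_isMinOn
      ⟨0, mem_closedBall_self zero_le_one⟩ hc
    have hval : ∀ x ∈ 𝔹 n, coneDensity (fun y => D.surf (0 : Height n (k + 2)) (ι l) y - p) x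
        = coneDensity (fun y => D.φ (ι l) y - p) x := by
      intro x hx
      simp only [coneDensity, pd_sub_const, surf_zero D hk2 (ι l) hx,
        fun j => pd_congr (surf_zero D hk2 (ι l)) j hx]
    have hpos : 0 < e l * D.orient (ι l) * coneDensity (fun y => D.surf (0 : Height n (k + 2)) (ι l) y - p) x₀ := by
      rw [hval x₀ hx₀]
      exact hsign0 l x₀ hx₀
    filter_upwards [eventually_abs_sub_le hmem (half_pos hpos)] with u hu x hx
    have h2 := hmin hx
    have h3 := (abs_le.1 (hu x hx)).1
    simp only [mem_ofPred_eq] at h2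
    linarith
  filter_upwards [eventually_surf_close hk (hk1 := hk1) D hk2 (ι 0) hε,
    eventually_surf_close hk (hk1 := hk1) D hk2 (ι 1) hε, hsign] with u hu0 hu1 hus
  have hclose : ∀ l, (∀ x ∈ 𝔹 n, ‖D.surf u (ι l) x - D.φ (ι l) x‖ ≤ ε) ∧
      ∀ x ∈ 𝔹 n, ∀ x' ∈ 𝔹 n,
        ‖(D.surf u (ι l) x - D.φ (ι l) x) - (D.surf u (ι l) x' - D.φ (ι l) x')‖ ≤ ε * ‖x - x'‖ := by
    intro l
    fin_cases l
    exacts [hu0, hu1]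
  have hcd : ∀ l, ContDiffOn ℝ 1 (fun y => D.surf u (ι l) y - p) (𝔹 n) := fun l =>
    (contDiffOn_surf hk (hk1 := hk1) D u (ι l)).sub contDiffOn_const
  have hZ : IsStarSurface fun l x => D.surf u (ι l) x - p := by
    refine hstable _ (fun l => (hcd l).continuousOn) (fun x hx l l' => ?_) (fun l x hx => ?_)
      fun l x hx x' hx' => ?_
    · simp only [surf_boundary D hk2 u (ι l) (ι l') hx]
    · rw [sub_sub_sub_cancel_right]
      exact (hclose l).1 x hx
    · rw [sub_sub_sub_cancel_right, sub_sub_sub_cancel_right]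
      exact (hclose l).2 x hx x' hx'
  have hvol := hZ.volume_enclosed hcd
  have himg : ((fun x => D.surf u (ι 0) x - p) '' 𝔹 n
      ∪ (fun x => D.surf u (ι 1) x - p) '' 𝔹 n)
      = (fun q => q - p) '' (D.surf u (ι 0) '' 𝔹 n ∪ D.surf u (ι 1) '' 𝔹 n) := by
    rw [image_union, image_image, image_image]
  rw [himg, volume_enclosed_image_sub] at hvol
  have hint : ∀ l, (∫ x, |coneDensity (fun y => D.surf u (ι l) y - p) x| ∂𝔪 n) / (n + 1)
      = e l * D.coneVolume p (ι l) u := by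
    intro l
    rw [ReferenceCluster.coneVolume, ← integral_const_mul, div_eq_inv_mul, ← integral_const_mul]
    refine setIntegral_congr_fun measurableSet_ball fun x hx => ?_
    have h2 := hus l x (ball_subset_closedBall hx)
    have h3 : |e l * D.orient (ι l)| = 1 := by
      rw [← sq_eq_sq₀ (abs_nonneg _) zero_le_one, sq_abs, mul_pow, D.sq_orient]
      fin_cases l <;> norm_num [e]
    have h4 : |coneDensity (fun y => D.surf u (ι l) y - p) x|
        = e l * D.orient (ι l) * coneDensity (fun y => D.surf u (ι l) y - p) x := by
      rw [← abs_of_pos h2, abs_mul, h3, one_mul]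
    rw [h4]
    ring
  have hsum : ∑ l, (∫ x, |coneDensity (fun y => D.surf u (ι l) y - p) x| ∂𝔪 n) / (n + 1)
      = D.coneVolume p (ι 0) u - D.coneVolume p (ι 1) u := by
    rw [Fin.sum_univ_two, hint, hint]
    simp [e]
    ring
  refine ⟨?_, by rw [hvol, hsum]⟩
  rw [← hsum]
  exact Finset.sum_nonneg fun l _ => div_nonneg (integral_nonneg fun x => abs_nonneg _) (by positivity)

end

section

variable {n : ℕ}

/-! ### The first variation of the enclosed volumes -/

section

variable {M : Type*} [AddCommGroup M] [Module ℝ M] (f : M [⋀^Fin (n + 1)]→ₗ[ℝ] ℝ)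

theorem map_cons_swap_zero (y : M) (e : Fin n → M) (m : Fin n) :
    f (Fin.cons (e m) (Function.update e m y)) = -f (Fin.cons y e) := by
  rw [← f.map_swap (Fin.cons y e : Fin (n + 1) → M) (Fin.succ_ne_zero m).symm]
  congr 1
  funext a
  refine Fin.cases ?_ (fun a => ?_) a
  · simp
  · by_cases h : a = m
    · subst h
      simp
    · have h2 : a.succ ≠ m.succ := fun h' => h (Fin.succ_injective _ h')
      simp [h, Equiv.swap_apply_of_ne_of_ne (Fin.succ_ne_zero a) h2]

theorem map_cons_update_swap (y : M) (e : Fin n → M) (p q : M) {m l : Fin n} (h : m ≠ l) :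
    f (Fin.cons y (Function.update (Function.update e m p) l q))
      = -f (Fin.cons y (Function.update (Function.update e l p) m q)) := by
  have hs : m.succ ≠ l.succ := fun h' => h (Fin.succ_injective _ h')
  rw [← f.map_swap _ hs]
  congr 1
  funext a
  refine Fin.cases ?_ (fun a => ?_) a
  · simp only [Function.comp_apply, Fin.cons_zero,
      Equiv.swap_apply_of_ne_of_ne (Fin.succ_ne_zero m).symm (Fin.succ_ne_zero l).symm]
  · by_cases h1 : a = m
    · subst h1
      simp [h, h.symm]
    · by_cases h2 : a = l
      · subst h2
        simp
      · have e1 : a.succ ≠ m.succ := fun h' => h1 (Fin.succ_injective _ h')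
        have e2 : a.succ ≠ l.succ := fun h' => h2 (Fin.succ_injective _ h')
        simp [h1, h2, Equiv.swap_apply_of_ne_of_ne e1 e2]

/-- The identity behind the first variation of volume: the variation of `f(y, ∂y)` in direction `ψ`
is `(n + 1) f(ψ, ∂y)` up to a divergence. Here `e` stands for `∂y`, the symmetric family `c` for
the second derivatives of `y`, and `ψ'` for `∂ψ`. The second derivatives cancel. -/
theorem sum_map_update_cons (y ψ : M) (e ψ' : Fin n → M) (c : Fin n → Fin n → M)
    (hc : ∀ m l, c m l = c l m) :
    ∑ a, f (Function.update (Fin.cons y e : Fin (n + 1) → M) a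
      ((Fin.cons ψ ψ' : Fin (n + 1) → M) a))
      = (n + 1) * f (Fin.cons ψ e) + ∑ m, ∑ a, f (Function.update
        (Fin.cons y (Function.update e m ψ) : Fin (n + 1) → M) a
        ((Fin.cons (e m) (Function.update (c m) m (ψ' m)) : Fin (n + 1) → M) a)) := by
  let G : Fin n → Fin n → ℝ := fun m l => if l = m then 0 else
    f (Fin.cons y (Function.update (Function.update e m ψ) l (c m l)))
  have hG : ∀ m l, G m l = -G l m := by
    intro m l
    simp only [G]
    by_cases h : l = m
    · subst h; simp
    · rw [if_neg h, if_neg (Ne.symm h), map_cons_update_swap f y e ψ _ (Ne.symm h), hc m l]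
  have hG0 : ∑ m, ∑ l, G m l = 0 := by
    have h1 : ∑ m, ∑ l, G m l = -∑ m, ∑ l, G m l := by
      conv_lhs => rw [Finset.sum_comm]
      rw [← Finset.sum_neg_distrib]
      refine sum_congr rfl fun m _ => ?_
      rw [← Finset.sum_neg_distrib]
      exact sum_congr rfl fun l _ => hG l m
    linarith
  have hin : ∀ m, ∑ a, f (Function.update
        (Fin.cons y (Function.update e m ψ) : Fin (n + 1) → M) a
        ((Fin.cons (e m) (Function.update (c m) m (ψ' m)) : Fin (n + 1) → M) a))
      = -f (Fin.cons ψ e) + (∑ l, G m l + f (Fin.cons y (Function.update e m (ψ' m)))) := by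
    intro m
    rw [Fin.sum_univ_succ]
    simp only [Fin.cons_zero, Fin.cons_succ, Fin.update_cons_zero, ← Fin.cons_update]
    rw [map_cons_swap_zero]
    congr 1
    have h1 : ∀ l, f (Fin.cons y (Function.update (Function.update e m ψ) l
        (Function.update (c m) m (ψ' m) l)))
        = G m l + if l = m then f (Fin.cons y (Function.update e m (ψ' m))) else 0 := by
      intro l
      by_cases h : l = m
      · subst h
        simp [G]
      · simp [G, h]
    rw [sum_congr rfl fun l _ => h1 l, sum_add_distrib]
    simp
  rw [sum_congr rfl fun m _ => hin m, sum_add_distrib, sum_add_distrib, hG0,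
    Fin.sum_univ_succ]
  simp only [Fin.cons_zero, Fin.cons_succ, Fin.update_cons_zero, ← Fin.cons_update]
  simp
  ring

end

/-- The determinant of a system of `n` vectors in `ℝⁿ`, as an alternating map. -/
def detRows (n : ℕ) : E n [⋀^Fin n]→ₗ[ℝ] ℝ :=
  Matrix.detRowAlternating.compLinearMap (WithLp.linearEquiv 2 ℝ (Fin n → ℝ)).toLinearMap

theorem detRows_cons (p : E (n + 1)) (v : Fin n → E (n + 1)) :
    detRows (n + 1) (Fin.cons p v) = ⟪p, cross v⟫ := by
  rw [inner_cross]
  change Matrix.det _ = _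
  congr 1
  ext a b
  refine Fin.cases ?_ (fun a => ?_) a <;> rfl

/-- The determinant of a system of `n` vectors in `ℝⁿ`, as a continuous multilinear map. -/
def detRowsL (n : ℕ) : ContinuousMultilinearMap ℝ (fun _ : Fin n => E n) ℝ where
  toMultilinearMap := (detRows n).toMultilinearMap
  cont := by
    refine Continuous.matrix_det (A := fun v : Fin n → E n => Matrix.of fun a => (v a).ofLp) ?_
    exact continuous_pi fun a => (PiLp.continuous_ofLp 2 _).comp (continuous_apply a)

theorem detRowsL_apply (v : Fin n → E n) : detRowsL n v = detRows n v := rfl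

theorem integral_pd_eq_zero [NeZero n] {h : E n → ℝ} (hh : ContDiffOn ℝ ∞ h (𝔹 n))
    (h0 : ∀ x ∈ 𝕊 n, h x = 0) (m : Fin n) :
    ∫ x, pd m h x ∂𝔪 n = 0 := by
  have hw := isWeakPartial_of_contDiffOn m ((hh.of_le (by simp)).mono ball_subset_closedBall)
  have heq : ∀ x ∈ ball (0 : E n) 1, pd m h x = fderiv ℝ h x (single m 1) :=
    fun x hx => by
      rw [pd, fderivWithin_of_mem_nhds (mem_of_superset (isOpen_ball.mem_nhds hx)
        ball_subset_closedBall)]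
  have hint : Integrable (fun x => fderiv ℝ h x (single m 1)) (𝔪 n) := by
    refine (integrable_of_continuousOn (contDiffOn_pd hh m).continuousOn).congr ?_
    filter_upwards [ae_restrict_mem measurableSet_ball] with x hx using heq x hx
  rw [setIntegral_congr_fun measurableSet_ball heq, hw.integral_eq hh.continuousOn hint]
  refine integral_eq_zero_of_ae (.of_forall fun y => ?_)
  simp [h0 y.1 y.2]

theorem pd_pd_comm {G : Type*} [NormedAddCommGroup G] [NormedSpace ℝ G] {Y : E n → G}
    (hY : ContDiffOn ℝ ∞ Y (𝔹 n)) (m l : Fin n) {x : E n}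
    (hx : x ∈ 𝔹 n) : pd m (pd l Y) x = pd l (pd m Y) x := by
  have hsymm := ContDiffWithinAt.isSymmSndFDerivWithinAt (hY x hx)
    (by rw [minSmoothness_of_isRCLikeNormedField]; exact WithTop.coe_le_coe.2 le_top)
    uniqueDiffOn_closedBall (by
      rw [interior_closedBall _ one_ne_zero, closure_ball _ one_ne_zero]; exact hx) hx
  have hd : DifferentiableWithinAt ℝ (fderivWithin ℝ Y (𝔹 n)) (𝔹 n) x :=
    (hY.fderivWithin uniqueDiffOn_closedBall (m := ∞) (by simp)).differentiableOn (by simp) x hx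
  have h1 : ∀ m l : Fin n, pd m (pd l Y) x = fderivWithin ℝ (fderivWithin ℝ Y (𝔹 n))
      (𝔹 n) x (single m 1) (single l 1) := by
    intro m l
    have h2 : HasFDerivWithinAt (fun y => fderivWithin ℝ Y (𝔹 n) y (single l 1))
        _ (𝔹 n) x := hd.hasFDerivWithinAt.clm_apply (hasFDerivWithinAt_const _ x _)
    have h3 : pd m (fun y => fderivWithin ℝ Y (𝔹 n) y (single l 1)) x = _ :=
      congrArg (fun L : E n →L[ℝ] G => L (single m 1))
        (h2.fderivWithin (uniqueDiffOn_closedBall x hx))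
    refine h3.trans ?_
    simp
  rw [h1, h1]
  exact hsymm _ _

/-- The first variation of the volume of a cone, for variations that vanish at the boundary. -/
theorem integral_first_variation [NeZero n] {Y ψ : E n → E (n + 1)}
    (hY : ContDiffOn ℝ ∞ Y (𝔹 n)) (hψ : ContDiffOn ℝ ∞ ψ (𝔹 n))
    (hψ0 : ∀ x ∈ 𝕊 n, ψ x = 0) :
    ∫ x, ∑ a, detRows (n + 1) (Function.update
      (Fin.cons (Y x) fun j => pd j Y x : Fin (n + 1) → E (n + 1)) a
      ((Fin.cons (ψ x) fun j => pd j ψ x : Fin (n + 1) → E (n + 1)) a)) ∂𝔪 n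
      = (n + 1) * ∫ x, ⟪ψ x, cross fun j => pd j Y x⟫ ∂𝔪 n := by
  -- the components of the vector field whose divergence appears
  let h : Fin n → E n → ℝ := fun m x => detRowsL (n + 1)
    fun a => (Fin.cons (Y x) (Function.update (fun j => pd j Y x) m (ψ x)) : Fin (n + 1) → E (n + 1)) a
  have hrow : ∀ m (a : Fin (n + 1)), ContDiffOn ℝ ∞ (fun x =>
      (Fin.cons (Y x) (Function.update (fun j => pd j Y x) m (ψ x)) : Fin (n + 1) → E (n + 1)) a)
      (𝔹 n) := by
    intro m a
    refine Fin.cases ?_ (fun a => ?_) a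
    · simpa using hY
    · simp only [Fin.cons_succ]
      by_cases ha : a = m
      · subst ha
        simpa using hψ
      · simpa [ha] using contDiffOn_pd hY a
  have hsm : ∀ m, ContDiffOn ℝ ∞ (h m) (𝔹 n) := fun m =>
    (detRowsL (n + 1)).contDiff.comp_contDiffOn (contDiffOn_pi.2 (hrow m))
  have hpd : ∀ m, ∀ x ∈ 𝔹 n, pd m (h m) x = ∑ a, detRows (n + 1) (Function.update
        (Fin.cons (Y x) (Function.update (fun j => pd j Y x) m (ψ x)) : Fin (n + 1) → E (n + 1)) a
        ((Fin.cons (pd m Y x) (Function.update (fun l => pd m (pd l Y) x) m (pd m ψ x)) :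
          Fin (n + 1) → E (n + 1)) a)) := by
    intro m x hx
    have hd := HasFDerivWithinAt.multilinear_comp (detRowsL (n + 1)) fun a =>
      ((hrow m a).differentiableOn (by simp) x hx).hasFDerivWithinAt
    have h1 : pd m (h m) x = _ := congrArg (fun L : E n →L[ℝ] ℝ => L (single m 1))
      (hd.fderivWithin (uniqueDiffOn_closedBall x hx))
    rw [h1, sum_apply]
    refine sum_congr rfl fun a _ => ?_
    rw [ContinuousLinearMap.comp_apply, ContinuousMultilinearMap.toContinuousLinearMap_apply,
      detRowsL_apply]
    congr 2
    refine Fin.cases ?_ (fun a => ?_) a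
    · rfl
    · by_cases ha : a = m
      · subst ha
        simp [pd]
      · simp only [Fin.cons_succ, ne_eq, ha, not_false_eq_true, Function.update_of_ne]
        rfl
  have hcongr : ∀ x ∈ ball (0 : E n) 1, ∑ a, detRows (n + 1) (Function.update
      (Fin.cons (Y x) fun j => pd j Y x : Fin (n + 1) → E (n + 1)) a
      ((Fin.cons (ψ x) fun j => pd j ψ x : Fin (n + 1) → E (n + 1)) a))
      = (n + 1) * ⟪ψ x, cross fun j => pd j Y x⟫ + ∑ m, pd m (h m) x := by
    intro x hx
    have hx' := ball_subset_closedBall hx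
    rw [sum_map_update_cons (detRows (n + 1)) (Y x) (ψ x) (fun j => pd j Y x) (fun j => pd j ψ x)
      (fun m l => pd m (pd l Y) x) fun m l => pd_pd_comm hY m l hx', detRows_cons]
    congr 1
    exact sum_congr rfl fun m _ => (hpd m x hx').symm
  have hcr : ContinuousOn (fun x => ⟪ψ x, cross fun j => pd j Y x⟫) (𝔹 n) := by
    have h1 : ContDiffOn ℝ ∞ (fun x => detRowsL (n + 1)
        fun a => (Fin.cons (ψ x) fun j => pd j Y x : Fin (n + 1) → E (n + 1)) a) (𝔹 n) := by
      refine (detRowsL (n + 1)).contDiff.comp_contDiffOn (contDiffOn_pi.2 fun a => ?_)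
      refine Fin.cases ?_ (fun a => ?_) a
      · simpa using hψ
      · simpa using contDiffOn_pd hY a
    refine h1.continuousOn.congr fun x _ => ?_
    exact (detRows_cons _ _).symm
  have hi : ∀ m ∈ Finset.univ, Integrable (pd m (h m)) (𝔪 n) := fun m _ =>
    integrable_of_continuousOn (contDiffOn_pd (hsm m) m).continuousOn
  rw [setIntegral_congr_fun measurableSet_ball hcongr, integral_add
    ((integrable_of_continuousOn hcr).const_mul _) (integrable_finsetSum _ hi), integral_const_mul,
    integral_finsetSum _ hi, Finset.sum_eq_zero fun m _ => integral_pd_eq_zero (hsm m) (fun x hx => ?_) m,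
    add_zero]
  -- a row vanishes on the boundary
  refine (detRowsL (n + 1)).map_coord_zero m.succ ?_
  simp [hψ0 x hx]

variable [NeZero n] {k : ℕ} {hk1 : n < 2 * (k + 1)}

/-- Integrals of local expressions may be differentiated pointwise. -/
theorem fderiv_integral_eq {q : Height n (k + 2) → E n → ℝ} (hq : q ∈ jetAlg hk1 univ)
    {I : Height n (k + 2) → ℝ} (hI : ∀ u, I u = ∫ x, q u x ∂𝔪 n) {b : Height n (k + 2)}
    {d : E n → ℝ} (hd : ∀ x ∈ 𝔹 n, HasDerivAt (fun t : ℝ => q (t • b) x) (d x) 0) :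
    fderiv ℝ I 0 b = ∫ x, d x ∂𝔪 n := by
  obtain ⟨F, ⟨hF, -⟩, hFq⟩ := hq
  have hI' : I = fun u => H.integralL (k + 1) (F u) := by
    funext u
    rw [hI, H.integralL_apply hk1 (hFq u (mem_univ u))]
  have hF' := (hF 0 (mem_univ _)).differentiableAt.hasFDerivAt
  have hline : HasDerivAt (fun t : ℝ => F (t • b)) (fderiv ℝ F 0 b) 0 := by
    have h1 : HasDerivAt (fun t : ℝ => t • b) b 0 := by
      simpa using (hasDerivAt_id (0 : ℝ)).smul_const b
    have h2 : HasFDerivAt F (fderiv ℝ F 0) ((0 : ℝ) • b) := by rwa [zero_smul]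
    exact h2.comp_hasDerivAt (0 : ℝ) h1
  have h3 : fderiv ℝ I 0 b = H.integralL (k + 1) (fderiv ℝ F 0 b) := by
    rw [hI']
    exact congrArg (fun L : Height n (k + 2) →L[ℝ] ℝ => L b)
      ((H.integralL (k + 1)).hasFDerivAt.comp 0 hF').fderiv
  rw [h3]
  refine H.integralL_apply hk1 fun x hx => ?_
  have h4 := (H.eval hk1 hx).hasFDerivAt.comp_hasDerivAt (0 : ℝ) hline
  refine h4.unique ((hd x hx).congr_of_eventuallyEq (.of_forall fun t => ?_))
  exact hFq (t • b) (mem_univ _) hx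

end

section

variable {n : ℕ} [NeZero n] {k : ℕ} (hk : n < 2 * k) (hk1 : n < 2 * (k + 1)) (hk2 : n < 2 * (k + 2))
  (D : ReferenceCluster n)

/-- The direction in which the `i`-th surface moves if the `j`-th bump function is added to the
height functions. -/
def ReferenceCluster.bumpField (j : Fin 2) (i : Fin 3) (x : E n) : E (n + 1) :=
  (if D.s j = i then D.f j x else 0) • D.N i x + (tangentialMatrix i (D.s j) * D.f j x) • D.τ i x

theorem surf_smul_bump (j : Fin 2) (i : Fin 3) (t : ℝ) :
    EqOn (D.surf (t • D.bump hk2 j) i) (fun x => D.φ i x + t • D.bumpField j i x)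
      (𝔹 n) := by
  intro x hx
  have h : ∀ a, ((t • D.bump hk2 j).1 a).contRep x = t * if D.s j = a then D.f j x else 0 := by
    intro a
    have h1 : (t • D.bump hk2 j).1 a = t • (D.bump hk2 j).1 a := rfl
    rw [h1, ← H.eval_apply hk2 hx, map_smul, H.eval_apply, D.contRep_bump hk2 j a hx, smul_eq_mul]
  have h2 : (tangentialMatrix *ᵥ fun a => ((t • D.bump hk2 j).1 a).contRep x) i
      = t * (tangentialMatrix i (D.s j) * D.f j x) := by
    simp only [Matrix.mulVec, dotProduct, h]
    rw [Finset.sum_eq_single (D.s j)]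
    · rw [if_pos rfl]; ring
    · intro a _ ha
      rw [if_neg (Ne.symm ha), mul_zero, mul_zero]
    · simp
  rw [ReferenceCluster.surf, ReferenceCluster.graph, h, h2]
  simp only [ReferenceCluster.bumpField]
  module

omit [NeZero n] in
theorem contDiffOn_bumpField (j : Fin 2) (i : Fin 3) :
    ContDiffOn ℝ ∞ (D.bumpField j i) (𝔹 n) := by
  have hf := (D.f_smooth j).contDiffOn (s := 𝔹 n)
  have h1 : ContDiffOn ℝ ∞ (fun x => if D.s j = i then D.f j x else 0) (𝔹 n) := by
    by_cases h : D.s j = i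
    · simpa [h] using hf
    · simpa [h] using contDiffOn_const
  have h2 : ContDiffOn ℝ ∞ (fun x => tangentialMatrix i (D.s j) * D.f j x) (𝔹 n) :=
    contDiffOn_const.mul hf
  exact (h1.smul (D.contDiffOn_N i)).add (h2.smul (D.τ_smooth i))

include hk hk1 in
/-- The derivatives of the volumes in the directions of the bump functions do not depend on the
vertex of the cone. -/
theorem fderiv_coneVolume_bump (p : E (n + 1)) (i : Fin 3) (j : Fin 2) :
    fderiv ℝ (fun u : Height n (k + 2) => D.coneVolume p i u) 0 (D.bump hk2 j)
      = if D.s j = i then 1 else 0 := by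
  set C : ℝ := (n + 1 : ℝ)⁻¹ * D.orient i with hC
  set Y : E n → E (n + 1) := fun y => D.φ i y - p with hYdef
  set ψ := D.bumpField j i with hψdef
  have hY : ContDiffOn ℝ ∞ Y (𝔹 n) := (D.φ_smooth i).sub contDiffOn_const
  have hψ : ContDiffOn ℝ ∞ ψ (𝔹 n) := contDiffOn_bumpField D j i
  have hq : (fun (u : Height n (k + 2)) x => C * coneDensity (fun y => D.surf u i y - p) x)
      ∈ jetAlg hk1 univ := (jetAlg hk1 univ).smul_mem (coneDensity_surf_mem hk D p i) C
  have hd : ∀ x ∈ 𝔹 n, HasDerivAt (fun t : ℝ =>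
      C * coneDensity (fun y => D.surf (t • D.bump hk2 j) i y - p) x)
      (C * ∑ a, detRows (n + 1) (Function.update
        (Fin.cons (Y x) fun j => pd j Y x : Fin (n + 1) → E (n + 1)) a
        ((Fin.cons (ψ x) fun j => pd j ψ x : Fin (n + 1) → E (n + 1)) a))) 0 := by
    intro x hx
    refine HasDerivAt.const_mul C ?_
    have hu := uniqueDiffOn_closedBall x hx
    have hYd := hY.differentiableOn (by simp) x hx
    have hψd := hψ.differentiableOn (by simp) x hx
    have e1 : ∀ t : ℝ, coneDensity (fun y => D.surf (t • D.bump hk2 j) i y - p) x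
        = detRowsL (n + 1) fun a => (Fin.cons (Y x) fun j => pd j Y x : Fin (n + 1) → E (n + 1)) a
          + t • (Fin.cons (ψ x) fun j => pd j ψ x : Fin (n + 1) → E (n + 1)) a := by
      intro t
      have h1 : EqOn (fun y => D.surf (t • D.bump hk2 j) i y - p) (fun y => Y y + t • ψ y)
          (𝔹 n) := fun y hy => by
        simp only [hYdef]
        rw [surf_smul_bump hk2 D j i t hy]
        module
      have h2 : ∀ l, pd l (fun y => D.surf (t • D.bump hk2 j) i y - p) x = pd l Y x + t • pd l ψ x := by
        intro l
        rw [pd_congr h1 l hx, pd, fderivWithin_fun_add hu hYd (hψd.fun_const_smul t),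
          fderivWithin_fun_const_smul hu hψd]
        rfl
      rw [coneDensity, ← detRows_cons, detRowsL_apply]
      congr 1
      funext a
      refine Fin.cases ?_ (fun a => ?_) a
      · exact h1 hx
      · exact h2 a
    simp only [e1]
    have h3 := (HasFDerivAt.multilinear_comp (detRowsL (n + 1)) (x := (0 : ℝ)) fun a =>
      (((hasDerivAt_id (0 : ℝ)).smul_const
        ((Fin.cons (ψ x) fun j => pd j ψ x : Fin (n + 1) → E (n + 1)) a)).const_add
        ((Fin.cons (Y x) fun j => pd j Y x : Fin (n + 1) → E (n + 1)) a)).hasFDerivAt).hasDerivAt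
    refine h3.congr_deriv ?_
    rw [sum_apply]
    refine sum_congr rfl fun a _ => ?_
    rw [ContinuousLinearMap.comp_apply, ContinuousMultilinearMap.toContinuousLinearMap_apply,
      detRowsL_apply]
    congr 1
    simp
  rw [fderiv_integral_eq hq (I := fun u => D.coneVolume p i u) (fun u => rfl) hd, integral_const_mul]
  have hψ0 : ∀ x ∈ 𝕊 n, ψ x = 0 := by
    intro x hx
    have h1 : D.f j x = 0 := image_eq_zero_of_notMem_tsupport fun h2 =>
      (mem_ball_zero_iff.1 (D.f_support j h2)).ne (mem_sphere_zero_iff_norm.1 hx)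
    simp [hψdef, ReferenceCluster.bumpField, h1]
  rw [integral_first_variation hY hψ hψ0]
  have hpt : ∀ x ∈ ball (0 : E n) 1, ⟪ψ x, cross fun j => pd j Y x⟫
      = D.orient i * if D.s j = i then D.f j x * areaDensity (D.φ i) x else 0 := by
    intro x hx
    have hx' := ball_subset_closedBall hx
    have hN : ⟪D.N i x, D.N i x⟫ = 1 := by rw [real_inner_self_eq_norm_sq, D.norm_N hx', one_pow]
    have hτ : ⟪D.τ i x, D.N i x⟫ = 0 := D.τ_tangent i x hx'
    simp only [hYdef, pd_sub_const]
    rw [D.cross_φ i hx', hψdef, ReferenceCluster.bumpField, real_inner_smul_right, inner_add_left,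
      real_inner_smul_left, real_inner_smul_left, hN, hτ]
    split_ifs <;> ring
  rw [setIntegral_congr_fun measurableSet_ball hpt, integral_const_mul]
  have hs := D.sq_orient i
  have hint : ∫ x, (if D.s j = i then D.f j x * areaDensity (D.φ i) x else 0) ∂𝔪 n
      = if D.s j = i then 1 else 0 := by
    by_cases h : D.s j = i
    · subst h
      simpa using D.f_integral j
    · simp [h]
  rw [hint, hC]
  field_simp
  split_ifs
  · linarith
  · simp

include hk in
/-- Near the reference cluster, the enclosed volumes are functions with local derivatives, and they
can be adjusted independently by means of the bump functions. -/
theorem exists_volume : ∃ (v : Fin 2 → Height n (k + 2) → ℝ) (U : Set (Height n (k + 2))),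
      IsOpen U ∧ 0 ∈ U ∧ (∀ j, HasLocalDeriv hk1 U (v j)) ∧
      (∀ u ∈ U, D.VolumeConstraint u ↔ ∀ j, v j u = v j 0) ∧
      (constraintMatrix v (D.bump hk2) 0).det ≠ 0 := by
  have hpi := Real.pi_pos
  have hθ := D.θ_mem
  have ha0 : D.angle 0 = D.θ := rfl
  have ha1 : D.angle 1 = D.θ + 2 * Real.pi / 3 := rfl
  have ha2 : D.angle 2 = D.θ - 2 * Real.pi / 3 := rfl
  obtain ⟨p, hp⟩ := exists_volume_eq hk (hk1 := hk1) D hk2 (ι := ![0, 1])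
    (by simp only [Matrix.cons_val_zero, ha0]; exact ⟨by linarith [hθ.1], hθ.2⟩) (by simp [ha0, ha1])
  obtain ⟨p', hp'⟩ := exists_volume_eq hk (hk1 := hk1) D hk2 (ι := ![2, 0])
    (by simp only [Matrix.cons_val_zero, ha2]; exact ⟨by linarith [hθ.1], by linarith [hθ.2]⟩)
    (by simp [ha0, ha2])
  obtain ⟨U, hU, hUo, h0U⟩ := _root_.mem_nhds_iff.1 (hp.and hp')
  have hloc : ∀ (p : E (n + 1)) (i : Fin 3),
      HasLocalDeriv hk1 U fun u : Height n (k + 2) => D.coneVolume p i u := fun p i =>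
    hasLocalDeriv_of_integral hUo
      ((jetAlg hk1 U).smul_mem (coneDensity_surf_mem hk D p i) ((n + 1 : ℝ)⁻¹ * D.orient i))
      fun u _ => rfl
  have hint : ∀ (p : E (n + 1)) (i : Fin 3), ∀ u ∈ U, Integrable (fun x =>
      ((n + 1 : ℝ)⁻¹ * D.orient i) * coneDensity (fun y => D.surf u i y - p) x) (𝔪 n) :=
    fun p i u hu => integrable_of_mem_jetAlg
      ((jetAlg hk1 U).smul_mem (coneDensity_surf_mem hk D p i) ((n + 1 : ℝ)⁻¹ * D.orient i)) hu
  have hloc2 : ∀ (p : E (n + 1)) (i i' : Fin 3), HasLocalDeriv hk1 U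
      fun u : Height n (k + 2) => D.coneVolume p i u - D.coneVolume p i' u := fun p i i' =>
    hasLocalDeriv_of_integral hUo (sub_mem
      ((jetAlg hk1 U).smul_mem (coneDensity_surf_mem hk D p i) ((n + 1 : ℝ)⁻¹ * D.orient i))
      ((jetAlg hk1 U).smul_mem (coneDensity_surf_mem hk D p i') ((n + 1 : ℝ)⁻¹ * D.orient i')))
      fun u hu => (integral_sub (hint p i u hu) (hint p i' u hu)).symm
  have hder : ∀ (p : E (n + 1)) (i i' : Fin 3) (j : Fin 2), fderiv ℝ
      (fun u : Height n (k + 2) => D.coneVolume p i u - D.coneVolume p i' u) 0 (D.bump hk2 j)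
      = (if D.s j = i then 1 else 0) - if D.s j = i' then 1 else 0 := by
    intro p i i' j
    rw [fderiv_fun_sub ((hloc p i).1 0 h0U).differentiableAt ((hloc p i').1 0 h0U).differentiableAt,
      sub_apply, fderiv_coneVolume_bump hk hk1, fderiv_coneVolume_bump hk hk1]
  refine ⟨![fun u => D.coneVolume p 0 u - D.coneVolume p 1 u,
    fun u => D.coneVolume p' 2 u - D.coneVolume p' 0 u], U, hUo, h0U, fun j => ?_, fun u hu => ?_, ?_⟩
  · fin_cases j
    exacts [hloc2 p 0 1, hloc2 p' 2 0]
  · have hsurf : ∀ i, D.surface i = D.surf (0 : Height n (k + 2)) i '' 𝔹 n := fun i => by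
      rw [← D.φ_image i]
      exact (surf_zero D hk2 i).symm.image_eq
    obtain ⟨⟨h1, h2⟩, h3, h4⟩ := hU hu
    obtain ⟨⟨h1', h2'⟩, h3', h4'⟩ := hU h0U
    simp only [Matrix.cons_val_zero, Matrix.cons_val_one] at h1 h2 h3 h4 h1' h2' h3' h4'
    have hvol : D.VolumeConstraint u ↔
        volume (enclosed (D.surf u 0 '' 𝔹 n ∪ D.surf u 1 '' 𝔹 n))
          = volume (enclosed (D.surface 0 ∪ D.surface 1)) ∧
        volume (enclosed (D.surf u 0 '' 𝔹 n ∪ D.surf u 2 '' 𝔹 n))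
          = volume (enclosed (D.surface 0 ∪ D.surface 2)) := by
      constructor
      · intro h
        exact ⟨h 1 (by decide), h 2 (by decide)⟩
      · rintro ⟨h1, h2⟩ j hj
        fin_cases j
        exacts [absurd rfl hj, h1, h2]
    rw [hvol, Fin.forall_fin_two, union_comm _ (D.surf u 2 '' _), union_comm _ (D.surface 2), hsurf,
      hsurf, hsurf, h2, h4, h2', h4', ENNReal.ofReal_eq_ofReal_iff h1 h1',
      ENNReal.ofReal_eq_ofReal_iff h3 h3']
    rfl
  · rw [Matrix.det_fin_two]
    simp only [constraintMatrix, Matrix.of_apply, Matrix.cons_val_zero, Matrix.cons_val_one, hder]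
    have hs : D.s 0 ≠ D.s 1 := fun h => absurd (D.s_injective h) (by decide)
    generalize D.s 0 = a at *
    generalize D.s 1 = b at *
    fin_cases a <;> fin_cases b <;> simp at hs ⊢

end

end

end TripleJunction

theorem mainTheorem8 {n m : ℕ} (hn : 1 ≤ n) (hm : (2 : ℝ) + n / 2 < m) (D : ReferenceCluster n) :
    ∃ (U : Set (D.V m)) (U' : Set (Height n m)),
      IsOpen U ∧ 0 ∈ U ∧ IsOpen U' ∧ 0 ∈ U' ∧
      -- tangent vectors
      (∀ j : Fin n, AnalyticIntoH (m - 1) U'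
        fun ρ (p : Fin 3 × Fin (n + 1)) x => pd j (D.surf ρ p.1) x p.2) ∧
      (∀ O t η, IsLocalFrame O t η → ∀ j, AnalyticIntoTrace (m - 1) U'
        fun ρ (p : Fin 3 × Fin (n + 1)) x => η x * dirDeriv (t j x) (D.surf ρ p.1) x p.2) ∧
      -- metric and inverse metric
      (∀ j k : Fin n, AnalyticIntoH (m - 1) U' fun ρ i x => metric (D.surf ρ i) x j k) ∧
      (∀ j k : Fin n, AnalyticIntoH (m - 1) U' fun ρ i x => (metric (D.surf ρ i) x)⁻¹ j k) ∧
      (∀ O t η, IsLocalFrame O t η → ∀ j k, AnalyticIntoTrace (m - 1) U'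
        fun ρ i x => η x * bdryMetric (D.surf ρ i) t x j k) ∧
      (∀ O t η, IsLocalFrame O t η → ∀ j k, AnalyticIntoTrace (m - 1) U'
        fun ρ i x => η x * (bdryMetric (D.surf ρ i) t x)⁻¹ j k) ∧
      -- area elements
      AnalyticIntoH (m - 1) U' (fun ρ i x => D.J ρ i x) ∧
      AnalyticIntoTrace (m - 1) U' (fun ρ i x => D.JBdry ρ i x) ∧
      -- normals
      AnalyticIntoH (m - 1) U'
        (fun ρ (p : Fin 3 × Fin (n + 1)) x => D.unitNormal ρ p.1 x p.2) ∧
      AnalyticIntoH (m - 1) U' (fun ρ i x => inner ℝ (D.unitNormal ρ i x) (D.N i x)) ∧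
      AnalyticIntoH (m - 1) U' (fun ρ i x => inner ℝ (D.unitNormal ρ i x) (D.τ i x)) ∧
      -- conormals
      AnalyticIntoTrace (m - 1) U' (fun ρ (p : Fin 3 × Fin (n + 1)) x => D.unitConormal ρ p.1 x p.2) ∧
      AnalyticIntoTrace (m - 1) U' (fun ρ i x => inner ℝ (D.unitConormal ρ i x) (D.N i x)) ∧
      AnalyticIntoTrace (m - 1) U' (fun ρ i x => inner ℝ (D.unitConormal ρ i x) (D.τ i x)) ∧
      -- second fundamental form and mean curvature
      (∀ j k : Fin n, AnalyticIntoH (m - 2) U'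
        fun ρ i x => D.secondFundamentalForm ρ i j k x) ∧
      AnalyticIntoH (m - 2) U' (fun ρ i x => D.meanCurvature ρ i x) ∧
      -- parametrization of the volume constraint
      ∃ γ : D.V m → Height n m, D.IsVolumeParametrization U U' γ ∧ AnalyticOnNhd ℝ γ U ∧
      -- derivative of the area under the volume constraint, with values in `W`
      ∃ dE : D.V m → ReferenceCluster.W n m, AnalyticOnNhd ℝ dE U ∧
        ∀ ρ ∈ U, ∃ L : D.V m →L[ℝ] ℝ,
          HasFDerivAt (fun σ => D.area (γ σ)) L ρ ∧ ∀ σ, L σ = D.pairing (dE ρ) σ := by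
  have : NeZero n := ⟨by omega⟩
  obtain ⟨k, rfl⟩ : ∃ k, m = k + 2 := by
    have h2 : (2 : ℝ) < m := lt_of_le_of_lt (by linarith [(Nat.cast_nonneg n : (0 : ℝ) ≤ n)]) hm
    have h3 : 2 < m := by exact_mod_cast h2
    exact ⟨m - 2, by omega⟩
  have hk : n < 2 * k := by
    push_cast at hm
    have : (n : ℝ) < 2 * k := by linarith
    exact_mod_cast this
  have hk1 : n < 2 * (k + 1) := by omega
  have hk2 : n < 2 * (k + 2) := by omega
  obtain ⟨U₀, hU₀⟩ := exists_isRegularNhd hk (hk1 := hk1) D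
  obtain ⟨v, U₁, hU₁, h0U₁, hv, hvol, hdet⟩ := exists_volume hk hk1 hk2 D
  have hU₂ := hU₀.mono (U' := U₀ ∩ U₁) inter_subset_left (hU₀.isOpen.inter hU₁)
    ⟨hU₀.zero_mem, h0U₁⟩
  obtain ⟨Ω, U', hΩ, h0Ω, hU', h0U', hUU', γ, hγ, hγa, hdE⟩ := exists_volume_param hk hk2 hU₂
    (fun j => (hv j).mono inter_subset_right) (fun u hu => hvol u hu.2) hdet
  have h := hU₂.mono hUU' hU' h0U'
  refine ⟨Ω, U', hΩ, h0Ω, hU', h0U', ?_, ?_, ?_, ?_, ?_, ?_, ?_, ?_, ?_, ?_, ?_, ?_, ?_, ?_, ?_, ?_,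
    γ, hγ, hγa, hdE⟩
  · exact fun j => analyticIntoH_of_mem (k := k + 1) (hk := hk1) fun p => pd_surf_mem' (hk := hk) p.1 j p.2
  · exact fun O t η ht j => analyticIntoTrace_of_mem (k := k + 1) (hk := hk1)
      (fun p => ht.dirDeriv_mem (hk := hk) p.1 j p.2) fun ρ _ p x _ => rfl
  · exact fun j l => analyticIntoH_of_mem (k := k + 1) (hk := hk1) fun i => metric_surf_mem (hk := hk) i j l
  · exact fun j l => analyticIntoH_of_mem (k := k + 1) (hk := hk1) fun i => h.metric_inv_mem (hk := hk) i j l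
  · exact fun O t η ht j l => analyticIntoTrace_of_mem (k := k + 1) (hk := hk1)
      (fun i => ht.bdryMetric_mem (hk := hk) i j l) fun ρ _ i x _ => rfl
  · intro O t η ht j l
    choose q hq hqx using fun i => ht.bdryMetric_inv_mem h (hk := hk) i j l
    exact analyticIntoTrace_of_mem (k := k + 1) (hk := hk1) (Q' := fun ρ i => q i ρ) hq fun ρ hρ i => hqx i ρ hρ
  · exact analyticIntoH_of_mem (k := k + 1) (hk := hk1) h.J_mem
  · choose q hq hqx using h.JBdry_mem
    exact analyticIntoTrace_of_mem (k := k + 1) (hk := hk1) (Q' := fun ρ i => q i ρ) hq fun ρ hρ i => hqx i ρ hρ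
  · exact analyticIntoH_of_mem (k := k + 1) (hk := hk1) fun p => h.unitNormal_mem (hk := hk) p.1 p.2
  · exact analyticIntoH_of_mem (k := k + 1) (hk := hk1) fun i => inner_mem (h.unitNormal_mem (hk := hk) i) (D.contDiffOn_N i)
  · exact analyticIntoH_of_mem (k := k + 1) (hk := hk1) fun i => inner_mem (h.unitNormal_mem (hk := hk) i) (D.τ_smooth i)
  · choose q hq hqx using h.unitConormal_mem (hk := hk)
    exact analyticIntoTrace_of_mem (k := k + 1) (hk := hk1) (Q' := fun ρ p => q p.1 p.2 ρ) (fun p => hq p.1 p.2)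
      fun ρ hρ p => hqx p.1 p.2 ρ hρ
  · choose q hq hqx using h.inner_unitConormal_mem (hk := hk) (G := D.N) D.contDiffOn_N
    exact analyticIntoTrace_of_mem (k := k + 1) (hk := hk1) (Q' := fun ρ i => q i ρ) hq fun ρ hρ i => hqx i ρ hρ
  · choose q hq hqx using h.inner_unitConormal_mem (hk := hk) (G := D.τ) D.τ_smooth
    exact analyticIntoTrace_of_mem (k := k + 1) (hk := hk1) (Q' := fun ρ i => q i ρ) hq fun ρ hρ i => hqx i ρ hρ
  · exact fun j l => analyticIntoH_of_mem (k := k) (hk := hk) fun i => h.secondFundamentalForm_mem (hk := hk) i j l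
  · exact analyticIntoH_of_mem (k := k) (hk := hk) fun i => h.meanCurvature_mem (hk := hk) i
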